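/- **Gauss diagrams and arrow diagrams.** A based *arrow diagram* consists of finitely many ($m\ge 1$) oriented circles, finitely many arrows joining pairwise distinct points of the circles, and a base point (different from all endpoints of arrows) on one of the circles, up to orientation-preserving homeomorphisms of the circles. A based *Gauss diagram* $G$ is a based arrow diagram in which every arrow carries a sign $\pm1$. The Gauss diagram of an oriented classical link diagram has one circle for each link component and one arrow for each crossing, pointing from the overpassing to the underpassing preimage and signed by the writhe of the crossing. Classical links are considered up to isotopy, i.e. as classical diagrams (planar four-valent diagrams with crossing information, given by Gauss diagrams of genus zero) modulo Reidemeister moves. **Pairing.** For an arrow diagram $A$ and a based Gauss diagram $G$, a homomorphism $\phi:A\to G$ consists of orientation-preserving homeomorphisms (up to isotopy) from the circles of $A$ onto the circles of $G$, in bijection, mapping base point to base point and inducing an injection of arrows that respects their directions. Put $\langle A,G\rangle=\sum_{\phi}\prod_{\alpha}\operatorname{sign}(\phi(\alpha))$, where $\phi$ runs over all homomorphisms $A\to G$ and $\alpha$ over the arrows of $A$. **Ascending and descending diagrams.** Let $\Sigma(A)$ be the oriented surface obtained by filling every circle of $A$ with a disk and attaching a ribbon along every arrow. Suppose $\Sigma(A)$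 has exactly one boundary component. Going along the boundary from the base point, one passes every ribbon twice, once in the direction of its arrow and once in the opposite direction. $A$ is *ascending* (respectively *descending*) if every ribbon is passed for the first time in the direction opposite to its arrow (respectively in the direction of its arrow). Let $\mathcal A_{n,m}$ (respectively $\mathcal D_{n,m}$) be the set of isomorphism classes of ascending (respectively descending) based arrow diagrams with $n$ arrows, $m$ circles and one boundary component. For a based Gauss diagram $G$ with $m$ circles set $$A_{n,m}(G)=\sum_{A\in\mathcal A_{n,m}}\langle A,G\rangle,\quad D_{n,m}(G)=\sum_{A\in\mathcal D_{n,m}}\langle A,G\rangle,\quad \nabla_A(G)=\sum_{n\ge0}A_{n,m}(G)z^n,\quad \nabla_D(G)=\sum_{n\ge0}D_{n,m}(G)z^n .$$ **Statement.** There is a unique function $\nabla$ from (isotopy classes of) oriented classical links with at least one component to $\mathbb Z[z]$ with $\nabla(\text{unknot})=1$ and $\nabla(L_+)-\nabla(L_-)=z\,\nabla(L_0)$ for every Conway triple of classical diagrams: the Conway polynomial. For every $m\ge1$, every classical oriented $m$-component link $L$, and every based Gauss diagram $G$ of a diagram of $L$ (with any choice of base point on any component), $$\nabla_A(G)=\nabla_D(G)=\nabla(L),$$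 i.e. $A_{n,m}(G)=D_{n,m}(G)=c_n(L)$ for all $n\ge0$, where $c_n(L)$ is the coefficient of $z^n$ in $\nabla(L)$. -/

import Mathlib

/-- A based arrow diagram whose arrows are labelled by `α`.

The endpoint `(a, true)` is the tail and `(a, false)` the head of the arrow `a`.  Each oriented
circle is recorded by the word of endpoints met along its orientation.  `base` is the word of the
circle carrying the base point, read from the base point on; `others` lists the words of the other
circles, each read from an arbitrary point, in an arbitrary order.  The empty word is a circle
without arrows.  There is at least one circle, and every endpoint lies on exactly one circle. -/
structure ArrowDiagram (α : Type) where
  base : List (α × Bool)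
  others : List (List (α × Bool))
  nodup : (base :: others).flatten.Nodup
  complete : ∀ p : α × Bool, p ∈ (base :: others).flatten

namespace ArrowDiagram

/-- The words of all circles, the based one first. -/
def circles {α : Type} (A : ArrowDiagram α) : List (List (α × Bool)) := A.base :: A.others

/-- The number of circles. -/
def numCircles {α : Type} (A : ArrowDiagram α) : ℕ := A.circles.length

/-- The endpoint that follows a given endpoint on its circle (in cyclic order, ignoring the
base point). -/
def next {α : Type} [DecidableEq α] (A : ArrowDiagram α) : Equiv.Perm (α × Bool) :=
  (A.circles.map List.formPerm).prod

/-- The other endpoint of the same arrow. -/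
def flip {α : Type} (p : α × Bool) : α × Bool := (p.1, !p.2)

/-- The passage along the boundary of the surface obtained from the disks bounded by the circles by
attaching an (orientation preserving) ribbon along every arrow.  If an arc of a circle is followed
until the endpoint `p` is approached, the boundary runs along the ribbon to the other endpoint of
the same arrow, and then along the circle there; `trace p` is the next endpoint approached. -/
def trace {α : Type} [DecidableEq α] (A : ArrowDiagram α) (p : α × Bool) : α × Bool :=
  A.next (flip p)

/-- The number of boundary components of the surface of an arrow diagram: the cycles of `trace`,
and one boundary circle for every circle without arrows. -/
noncomputable def numBoundary {α : Type} [DecidableEq α] (A : ArrowDiagram α) : ℕ :=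
  Nat.card (Quot fun p q : α × Bool => q = A.trace p) + A.circles.count []

/-- In the passage along the boundary that starts at the base point, no ribbon is passed in the
direction of its arrow (approached at the tail) unless it was passed before in the opposite
direction (approached at the head). -/
def IsAscending {α : Type} [DecidableEq α] (A : ArrowDiagram α) : Prop :=
  ∀ p ∈ A.base.head?, ∀ (a : α) (k : ℕ),
    A.trace^[k] p = (a, true) → ∃ j < k, A.trace^[j] p = (a, false)

/-- In the passage along the boundary that starts at the base point, no ribbon is passed opposite
to its arrow (approached at the head) unless it was passed before in the direction of the arrow
(approached at the tail). -/
def IsDescending {α : Type} [DecidableEq α] (A : ArrowDiagram α) : Prop :=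
  ∀ p ∈ A.base.head?, ∀ (a : α) (k : ℕ),
    A.trace^[k] p = (a, false) → ∃ j < k, A.trace^[j] p = (a, true)

/-- Homomorphisms of based arrow diagrams: orientation preserving homeomorphisms between the circles
that respect the base points and induce an injection of arrows, up to isotopy.  Such a map is given
by the injection of arrows and the bijection of circles (the based circle going to the based
circle): on the base circle the endpoints of `A` must be mapped, in order, to the endpoints of the
image arrows on the base circle of `B`; on the other circles the same holds cyclically. -/
structure Hom {α β : Type} [Fintype α] [DecidableEq β]
    (A : ArrowDiagram α) (B : ArrowDiagram β) where
  arrow : α ↪ β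
  circle : Fin A.others.length ≃ Fin B.others.length
  map_base : A.base.map (Prod.map arrow id) = B.base.filter (fun p => ∃ a, arrow a = p.1)
  map_others : ∀ i : Fin A.others.length,
    ((A.others.get i).map (Prod.map arrow id)).IsRotated
      ((B.others.get (circle i)).filter (fun p => ∃ a, arrow a = p.1))

/-- There are finitely many homomorphisms, so sums over them make sense. -/
instance Hom.instFinite {α β : Type} [Fintype α] [Finite β] [DecidableEq β]
    (A : ArrowDiagram α) (B : ArrowDiagram β) : Finite (Hom A B) :=
  Finite.of_injective
    (fun φ : Hom A B => (φ.arrow, φ.circle))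
    (by
      rintro ⟨f, c, _, _⟩ ⟨f', c', _, _⟩ h
      simp only [Prod.mk.injEq] at h
      obtain ⟨rfl, rfl⟩ := h
      rfl)

/-- Isomorphism of based arrow diagrams with `n` arrows (a homomorphism is then automatically
bijective on arrows). -/
def Iso {n : ℕ} (A B : ArrowDiagram (Fin n)) : Prop := Nonempty (Hom A B)

/-- Based arrow diagrams with `n` arrows, up to isomorphism. -/
def Class (n : ℕ) : Type := Quot (Iso (n := n))

end ArrowDiagram

/-- Ascending (isomorphism classes of) based arrow diagrams with `n` arrows, `m` circles and one
boundary component.  Having one boundary component forces the diagram to be connected. -/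
def ascendingDiagrams (n m : ℕ) : Set (ArrowDiagram.Class n) :=
  Quot.mk _ '' {A : ArrowDiagram (Fin n) |
    A.numCircles = m ∧ A.numBoundary = 1 ∧ A.IsAscending}

/-- Descending (isomorphism classes of) based arrow diagrams with `n` arrows, `m` circles and one
boundary component. -/
def descendingDiagrams (n m : ℕ) : Set (ArrowDiagram.Class n) :=
  Quot.mk _ '' {A : ArrowDiagram (Fin n) |
    A.numCircles = m ∧ A.numBoundary = 1 ∧ A.IsDescending}

/-- A based (not necessarily realizable) Gauss diagram: a based arrow diagram with signed arrows.
An arrow points from the overpassing preimage `(a, true)` of a crossing to the underpassing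
preimage `(a, false)`. -/
structure GaussDiagram (α : Type) extends ArrowDiagram α where
  sign : α → ℤˣ

namespace GaussDiagram

open ArrowDiagram

/-- The pairing `⟨A, G⟩`: the sum of the signs of all homomorphisms from `A` to `G`. -/
noncomputable def pairing {n : ℕ} {α : Type} [DecidableEq α]
    (A : ArrowDiagram (Fin n)) (G : GaussDiagram α) : ℤ :=
  ∑ᶠ φ : Hom A G.toArrowDiagram, ∏ i : Fin n, (G.sign (φ.arrow i) : ℤ)

/-- `A_{n,m}(G)`, where `m` is the number of circles of `G`. -/
noncomputable def ascendingCount {α : Type} [DecidableEq α] (G : GaussDiagram α) (n : ℕ) : ℤ :=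
  ∑ᶠ A ∈ ascendingDiagrams n G.numCircles, pairing (Quot.out A) G

/-- `D_{n,m}(G)`, where `m` is the number of circles of `G`. -/
noncomputable def descendingCount {α : Type} [DecidableEq α] (G : GaussDiagram α) (n : ℕ) : ℤ :=
  ∑ᶠ A ∈ descendingDiagrams n G.numCircles, pairing (Quot.out A) G

/-- `∇_A(G) = ∑ A_{n,m}(G) zⁿ`. -/
noncomputable def nablaA {α : Type} [DecidableEq α] (G : GaussDiagram α) : PowerSeries ℤ :=
  PowerSeries.mk G.ascendingCount

/-- `∇_D(G) = ∑ D_{n,m}(G) zⁿ`. -/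
noncomputable def nablaD {α : Type} [DecidableEq α] (G : GaussDiagram α) : PowerSeries ℤ :=
  PowerSeries.mk G.descendingCount

/-! ### Classical Gauss diagrams

The crossings of `G` and the arcs between them form an oriented four-valent graph.  At a positive
crossing the four half-edges are, counterclockwise: over-outgoing, under-outgoing, over-incoming,
under-incoming; at a negative crossing: over-outgoing, under-incoming, over-incoming,
under-outgoing.  `G` comes from a diagram on the sphere (equivalently, in the plane) if and only if
every connected component of the closed surface defined by this graph with these cyclic orders is a
sphere. -/

/-- The half-edge `(p, true)` leaves the crossing at the passage `p`, the half-edge `(p, false)`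
enters the crossing at the passage `p`.  `opposite` is the other half of the same edge. -/
def opposite {α : Type} [DecidableEq α] (G : GaussDiagram α) :
    (α × Bool) × Bool → (α × Bool) × Bool
  | (p, true) => (G.next p, false)
  | (p, false) => (G.next.symm p, true)

/-- The next half-edge, counterclockwise, at the same crossing. -/
def rotate {α : Type} (G : GaussDiagram α) :
    (α × Bool) × Bool → (α × Bool) × Bool
  | ((a, b), x) => ((a, !b), if (G.sign a = 1 ↔ b = true) then x else !x)

/-- The number of faces: the cycles of the face permutation on half-edges. -/
noncomputable def numFaces {α : Type} [DecidableEq α] (G : GaussDiagram α) : ℕ :=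
  Nat.card (Quot fun d e : (α × Bool) × Bool => e = G.rotate (G.opposite d))

/-- The number of connected components of the graph of crossings and edges (circles without
crossings are not counted). -/
noncomputable def numGraphComponents {α : Type} [DecidableEq α] (G : GaussDiagram α) : ℕ :=
  Nat.card (Quot fun a b : α => ∃ x y : Bool, G.next (a, x) = (b, y))

/-- `G` is the Gauss diagram of a classical link diagram: in `V - E + F = 2c`, where `V` is the
number of crossings, `E = 2V`, `F` the number of faces and `c` the number of connected components
of the graph. -/
def IsClassical {α : Type} [DecidableEq α] [Fintype α] (G : GaussDiagram α) : Prop :=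
  (Fintype.card α : ℤ) - 2 * Fintype.card α + G.numFaces = 2 * G.numGraphComponents

/-! ### Reidemeister moves and Conway triples -/

/-- `G` and `G'` differ only in the labels of the arrows, in the order in which the circles are
listed and in the points from which the circles are read; that is, they are the same once base
points are forgotten. -/
def SameUnbased {α β : Type} (G : GaussDiagram α) (G' : GaussDiagram β) : Prop :=
  ∃ e : α ≃ β, (∀ a, G'.sign (e a) = G.sign a) ∧
    ∃ L : List (List (β × Bool)),
      (G.circles.map (List.map (Prod.map e id))).Perm L ∧ List.Forall₂ List.IsRotated L G'.circles

/-- `G'` is obtained from `G` by deleting the arrows that do not satisfy `keep`. -/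
def DeletesTo {α β : Type} (G : GaussDiagram α) (keep : α → Prop) [DecidablePred keep]
    (G' : GaussDiagram β) : Prop :=
  ∃ ι : β ↪ α, (∀ b, G'.sign b = G.sign (ι b)) ∧
    G'.circles.map (List.map (Prod.map ι id)) =
      G.circles.map (List.filter fun p => keep p.1)

/-- The endpoint `q` comes immediately after `p` in the word of some circle. -/
def Adjacent {α : Type} (G : GaussDiagram α) (p q : α × Bool) : Prop :=
  ∃ w ∈ G.circles, [p, q] <:+: w

/-- `p` and `q` are neighbours; `s = 1` if `p` comes first, and `s = -1` if `q` comes first. -/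
def Neighbours {α : Type} (G : GaussDiagram α) (p q : α × Bool) (s : ℤˣ) : Prop :=
  (s = 1 ∧ G.Adjacent p q) ∨ (s = -1 ∧ G.Adjacent q p)

/-- First Reidemeister move: `G'` is obtained from `G` by removing a kink. -/
def Reidemeister1 {α β : Type} [DecidableEq α] (G : GaussDiagram α) (G' : GaussDiagram β) : Prop :=
  ∃ (a : α) (x : Bool), G.Adjacent (a, x) (a, !x) ∧ G.DeletesTo (fun c => c ≠ a) G'

/-- Second Reidemeister move: `G'` is obtained from `G` by removing two crossings of opposite signs
which are consecutive both on an overpassing and on an underpassing strand (the two strands may have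
the same or opposite directions). -/
def Reidemeister2 {α β : Type} [DecidableEq α] (G : GaussDiagram α) (G' : GaussDiagram β) : Prop :=
  ∃ a b : α, a ≠ b ∧ G.sign a = -G.sign b ∧
    G.Adjacent (a, true) (b, true) ∧
    (G.Adjacent (a, false) (b, false) ∨ G.Adjacent (b, false) (a, false)) ∧
    G.DeletesTo (fun c => c ≠ a ∧ c ≠ b) G'

/-- Third Reidemeister move on a top, a middle and a bottom strand which pairwise cross in
`tm` (top over middle), `tb` (top over bottom) and `mb` (middle over bottom).  On each strand the two
crossings are neighbours, and the move exchanges them on each strand.  The two equations between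
signs and orders express that the three crossings are the vertices of a triangle: if the strands
have directions `t, m, b`, the signs are those of `det (t, m)`, `det (t, b)`, `det (m, b)`, and the
sides of the triangle satisfy `x t + w b = y m` up to positive factors. -/
def Reidemeister3 {α : Type} [DecidableEq α] (G G' : GaussDiagram α) : Prop :=
  ∃ (tm tb mb : α) (x y w : ℤˣ), tm ≠ tb ∧ tm ≠ mb ∧ tb ≠ mb ∧
    G.Neighbours (tm, true) (tb, true) x ∧
    G.Neighbours (tm, false) (mb, true) y ∧
    G.Neighbours (tb, false) (mb, false) w ∧
    y * G.sign tm = w * G.sign tb ∧ x * G.sign tb = y * G.sign mb ∧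
    (∀ a, G'.sign a = G.sign a) ∧
    G'.circles = G.circles.map (List.map
      (Equiv.swap (tm, true) (tb, true) * Equiv.swap (tm, false) (mb, true) *
        Equiv.swap (tb, false) (mb, false) : Equiv.Perm (α × Bool)))

/-- `Gm` is obtained from `Gp` by changing the positive crossing `a` into a negative one. -/
def CrossingChange {α : Type} [DecidableEq α] (Gp Gm : GaussDiagram α) (a : α) : Prop :=
  Gp.sign a = 1 ∧ Gm.sign = Function.update Gp.sign a (-1) ∧
    Gm.circles = Gp.circles.map (List.map (Equiv.swap (a, true) (a, false)))

/-- `Gz` is obtained from `G` by the orientation preserving smoothing of the crossing `a`.  The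
circles are read from a passage through `a`: if `a` is a self-crossing, the circle is split into two;
otherwise the two circles through `a` are merged. -/
def Smoothing {α β : Type} (G : GaussDiagram α) (Gz : GaussDiagram β) (a : α) : Prop :=
  ∃ ι : β ↪ α, (∀ b, Gz.sign b = G.sign (ι b)) ∧
    ∃ (x : Bool) (u v : List (α × Bool)) (rest : List (List (α × Bool))),
      (G.circles = ((a, x) :: u ++ (a, !x) :: v) :: rest ∧
        Gz.circles.map (List.map (Prod.map ι id)) = u :: v :: rest) ∨
      (G.circles = ((a, x) :: u) :: ((a, !x) :: v) :: rest ∧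
        Gz.circles.map (List.map (Prod.map ι id)) = (u ++ v) :: rest)

/-- A Conway triple. -/
def ConwayTriple {α β : Type} [DecidableEq α] (Gp Gm : GaussDiagram α) (Gz : GaussDiagram β) :
    Prop :=
  ∃ a : α, CrossingChange Gp Gm a ∧ Smoothing Gp Gz a

end GaussDiagram

/-- A classical oriented link diagram (with at least one component) with a base point, given by its
Gauss diagram. -/
structure ClassicalDiagram where
  n : ℕ
  gauss : GaussDiagram (Fin n)
  classical : gauss.IsClassical

/-- The elementary steps of isotopy: forgetting base points and labels, and Reidemeister moves
between classical diagrams. -/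
inductive ClassicalDiagram.Step : ClassicalDiagram → ClassicalDiagram → Prop
  | same (D D' : ClassicalDiagram) : D.gauss.SameUnbased D'.gauss → Step D D'
  | r1 (D D' : ClassicalDiagram) : D.gauss.Reidemeister1 D'.gauss → Step D D'
  | r2 (D D' : ClassicalDiagram) : D.gauss.Reidemeister2 D'.gauss → Step D D'
  | r3 {n : ℕ} (G G' : GaussDiagram (Fin n)) (h : G.IsClassical) (h' : G'.IsClassical) :
      G.Reidemeister3 G' → Step ⟨n, G, h⟩ ⟨n, G', h'⟩

/-- Classical oriented links up to isotopy: classical diagrams modulo the equivalence relation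
generated by the Reidemeister moves. -/
def ClassicalLink : Type := Quot ClassicalDiagram.Step

/-- The link represented by a classical diagram. -/
def ClassicalDiagram.link (D : ClassicalDiagram) : ClassicalLink := Quot.mk _ D

/-- The diagram of the unknot that consists of one circle without crossings. -/
def ClassicalDiagram.unknot : ClassicalDiagram where
  n := 0
  gauss :=
    { base := []
      others := []
      nodup := by simp
      complete := fun p => p.1.elim0
      sign := fun _ => 1 }
  classical := by
    simp [GaussDiagram.IsClassical, GaussDiagram.numFaces, GaussDiagram.numGraphComponents]

/-- The defining properties of the Conway polynomial, as a polynomial valued function of links: it is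
`1` on the unknot, and it satisfies the skein relation `∇(L₊) - ∇(L₋) = z ∇(L₀)`. -/
structure IsConwayPolynomial (C : ClassicalLink → Polynomial ℤ) : Prop where
  unknot : C ClassicalDiagram.unknot.link = 1
  skein : ∀ {n k : ℕ} (Gp Gm : GaussDiagram (Fin n)) (Gz : GaussDiagram (Fin k))
    (hp : Gp.IsClassical) (hm : Gm.IsClassical) (hz : Gz.IsClassical),
    GaussDiagram.ConwayTriple Gp Gm Gz →
      C (ClassicalDiagram.link ⟨n, Gp, hp⟩) - C (ClassicalDiagram.link ⟨n, Gm, hm⟩) =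
        Polynomial.X * C (ClassicalDiagram.link ⟨k, Gz, hz⟩)

/-! A link diagram is encoded by a permutation `σ` of finitely many points on its circles and an
involution `mate` that pairs the two passages through each crossing (`Crossings`). Fixed points of
`mate` are points without a crossing ("dummies"); they serve as markers and base points and keep
circles without arrows visible. The ribbon surface of an arrow diagram has as its boundary the curve
obtained by smoothing every arrow. A homomorphism from an arrow diagram with one boundary component
is determined by the set `S` of crossings in its image. Hence `A_{n,m}(G)` is the `stateSum`: the
signed number of `n`-element sets `S` whose smoothing, the orbits of `σ * X.flip S`, is a single
curve which meets every crossing of `S` first from below (`Rep.count_eq`). Descending diagrams give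
the same sum after over and under are exchanged and the writhes kept (`turn`).

Skein relation: of the states through a crossing `p`, one of the two diagrams counts those that meet
one passage of `p` first, the other diagram those that meet the other passage first. Together these
are all states of the smoothed diagram (`skein`).

Reidemeister moves away from the base point: smoothing a kink splits off a curve; in a bigon no
state uses both crossings, and states through one of them cancel in pairs (`Bigon.stateSum_eq`). For
the third move (`Triangle.defect_eq_zero`) the skein relation shows, by induction on the degree,
that crossing changes do not alter the difference of the two sums. So the diagram may be assumed
descending, and then sums of positive degree vanish (`stateSum_descending`).

Base point: it may move past a crossing if the sums of the smoothed diagram, one degree lower, are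
independent of the base point (`stateSum_shift`). Passing to another circle needs planarity. A
planar diagram can be freed of all crossings by Reidemeister moves and crossing changes
(`PlanarCurve.exists_trivial`), and given independence in degree `k`, each of these steps preserves
and reflects independence in degree `k + 1` (`Move.sum_const_iff`). Without crossings the sums of
positive degree are zero, which proves `baseFree`.

Planarity is used in homological form: every flow on the graph of the diagram is the boundary of a
function on the faces (`Planar`). By a dimension count this is the Euler characteristic condition
(`isClassical_iff`), and unlike the latter it passes easily through smoothings and moves. It also
serves as the Jordan curve theorem when loops are removed.

Uniqueness uses the same reduction: by induction on the degree, the difference of two solutions is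
unchanged by crossing changes, and the skein relation determines the value on unlinks
(`isConwayPolynomial_unique`). -/

open Equiv
open Classical (propDecidable)

/-! ### Orbits followed until a condition fails, and the order of visits -/

/-- `Walk τ A b q`: the orbit of `b` under `τ` reaches `q`, leaving only points that satisfy `A`. -/
def Walk {P : Type} (τ : P → P) (A : P → Prop) : P → P → Prop :=
  Relation.ReflTransGen fun z w => A z ∧ τ z = w

/-- From `b` on, the point `y` is not reached before `x`. -/
def Before {P : Type} (τ : P → P) (b x y : P) : Prop := ¬ Walk τ (· ≠ x) b y

/-- Every point is reached from `b`. -/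
def Conn {P : Type} (τ : P → P) (b : P) : Prop := ∀ q, Walk τ (fun _ => True) b q

namespace Walk

variable {P : Type} {τ : P → P} {A B : P → Prop} {b x y z : P}

lemma refl (b : P) : Walk τ A b b := Relation.ReflTransGen.refl

lemma trans (h : Walk τ A x y) (h' : Walk τ A y z) : Walk τ A x z :=
  Relation.ReflTransGen.trans h h'

lemma head (hx : A x) (h : Walk τ A (τ x) y) : Walk τ A x y :=
  Relation.ReflTransGen.head ⟨hx, rfl⟩ h

lemma tail (h : Walk τ A x y) (hy : A y) : Walk τ A x (τ y) :=
  Relation.ReflTransGen.tail h ⟨hy, rfl⟩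

lemma cases_head (h : Walk τ A x y) : x = y ∨ A x ∧ Walk τ A (τ x) y := by
  rcases Relation.ReflTransGen.cases_head h with h | ⟨c, ⟨h1, rfl⟩, h2⟩
  · exact Or.inl h
  · exact Or.inr ⟨h1, h2⟩

lemma mono (hAB : ∀ z, A z → B z) (h : Walk τ A x y) : Walk τ B x y :=
  Relation.ReflTransGen.mono (fun _ _ h => ⟨hAB _ h.1, h.2⟩) _ _ h

@[elab_as_elim]
lemma head_induction {motive : P → Prop} (h : Walk τ A x y) (hrefl : motive y)
    (hhead : ∀ z, A z → Walk τ A (τ z) y → motive (τ z) → motive z) : motive x := by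
  unfold Walk at h
  induction h using Relation.ReflTransGen.head_induction_on with
  | refl => exact hrefl
  | head h1 h2 ih =>
    obtain ⟨h1, rfl⟩ := h1
    exact hhead _ h1 h2 ih

@[elab_as_elim]
lemma tail_induction {motive : P → Prop} (h : Walk τ A x y) (hrefl : motive x)
    (htail : ∀ z, A z → Walk τ A x z → motive z → motive (τ z)) : motive y := by
  unfold Walk at h
  induction h with
  | refl => exact hrefl
  | tail h1 h2 ih =>
    obtain ⟨h2, rfl⟩ := h2
    exact htail _ h2 h1 ih

lemma total (h : Walk τ A x y) (h' : Walk τ A x z) : Walk τ A y z ∨ Walk τ A z y :=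
  Relation.ReflTransGen.total_of_right_unique (fun _ _ _ h1 h2 => h1.2.symm.trans h2.2) h h'

/-- A walk may be cut at the first visit of its end. -/
lemma trunc (h : Walk τ A x y) : Walk τ (fun z => A z ∧ z ≠ y) x y := by
  refine h.head_induction (refl _) fun z hz _ ih => ?_
  by_cases hzy : z = y
  · subst hzy; exact refl _
  · exact head ⟨hz, hzy⟩ ih

lemma eq_of_not (hx : ¬ A x) (h : Walk τ A x y) : x = y :=
  h.cases_head.resolve_right fun h => hx h.1

lemma iterate (h : Walk τ A x y) : ∃ k, τ^[k] x = y ∧ ∀ j < k, A (τ^[j] x) := by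
  refine h.head_induction ⟨0, rfl, by simp⟩ fun z hz _ ⟨k, hk, hA⟩ => ⟨k + 1, hk, ?_⟩
  rintro (_ | j) hj
  · exact hz
  · exact hA j (by omega)

lemma of_iterate : ∀ (k : ℕ) {x : P}, (∀ j < k, A (τ^[j] x)) → Walk τ A x (τ^[k] x)
  | 0, _, _ => refl _
  | k + 1, x, h => by
    rw [Function.iterate_succ_apply]
    exact head (h 0 (by omega)) (of_iterate k fun j hj => h (j + 1) (by omega))

/-- Orbits of a permutation of a finite set are cycles, so going forward eventually leads back. -/
lemma symm_of_perm {P : Type} [Finite P] {σ : Perm P} {x y : P}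
    (h : Walk σ (fun _ => True) x y) : Walk σ (fun _ => True) y x := by
  obtain ⟨k, hk, -⟩ := h.iterate
  have : Perm.SameCycle σ y x := ⟨-k, by
    rw [← hk, Perm.iterate_eq_pow, zpow_neg, zpow_natCast]; simp⟩
  obtain ⟨i, -, hi⟩ := this.exists_pow_eq'
  rw [← hi, ← Perm.iterate_eq_pow]
  exact of_iterate i (by simp)

end Walk

/-- The right-hand side is the form in which `IsAscending` and `IsDescending` are stated. -/
lemma before_iff_iterate {P : Type} {τ : P → P} {b x y : P} :
    Before τ b x y ↔ ∀ k, τ^[k] b = y → ∃ j < k, τ^[j] b = x := by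
  constructor
  · intro h k hk
    by_contra! hc
    exact h (hk ▸ Walk.of_iterate k hc)
  · intro h hw
    obtain ⟨k, hk, hA⟩ := hw.iterate
    obtain ⟨j, hj, hjx⟩ := h k hk
    exact hA j hj hjx

section Before

variable {P : Type} {τ : P → P} {b x y : P}

lemma before_shift (hx : b ≠ x) (hy : b ≠ y) : Before τ (τ b) x y ↔ Before τ b x y := by
  unfold Before
  refine not_congr ⟨fun h => h.head hx, fun h => ?_⟩
  exact (h.cases_head.resolve_left hy).2

lemma before_self_left (h : x ≠ y) : Before τ x x y := fun hw =>
  h (hw.eq_of_not (by simp))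

lemma not_before_self_right : ¬ Before τ y x y := fun h => h (Walk.refl _)

/-- Seen from `τ y`, the point `y` is the last one of its cycle. -/
lemma before_next_right (hxy : x ≠ y) (hc : Walk τ (fun _ => True) y x) : Before τ (τ y) x y := by
  intro hw
  have key : Walk τ (· ≠ x) x y := by
    refine (hc.tail_induction (motive := fun z => Walk τ (· ≠ x) (τ y) z ∧ Walk τ (· ≠ x) z y)
      ⟨hw, Walk.refl _⟩ fun z _ _ ⟨h1, h2⟩ => ?_).2
    rcases h2.cases_head with rfl | ⟨h3, h4⟩
    · exact ⟨Walk.refl _, hw⟩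
    · exact ⟨h1.tail h3, h4⟩
  exact hxy (key.eq_of_not (by simp))

lemma not_before_next_left (hc : Walk τ (fun _ => True) (τ x) y) : ¬ Before τ (τ x) x y := by
  refine not_not.2 (hc.tail_induction (Walk.refl _) fun z _ _ hz => ?_)
  by_cases h : z = x
  · subst h; exact Walk.refl _
  · exact hz.tail h

/-- Of two distinct points, one of which is reached, exactly one is met first. In the skein relation
this makes the states through a crossing of the two diagrams complementary. -/
lemma before_dichotomy (hxy : x ≠ y) (hc : Walk τ (fun _ => True) b x) :
    Before τ b x y ↔ ¬ Before τ b y x := by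
  unfold Before
  rw [not_not]
  constructor
  · intro h
    by_contra hc'
    have : Walk τ (· ≠ y) b x ∨ Walk τ (· ≠ x) b y := by
      refine hc.head_induction (Or.inl (Walk.refl _)) fun z _ _ ih => ?_
      by_cases h1 : z = x
      · subst h1; exact Or.inl (Walk.refl _)
      by_cases h2 : z = y
      · subst h2; exact Or.inr (Walk.refl _)
      exact ih.imp (Walk.head h2) (Walk.head h1)
    exact this.elim hc' h
  · intro h1 h2
    have h1' := h1.trunc
    have h2' : Walk τ (fun z => z ≠ y ∧ z ≠ x) b y := h2.trunc.mono fun _ h => ⟨h.2, h.1⟩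
    rcases h1'.total h2' with h | h
    · exact hxy (h.eq_of_not (by simp))
    · exact hxy (h.eq_of_not (by simp)).symm

end Before

/-- The walk from `b` to the first point that satisfies `D`. -/
lemma Walk.first {P : Type} {τ : P → P} {A : P → Prop} {b q : P} (D : P → Prop)
    (h : Walk τ A b q) (hq : D q) :
    ∃ r, D r ∧ Walk τ (fun z => A z ∧ ¬ D z) b r ∧ Walk τ A r q := by
  refine h.head_induction ⟨q, hq, .refl _, .refl _⟩ fun z hz hw ⟨r, hr, h1, h2⟩ => ?_
  by_cases hD : D z
  · exact ⟨z, hD, .refl _, hw.head hz⟩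
  · exact ⟨r, hr, h1.head ⟨hz, hD⟩, h2⟩

/-- Walks of `τ` and of the permutation `τ'` obtained by inserting a point `d`. -/
lemma walk_insert {P : Type} {τ τ' : P → P} {A : P → Prop} {d b y : P} (hA : A d)
    (h : ∀ z, z ≠ d → τ' z = τ z ∨ τ' z = d ∧ τ' d = τ z) (hd : ∀ z, z ≠ d → τ z ≠ d)
    (hb : b ≠ d) (hy : y ≠ d) : Walk τ A b y ↔ Walk τ' A b y := by
  constructor
  · intro hw
    refine (hw.tail_induction (motive := fun z => z ≠ d ∧ Walk τ' A b z) ⟨hb, .refl _⟩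
      fun z hz _ ⟨hzd, ih⟩ => ⟨hd z hzd, ?_⟩).2
    rcases h z hzd with h1 | ⟨h1, h2⟩
    · rw [← h1]; exact ih.tail hz
    · rw [← h2, ← h1]; exact (ih.tail hz).tail (h1 ▸ hA)
  · intro hw
    -- While the walk stands at `d`, the induction keeps the point `r` from which `d` was entered,
    -- since `τ` jumps from `r` over `d`.
    have := hw.tail_induction (motive := fun z => (z ≠ d → Walk τ A b z) ∧
      (z = d → ∃ r, r ≠ d ∧ A r ∧ τ' r = d ∧ Walk τ A b r)) ⟨fun _ => .refl _, fun h => (hb h).elim⟩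
      fun z hz _ ⟨ih1, ih2⟩ => ?_
    · exact this.1 hy
    by_cases hzd : z = d
    · subst hzd
      obtain ⟨r, hr, hAr, hr', hwr⟩ := ih2 rfl
      refine ⟨fun hne => ?_, fun he => ⟨r, hr, hAr, hr', hwr⟩⟩
      rcases h r hr with h1 | ⟨_, h2⟩
      · exact (hd r hr (h1 ▸ hr')).elim
      · rw [h2]; exact hwr.tail hAr
    · refine ⟨fun hne => ?_, fun he => ⟨z, hzd, hz, he, ih1 hzd⟩⟩
      rcases h z hzd with h1 | ⟨h1, _⟩
      · rw [h1]; exact (ih1 hzd).tail hz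
      · exact (hne h1).elim

/-! ### Crossings and the state sum -/

/-- Crossings on the points of an oriented curve.  `mate` pairs the two passages through a crossing
(its fixed points are not crossings); `ε p = 1` if the other strand crosses the strand of `p` from
right to left; `up p` tells whether `p` is the overpassing. -/
@[ext]
structure Crossings (P : Type) where
  mate : P → P
  ε : P → ℤˣ
  up : P → Bool
  mate_mate : ∀ p, mate (mate p) = p
  ε_mate : ∀ p, mate p ≠ p → ε (mate p) = -ε p
  up_mate : ∀ p, mate p ≠ p → up (mate p) = !up p

namespace Crossings

open Classical

variable {P : Type}

/-- The writhe of the crossing at `p`. -/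
def sgn (X : Crossings P) (p : P) : ℤˣ := if X.up p then X.ε p else -X.ε p

/-- Forget the crossings outside `K`. -/
noncomputable def keep (X : Crossings P) (K : P → Prop) : Crossings P where
  mate z := if K z ∧ K (X.mate z) then X.mate z else z
  ε := X.ε
  up := X.up
  mate_mate := by grind [X.mate_mate]
  ε_mate := by grind [X.ε_mate]
  up_mate := by grind [X.up_mate]

/-- Forget the crossing at `p`. -/
noncomputable def del (X : Crossings P) (p : P) : Crossings P := X.keep (· ≠ p)

lemma keep_mate (X : Crossings P) (K : P → Prop) (z : P) :
    (X.keep K).mate z = if K z ∧ K (X.mate z) then X.mate z else z := rfl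

lemma del_mate (X : Crossings P) (p z : P) :
    (X.del p).mate z = if z ≠ p ∧ X.mate z ≠ p then X.mate z else z := by
  unfold del
  rw [keep_mate]
  congr

lemma mate_eq_iff (X : Crossings P) {p q : P} : X.mate p = q ↔ p = X.mate q := by
  grind [X.mate_mate]

lemma mate_inj (X : Crossings P) {p q : P} : X.mate p = X.mate q ↔ p = q := by
  rw [X.mate_eq_iff, X.mate_mate]

/-- Change the crossing at `p`. -/
noncomputable def cc (X : Crossings P) (p : P) : Crossings P where
  mate := X.mate
  ε := X.ε
  up z := if z = p ∨ z = X.mate p then !X.up z else X.up z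
  mate_mate := X.mate_mate
  ε_mate := X.ε_mate
  up_mate z hz := by
    have := X.mate_mate
    have := X.up_mate z hz
    grind

/-- Transport along a bijection of the points. -/
def map {P' : Type} (X : Crossings P) (e : P ≃ P') : Crossings P' where
  mate z := e (X.mate (e.symm z))
  ε z := X.ε (e.symm z)
  up z := X.up (e.symm z)
  mate_mate p := by simp [X.mate_mate]
  ε_mate p h := by
    simp only [Equiv.symm_apply_apply]
    exact X.ε_mate _ fun h' => h (by simp [h'])
  up_mate p h := by
    simp only [Equiv.symm_apply_apply]
    exact X.up_mate _ fun h' => h (by simp [h'])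

/-- Exchange over and under everywhere, keeping the writhes. -/
def rev (X : Crossings P) : Crossings P where
  mate := X.mate
  ε z := -X.ε z
  up z := !X.up z
  mate_mate := X.mate_mate
  ε_mate p h := by rw [X.ε_mate p h]
  up_mate p h := by rw [X.up_mate p h]

lemma rev_sgn (X : Crossings P) (p : P) : X.rev.sgn p = X.sgn p := by
  unfold sgn rev
  cases h : X.up p <;> simp [h]

lemma sgn_mate (X : Crossings P) (p : P) : X.sgn (X.mate p) = X.sgn p := by
  by_cases h : X.mate p = p <;> grind [sgn, X.up_mate, X.ε_mate, neg_neg]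

lemma del_del (X : Crossings P) {p : P} : X.del (X.mate p) = X.del p := by
  ext z
  · simp only [del_mate]
    have := X.mate_mate
    grind
  · rfl
  · rfl

/-- Exchange the two passages through the crossings in `S`. -/
noncomputable def flip (X : Crossings P) (S : Finset P) : Perm P :=
  Function.Involutive.toPerm (fun z => if z ∈ S ∨ X.mate z ∈ S then X.mate z else z) (by
    intro z
    grind [X.mate_mate])

lemma flip_apply (X : Crossings P) (S : Finset P) (z : P) :
    X.flip S z = if z ∈ S ∨ X.mate z ∈ S then X.mate z else z := rfl

lemma flip_empty (X : Crossings P) : X.flip ∅ = 1 := by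
  ext z; simp [flip_apply]

/-- The overpassings. -/
noncomputable def tails [Fintype P] (X : Crossings P) : Finset P :=
  Finset.univ.filter fun p => X.mate p ≠ p ∧ X.up p = true

lemma mem_tails [Fintype P] {X : Crossings P} {p : P} :
    p ∈ X.tails ↔ X.mate p ≠ p ∧ X.up p = true := by simp [tails]

lemma mate_notMem_tails [Fintype P] {X : Crossings P} {p : P} (h : p ∈ X.tails) :
    X.mate p ∉ X.tails := by
  grind [mem_tails, X.up_mate]

/-- Smoothing the crossings in `S` yields a single curve, which passes each of them first below. -/
def Good (X : Crossings P) (σ : Perm P) (b : P) (S : Finset P) : Prop :=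
  Conn (σ * X.flip S) b ∧ ∀ p ∈ S, Before (σ * X.flip S) b (X.mate p) p

/-- The sum over the `k`-element sets of crossings whose smoothing is a single curve passing each of
them first below, weighted by signs. -/
noncomputable def stateSum [Fintype P] (k : ℕ) (σ : Perm P) (X : Crossings P) (b : P) : ℤ :=
  ∑ S ∈ X.tails.powersetCard k, if X.Good σ b S then ∏ p ∈ S, (X.sgn p : ℤ) else 0

lemma stateSum_zero [Fintype P] (σ : Perm P) (X : Crossings P) (b : P) :
    stateSum 0 σ X b = if Conn σ b then 1 else 0 := by
  simp [stateSum, Good, flip_empty]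

/-- At the fixed points of `mate` the values of `ε` and `up` are meaningless defaults; the state sum
ignores them. -/
lemma stateSum_congr [Fintype P] {X Y : Crossings P} (k : ℕ) (σ : Perm P) (b : P)
    (hm : X.mate = Y.mate) (hε : ∀ p, X.mate p ≠ p → X.ε p = Y.ε p)
    (ho : ∀ p, X.mate p ≠ p → X.up p = Y.up p) : stateSum k σ X b = stateSum k σ Y b := by
  have ht : X.tails = Y.tails := by
    ext p
    rw [mem_tails, mem_tails, hm]
    refine and_congr_right fun h => ?_
    rw [ho p (hm ▸ h)]
  have hf : ∀ S, X.flip S = Y.flip S := fun S => by ext z; simp [flip_apply, hm]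
  unfold stateSum
  rw [ht]
  refine Finset.sum_congr rfl fun S hS => ?_
  have : X.Good σ b S ↔ Y.Good σ b S := by simp [Good, hf, hm]
  rw [if_congr this rfl rfl, Finset.prod_congr rfl fun p hp => ?_]
  have := (mem_tails.1 ((Finset.mem_powersetCard.1 hS).1 hp)).1
  unfold sgn
  rw [hε p (hm ▸ this), ho p (hm ▸ this)]

/-! ### The skein relation -/

section Skein

variable [Fintype P] {X : Crossings P} {p : P}

lemma del_tails (X : Crossings P) (p : P) (hp : p ∈ X.tails) : (X.del p).tails = X.tails.erase p := by
  ext z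
  have : (X.del p).up = X.up := rfl
  grind [mem_tails, mate_notMem_tails, del_mate, X.mate_mate]

lemma flip_del (hp : p ∈ X.tails) {S : Finset P} (hS : S ⊆ X.tails.erase p) :
    (X.del p).flip S = X.flip S := by
  ext z
  have := mate_notMem_tails hp
  grind [flip_apply, del_mate, X.mate_mate]

/-- Smoothing one more crossing contributes one transposition, so a state through `p` is a state of
the diagram smoothed at `p`, whose permutation is `σ * swap p (X.mate p)`. -/
lemma flip_insert (hp : p ∈ X.tails) {S : Finset P} (hS : S ⊆ X.tails.erase p) :
    X.flip (insert p S) = swap p (X.mate p) * (X.del p).flip S := by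
  ext z
  have := mate_notMem_tails hp
  have := X.mate_mate
  grind [Perm.mul_apply, flip_del, flip_apply]

/-- The states that contain `p`, with an arbitrary condition `C` instead of the one at `p`. -/
lemma stateSum_succ (k : ℕ) (σ : Perm P) (b : P) (hp : p ∈ X.tails) :
    stateSum (k + 1) σ X b = stateSum (k + 1) σ (X.del p) b +
      X.sgn p * ∑ S ∈ (X.del p).tails.powersetCard k,
        if (X.del p).Good (σ * swap p (X.mate p)) b S ∧
            Before (σ * swap p (X.mate p) * (X.del p).flip S : Perm P) b (X.mate p) p
        then ∏ q ∈ S, ((X.del p).sgn q : ℤ) else 0 := by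
  have hmate : ∀ S ⊆ X.tails.erase p, ∀ q ∈ S, (X.del p).mate q = X.mate q := by
    have := mate_notMem_tails hp
    grind [del_mate, X.mate_mate]
  have hins : X.tails = insert p (X.tails.erase p) := (Finset.insert_erase hp).symm
  have hsgn : ∀ q, (X.del p).sgn q = X.sgn q := fun _ => rfl
  -- The states are split according to whether they contain `p`. For those that do, `Good` separates
  -- into `Good` for the smoothed diagram and the order condition at `p` itself.
  rw [stateSum, hins, Finset.powersetCard_succ_insert (by simp), Finset.sum_union, stateSum,
    del_tails X p hp]
  · congr 1
    · refine Finset.sum_congr rfl fun S hS => ?_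
      have hS' := (Finset.mem_powersetCard.1 hS).1
      refine if_congr ?_ rfl rfl
      unfold Good
      rw [flip_del hp hS']
      refine and_congr_right fun _ => forall₂_congr fun q hq => ?_
      rw [hmate S hS' q hq]
    · rw [Finset.sum_image, Finset.mul_sum]
      · refine Finset.sum_congr rfl fun S hS => ?_
        have hS' := (Finset.mem_powersetCard.1 hS).1
        have hpS : p ∉ S := fun h => by simpa using hS' h
        rw [Finset.prod_insert hpS, mul_ite, mul_zero]
        refine if_congr ?_ rfl rfl
        unfold Good
        rw [flip_insert hp hS', ← mul_assoc, Finset.forall_mem_insert, and_assoc]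
        refine and_congr_right fun _ => ?_
        rw [and_comm]
        refine and_congr_left fun _ => forall₂_congr fun q hq => ?_
        rw [hmate S hS' q hq]
      · intro S hS T hT hST
        have h1 : p ∉ S := by grind
        have h2 : p ∉ T := by grind
        rw [← Finset.erase_insert h1, ← Finset.erase_insert h2]
        exact congrArg (fun S => Finset.erase S p) hST
  · grind [Finset.disjoint_left]

lemma cc_mem_tails (hp : p ∈ X.tails) : X.mate p ∈ (X.cc p).tails := by
  grind [mem_tails, cc, X.mate_mate, X.up_mate]

lemma cc_sgn (hp : X.mate p ≠ p) : (X.cc p).sgn (X.mate p) = -X.sgn p := by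
  simp only [sgn, cc]
  grind [X.up_mate, X.ε_mate, neg_neg]

lemma stateSum_del_cc (k : ℕ) (σ : Perm P) (X : Crossings P) (p b : P) :
    stateSum k σ ((X.cc p).del p) b = stateSum k σ (X.del p) b := by
  refine stateSum_congr k σ b rfl (fun _ _ => rfl) fun z hz => ?_
  have hz' : (X.del p).mate z ≠ z := hz
  show (if _ then _ else _) = X.up z
  grind [del_mate, X.mate_mate]

/-- The states avoiding `p` cancel. The states through `p` are states of the smoothing in which
`X.mate p` comes before `p`, respectively, after the crossing change, `p` before `X.mate p`. By
`before_dichotomy` these two classes partition all states of the smoothing, and the opposite writhes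
turn the difference into a sum. -/
lemma skein_tail (k : ℕ) (σ : Perm P) (b : P) (hp : p ∈ X.tails) :
    stateSum (k + 1) σ X b - stateSum (k + 1) σ (X.cc p) b =
      X.sgn p * stateSum k (σ * swap p (X.mate p)) (X.del p) b := by
  have hpm : X.mate p ≠ p := (mem_tails.1 hp).1
  rw [stateSum_succ k σ b hp, stateSum_succ k σ b (cc_mem_tails hp)]
  have hm : (X.cc p).mate = X.mate := rfl
  have hd : (X.cc p).del (X.mate p) = (X.cc p).del p := by
    rw [← hm, del_del]
  rw [hd, stateSum_del_cc, hm, X.mate_mate, cc_sgn hpm, Equiv.swap_comm (X.mate p) p]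
  have ht : ((X.cc p).del p).tails = (X.del p).tails := by
    ext z
    rw [mem_tails, mem_tails]
    refine and_congr_right fun hz => ?_
    have hz' : (X.del p).mate z ≠ z := hz
    show (if _ then _ else _) = true ↔ X.up z = true
    grind [del_mate, X.mate_mate]
  have hf : ∀ S, ((X.cc p).del p).flip S = (X.del p).flip S := fun S => by
    ext z; rfl
  rw [ht]
  have : ∀ a b c d e : ℤ, d + e = c → a + b * d - (a + -b * e) = b * c := by
    rintro a b c d e rfl; ring
  rw [Units.val_neg]
  apply this
  rw [stateSum, ← Finset.sum_add_distrib]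
  refine Finset.sum_congr rfl fun S hS => ?_
  have hG : ∀ σ, ((X.cc p).del p).Good σ b S ↔ (X.del p).Good σ b S := fun σ => Iff.rfl
  have hprod : ∏ q ∈ S, (((X.cc p).del p).sgn q : ℤ) = ∏ q ∈ S, ((X.del p).sgn q : ℤ) := by
    refine Finset.prod_congr rfl fun q hq => ?_
    have hq' := (Finset.mem_powersetCard.1 hS).1 hq
    rw [del_tails X p hp] at hq'
    have h1 : q ≠ p := Finset.ne_of_mem_erase hq'
    have h2 : q ≠ X.mate p := fun h => mate_notMem_tails hp (h ▸ Finset.mem_of_mem_erase hq')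
    have h3 : ((X.cc p).del p).up q = X.up q := by
      show (if _ then _ else _) = X.up q
      grind
    unfold sgn
    rw [h3]
    rfl
  simp only [hG, hf, hprod]
  by_cases hg : (X.del p).Good (σ * swap p (X.mate p)) b S
  · have := before_dichotomy (τ := (σ * swap p (X.mate p) * (X.del p).flip S : Perm P))
      (b := b) hpm (hg.1 _)
    grind
  · simp only [hg, false_and, if_false, add_zero]

lemma cc_cc (X : Crossings P) (p : P) : (X.cc p).cc p = X := by
  ext z
  · rfl
  · rfl
  · simp only [cc]
    split_ifs <;> simp

lemma cc_mate (X : Crossings P) (p : P) (hp : X.mate p ≠ p) : X.cc (X.mate p) = X.cc p := by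
  ext z
  · rfl
  · rfl
  · simp only [cc, X.mate_mate, or_comm]

/-- The skein relation. -/
lemma skein (k : ℕ) (σ : Perm P) (b : P) (hp : X.mate p ≠ p) :
    stateSum (k + 1) σ X b - stateSum (k + 1) σ (X.cc p) b =
      X.sgn p * stateSum k (σ * swap p (X.mate p)) (X.del p) b := by
  by_cases ho : X.up p = true
  · exact skein_tail k σ b (mem_tails.2 ⟨hp, ho⟩)
  · have hq : X.mate p ∈ X.tails := by grind [mem_tails, X.mate_mate, X.up_mate]
    have := skein_tail k σ b hq
    rwa [cc_mate X p hp, X.sgn_mate, X.mate_mate, Equiv.swap_comm, X.del_del] at this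

end Skein

end Crossings

/-! ### The base point, descending diagrams and points without crossings -/

namespace Crossings

open Classical

variable {P : Type} [Fintype P] {X : Crossings P} {p : P}

lemma conn_shift {τ : Perm P} {b : P} : Conn τ (τ b) ↔ Conn τ b := by
  exact ⟨fun h q => (h q).head trivial, fun h q => (h (τ b)).symm_of_perm.trans (h q)⟩

lemma flip_apply_dummy {S : Finset P} {d : P} (hd : X.mate d = d) : X.flip S d = d := by
  rw [flip_apply, hd, ite_self]

lemma stateSum_shift_dummy (k : ℕ) (σ : Perm P) {b : P} (hb : X.mate b = b) :
    stateSum k σ X (σ b) = stateSum k σ X b := by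
  unfold stateSum
  refine Finset.sum_congr rfl fun S hS => if_congr ?_ rfl rfl
  have hτ : (σ * X.flip S) b = σ b := by rw [Perm.mul_apply, flip_apply_dummy hb]
  unfold Good
  rw [← hτ, conn_shift]
  refine and_congr_right fun _ => forall₂_congr fun p hp => ?_
  have hp' := (mem_tails.1 ((Finset.mem_powersetCard.1 hS).1 hp)).1
  refine before_shift ?_ ?_
  · have := X.mate_mate p
    grind
  · grind

/-- Moving the base point past a crossing. -/
lemma stateSum_shift (k : ℕ) (σ : Perm P) (b : P)
    (ih : ∀ c c', stateSum k (σ * swap b (X.mate b)) (X.del b) c =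
      stateSum k (σ * swap b (X.mate b)) (X.del b) c') :
    stateSum (k + 1) σ X (σ b) = stateSum (k + 1) σ X b := by
  have hdel : ∀ p, (X.del p).mate p = p := fun p => by simp [del_mate]
  by_cases hb : X.mate b = b
  · exact stateSum_shift_dummy _ _ hb
  by_cases ho : X.up b = true
  -- `b` is an overpassing. Starting at `b`, it is met before its partner; starting at `σ b`, which
  -- follows `X.mate b` on every smoothed curve, the underpassing is met last. Neither way is a
  -- state through this crossing counted.
  · have hp := mem_tails.2 ⟨hb, ho⟩
    rw [stateSum_succ k σ _ hp, stateSum_succ k σ _ hp, stateSum_shift_dummy _ _ (hdel b)]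
    congr 2
    refine Finset.sum_congr rfl fun S hS => ?_
    rw [if_neg, if_neg]
    · exact fun h => not_before_self_right h.2
    · rintro ⟨h1, h2⟩
      have hm : (X.del b).mate (X.mate b) = X.mate b := by simp [del_mate, X.mate_mate]
      have hτ : (σ * swap b (X.mate b) * (X.del b).flip S) (X.mate b) = σ b := by
        rw [Perm.mul_apply, flip_apply_dummy hm, Perm.mul_apply, swap_apply_right]
      rw [← hτ] at h2
      refine not_before_next_left ?_ h2
      rw [hτ]
      exact h1.1 _
  -- `b` is an underpassing. Now the order condition at this crossing holds automatically from both
  -- starting points, so both contributions are full state sums of the smoothing, and `ih` compares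
  -- them.
  · have hp : X.mate b ∈ X.tails := by grind [mem_tails, X.mate_mate, X.up_mate]
    have hm : (X.del (X.mate b)).mate b = b := by rw [del_del]; exact hdel b
    rw [stateSum_succ k σ _ hp, stateSum_succ k σ _ hp, stateSum_shift_dummy _ _ hm]
    congr 2
    rw [X.mate_mate, Equiv.swap_comm, del_del]
    have key : ∀ c, (c = b ∨ c = σ b) → ∀ S ∈ (X.del b).tails.powersetCard k,
        (((X.del b).Good (σ * swap b (X.mate b)) c S ∧
          Before (σ * swap b (X.mate b) * (X.del b).flip S : Perm P) c b (X.mate b)) ↔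
          (X.del b).Good (σ * swap b (X.mate b)) c S) := by
      intro c hc S hS
      refine and_iff_left_of_imp fun hG => ?_
      rcases hc with rfl | rfl
      · exact before_self_left (Ne.symm hb)
      · have hm : (X.del b).mate (X.mate b) = X.mate b := by simp [del_mate, X.mate_mate]
        have hτ : (σ * swap b (X.mate b) * (X.del b).flip S) (X.mate b) = σ b := by
          rw [Perm.mul_apply, flip_apply_dummy hm, Perm.mul_apply,
            swap_apply_right]
        rw [← hτ]
        refine before_next_right (Ne.symm hb) ?_
        have := hG.1
        rw [← hτ, conn_shift] at this
        exact this b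
    rw [Finset.sum_congr rfl fun S hS => if_congr (key _ (Or.inr rfl) S hS) rfl rfl,
      Finset.sum_congr rfl fun S hS => if_congr (key _ (Or.inl rfl) S hS) rfl rfl]
    exact ih _ _

/-- The state sum of a descending diagram. -/
lemma stateSum_descending (k : ℕ) (σ : Perm P) (b : P)
    (h : ∀ p, X.mate p ≠ p → X.up p = false → Before σ b (X.mate p) p) :
    stateSum (k + 1) σ X b = 0 := by
  unfold stateSum
  refine Finset.sum_eq_zero fun S hS => if_neg ?_
  rintro ⟨hc, hB⟩
  obtain ⟨hS1, hS2⟩ := Finset.mem_powersetCard.1 hS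
  obtain ⟨p, hp⟩ : S.Nonempty := by rw [← Finset.card_pos]; omega
  -- Up to its first point `r` on a crossing of `S`, the smoothed curve follows the original one.
  -- The state requires `r` to be an underpassing, the hypothesis `h` an overpassing.
  obtain ⟨r, hr, hw, -⟩ := (hc p).first (fun z => z ∈ S ∨ X.mate z ∈ S) (Or.inl hp)
  have hw' : Walk (σ * X.flip S : Perm P) (fun z => ¬ (z ∈ S ∨ X.mate z ∈ S)) b r :=
    hw.mono fun _ h => h.2
  rcases hr with hr | hr
  · have hr' := (mem_tails.1 (hS1 hr))
    refine hB r hr (hw'.mono ?_)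
    rintro z hz rfl
    exact hz (Or.inr (by rwa [X.mate_mate]))
  · have hr' := (mem_tails.1 (hS1 hr))
    rw [X.mate_mate] at hr'
    have hr1 : X.mate r ≠ r := hr'.1.symm
    have hlow : X.up r = false := by grind [X.up_mate]
    refine h r hr1 hlow ?_
    refine (hw'.tail_induction (motive := fun z => Walk σ (· ≠ X.mate r) b z) (.refl _)
      fun z hz _ ih => ?_)
    have : (σ * X.flip S) z = σ z := by
      rw [Perm.mul_apply, flip_apply, if_neg hz]
    rw [this]
    exact ih.tail fun h => hz (Or.inl (h ▸ hr))

/-- The position of a point without a crossing does not matter. -/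
lemma stateSum_moveDummy (k : ℕ) {σ σ' : Perm P} {b d : P} (hd : X.mate d = d) (hb : b ≠ d)
    (h1 : σ d ≠ d) (h2 : σ' d ≠ d)
    (h : ∀ z, z ≠ d → (if σ z = d then σ d else σ z) = if σ' z = d then σ' d else σ' z) :
    stateSum k σ X b = stateSum k σ' X b := by
  unfold stateSum
  refine Finset.sum_congr rfl fun S hS => if_congr ?_ rfl rfl
  have hfd : X.flip S d = d := flip_apply_dummy hd
  set f := X.flip S with hf
  have hfz : ∀ z, z ≠ d → f z ≠ d := fun z hz hz' => hz (f.injective (hz'.trans hfd.symm))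
  -- `τ₀` is the smoothed curve with `d` skipped. It is the same for `σ` and `σ'`, and `walk_insert`
  -- compares both with it.
  set τ₀ : P → P := fun z => if σ (f z) = d then σ d else σ (f z) with hτ₀
  have key : ∀ σ'' : Perm P, σ'' d ≠ d →
      (∀ z, z ≠ d → τ₀ z = if σ'' (f z) = d then σ'' d else σ'' (f z)) →
      (X.Good σ'' b S ↔ (∀ q, q ≠ d → Walk τ₀ (fun _ => True) b q) ∧
        ∀ p ∈ S, Before τ₀ b (X.mate p) p) := by
    intro σ'' h3 h4
    have hτ : ∀ z, (σ'' * f) z = σ'' (f z) := fun z => rfl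
    have hτd : (σ'' * f) d = σ'' d := by rw [hτ, hfd]
    have hins : ∀ z, z ≠ d → (σ'' * f) z = τ₀ z ∨ (σ'' * f) z = d ∧ (σ'' * f) d = τ₀ z := by
      intro z hz
      rw [h4 z hz, hτd, hτ]
      grind
    have hne : ∀ z, z ≠ d → τ₀ z ≠ d := by grind
    have hwi : ∀ {A : P → Prop} {y}, A d → y ≠ d →
        (Walk τ₀ A b y ↔ Walk (σ'' * f : Perm P) A b y) :=
      fun hA hy => walk_insert hA hins hne hb hy
    unfold Good
    refine and_congr ?_ ?_
    · constructor
      · intro hc q hq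
        exact (hwi trivial hq).2 (hc q)
      · intro hc q
        by_cases hq : q = d
        · subst hq
          obtain ⟨r, hr⟩ := (σ'' * f).surjective q
          have hrd : r ≠ q := by grind
          have := ((hwi trivial hrd).1 (hc r hrd)).tail trivial
          rwa [hr] at this
        · exact (hwi trivial hq).1 (hc q hq)
    · refine forall₂_congr fun p hp => not_congr ?_
      have hp' := (mem_tails.1 ((Finset.mem_powersetCard.1 hS).1 hp)).1
      have := X.mate_mate p
      have h5 : p ≠ d := by grind
      have h6 : X.mate p ≠ d := by grind
      exact (hwi (A := (· ≠ X.mate p)) h6.symm h5).symm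
  rw [key σ h1 fun z hz => rfl, key σ' h2 fun z hz => h _ (hfz z hz)]

lemma walk_conj {P Q : Type} {τ : P → P} {τ' : Q → Q} {A : P → Prop} {A' : Q → Prop} (e : P → Q)
    (h : ∀ z, τ' (e z) = e (τ z)) (hA : ∀ z, A z → A' (e z)) {x y : P} (hw : Walk τ A x y) :
    Walk τ' A' (e x) (e y) := by
  refine hw.tail_induction (.refl _) fun z hz _ ih => ?_
  rw [← h]
  exact ih.tail (hA z hz)

lemma map_tails {Q : Type} [Fintype Q] (X : Crossings P) (e : P ≃ Q) :
    (X.map e).tails = X.tails.map e.toEmbedding := by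
  ext z
  rw [mem_tails, Finset.mem_map_equiv, mem_tails]
  refine and_congr (not_congr ?_) Iff.rfl
  show e (X.mate (e.symm z)) = z ↔ _
  rw [← Equiv.eq_symm_apply]

lemma map_flip {Q : Type} [Fintype Q] (X : Crossings P) (e : P ≃ Q) (S : Finset P) (z : P) :
    (X.map e).flip (S.map e.toEmbedding) (e z) = e (X.flip S z) := by
  rw [flip_apply, flip_apply]
  have : (X.map e).mate (e z) = e (X.mate z) := by simp [map]
  rw [this]
  simp only [Finset.mem_map_equiv, Equiv.symm_apply_apply]
  split_ifs <;> rfl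

/-- The state sum only depends on the points up to bijection. -/
lemma stateSum_map {Q : Type} [Fintype Q] (k : ℕ) (σ : Perm P) (X : Crossings P) (b : P)
    (e : P ≃ Q) (σ' : Perm Q) (hσ : ∀ z, σ' (e z) = e (σ z)) :
    stateSum k σ' (X.map e) (e b) = stateSum k σ X b := by
  unfold stateSum
  rw [map_tails, Finset.powersetCard_map, Finset.sum_map]
  refine Finset.sum_congr rfl fun S hS => ?_
  have hmap : Finset.mapEmbedding e.toEmbedding S = S.map e.toEmbedding := rfl
  have hsgn : ∀ p, (X.map e).sgn (e p) = X.sgn p := fun p => by simp [sgn, map]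
  have hm : ∀ p, (X.map e).mate (e p) = e (X.mate p) := fun p => by simp [map]
  have hτ : ∀ z, (σ' * (X.map e).flip (S.map e.toEmbedding)) (e z) = e ((σ * X.flip S) z) := by
    intro z
    rw [Perm.mul_apply, map_flip, hσ]; rfl
  have hτ' : ∀ z, (σ * X.flip S) (e.symm z) =
      e.symm ((σ' * (X.map e).flip (S.map e.toEmbedding)) z) := by
    intro z
    rw [Equiv.eq_symm_apply, ← hτ, e.apply_symm_apply]
  have hprod : ∏ p ∈ S.map e.toEmbedding, ((X.map e).sgn p : ℤ) = ∏ p ∈ S, (X.sgn p : ℤ) := by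
    rw [Finset.prod_map]
    exact Finset.prod_congr rfl fun p _ => by rw [← hsgn p]; rfl
  have hG : (X.map e).Good σ' (e b) (S.map e.toEmbedding) ↔ X.Good σ b S := by
    unfold Good
    refine and_congr ?_ ?_
    · constructor
      · intro hc q
        have := walk_conj e.symm (A' := fun _ => True) hτ' (fun _ _ => trivial) (hc (e q))
        simpa using this
      · intro hc q
        have := walk_conj e (A' := fun _ => True) hτ (fun _ _ => trivial) (hc (e.symm q))
        simpa using this
    · constructor
      · intro h p hp hw
        refine h (e p) (by simpa using hp) ?_
        rw [hm]
        exact walk_conj e hτ (fun z hz h => hz (e.injective h)) hw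
      · intro h q hq hw
        obtain ⟨p, hp, rfl⟩ := Finset.mem_map.1 hq
        refine h p hp ?_
        have := walk_conj e.symm (A' := (· ≠ X.mate p)) hτ'
          (fun z hz h => hz (by
            show z = (X.map e).mate (e p)
            rw [hm, ← h, e.apply_symm_apply])) hw
        simpa using this
  show (if (X.map e).Good σ' (e b) (S.map e.toEmbedding)
    then ∏ p ∈ S.map e.toEmbedding, ((X.map e).sgn p : ℤ) else 0) = _
  rw [hprod, if_congr hG rfl rfl]

end Crossings

/-! ### Kinks, opposite crossings and shifts of a crossing along a strand -/

namespace Crossings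

open Classical

variable {P : Type} [Fintype P] {X : Crossings P} {p : P}

lemma not_conn_of_fixed {τ : Perm P} {b q : P} (hq : τ q = q) (hb : b ≠ q) :
    ¬ Conn τ b := fun h => by
  have := (h q).symm_of_perm.tail_induction (motive := fun z => z = q) rfl
    fun z _ _ hz => by rw [hz, hq]
  exact hb this

lemma stateSum_del_of_not_conn (k : ℕ) (σ : Perm P) (b : P) (hp : X.mate p ≠ p)
    (h : ∀ S, ¬ Conn (σ * swap p (X.mate p) * (X.del p).flip S : Perm P) b) :
    stateSum k σ X b = stateSum k σ (X.del p) b := by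
  rcases k with _ | k
  · rw [stateSum_zero, stateSum_zero]
  have key : ∀ q ∈ X.tails, X.del q = X.del p → swap q (X.mate q) = swap p (X.mate p) →
      stateSum (k + 1) σ X b = stateSum (k + 1) σ (X.del p) b := by
    intro q hq hd hs
    rw [stateSum_succ k σ b hq, hd, hs, Finset.sum_eq_zero, mul_zero, add_zero]
    intro S _
    rw [if_neg]
    exact fun h' => h S h'.1.1
  by_cases ho : X.up p = true
  · exact key p (mem_tails.2 ⟨hp, ho⟩) rfl rfl
  · refine key (X.mate p) ?_ X.del_del (by rw [X.mate_mate, Equiv.swap_comm])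
    grind [mem_tails, X.mate_mate, X.up_mate]

/-- Removing a kink. -/
lemma stateSum_kink (k : ℕ) (σ : Perm P) {b : P} (hp : X.mate p ≠ p)
    (h : σ p = X.mate p) (hb : b ≠ X.mate p) :
    stateSum k σ X b = stateSum k σ (X.del p) b := by
  -- Smoothing the kink makes `X.mate p` a closed curve of its own, which does not contain the base
  -- point.
  refine stateSum_del_of_not_conn k σ b hp fun S => not_conn_of_fixed (q := X.mate p) ?_ hb
  have hm : (X.del p).mate (X.mate p) = X.mate p := by simp [del_mate, X.mate_mate]
  rw [Perm.mul_apply, flip_apply_dummy hm, Perm.mul_apply, swap_apply_right, h]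

/-- Two diagrams which differ in the sign of one crossing. -/
lemma stateSum_add_neg (k : ℕ) (σ : Perm P) (b : P) {Y : Crossings P} (hp : X.mate p ≠ p)
    (hm : Y.mate = X.mate) (hu : ∀ z, X.mate z ≠ z → Y.up z = X.up z)
    (hε : ∀ z, X.mate z ≠ z → z ≠ p → z ≠ X.mate p → Y.ε z = X.ε z) (hεp : Y.ε p = -X.ε p) :
    stateSum k σ X b + stateSum k σ Y b = 2 * stateSum k σ (X.del p) b := by
  rcases k with _ | k
  · rw [stateSum_zero, stateSum_zero, stateSum_zero]; ring
  have hdm : (Y.del p).mate = (X.del p).mate := by ext z; simp only [del_mate, hm]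
  have hdne : ∀ z, (Y.del p).mate z ≠ z → X.mate z ≠ z ∧ z ≠ p ∧ z ≠ X.mate p := by
    have := X.mate_mate
    grind [del_mate]
  have hYd : ∀ k σ b, stateSum k σ (Y.del p) b = stateSum k σ (X.del p) b := fun k σ b =>
    stateSum_congr k σ b hdm (fun z hz => hε z (hdne z hz).1 (hdne z hz).2.1 (hdne z hz).2.2)
      fun z hz => hu z (hdne z hz).1
  have hht : (Y.del p).tails = (X.del p).tails := by
    ext z
    have : (Y.del p).up z = Y.up z ∧ (X.del p).up z = X.up z := ⟨rfl, rfl⟩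
    grind [mem_tails]
  have hhf : ∀ S, (Y.del p).flip S = (X.del p).flip S := fun S => by
    ext z; simp only [flip_apply, hdm]
  -- Whether a state is counted does not depend on `ε`, so the states through the crossing cancel
  -- between the two diagrams; the states avoiding it are counted twice.
  have key : ∀ q ∈ X.tails, X.del q = X.del p → Y.del q = Y.del p → Y.sgn q = -X.sgn q →
      stateSum (k + 1) σ X b + stateSum (k + 1) σ Y b = 2 * stateSum (k + 1) σ (X.del p) b := by
    intro q hq hd hd' hs
    have hq' : q ∈ Y.tails := by grind [mem_tails]
    rw [stateSum_succ k σ b hq, stateSum_succ k σ b hq', hd, hd', hYd, hs, hm, Units.val_neg, hht]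
    have : ∀ u v s t t' : ℤ, u = v → t = t' → u + s * t + (v + -s * t') = 2 * u := by
      rintro u v s t t' rfl rfl; ring
    refine this _ _ _ _ _ rfl (Finset.sum_congr rfl fun S hS => ?_)
    have hprod : ∏ q ∈ S, ((Y.del p).sgn q : ℤ) = ∏ q ∈ S, ((X.del p).sgn q : ℤ) := by
      refine Finset.prod_congr rfl fun z hz => ?_
      have hz' := (mem_tails.1 ((Finset.mem_powersetCard.1 hS).1 hz)).1
      have := hdne z (hdm ▸ hz')
      show ((if Y.up z then Y.ε z else -Y.ε z : ℤˣ) : ℤ) = (if X.up z then X.ε z else -X.ε z : ℤˣ)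
      rw [hu z this.1, hε z this.1 this.2.1 this.2.2]
    have hG : ∀ σ, (Y.del p).Good σ b S ↔ (X.del p).Good σ b S := fun σ => by
      unfold Good; rw [hhf, hdm]
    simp only [hG, hhf, hprod]
  have hεm : Y.ε (X.mate p) = -X.ε (X.mate p) := by
    rw [X.ε_mate p hp, ← hεp, ← hm, Y.ε_mate p (by rwa [hm])]
  by_cases ho : X.up p = true
  · refine key p (mem_tails.2 ⟨hp, ho⟩) rfl rfl ?_
    unfold sgn; rw [hu p hp, hεp]; split_ifs <;> rfl
  · refine key (X.mate p) ?_ X.del_del (by rw [← hm, Y.del_del]) ?_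
    · grind [mem_tails, X.mate_mate, X.up_mate]
    · unfold sgn; rw [hu _ (by rw [X.mate_mate]; exact hp.symm), hεm]; split_ifs <;> rfl

/-- A point without a crossing may be exchanged with its successor. -/
lemma stateSum_conj_swap (k : ℕ) {σ : Perm P} {b d : P} (hd : X.mate d = d) (hb : b ≠ d)
    (hpd : p ≠ d) (h : σ p = d ∨ σ d = p) (hdd : σ d ≠ d) :
    stateSum k (swap p d * σ * swap p d) X b = stateSum k σ X b := by
  refine (stateSum_moveDummy k hd hb hdd ?_ fun z hz => ?_).symm
  · simp only [Perm.mul_apply, swap_apply_def]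
    have := σ.injective.ne hpd
    grind
  · simp only [Perm.mul_apply, swap_apply_def]
    have h1 := Equiv.injective σ |>.eq_iff (a := z) (b := d)
    have h2 := Equiv.injective σ |>.eq_iff (a := z) (b := p)
    have h3 := Equiv.injective σ |>.eq_iff (a := p) (b := d)
    grind

end Crossings

/-! ### The second Reidemeister move -/

namespace Crossings

open Classical

variable {P : Type} [Fintype P] {X : Crossings P}

lemma del_comm (X : Crossings P) (p q : P) : (X.del p).del q = (X.del q).del p := by
  ext z
  · simp only [del_mate]; split_ifs <;> grind
  · rfl
  · rfl

/-- Configuration of the second Reidemeister move. -/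
structure Bigon (σ : Perm P) (X : Crossings P) (p₁ p₂ q₁ q₂ : P) : Prop where
  nodup : [p₁, p₂, q₁, q₂].Nodup
  mate₁ : X.mate p₁ = q₁
  mate₂ : X.mate p₂ = q₂
  next_p : σ p₁ = p₂
  next_q : σ q₁ = q₂ ∨ σ q₂ = q₁
  up_eq : X.up p₁ = X.up p₂
  ε_neg : X.ε p₂ = -X.ε p₁

namespace Bigon

variable {σ : Perm P} {p₁ p₂ q₁ q₂ b : P}

lemma del_mate_right (h : Bigon σ X p₁ p₂ q₁ q₂) : (X.del p₁).mate p₂ = q₂ := by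
  obtain ⟨hn, h1, h2, -⟩ := h
  have := X.mate_mate p₁
  simp only [List.nodup_cons, List.mem_cons] at hn
  rw [del_mate, if_pos]
  · exact h2
  · grind

/-- No state contains both crossings. If the sides are parallel, the smoothed curve goes from `q₁`
to `p₂` and from `p₁` to `q₂`; so if `q₁` comes before `p₁`, then `p₂` comes before `q₂`, against
the condition at `p₂`. If they are antiparallel, `q₁` and `p₂` form a closed curve without the base
point. -/
lemma not_good (h : Bigon σ X p₁ p₂ q₁ q₂) (hb : b ∉ [p₁, p₂, q₁, q₂]) {S : Finset P}
    (hS : p₂ ∈ S) : ¬ ((X.del p₁).Good (σ * swap p₁ q₁) b S ∧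
      Before (σ * swap p₁ q₁ * (X.del p₁).flip S : Perm P) b q₁ p₁) := by
  have hdm := h.del_mate_right
  obtain ⟨hn, h1, h2, h3, h4, h5, h6⟩ := h
  rintro ⟨⟨hc, hB⟩, hB1⟩
  have hB2 := hB p₂ hS
  rw [hdm] at hB2
  simp only [List.nodup_cons, List.mem_cons, List.not_mem_nil, or_false, not_or] at hn hb
  have m1 : (X.del p₁).mate p₁ = p₁ := by simp [del_mate]
  have m2 : (X.del p₁).mate q₁ = q₁ := by rw [← h1]; simp [del_mate, X.mate_mate]
  have m3 : (X.del p₁).flip S p₂ = q₂ := by rw [flip_apply, if_pos (Or.inl hS), hdm]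
  have m4 : (X.del p₁).flip S q₂ = p₂ := by
    have : (X.del p₁).mate q₂ = p₂ := by rw [← hdm, mate_mate]
    rw [flip_apply, if_pos (Or.inr (this ▸ hS)), this]
  set τ : Perm P := σ * swap p₁ q₁ * (X.del p₁).flip S with hτ
  have t1 : τ p₁ = σ q₁ := by
    simp [hτ, Perm.mul_apply, flip_apply_dummy m1]
  have t2 : τ q₁ = p₂ := by
    simp [hτ, Perm.mul_apply, flip_apply_dummy m2, h3]
  have t3 : τ p₂ = σ q₂ := by
    simp only [hτ, Perm.mul_apply, m3]
    rw [swap_apply_of_ne_of_ne] <;> grind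
  rcases h4 with h4 | h4
  · have hq := (before_dichotomy (by grind) (hc q₁)).1 hB1
    have hq := not_not.1 hq
    refine hB2 ?_
    rw [← t2]
    refine Walk.tail ?_ (show q₁ ≠ q₂ by grind)
    refine (hq.tail_induction (motive := fun z => z ≠ q₂ ∧ Walk τ (· ≠ q₂) b z)
      ⟨by grind, .refl _⟩ fun z hz _ ⟨hz1, hz2⟩ => ⟨fun h => hz ?_, hz2.tail hz1⟩).2
    apply τ.injective
    rw [t1, h4]; exact h
  · have := (hc q₁).symm_of_perm.tail_induction (motive := fun z => z = q₁ ∨ z = p₂) (Or.inl rfl)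
      (fun z _ _ hz => by
        rcases hz with rfl | rfl
        · exact Or.inr t2
        · left; rw [t3, h4])
    grind

/-- Two diagrams are compared that each retain one crossing of the bigon. The remaining crossing of
one of them can be shifted over the points vacated by the other crossing; then the diagrams differ
only in the sign of that crossing and `stateSum_add_neg` applies. -/
lemma stateSum_del (h : Bigon σ X p₁ p₂ q₁ q₂) (hb : b ∉ [p₁, p₂, q₁, q₂]) (k : ℕ) :
    stateSum k σ (X.del p₁) b + stateSum k σ (X.del p₂) b =
      2 * stateSum k σ ((X.del p₁).del p₂) b := by
  have hdm := h.del_mate_right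
  obtain ⟨hn, h1, h2, h3, h4, h5, h6⟩ := h
  have h1' := X.mate_mate p₁
  have h2' := X.mate_mate p₂
  rw [h1] at h1'
  rw [h2] at h2'
  simp only [List.nodup_cons, List.mem_cons, List.not_mem_nil, or_false, not_or] at hn hb
  -- `π` shifts the crossing at `p₁, q₁` to `p₂, q₂`. On the level of `σ` this exchanges a dummy
  -- with its neighbour on each of the two sides.
  let π : Perm P := swap p₁ p₂ * swap q₁ q₂
  have hπ : ∀ z, π z = if z = p₁ then p₂ else if z = p₂ then p₁ else if z = q₁ then q₂ else
      if z = q₂ then q₁ else z := by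
    intro z
    simp only [π, Perm.mul_apply, swap_apply_def]
    grind
  have hπi : π.symm = π := by
    have : π * π = 1 := by
      ext z; simp only [Perm.mul_apply, hπ, Perm.one_apply]; grind
    exact inv_eq_of_mul_eq_one_left this
  set Y := (X.del p₂).map π with hY
  have hYm : ∀ z, Y.mate z = π ((X.del p₂).mate (π z)) := fun z => by
    rw [← hπi]; simp [hY, map, hπi]
  have hYm' : Y.mate = (X.del p₁).mate := by
    ext z
    rw [hYm, del_mate, del_mate]
    have := X.mate_mate z
    grind
  have hd1 : Y.mate p₁ = p₁ := by rw [hYm']; simp [del_mate]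
  have hd2 : Y.mate q₁ = q₁ := by rw [hYm', ← h1]; simp [del_mate, X.mate_mate]
  have key : stateSum k σ (X.del p₂) b = stateSum k σ Y b := by
    have hb' : π b = b := by rw [hπ]; simp [hb]
    rw [← stateSum_map k σ (X.del p₂) b π (π * σ * π) fun z => by
        have : π (π z) = z := by nth_rw 1 [← hπi]; simp
        simp only [Perm.mul_apply, this], hb']
    have : π * σ * π = swap q₂ q₁ * (swap p₂ p₁ * σ * swap p₂ p₁) *
        swap q₂ q₁ := by
      have hcomm : swap p₂ p₁ * swap q₂ q₁ = swap q₂ q₁ * swap p₂ p₁ := by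
        ext z; simp only [Perm.mul_apply, swap_apply_def]; grind
      have hπ' : π = swap p₂ p₁ * swap q₂ q₁ := by
        simp only [π]; rw [Equiv.swap_comm p₁, Equiv.swap_comm q₁]
      nth_rw 1 [hπ', hcomm]
      rw [hπ']; simp only [mul_assoc]
    rw [this, stateSum_conj_swap k hd2, stateSum_conj_swap k hd1]
    · exact hb.1
    · grind
    · exact Or.inr h3
    · rw [h3]; grind
    · grind
    · grind
    · simp only [Perm.mul_apply, swap_apply_def]; grind
    · have := σ.injective.eq_iff (a := q₁) (b := q₂)
      simp only [Perm.mul_apply, swap_apply_def]; grind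
  rw [key]
  have hne : ∀ z, (X.del p₁).mate z ≠ z → z ≠ p₁ ∧ z ≠ q₁ := by
    intro z hz
    rw [← hYm'] at hz
    exact ⟨fun h => hz (h ▸ hd1), fun h => hz (h ▸ hd2)⟩
  refine stateSum_add_neg k σ b (by rw [hdm]; grind) hYm' (fun z hz => ?_) (fun z hz hz1 hz2 => ?_) ?_
  · show X.up (π.symm z) = X.up z
    rw [hπi, hπ]
    have := hne z hz
    have e1 := X.up_mate p₁ (by grind)
    have e2 := X.up_mate p₂ (by grind)
    grind
  · show X.ε (π.symm z) = X.ε z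
    rw [hπi, hπ]
    rw [hdm] at hz2
    have := hne z hz
    grind
  · show X.ε (π.symm p₂) = -X.ε p₂
    rw [hπi, hπ, h6, if_neg (Ne.symm hn.1.1), if_pos rfl, neg_neg]

/-- The second Reidemeister move. -/
lemma stateSum_of_up (h : Bigon σ X p₁ p₂ q₁ q₂) (hb : b ∉ [p₁, p₂, q₁, q₂]) (k : ℕ)
    (hu : X.up p₁ = true) :
    stateSum k σ X b = stateSum k σ ((X.del p₁).del p₂) b := by
  rcases k with _ | k
  · rw [stateSum_zero, stateSum_zero]
  -- By `not_good` the contribution of the states through `p₁` does not depend on the presence of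
  -- the second crossing. So the sum for `X` is the sum for `X.del p₁`, plus that for `X.del p₂`,
  -- minus that with both deleted, and `stateSum_del` evaluates this.
  have hd := h.stateSum_del hb (k + 1)
  have hdm := h.del_mate_right
  obtain ⟨hn, h1, h2, h3, h4, h5, h6⟩ := id h
  simp only [List.nodup_cons, List.mem_cons, List.not_mem_nil, or_false, not_or] at hn
  have hp : p₁ ∈ X.tails := mem_tails.2 ⟨by grind, hu⟩
  have hp' : p₁ ∈ (X.del p₂).tails := by
    rw [mem_tails, del_mate, if_pos]
    · exact ⟨by grind, hu⟩
    · grind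
  have hp2 : p₂ ∈ (X.del p₁).tails := mem_tails.2 ⟨by grind, h5 ▸ hu⟩
  have e1 := stateSum_succ k σ b hp
  have e2 := stateSum_succ k σ b hp'
  have m1 : (X.del p₂).mate p₁ = q₁ := by
    rw [del_mate, if_pos]
    · exact h1
    · grind
  rw [m1, del_comm] at e2
  rw [h1] at e1
  have hsum : ∀ f : Finset P → ℤ, (∑ S ∈ (X.del p₁).tails.powersetCard k,
      if (X.del p₁).Good (σ * swap p₁ q₁) b S ∧
        Before (σ * swap p₁ q₁ * (X.del p₁).flip S : Perm P) b q₁ p₁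
      then f S else 0) = ∑ S ∈ ((X.del p₁).del p₂).tails.powersetCard k,
      if ((X.del p₁).del p₂).Good (σ * swap p₁ q₁) b S ∧
        Before (σ * swap p₁ q₁ * ((X.del p₁).del p₂).flip S : Perm P) b q₁ p₁
      then f S else 0 := by
    intro f
    rw [del_tails _ _ hp2]
    symm
    rw [Finset.sum_congr rfl (g := fun S =>
      if (X.del p₁).Good (σ * swap p₁ q₁) b S ∧
        Before (σ * swap p₁ q₁ * (X.del p₁).flip S : Perm P) b q₁ p₁
      then f S else 0)]
    · refine Finset.sum_subset (Finset.powersetCard_mono (Finset.erase_subset _ _)) fun S hS hS' => ?_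
      rw [if_neg]
      refine h.not_good hb ?_
      by_contra hpS
      refine hS' (Finset.mem_powersetCard.2 ⟨fun z hz => Finset.mem_erase.2 ⟨?_, ?_⟩, ?_⟩)
      · rintro rfl; exact hpS hz
      · exact (Finset.mem_powersetCard.1 hS).1 hz
      · exact (Finset.mem_powersetCard.1 hS).2
    · intro S hS
      have hS' := (Finset.mem_powersetCard.1 hS).1
      refine if_congr ?_ rfl rfl
      rw [flip_del hp2 hS']
      refine and_congr_left fun _ => ?_
      unfold Good
      rw [flip_del hp2 hS']
      refine and_congr_right fun _ => forall₂_congr fun q hq => ?_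
      have hq' := Finset.mem_erase.1 (hS' hq)
      rw [del_mate (X.del p₁) p₂ q, if_pos]
      refine ⟨hq'.1, fun hq'' => ?_⟩
      rw [mate_eq_iff] at hq''
      exact mate_notMem_tails hp2 (hq'' ▸ hq'.2)
  have hsgn : ∀ q, ((X.del p₁).del p₂).sgn q = (X.del p₁).sgn q := fun _ => rfl
  have hsgn' : (X.del p₂).sgn p₁ = X.sgn p₁ := rfl
  rw [hsum] at e1
  simp only [hsgn, hsgn'] at e2
  linarith

/-- If `p₁` is an underpassing, the two sides of the bigon exchange their roles. -/
lemma stateSum_eq (h : Bigon σ X p₁ p₂ q₁ q₂) (hb : b ∉ [p₁, p₂, q₁, q₂]) (k : ℕ) :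
    stateSum k σ X b = stateSum k σ ((X.del p₁).del p₂) b := by
  by_cases hu : X.up p₁ = true
  · exact h.stateSum_of_up hb k hu
  obtain ⟨hn, h1, h2, h3, h4, h5, h6⟩ := h
  simp only [List.nodup_cons, List.mem_cons, List.not_mem_nil, or_false, not_or] at hn hb
  have h1' := X.mate_mate p₁
  have h2' := X.mate_mate p₂
  rw [h1] at h1'
  rw [h2] at h2'
  have e1 := X.up_mate p₁ (by grind)
  have e2 := X.up_mate p₂ (by grind)
  have e3 := X.ε_mate p₁ (by grind)
  have e4 := X.ε_mate p₂ (by grind)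
  rw [h1] at e1 e3
  rw [h2] at e2 e4
  have d1 : X.del q₁ = X.del p₁ := by rw [← h1, del_del]
  have d2 : ∀ Y : Crossings P, Y.mate p₂ = q₂ → Y.del q₂ = Y.del p₂ := fun Y hY => by
    rw [← hY, del_del]
  rcases h4 with h4 | h4
  · have hB : Bigon σ X q₁ q₂ p₁ p₂ := by
      refine ⟨?_, h1', h2', h4, Or.inl h3, ?_, ?_⟩
      · simp; grind
      · rw [e1, e2, h5]
      · rw [e3, e4, h6]
    rw [hB.stateSum_of_up (by simp; grind) k (by rw [e1]; simpa using hu), d1, d2]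
    rw [del_mate, if_pos]
    · exact h2
    · grind
  · have hB : Bigon σ X q₂ q₁ p₂ p₁ := by
      refine ⟨?_, h2', h1', h4, Or.inr h3, ?_, ?_⟩
      · simp; grind
      · rw [e1, e2, h5]
      · rw [e3, e4, h6]; simp
    rw [hB.stateSum_of_up (by simp; grind) k (by rw [e2, ← h5]; simpa using hu), del_comm, d1, d2]
    rw [del_mate, if_pos]
    · exact h2
    · grind

end Bigon

end Crossings

/-! ### The third Reidemeister move: symmetries and smoothings of a triangle -/

namespace Crossings

open Classical

variable {P : Type} {X : Crossings P}

/-- `p` and `q` are neighbours; `p` comes first if `s = 1`. -/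
def Nb (σ : Perm P) (p q : P) (s : ℤˣ) : Prop := (s = 1 ∧ σ p = q) ∨ (s = -1 ∧ σ q = p)

lemma Nb.symm {σ : Perm P} {p q : P} {s : ℤˣ} (h : Nb σ p q s) : Nb σ q p (-s) := by
  rcases h with ⟨rfl, h⟩ | ⟨rfl, h⟩
  · exact Or.inr ⟨rfl, h⟩
  · exact Or.inl ⟨by simp, h⟩

lemma Nb.one {σ : Perm P} {p q : P} : Nb σ p q 1 ↔ σ p = q := by simp [Nb]

lemma Nb.neg_one {σ : Perm P} {p q : P} : Nb σ p q (-1) ↔ σ q = p := by simp [Nb]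

lemma eq_or_of_not_ne {p a a' c c' e e' : P}
    (h : ¬ (p ≠ a ∧ p ≠ a' ∧ p ≠ c ∧ p ≠ c' ∧ p ≠ e ∧ p ≠ e')) :
    p = a ∨ p = a' ∨ p = c ∨ p = c' ∨ p = e ∨ p = e' := by tauto

/-- Configuration of the third Reidemeister move: three strands meeting in `a, c`, in `a', e` and in
`c', e'`. -/
structure Triangle (σ : Perm P) (X : Crossings P) (a a' c c' e e' : P) (x y w : ℤˣ) :
    Prop where
  nodup : [a, a', c, c', e, e'].Nodup
  ma : X.mate a = a'
  mc : X.mate c = c'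
  me : X.mate e = e'
  hx : Nb σ a c x
  hy : Nb σ a' e y
  hw : Nb σ c' e' w
  h₁ : y * X.ε a = w * X.ε c
  h₂ : x * X.ε c = y * X.ε e

/-- The permutation of the third Reidemeister move. -/
noncomputable def triPerm (a a' c c' e e' : P) : Perm P :=
  swap a c * swap a' e * swap c' e'

namespace Triangle

variable {σ : Perm P} {a a' c c' e e' b : P} {x y w : ℤˣ}

lemma _root_.units_eq (u : ℤˣ) : u = 1 ∨ u = -1 := Int.units_eq_one_or u

lemma ne (T : Triangle σ X a a' c c' e e' x y w) :
    (a ≠ a' ∧ a ≠ c ∧ a ≠ c' ∧ a ≠ e ∧ a ≠ e') ∧ (a' ≠ c ∧ a' ≠ c' ∧ a' ≠ e ∧ a' ≠ e') ∧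
      (c ≠ c' ∧ c ≠ e ∧ c ≠ e') ∧ (c' ≠ e ∧ c' ≠ e') ∧ e ≠ e' := by
  have := T.nodup
  simpa only [List.nodup_cons, List.mem_cons, List.not_mem_nil, or_false, not_or, List.nodup_nil,
    and_true, not_false_iff, ← ne_eq] using this

lemma mate_facts (T : Triangle σ X a a' c c' e e' x y w) :
    X.mate a = a' ∧ X.mate a' = a ∧ X.mate c = c' ∧ X.mate c' = c ∧ X.mate e = e' ∧
      X.mate e' = e := by
  obtain ⟨-, ma, mc, me, -⟩ := T
  refine ⟨ma, ?_, mc, ?_, me, ?_⟩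
  · rw [← ma, mate_mate]
  · rw [← mc, mate_mate]
  · rw [← me, mate_mate]

lemma ε_facts (T : Triangle σ X a a' c c' e e' x y w) :
    X.ε a' = -X.ε a ∧ X.ε c' = -X.ε c ∧ X.ε e' = -X.ε e := by
  have hn := T.ne
  obtain ⟨-, ma, mc, me, -⟩ := T
  refine ⟨?_, ?_, ?_⟩
  · rw [← ma, X.ε_mate]; rw [ma]; exact hn.1.1.symm
  · rw [← mc, X.ε_mate]; rw [mc]; exact hn.2.2.1.1.symm
  · rw [← me, X.ε_mate]; rw [me]; exact hn.2.2.2.2.symm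

lemma up_facts (T : Triangle σ X a a' c c' e e' x y w) :
    X.up a' = (!X.up a) ∧ X.up c' = (!X.up c) ∧ X.up e' = (!X.up e) := by
  have hn := T.ne
  obtain ⟨-, ma, mc, me, -⟩ := T
  refine ⟨?_, ?_, ?_⟩
  · rw [← ma, X.up_mate]; rw [ma]; exact hn.1.1.symm
  · rw [← mc, X.up_mate]; rw [mc]; exact hn.2.2.1.1.symm
  · rw [← me, X.up_mate]; rw [me]; exact hn.2.2.2.2.symm

lemma perm_apply (T : Triangle σ X a a' c c' e e' x y w) (z : P) :
    triPerm a a' c c' e e' z = if z = a then c else if z = c then a else if z = a' then e else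
      if z = e then a' else if z = c' then e' else if z = e' then c' else z := by
  have hn := T.ne
  simp only [triPerm, Perm.mul_apply, swap_apply_def]
  grind

lemma perm_symm (T : Triangle σ X a a' c c' e e' x y w) :
    (triPerm a a' c c' e e').symm = triPerm a a' c c' e e' := by
  have : triPerm a a' c c' e e' * triPerm a a' c c' e e' = 1 := by
    have hn := T.ne
    ext z; simp only [Perm.mul_apply, T.perm_apply, Perm.one_apply]; grind
  exact inv_eq_of_mul_eq_one_left this

lemma perm_values (T : Triangle σ X a a' c c' e e' x y w) :
    triPerm a a' c c' e e' a = c ∧ triPerm a a' c c' e e' c = a ∧ triPerm a a' c c' e e' a' = e ∧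
      triPerm a a' c c' e e' e = a' ∧ triPerm a a' c c' e e' c' = e' ∧
      triPerm a a' c c' e e' e' = c' := by
  have hn := T.ne
  simp only [T.perm_apply]
  refine ⟨?_, ?_, ?_, ?_, ?_, ?_⟩ <;> grind

lemma perm_of_notMem (T : Triangle σ X a a' c c' e e' x y w) {z : P}
    (hz : z ≠ a ∧ z ≠ a' ∧ z ≠ c ∧ z ≠ c' ∧ z ≠ e ∧ z ≠ e') : triPerm a a' c c' e e' z = z := by
  rw [T.perm_apply]; grind

lemma map_mate (T : Triangle σ X a a' c c' e e' x y w) (z : P) :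
    (X.map (triPerm a a' c c' e e')).mate z =
      triPerm a a' c c' e e' (X.mate (triPerm a a' c c' e e' z)) := by
  conv_rhs => rw [← T.perm_symm]
  rw [T.perm_symm]
  simp [map, T.perm_symm]

lemma mate_notMem (T : Triangle σ X a a' c c' e e' x y w) {z : P}
    (hz : z ≠ a ∧ z ≠ a' ∧ z ≠ c ∧ z ≠ c' ∧ z ≠ e ∧ z ≠ e') :
    X.mate z ≠ a ∧ X.mate z ≠ a' ∧ X.mate z ≠ c ∧ X.mate z ≠ c' ∧ X.mate z ≠ e ∧ X.mate z ≠ e' := by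
  have hm := T.mate_facts
  have := X.mate_mate z
  grind

/-- Exchange the first two strands. -/
lemma swap₁ (T : Triangle σ X a a' c c' e e' x y w) :
    Triangle σ X a' a e e' c c' y x (-w) := by
  have hn := T.ne
  have hm := T.mate_facts
  have hε := T.ε_facts
  obtain ⟨-, ma, mc, me, hx, hy, hw, h1, h2⟩ := T
  refine ⟨by simp; grind, hm.2.1, me, mc, hy, hx, hw.symm, ?_, h2.symm⟩
  -- What is left is, up to signs, `x * X.ε a = w * X.ε e`, the relation for the third pair of
  -- crossings; it follows from the two given ones.
  rw [hε.1]
  have : w * X.ε c * (y * X.ε e) * X.ε c = y * X.ε a * (x * X.ε c) * X.ε c := by rw [h1, h2]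
  rcases units_eq (X.ε a) with h | h <;> rcases units_eq (X.ε c) with h' | h' <;>
    rcases units_eq (X.ε e) with h'' | h'' <;> rcases units_eq x with rfl | rfl <;>
    rcases units_eq y with rfl | rfl <;> rcases units_eq w with rfl | rfl <;>
    simp_all

/-- Exchange the last two strands. -/
lemma swap₂ (T : Triangle σ X a a' c c' e e' x y w) :
    Triangle σ X c c' a a' e' e (-x) w y := by
  have hn := T.ne
  have hm := T.mate_facts
  have hε := T.ε_facts
  obtain ⟨-, ma, mc, me, hx, hy, hw, h1, h2⟩ := T
  refine ⟨by simp; grind, mc, ma, hm.2.2.2.2.2, hx.symm, hw, hy, h1.symm, ?_⟩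
  rw [hε.2.2]
  rcases units_eq (X.ε a) with h | h <;> rcases units_eq (X.ε c) with h' | h' <;>
    rcases units_eq (X.ε e) with h'' | h'' <;> rcases units_eq x with rfl | rfl <;>
    rcases units_eq y with rfl | rfl <;> rcases units_eq w with rfl | rfl <;>
    simp_all

lemma perm_swap₁ (T : Triangle σ X a a' c c' e e' x y w) :
    triPerm a' a e e' c c' = triPerm a a' c c' e e' := by
  ext z
  rw [T.perm_apply, T.swap₁.perm_apply]
  have hn := T.ne
  grind

lemma perm_swap₂ (T : Triangle σ X a a' c c' e e' x y w) :
    triPerm c c' a a' e' e = triPerm a a' c c' e e' := by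
  ext z
  rw [T.perm_apply, T.swap₂.perm_apply]
  have hn := T.ne
  grind

variable [Fintype P]

/-- The tuple of crossings other than `a` after the move, moved back. -/
lemma smooth_eq_of_parallel (T : Triangle σ X a a' c c' e e' x y w) (hup : X.up c = X.up e)
    (hb : b ∉ [a, a', c, c', e, e']) (hxy : x = y) (k : ℕ) :
    stateSum k (σ * swap a a') (X.del a) b =
      stateSum k (σ * swap c e) ((X.map (triPerm a a' c c' e e')).del c) b := by
  have hn := T.ne
  have hm := T.mate_facts
  have hε := T.ε_facts
  have hu := T.up_facts
  have hmm := T.map_mate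
  have hnm := @T.mate_notMem
  have hεc : X.ε c = X.ε e := by
    have := T.h₂
    rw [hxy] at this
    exact mul_left_cancel this
  simp only [List.mem_cons, List.not_mem_nil, or_false, not_or] at hb
  -- `ρ` carries the crossings that remain after the move, `a, e'` and `a', c'`, to those that
  -- remain before it, `e, e'` and `c, c'`. The strands being parallel, the curves then differ only
  -- in the positions of the dummies `a` and `a'`.
  let ρ : Perm P := swap a e * swap a' c
  have hρ : ∀ z, ρ z = if z = a then e else if z = e then a else if z = a' then c else
      if z = c then a' else z := by
    intro z; simp only [ρ, Perm.mul_apply, swap_apply_def]; grind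
  have hρi : ρ.symm = ρ := by
    have : ρ * ρ = 1 := by
      ext z; simp only [Perm.mul_apply, hρ, Perm.one_apply]; grind
    exact inv_eq_of_mul_eq_one_left this
  have hconj : stateSum k (σ * swap c e) ((X.map (triPerm a a' c c' e e')).del c) b =
      stateSum k (ρ * (σ * swap c e) * ρ) (X.del a) b := by
    rw [← stateSum_map k _ _ b ρ (ρ * (σ * swap c e) * ρ) fun z => by
        have : ρ (ρ z) = z := by nth_rw 1 [← hρi]; simp
        simp only [Perm.mul_apply, this]]
    have hρb : ρ b = b := by rw [hρ]; simp [hb]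
    rw [hρb]
    have hmate : (((X.map (triPerm a a' c c' e e')).del c).map ρ).mate = (X.del a).mate := by
      ext z
      show ρ (((X.map (triPerm a a' c c' e e')).del c).mate (ρ.symm z)) = _
      rw [hρi, del_mate, del_mate, hmm]
      have hπv := T.perm_values
      have hρv : ρ a = e ∧ ρ e = a ∧ ρ a' = c ∧ ρ c = a' ∧ ρ c' = c' ∧ ρ e' = e' := by
        simp only [hρ]; refine ⟨?_, ?_, ?_, ?_, ?_, ?_⟩ <;> grind
      by_cases h : z ≠ a ∧ z ≠ a' ∧ z ≠ c ∧ z ≠ c' ∧ z ≠ e ∧ z ≠ e'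
      · have h' := hnm h
        have hρz : ∀ z, (z ≠ a ∧ z ≠ a' ∧ z ≠ c ∧ z ≠ c' ∧ z ≠ e ∧ z ≠ e') → ρ z = z := by
          intro z hz; rw [hρ]; grind
        rw [hρz z h, T.perm_of_notMem h, T.perm_of_notMem h', if_pos ⟨h.2.2.1, h'.2.2.1⟩,
          if_pos ⟨h.1, h'.1⟩, hρz _ h']
      · have : z = a ∨ z = a' ∨ z = c ∨ z = c' ∨ z = e ∨ z = e' := eq_or_of_not_ne h
        rcases this with rfl | rfl | rfl | rfl | rfl | rfl <;>
          simp only [hρv, hπv, hm] <;> grind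
    refine stateSum_congr k _ _ hmate (fun z hz => ?_) fun z hz => ?_
    · rw [hmate, del_mate] at hz
      show X.ε ((triPerm a a' c c' e e').symm (ρ.symm z)) = X.ε z
      rw [hρi, T.perm_symm, hρ, T.perm_apply]; grind
    · rw [hmate, del_mate] at hz
      show X.up ((triPerm a a' c c' e e').symm (ρ.symm z)) = X.up z
      rw [hρi, T.perm_symm, hρ, T.perm_apply]; grind
  rw [hconj]
  have hd : (X.del a).mate a = a := by simp [del_mate]
  have hd' : (X.del a).mate a' = a' := by simp [del_mate, hm.2.1]
  have inj := σ.injective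
  subst hxy
  rcases T.hx with ⟨rfl, hx⟩ | ⟨rfl, hx⟩
  · have hy : σ a' = e := Nb.one.1 T.hy
    -- The dummies are moved one at a time; in the intermediate permutation `a'` has been moved and
    -- `a` has not.
    trans stateSum k (swap a' c * σ * swap a a' * swap e a') (X.del a) b
    · refine stateSum_moveDummy k hd' (by grind) ?_ ?_ fun z hz => ?_ <;>
        (simp only [Perm.mul_apply, swap_apply_def]; grind)
    · refine stateSum_moveDummy k hd (by grind) ?_ ?_ fun z hz => ?_ <;>
        (simp only [Perm.mul_apply, hρ, swap_apply_def]; grind)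
  · have hy : σ e = a' := Nb.neg_one.1 T.hy
    trans stateSum k (swap c a' * swap a' (σ a) * σ * swap a a') (X.del a) b
    · refine stateSum_moveDummy k hd' (by grind) ?_ ?_ fun z hz => ?_ <;>
        (simp only [Perm.mul_apply, swap_apply_def]; grind)
    · refine stateSum_moveDummy k hd (by grind) ?_ ?_ fun z hz => ?_ <;>
        (simp only [Perm.mul_apply, hρ, swap_apply_def]; grind)

end Triangle

end Crossings

namespace Crossings

open Classical

variable {P : Type} {X : Crossings P}

namespace Triangle

variable {σ : Perm P} {a a' c c' e e' b : P} {x y w : ℤˣ} [Fintype P]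

-- Smoothing the crossing of two antiparallel strands produces two turning arcs. The third strand
-- forms a bigon with one of them before the move and with the other one after it. Both bigons are
-- removed by the second Reidemeister move, and the same diagram is left.
set_option maxHeartbeats 1000000 in
lemma smooth_eq_of_antiparallel (T : Triangle σ X a a' c c' e e' x y w) (hup : X.up c = X.up e)
    (hb : b ∉ [a, a', c, c', e, e']) (hxy : x = -y) (k : ℕ) :
    stateSum k (σ * swap a a') (X.del a) b =
      stateSum k (σ * swap c e) ((X.map (triPerm a a' c c' e e')).del c) b := by
  have hn := T.ne
  have hm := T.mate_facts
  have hε := T.ε_facts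
  have hu := T.up_facts
  have hmm := T.map_mate
  have hnm := @T.mate_notMem
  have hπv := T.perm_values
  have hπs := T.perm_symm
  have hεc : X.ε e = -X.ε c := by
    have := T.h₂
    rw [hxy, neg_mul, ← mul_neg] at this
    exact (mul_left_cancel this).symm
  simp only [List.mem_cons, List.not_mem_nil, or_false, not_or] at hb
  set X' := X.map (triPerm a a' c c' e e') with hX'
  have hX'm : X'.mate a = e' ∧ X'.mate e' = a ∧ X'.mate a' = c' ∧ X'.mate c' = a' ∧ X'.mate c = e ∧
      X'.mate e = c := by
    simp only [hmm, hπv, hm]; simp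
  have hX'ε : ∀ z, X'.ε z = X.ε (triPerm a a' c c' e e' z) := fun z => by
    rw [← hπs]; rfl
  have hX'u : ∀ z, X'.up z = X.up (triPerm a a' c c' e e' z) := fun z => by
    rw [← hπs]; rfl
  -- Once all three crossings of the triangle are forgotten, the diagrams before and after the move
  -- coincide.
  have hdel : ∀ τ, stateSum k τ (((X.del a).del e).del c) b =
      stateSum k τ (((X'.del c).del a).del a') b := by
    intro τ
    have hmate : (((X.del a).del e).del c).mate = (((X'.del c).del a).del a').mate := by
      ext z
      by_cases h : z ≠ a ∧ z ≠ a' ∧ z ≠ c ∧ z ≠ c' ∧ z ≠ e ∧ z ≠ e'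
      · have h' := hnm h
        have : X'.mate z = X.mate z := by
          rw [hmm, T.perm_of_notMem h, T.perm_of_notMem h']
        simp only [del_mate, this]
        grind
      · have : z = a ∨ z = a' ∨ z = c ∨ z = c' ∨ z = e ∨ z = e' := eq_or_of_not_ne h
        rcases this with rfl | rfl | rfl | rfl | rfl | rfl <;>
          simp only [del_mate, hm, hX'm] <;> grind
    have hout : ∀ z, (((X.del a).del e).del c).mate z ≠ z → triPerm a a' c c' e e' z = z := by
      intro z hz
      refine T.perm_of_notMem ?_
      by_contra h
      have : z = a ∨ z = a' ∨ z = c ∨ z = c' ∨ z = e ∨ z = e' := eq_or_of_not_ne h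
      rcases this with rfl | rfl | rfl | rfl | rfl | rfl <;> apply hz <;>
          simp only [del_mate, hm] <;> grind
    refine stateSum_congr k τ b hmate (fun z hz => ?_) fun z hz => ?_
    · show X.ε z = X'.ε z
      rw [hX'ε, hout z hz]
    · show X.up z = X'.up z
      rw [hX'u, hout z hz]
  have hda : (X.del a).mate a = a := by simp [del_mate]
  have hda' : (X.del a).mate a' = a' := by simp [del_mate, hm.2.1]
  have hdc : (X'.del c).mate c = c := by simp [del_mate]
  have hde : (X'.del c).mate e = e := by simp [del_mate, hX'm]
  have hme : (X.del a).mate e = e' ∧ (X.del a).mate c = c' := by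
    simp only [del_mate, hm]; grind
  have hma : (X'.del c).mate a = e' ∧ (X'.del c).mate a' = c' := by
    simp only [del_mate, hX'm]; grind
  have inj := σ.injective
  rcases units_eq y with rfl | rfl
  · subst hxy
    have hx : σ c = a := Nb.neg_one.1 T.hx
    have hy : σ a' = e := Nb.one.1 T.hy
    have h1 : stateSum k (σ * swap a a') (X.del a) b =
        stateSum k (swap a e * σ) (X.del a) b := by
      refine stateSum_moveDummy k hda (by grind) ?_ ?_ fun z hz => ?_ <;>
        (simp only [Perm.mul_apply, swap_apply_def]; grind)
    have h2 : stateSum k (σ * swap c e) (X'.del c) b =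
        stateSum k (swap a e * σ) (X'.del c) b := by
      refine stateSum_moveDummy k hde (by grind) ?_ ?_ fun z hz => ?_ <;>
        (simp only [Perm.mul_apply, swap_apply_def]; grind)
    have B1 : Bigon (swap a e * σ) (X.del a) c e c' e' := by
      refine ⟨by simp; grind, hme.2, hme.1, ?_, ?_, hup, hεc⟩
      · simp only [Perm.mul_apply, hx, swap_apply_left]
      · simp only [Perm.mul_apply, swap_apply_def]
        rcases T.hw with ⟨-, h⟩ | ⟨-, h⟩ <;> grind
    have B2 : Bigon (swap a e * σ) (X'.del c) a' a c' e' := by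
      refine ⟨by simp; grind, hma.2, hma.1, ?_, ?_, ?_, ?_⟩
      · simp only [Perm.mul_apply, hy, swap_apply_right]
      · simp only [Perm.mul_apply, swap_apply_def]
        rcases T.hw with ⟨-, h⟩ | ⟨-, h⟩ <;> grind
      · show X'.up a' = X'.up a
        rw [hX'u, hX'u, hπv.1, hπv.2.2.1, hup]
      · show X'.ε a = -X'.ε a'
        rw [hX'ε, hX'ε, hπv.1, hπv.2.2.1, hεc, neg_neg]
    rw [h1, h2, B1.stateSum_eq (by simp; grind), B2.stateSum_eq (by simp; grind), del_comm, hdel,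
      del_comm (X'.del c)]
  · rw [neg_neg] at hxy
    subst hxy
    have hx : σ a = c := Nb.one.1 T.hx
    have hy : σ e = a' := Nb.neg_one.1 T.hy
    have h1 : stateSum k (σ * swap a a') (X.del a) b =
        stateSum k (swap a' c * σ) (X.del a) b := by
      refine stateSum_moveDummy k hda' (by grind) ?_ ?_ fun z hz => ?_ <;>
        (simp only [Perm.mul_apply, swap_apply_def]; grind)
    have h2 : stateSum k (σ * swap c e) (X'.del c) b =
        stateSum k (swap a' c * σ) (X'.del c) b := by
      refine stateSum_moveDummy k hdc (by grind) ?_ ?_ fun z hz => ?_ <;>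
        (simp only [Perm.mul_apply, swap_apply_def]; grind)
    have B1 : Bigon (swap a' c * σ) (X.del a) e c e' c' := by
      refine ⟨by simp; grind, hme.1, hme.2, ?_, ?_, hup.symm, ?_⟩
      · simp only [Perm.mul_apply, hy, swap_apply_left]
      · simp only [Perm.mul_apply, swap_apply_def]
        rcases T.hw with ⟨-, h⟩ | ⟨-, h⟩ <;> grind
      · show X.ε c = -X.ε e
        rw [hεc, neg_neg]
    have B2 : Bigon (swap a' c * σ) (X'.del c) a a' e' c' := by
      refine ⟨by simp; grind, hma.1, hma.2, ?_, ?_, ?_, ?_⟩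
      · simp only [Perm.mul_apply, hx, swap_apply_right]
      · simp only [Perm.mul_apply, swap_apply_def]
        rcases T.hw with ⟨-, h⟩ | ⟨-, h⟩ <;> grind
      · show X'.up a = X'.up a'
        rw [hX'u, hX'u, hπv.1, hπv.2.2.1, hup]
      · show X'.ε a' = -X'.ε a
        rw [hX'ε, hX'ε, hπv.1, hπv.2.2.1, hεc]
    rw [h1, h2, B1.stateSum_eq (by simp; grind), B2.stateSum_eq (by simp; grind), hdel]

lemma smooth_eq (T : Triangle σ X a a' c c' e e' x y w) (hup : X.up c = X.up e)
    (hb : b ∉ [a, a', c, c', e, e']) (k : ℕ) :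
    stateSum k (σ * swap a a') (X.del a) b =
      stateSum k (σ * swap c e) ((X.map (triPerm a a' c c' e e')).del c) b := by
  by_cases h : x = y
  · exact T.smooth_eq_of_parallel hup hb h k
  · refine T.smooth_eq_of_antiparallel hup hb ?_ k
    rcases units_eq x with rfl | rfl <;> rcases units_eq y with rfl | rfl <;> simp_all

/-- The effect of the third Reidemeister move. -/
noncomputable def defect (k : ℕ) (σ : Perm P) (X : Crossings P) (b a a' c c' e e' : P) : ℤ :=
  stateSum k σ X b - stateSum k σ (X.map (triPerm a a' c c' e e')) b

lemma cc_triangle (T : Triangle σ X a a' c c' e e' x y w) (p : P) :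
    Triangle σ (X.cc p) a a' c c' e e' x y w :=
  ⟨T.nodup, T.ma, T.mc, T.me, T.hx, T.hy, T.hw, T.h₁, T.h₂⟩

lemma map_cc {Q : Type} (X : Crossings P) (f : P ≃ Q) (p : P) :
    (X.cc p).map f = (X.map f).cc (f p) := by
  ext z
  · rfl
  · rfl
  · show (if f.symm z = p ∨ f.symm z = X.mate p then !X.up (f.symm z) else X.up (f.symm z)) =
      if z = f p ∨ z = f (X.mate (f.symm (f p))) then !X.up (f.symm z) else X.up (f.symm z)
    simp only [Equiv.symm_apply_apply, Equiv.symm_apply_eq]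

lemma map_del {Q : Type} (X : Crossings P) (f : P ≃ Q) (p : P) :
    (X.del p).map f = (X.map f).del (f p) := by
  ext z
  · show f ((X.del p).mate (f.symm z)) = _
    rw [del_mate, del_mate]
    show _ = if z ≠ f p ∧ f (X.mate (f.symm z)) ≠ f p then f (X.mate (f.symm z)) else z
    simp only [ne_eq, Equiv.symm_apply_eq, f.injective.eq_iff]
    split_ifs <;> simp
  · rfl
  · rfl

/-- By `skein` the two sums of the defect change by the state sums of the smoothings at `a` before
and after the move, which agree by `smooth_eq`. The hypothesis `hup` says that the third strand runs
over both strands of this crossing or under both. -/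
lemma defect_cc (T : Triangle σ X a a' c c' e e' x y w) (hup : X.up c = X.up e)
    (hb : b ∉ [a, a', c, c', e, e']) (k : ℕ) :
    defect (k + 1) σ (X.cc a) b a a' c c' e e' = defect (k + 1) σ X b a a' c c' e e' := by
  have hn := T.ne
  have hm := T.mate_facts
  have h1 := skein (X := X) k σ b (p := a) (by rw [T.ma]; exact hn.1.1.symm)
  have hmc : (X.map (triPerm a a' c c' e e')).mate c = e := by
    rw [T.map_mate, T.perm_values.2.1, T.ma, T.perm_values.2.2.1]
  have h2 := skein (X := X.map (triPerm a a' c c' e e')) k σ b (p := c)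
    (by rw [hmc]; exact hn.2.2.1.2.1.symm)
  have hs : (X.map (triPerm a a' c c' e e')).sgn c = X.sgn a := by
    have : (triPerm a a' c c' e e').symm c = a := by rw [T.perm_symm, T.perm_values.2.1]
    unfold sgn map; simp only [this]
  rw [T.ma, T.smooth_eq hup hb] at h1
  rw [hmc, hs] at h2
  unfold defect
  rw [map_cc, T.perm_values.1]
  linarith

/-- The change is the defect, one degree lower, of the diagram smoothed at `p`, which still contains
the triangle. -/
lemma defect_cc_of_notMem (T : Triangle σ X a a' c c' e e' x y w) {p : P}
    (hp : p ≠ a ∧ p ≠ a' ∧ p ≠ c ∧ p ≠ c' ∧ p ≠ e ∧ p ≠ e') (k : ℕ)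
    (ih : defect k (σ * swap p (X.mate p)) (X.del p) b a a' c c' e e' = 0)
    (hpm : X.mate p ≠ p) :
    defect (k + 1) σ (X.cc p) b a a' c c' e e' = defect (k + 1) σ X b a a' c c' e e' := by
  have hp' := T.mate_notMem hp
  have h1 := skein (X := X) k σ b hpm
  have hm2 : (X.map (triPerm a a' c c' e e')).mate p = X.mate p := by
    rw [T.map_mate, T.perm_of_notMem hp, T.perm_of_notMem hp']
  have h2 := skein (X := X.map (triPerm a a' c c' e e')) k σ b (p := p) (by rwa [hm2])
  have hs : (X.map (triPerm a a' c c' e e')).sgn p = X.sgn p := by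
    have : (triPerm a a' c c' e e').symm p = p := by rw [T.perm_symm, T.perm_of_notMem hp]
    unfold sgn map; simp only [this]
  unfold defect at ih ⊢
  rw [map_del, T.perm_of_notMem hp] at ih
  rw [hm2, hs] at h2
  rw [map_cc, T.perm_of_notMem hp]
  have : stateSum k (σ * swap p (X.mate p)) (X.del p) b =
    stateSum k (σ * swap p (X.mate p)) ((X.map (triPerm a a' c c' e e')).del p) b := by linarith
  rw [this] at h1
  linarith

lemma smooth_triangle (T : Triangle σ X a a' c c' e e' x y w) {p : P}
    (hp : p ≠ a ∧ p ≠ a' ∧ p ≠ c ∧ p ≠ c' ∧ p ≠ e ∧ p ≠ e') :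
    Triangle (σ * swap p (X.mate p)) (X.del p) a a' c c' e e' x y w := by
  have hp' := T.mate_notMem hp
  have hm := T.mate_facts
  have hNb : ∀ {u v : P} {s : ℤˣ}, u ≠ p → u ≠ X.mate p → v ≠ p → v ≠ X.mate p → Nb σ u v s →
      Nb (σ * swap p (X.mate p)) u v s := by
    intro u v s h1 h2 h3 h4 h
    unfold Nb
    rw [Perm.mul_apply, Perm.mul_apply, swap_apply_of_ne_of_ne h1 h2,
      swap_apply_of_ne_of_ne h3 h4]
    exact h
  obtain ⟨hnd, ma, mc, me, hx, hy, hw, h1, h2⟩ := T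
  refine ⟨hnd, ?_, ?_, ?_, ?_, ?_, ?_, h1, h2⟩
  · rw [del_mate, ma]; grind
  · rw [del_mate, mc]; grind
  · rw [del_mate, me]; grind
  · exact hNb (by grind) (by grind) (by grind) (by grind) hx
  · exact hNb (by grind) (by grind) (by grind) (by grind) hy
  · exact hNb (by grind) (by grind) (by grind) (by grind) hw

end Triangle

end Crossings

lemma walk_nb_left {P : Type} {σ : Perm P} {b p q y : P} (h : σ p = q) (hbq : b ≠ q)
    (hyp : y ≠ p) (hyq : y ≠ q) : Walk σ (· ≠ q) b y ↔ Walk σ (· ≠ p) b y := by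
  constructor
  · intro hw
    refine hw.head_induction (.refl _) fun z _ hw' ih => ?_
    by_cases hzp : z = p
    · subst hzp
      rw [h] at hw'
      exact (hyq (hw'.eq_of_not (by simp)).symm).elim
    · exact ih.head hzp
  · intro hw
    refine (hw.tail_induction (motive := fun z => z ≠ q ∧ Walk σ (· ≠ q) b z) ⟨hbq, .refl _⟩
      fun z hz _ ⟨h1, h2⟩ => ⟨fun h' => hz (σ.injective (h'.trans h.symm)), h2.tail h1⟩).2

lemma walk_nb_right {P : Type} {σ : Perm P} {b p q y : P} (h : σ p = q) (hbq : b ≠ q)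
    (hyp : y ≠ p) : Walk σ (· ≠ y) b p ↔ Walk σ (· ≠ y) b q := by
  constructor
  · intro hw
    rw [← h]; exact hw.tail hyp.symm
  · intro hw
    refine hw.tail_induction (motive := fun z => z = q → Walk σ (· ≠ y) b p)
      (fun h => (hbq h).elim) (fun z _ hw' _ hz => ?_) rfl
    rwa [← σ.injective (hz.trans h.symm)]

lemma before_trans {P : Type} {τ : P → P} {b s t m : P} (h1 : ¬ Before τ b m t)
    (h2 : ¬ Before τ b s m) : ¬ Before τ b s t := by
  unfold Before at *
  rw [not_not] at *
  revert h2
  refine h1.head_induction (fun _ => .refl _) fun z hz _ ih hw => ?_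
  rcases hw.cases_head with rfl | ⟨h3, h4⟩
  · exact (hz rfl).elim
  · exact (ih h4).head h3

lemma before_trans' {P : Type} {τ : P → P} {b s t m : P} (h1 : Before τ b m t)
    (h2 : Before τ b s m) : Before τ b s t := by
  intro hw
  have : Walk τ (· ≠ m) b t ∨ Walk τ (· ≠ s) b m := by
    refine hw.head_induction (Or.inl (.refl _)) fun z hz _ ih => ?_
    by_cases hzm : z = m
    · subst hzm; exact Or.inr (.refl _)
    · exact ih.imp (Walk.head hzm) (Walk.head hz)
  exact this.elim h1 h2

/-! ### The third Reidemeister move: reduction to descending diagrams -/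

namespace Crossings

open Classical

variable {P : Type} {X : Crossings P}

/-- A walk that starts elsewhere meets neighbours in immediate succession, so they compare in the
same way with every third point. -/
lemma Nb.before {σ : Perm P} {b p q y : P} {s : ℤˣ} (h : Nb σ p q s) (hbp : b ≠ p)
    (hbq : b ≠ q) (hyp : y ≠ p) (hyq : y ≠ q) :
    (Before σ b p y ↔ Before σ b q y) ∧ (Before σ b y p ↔ Before σ b y q) := by
  rcases h with ⟨-, h⟩ | ⟨-, h⟩
  · exact ⟨not_congr (walk_nb_left h hbq hyp hyq).symm, not_congr (walk_nb_right h hbq hyp)⟩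
  · exact ⟨not_congr (walk_nb_left h hbp hyq hyp), not_congr (walk_nb_right h hbp hyq).symm⟩

namespace Triangle

variable {σ : Perm P} {a a' c c' e e' b : P} {x y w : ℤˣ}

/-- Prescribe which strand is on top at the three crossings. -/
noncomputable def bits (T : Triangle σ X a a' c c' e e' x y w) (A B C : Bool) : Crossings P where
  mate := X.mate
  ε := X.ε
  up z := if z = a then A else if z = a' then !A else if z = c then B else if z = c' then !B else
    if z = e then C else if z = e' then !C else X.up z
  mate_mate := X.mate_mate
  ε_mate := X.ε_mate
  up_mate z hz := by
    have hn := T.ne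
    have hm := T.mate_facts
    have := X.up_mate z hz
    by_cases h : z ≠ a ∧ z ≠ a' ∧ z ≠ c ∧ z ≠ c' ∧ z ≠ e ∧ z ≠ e'
    · have h' := T.mate_notMem h
      grind
    · rcases eq_or_of_not_ne h with rfl | rfl | rfl | rfl | rfl | rfl <;> grind

lemma bits_triangle (T : Triangle σ X a a' c c' e e' x y w) (A B C : Bool) :
    Triangle σ (T.bits A B C) a a' c c' e e' x y w :=
  ⟨T.nodup, T.ma, T.mc, T.me, T.hx, T.hy, T.hw, T.h₁, T.h₂⟩

lemma bits_up (T : Triangle σ X a a' c c' e e' x y w) (A B C : Bool) :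
    (T.bits A B C).up a = A ∧ (T.bits A B C).up c = B ∧ (T.bits A B C).up e = C ∧
      (T.bits A B C).up a' = (!A) ∧ (T.bits A B C).up c' = (!B) ∧ (T.bits A B C).up e' = !C := by
  have hn := T.ne
  unfold bits
  refine ⟨?_, ?_, ?_, ?_, ?_, ?_⟩ <;> grind

lemma bits_self (T : Triangle σ X a a' c c' e e' x y w) :
    T.bits (X.up a) (X.up c) (X.up e) = X := by
  have hu := T.up_facts
  ext z
  · rfl
  · rfl
  · unfold bits; grind

lemma bits_cc (T : Triangle σ X a a' c c' e e' x y w) (A B C : Bool) :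
    (T.bits A B C).cc a = T.bits (!A) B C ∧ (T.bits A B C).cc c = T.bits A (!B) C ∧
      (T.bits A B C).cc e = T.bits A B (!C) := by
  have hn := T.ne
  have hm := T.mate_facts
  refine ⟨?_, ?_, ?_⟩ <;> ext z <;> try rfl
  all_goals
    unfold cc bits
    simp only [hm, Bool.not_not]
    split_ifs <;> grind

/-- The three strands are layered. -/
def Layered (A B C : Bool) : Prop := A = B ∨ B = C

variable [Fintype P]

lemma defect_swap₁ (T : Triangle σ X a a' c c' e e' x y w) (Y : Crossings P) (k : ℕ) :
    defect k σ Y b a' a e e' c c' = defect k σ Y b a a' c c' e e' := by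
  unfold defect; rw [T.perm_swap₁]

lemma defect_swap₂ (T : Triangle σ X a a' c c' e e' x y w) (Y : Crossings P) (k : ℕ) :
    defect k σ Y b c c' a a' e' e = defect k σ Y b a a' c c' e e' := by
  unfold defect; rw [T.perm_swap₂]

/-- The layered choices are the six possible orders of three strands by height; the two others are
cyclic. The crossing of two strands adjacent in height may be changed by `defect_cc`, applied to the
triangle with its strands renamed, and such changes connect the six orders. -/
lemma defect_bits (T : Triangle σ X a a' c c' e e' x y w) (hb : b ∉ [a, a', c, c', e, e'])
    (k : ℕ) {A B C A' B' C' : Bool} (h : Layered A B C) (h' : Layered A' B' C') :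
    defect (k + 1) σ (T.bits A B C) b a a' c c' e e' =
      defect (k + 1) σ (T.bits A' B' C') b a a' c c' e e' := by
  -- `r1`, `r2`, `r3` change the crossing of the first and second, first and third, second and third
  -- strand, the remaining strand being at the top or at the bottom.
  have r1 : ∀ A B, defect (k + 1) σ (T.bits (!A) B B) b a a' c c' e e' =
      defect (k + 1) σ (T.bits A B B) b a a' c c' e e' := fun A B => by
    rw [← (T.bits_cc A B B).1]
    exact (T.bits_triangle A B B).defect_cc
      (by rw [(T.bits_up A B B).2.1, (T.bits_up A B B).2.2.1]) hb k
  have r2 : ∀ A B, defect (k + 1) σ (T.bits A (!B) (!A)) b a a' c c' e e' =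
      defect (k + 1) σ (T.bits A B (!A)) b a a' c c' e e' := fun A B => by
    rw [← (T.bits_cc A B (!A)).2.1, ← T.defect_swap₂, ← T.defect_swap₂]
    have hu := T.bits_up A B (!A)
    exact (T.bits_triangle A B (!A)).swap₂.defect_cc
      (by rw [hu.1, hu.2.2.2.2.2]; simp) (by simp at hb ⊢; grind) k
  have r3 : ∀ A C, defect (k + 1) σ (T.bits A A (!C)) b a a' c c' e e' =
      defect (k + 1) σ (T.bits A A C) b a a' c c' e e' := fun A C => by
    rw [← (T.bits_cc A A C).2.2, ← T.defect_swap₁, ← T.defect_swap₁, ← T.swap₁.defect_swap₂,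
      ← T.swap₁.defect_swap₂]
    have hu := T.bits_up A A C
    exact (T.bits_triangle A A C).swap₁.swap₂.defect_cc
      (by rw [hu.2.2.2.1, hu.2.2.2.2.1]) (by simp at hb ⊢; grind) k
  have e1 := r1 false false
  have e2 := r1 false true
  have e3 := r2 false false
  have e4 := r2 true false
  have e5 := r3 false false
  have e6 := r3 true false
  simp only [Bool.not_false, Bool.not_true] at e1 e2 e3 e4 e5 e6
  unfold Layered at h h'
  cases A <;> cases B <;> cases C <;> cases A' <;> cases B' <;> cases C' <;> simp at h h' <;>
    grind

/-- Make the crossings outside the triangle descending. -/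
lemma exists_descending (T : Triangle σ X a a' c c' e e' x y w) (k : ℕ)
    (ih : ∀ (σ : Perm P) (Y : Crossings P), Triangle σ Y a a' c c' e e' x y w →
      Layered (Y.up a) (Y.up c) (Y.up e) → defect k σ Y b a a' c c' e e' = 0)
    (hl : Layered (X.up a) (X.up c) (X.up e)) (n : ℕ)
    (hn : (Finset.univ.filter fun p => (p ≠ a ∧ p ≠ a' ∧ p ≠ c ∧ p ≠ c' ∧ p ≠ e ∧ p ≠ e') ∧
      X.mate p ≠ p ∧ X.up p = false ∧ ¬ Before σ b (X.mate p) p).card = n) :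
    ∃ Y : Crossings P, Triangle σ Y a a' c c' e e' x y w ∧
      Layered (Y.up a) (Y.up c) (Y.up e) ∧
      defect (k + 1) σ Y b a a' c c' e e' = defect (k + 1) σ X b a a' c c' e e' ∧
      ∀ p, (p ≠ a ∧ p ≠ a' ∧ p ≠ c ∧ p ≠ c' ∧ p ≠ e ∧ p ≠ e') → Y.mate p ≠ p → Y.up p = false →
        Before σ b (Y.mate p) p := by
  induction n generalizing X with
  | zero =>
    refine ⟨X, T, hl, rfl, fun p h1 h2 h3 => ?_⟩
    by_contra h4
    rw [Finset.card_eq_zero] at hn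
    have : p ∈ (∅ : Finset P) := hn ▸ Finset.mem_filter.2 ⟨Finset.mem_univ _, h1, h2, h3, h4⟩
    simp at this
  | succ n ihn =>
    obtain ⟨p, hp⟩ := Finset.card_pos.1 (lt_of_lt_of_eq n.succ_pos hn.symm)
    obtain ⟨-, h1, h2, h3, h4⟩ := Finset.mem_filter.1 hp
    have h1' := T.mate_notMem h1
    have hup : ∀ z, z ≠ p → z ≠ X.mate p → (X.cc p).up z = X.up z := fun z hz hz' => by
      show (if z = p ∨ z = X.mate p then _ else _) = _
      rw [if_neg]; tauto
    have hupp : (X.cc p).up p = true := by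
      show (if p = p ∨ p = X.mate p then _ else _) = _
      simp [h3]
    have hua : (X.cc p).up a = X.up a ∧ (X.cc p).up c = X.up c ∧ (X.cc p).up e = X.up e :=
      ⟨hup _ h1.1.symm h1'.1.symm, hup _ h1.2.2.1.symm h1'.2.2.1.symm,
        hup _ h1.2.2.2.2.1.symm h1'.2.2.2.2.1.symm⟩
    have hbef : Before σ b p (X.mate p) := by
      have hw := not_not.1 h4
      exact (before_dichotomy h2.symm (hw.mono fun _ _ => trivial)).2 h4
    have hd := T.defect_cc_of_notMem (b := b) h1 k
      (ih _ _ (T.smooth_triangle h1) hl) h2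
    -- The crossing change removes `p` from the set of bad points and adds none: `X.mate p` becomes
    -- an underpassing, but it is met after `p`.
    have hset : (Finset.univ.filter fun q => (q ≠ a ∧ q ≠ a' ∧ q ≠ c ∧ q ≠ c' ∧ q ≠ e ∧ q ≠ e') ∧
          (X.cc p).mate q ≠ q ∧ (X.cc p).up q = false ∧ ¬ Before σ b ((X.cc p).mate q) q) =
          (Finset.univ.filter fun p => (p ≠ a ∧ p ≠ a' ∧ p ≠ c ∧ p ≠ c' ∧ p ≠ e ∧ p ≠ e') ∧
      X.mate p ≠ p ∧ X.up p = false ∧ ¬ Before σ b (X.mate p) p).erase p := by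
        ext z
        have hm : (X.cc p).mate = X.mate := rfl
        simp only [Finset.mem_filter, Finset.mem_erase, Finset.mem_univ, true_and, hm]
        by_cases hz : z = p
        · subst hz; simp [hupp]
        by_cases hz' : z = X.mate p
        · subst hz'
          have hum := X.up_mate p h2
          rw [h3] at hum
          simp [X.mate_mate, hbef, hum]
        · rw [hup z hz hz']; simp [hz]
    have hcard := (congrArg Finset.card hset).trans (by rw [Finset.card_erase_of_mem hp, hn, Nat.add_sub_cancel])
    obtain ⟨Y, hY1, hY2, hY3, hY4⟩ := ihn (T.cc_triangle p) (by rwa [hua.1, hua.2.1, hua.2.2]) hcard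
    exact ⟨Y, hY1, hY2, hY3.trans hd, hY4⟩

lemma before_facts (T : Triangle σ X a a' c c' e e' x y w)
    (hb : b ∉ [a, a', c, c', e, e']) :
    (Before σ b a' a ↔ Before σ b e c) ∧ (Before σ b a a' ↔ Before σ b c e) ∧
      (Before σ b c' c ↔ Before σ b e' a) ∧ (Before σ b c c' ↔ Before σ b a e') ∧
      (Before σ b e' e ↔ Before σ b c' a') ∧ (Before σ b e e' ↔ Before σ b a' c') := by
  simp only [List.mem_cons, List.not_mem_nil, or_false, not_or] at hb
  have hn := T.ne
  have x1 := fun y => T.hx.before (b := b) (y := y) hb.1 hb.2.2.1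
  have x2 := fun y => T.hy.before (b := b) (y := y) hb.2.1 hb.2.2.2.2.1
  have x3 := fun y => T.hw.before (b := b) (y := y) hb.2.2.2.1 hb.2.2.2.2.2
  refine ⟨?_, ?_, ?_, ?_, ?_, ?_⟩ <;> grind

/-- Each strand meets the triangle in two consecutive points, so the strands are ordered by their
first visits; this order is transitive and therefore not cyclic. -/
lemma layered_before (T : Triangle σ X a a' c c' e e' x y w)
    (hb : b ∉ [a, a', c, c', e, e']) :
    Layered (!decide (Before σ b a' a)) (!decide (Before σ b c' c)) (!decide (Before σ b e' e)) := by
  obtain ⟨-, -, tb, -, mb, -⟩ := T.before_facts hb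
  simp only [List.mem_cons, List.not_mem_nil, or_false, not_or] at hb
  have hn := T.ne
  have hmid : Before σ b c' a ↔ Before σ b e' a :=
    (T.hw.before hb.2.2.2.1 hb.2.2.2.2.2 hn.1.2.2.1 hn.1.2.2.2.2).1
  unfold Layered
  have h1 := @before_trans' P σ b c' a a'
  have h2 := @before_trans P σ b c' a a'
  by_cases Before σ b a' a <;> by_cases Before σ b c' c <;> by_cases Before σ b e' e <;> simp_all

/-- The third Reidemeister move. -/
lemma defect_eq_zero (hb : b ∉ [a, a', c, c', e, e']) (k : ℕ) :
    ∀ (σ : Perm P) (X : Crossings P), Triangle σ X a a' c c' e e' x y w →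
      Layered (X.up a) (X.up c) (X.up e) → defect k σ X b a a' c c' e e' = 0 := by
  induction k with
  | zero =>
    intro σ X T hl
    unfold defect; rw [stateSum_zero, stateSum_zero, sub_self]
  | succ k ih =>
    intro σ X T hl
    -- The crossings outside the triangle are made descending, and by `defect_bits` those of the
    -- triangle may be chosen descending as well. The move preserves the order in which strands are
    -- visited, so the diagram after it is descending too and both sums vanish.
    obtain ⟨Y, hY, hYl, hYd, hYB⟩ := T.exists_descending (b := b) k ih hl _ rfl
    rw [← hYd]
    clear hYd hl T X
    have hb' := hb
    simp only [List.mem_cons, List.not_mem_nil, or_false, not_or] at hb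
    have hn := hY.ne
    have hm := hY.mate_facts
    set A := !decide (Before σ b a' a) with hA
    set B := !decide (Before σ b c' c) with hB
    set C := !decide (Before σ b e' e) with hC
    obtain ⟨tm, tm', tb, tb', mb, mb'⟩ := hY.before_facts hb'
    have hl : Layered A B C := hY.layered_before hb'
    rw [← hY.bits_self, hY.defect_bits hb' k hYl hl]
    set Z := hY.bits A B C with hZ
    have hu := hY.bits_up A B C
    have hZm : Z.mate = Y.mate := rfl
    have hZu : ∀ z, (z ≠ a ∧ z ≠ a' ∧ z ≠ c ∧ z ≠ c' ∧ z ≠ e ∧ z ≠ e') → Z.up z = Y.up z := by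
      intro z hz
      simp only [hZ, bits]; grind
    have key : ∀ {p q : P}, p ≠ q → ¬ Before σ b q p → Before σ b p q := fun hne h =>
      (before_dichotomy hne ((not_not.1 h).mono fun _ _ => trivial)).2 h
    have d1 : A = true → Before σ b a a' := fun h => key hn.1.1 (by simpa [hA] using h)
    have d2 : B = true → Before σ b c c' := fun h => key hn.2.2.1.1 (by simpa [hB] using h)
    have d3 : C = true → Before σ b e e' := fun h => key hn.2.2.2.2 (by simpa [hC] using h)
    have d1' : A = false → Before σ b a' a := fun h => by simpa [hA] using h
    have d2' : B = false → Before σ b c' c := fun h => by simpa [hB] using h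
    have d3' : C = false → Before σ b e' e := fun h => by simpa [hC] using h
    unfold defect
    rw [stateSum_descending, stateSum_descending, sub_self]
    · intro p hp hpu
      have T := hY.bits_triangle A B C
      have hpm : (Z.map (triPerm a a' c c' e e')).mate p = triPerm a a' c c' e e'
        (Z.mate (triPerm a a' c c' e e' p)) := T.map_mate p
      have hpu' : Z.up (triPerm a a' c c' e e' p) = false := by
        rw [← hY.perm_symm]; exact hpu
      rw [hpm] at hp ⊢
      by_cases h : p ≠ a ∧ p ≠ a' ∧ p ≠ c ∧ p ≠ c' ∧ p ≠ e ∧ p ≠ e'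
      · have e1 := hY.perm_of_notMem h
        have e2 := hY.perm_of_notMem (hY.mate_notMem h)
        grind
      · have hv := T.perm_values
        rcases eq_or_of_not_ne h with rfl | rfl | rfl | rfl | rfl | rfl <;>
          simp only [hv, hZm, hm] at hpu' ⊢ <;> grind
    · intro p hp hpu
      by_cases h : p ≠ a ∧ p ≠ a' ∧ p ≠ c ∧ p ≠ c' ∧ p ≠ e ∧ p ≠ e'
      · exact hYB p h hp (hZu p h ▸ hpu)
      · rcases eq_or_of_not_ne h with rfl | rfl | rfl | rfl | rfl | rfl <;>
          simp only [hZm, hm] <;> grind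

/-- The third Reidemeister move. -/
lemma stateSum_eq (T : Triangle σ X a a' c c' e e' x y w) (hb : b ∉ [a, a', c, c', e, e'])
    (hl : Layered (X.up a) (X.up c) (X.up e)) (k : ℕ) :
    stateSum k σ (X.map (triPerm a a' c c' e e')) b = stateSum k σ X b := by
  have := defect_eq_zero hb k σ X T hl
  unfold defect at this
  linarith

end Triangle

end Crossings

/-! ### First return maps: deleting points without crossings -/

lemma walk_unique {P : Type} {τ : P → P} {A : P → Prop} {x y z : P} (hy : ¬ A y) (hz : ¬ A z)
    (h : Walk τ A x y) (h' : Walk τ A x z) : y = z := by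
  rcases h.total h' with h | h
  · exact h.eq_of_not hy
  · exact (h.eq_of_not hz).symm

/-- Walks on a set of points and walks of the first return map to it. -/
lemma walk_ret {P Q : Type} {ι : Q → P} {g : Q → Q} {τ : P → P} {A : P → Prop} {x y : Q}
    (hι : Function.Injective ι)
    (h : ∀ q, Walk τ (· ∉ Set.range ι) (τ (ι q)) (ι (g q))) (hA : ∀ z, z ∉ Set.range ι → A z) :
    Walk τ A (ι x) (ι y) ↔ Walk g (fun q => A (ι q)) x y := by
  constructor
  · intro hw
    -- The walk is tracked by the last point `q` of the range that it has visited.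
    obtain ⟨q, h1, h2⟩ := hw.tail_induction (motive := fun z => ∃ q, Walk g (fun q => A (ι q)) x q ∧
        (z = ι q ∨ A (ι q) ∧ z ∉ Set.range ι ∧ Walk τ (· ∉ Set.range ι) (τ (ι q)) z))
      ⟨x, .refl _, Or.inl rfl⟩ (fun z hz _ ⟨q, h1, h2⟩ => by
        have hAq : A (ι q) := by
          rcases h2 with rfl | h2
          · exact hz
          · exact h2.1
        have hw' : Walk τ (· ∉ Set.range ι) (τ (ι q)) (τ z) := by
          rcases h2 with rfl | h2
          · exact .refl _
          · exact h2.2.2.tail h2.2.1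
        by_cases hr : τ z ∈ Set.range ι
        · refine ⟨g q, h1.tail hAq, Or.inl ?_⟩
          exact walk_unique (not_not.2 hr) (by simp) hw' (h q)
        · exact ⟨q, h1, Or.inr ⟨hAq, hr, hw'⟩⟩)
    rcases h2 with h2 | h2
    · rwa [hι h2]
    · exact (h2.2.1 ⟨y, rfl⟩).elim
  · intro hw
    refine hw.tail_induction (.refl _) fun z hz _ ih => ?_
    exact (ih.tail hz).trans ((h z).mono hA)

/-- `σ'` is the first return map of `σ` to the range of `ι`. -/
structure Embeds {P Q : Type} (ι : Q → P) (σ' : Perm Q) (σ : Perm P) : Prop where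
  inj : Function.Injective ι
  ret : ∀ q, Walk σ (· ∉ Set.range ι) (σ (ι q)) (ι (σ' q))
  reach : ∀ z, ∃ q, Walk σ (fun _ => True) (ι q) z

lemma Embeds.reach' {P Q : Type} {ι : Q → P} {σ' : Perm Q} {σ : Perm P}
    (h : Embeds ι σ' σ) {z : P} (hz : z ∉ Set.range ι) :
    ∃ q, Walk σ (· ∉ Set.range ι) (σ (ι q)) z := by
  obtain ⟨q, hq⟩ := h.reach z
  refine (hq.tail_induction (motive := fun z => z ∈ Set.range ι ∨
    ∃ q, Walk σ (· ∉ Set.range ι) (σ (ι q)) z) (Or.inl ⟨q, rfl⟩) fun z _ _ ih => ?_).resolve_left hz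
  by_cases hzr : z ∈ Set.range ι
  · obtain ⟨q, rfl⟩ := hzr
    exact Or.inr ⟨q, .refl _⟩
  · obtain ⟨q, hq⟩ := ih.resolve_left hzr
    exact Or.inr ⟨q, hq.tail hzr⟩

namespace Crossings

open Classical

variable {P Q : Type} {ι : Q → P} {σ' : Perm Q} {σ : Perm P} {X' : Crossings Q}
  {X : Crossings P}

/-- The smoothed crossings lie in the range of `ι` and leave the stretches between its points
untouched. Hence the first return map of the smoothed curve is the smoothed first return map. -/
lemma good_embed (h : Embeds ι σ' σ) (S : Finset Q) (T : Finset P) (b : Q)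
    (hT : ∀ z, z ∈ T ↔ ∃ q ∈ S, ι q = z)
    (hm : ∀ q, q ∈ S ∨ X'.mate q ∈ S → X.mate (ι q) = ι (X'.mate q)) :
    X.Good σ (ι b) T ↔ X'.Good σ' b S := by
  have hTι : ∀ q, ι q ∈ T ↔ q ∈ S := fun q => by
    rw [hT]
    exact ⟨fun ⟨q', h1, h2⟩ => h.inj h2 ▸ h1, fun h => ⟨q, h, rfl⟩⟩
  have hf : ∀ q, X.flip T (ι q) = ι (X'.flip S q) := by
    intro q
    rw [flip_apply, flip_apply]
    have := h.inj
    grind [X.mate_mate, X'.mate_mate, Function.Injective]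
  have hf' : ∀ z, z ∉ Set.range ι → X.flip T z = z := by
    intro z hz
    have := X.mate_mate z
    grind [flip_apply]
  have hw : ∀ {x y : P}, Walk σ (· ∉ Set.range ι) x y →
      Walk (σ * X.flip T : Perm P) (· ∉ Set.range ι) x y := by
    intro x y hw
    refine hw.tail_induction (.refl _) fun z hz _ ih => ?_
    have := ih.tail hz
    rwa [Perm.mul_apply, hf' z hz] at this
  have hret : ∀ q, Walk (σ * X.flip T : Perm P) (· ∉ Set.range ι)
      ((σ * X.flip T : Perm P) (ι q)) (ι ((σ' * X'.flip S : Perm Q) q)) := by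
    intro q
    rw [Perm.mul_apply, Perm.mul_apply, hf]
    exact hw (h.ret _)
  unfold Good
  refine and_congr ⟨fun hc q => ?_, fun hc z => ?_⟩ ⟨fun hB q hq => ?_, fun hB z hz => ?_⟩
  · exact (walk_ret h.inj hret (fun _ _ => trivial)).1 (hc (ι q))
  · by_cases hz : z ∈ Set.range ι
    · obtain ⟨q, rfl⟩ := hz
      exact (walk_ret h.inj hret (fun _ _ => trivial)).2 (hc q)
    · obtain ⟨q, hq⟩ := h.reach' hz
      have h1 := (walk_ret h.inj hret (A := fun _ => True) (fun _ _ => trivial)).2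
        (hc (X'.flip S q))
      refine h1.trans (Walk.head trivial ?_)
      rw [Perm.mul_apply, hf]
      have : X'.flip S (X'.flip S q) = q := Function.Involutive.toPerm_involutive _ q
      rw [this]
      exact (hw hq).mono fun _ _ => trivial
  · have := hB (ι q) ((hTι q).2 hq)
    rw [hm q (Or.inl hq)] at this
    refine fun hw => this ((walk_ret (A := fun z => z ≠ ι (X'.mate q)) h.inj hret
      (fun z hz h => hz ⟨_, Eq.symm h⟩)).2 ?_)
    exact hw.mono fun _ hz h' => hz (h.inj h')
  · obtain ⟨q, hq, rfl⟩ := (hT z).1 hz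
    rw [hm q (Or.inl hq)]
    refine fun hw => hB q hq (((walk_ret (A := fun z => z ≠ ι (X'.mate q)) h.inj hret
      (fun z hz h => hz ⟨_, Eq.symm h⟩)).1 hw).mono ?_)
    exact fun _ hz h => hz (h ▸ rfl)

/-- The diagram on `Q` is obtained from the one on `P` by deleting points without crossings. -/
structure Emb (ι : Q → P) (σ' : Perm Q) (X' : Crossings Q) (σ : Perm P)
    (X : Crossings P) : Prop extends Embeds ι σ' σ where
  mate : ∀ q, X.mate (ι q) = ι (X'.mate q)
  dummy : ∀ z, z ∉ Set.range ι → X.mate z = z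
  ε : ∀ q, X'.mate q ≠ q → X.ε (ι q) = X'.ε q
  up : ∀ q, X'.mate q ≠ q → X.up (ι q) = X'.up q

lemma Emb.stateSum_eq [Fintype P] [Fintype Q] (h : Emb ι σ' X' σ X) (k : ℕ) (b : Q) :
    stateSum k σ X (ι b) = stateSum k σ' X' b := by
  have ht : X.tails = X'.tails.map ⟨ι, h.inj⟩ := by
    ext z
    simp only [mem_tails, Finset.mem_map, Function.Embedding.coeFn_mk]
    have := h.mate
    have := h.dummy z
    have := h.up
    grind [h.inj.eq_iff]
  unfold stateSum
  rw [ht, Finset.powersetCard_map, Finset.sum_map]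
  refine Finset.sum_congr rfl fun S hS => ?_
  show (if X.Good σ (ι b) (S.map ⟨ι, h.inj⟩) then ∏ p ∈ S.map ⟨ι, h.inj⟩, (X.sgn p : ℤ) else 0) = _
  rw [Finset.prod_map]
  refine if_congr (good_embed h.toEmbeds S _ b (fun z => by simp) fun q _ => h.mate q) ?_ rfl
  refine Finset.prod_congr rfl fun q hq => ?_
  have := (mem_tails.1 ((Finset.mem_powersetCard.1 hS).1 hq)).1
  simp only [Function.Embedding.coeFn_mk, sgn, h.ε q this, h.up q this]

/-- A bijection of points is an embedding. -/
lemma Emb.ofEquiv (e : Q ≃ P) (hσ : ∀ q, σ (e q) = e (σ' q))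
    (mate : ∀ q, X.mate (e q) = e (X'.mate q)) (ε : ∀ q, X'.mate q ≠ q → X.ε (e q) = X'.ε q)
    (up : ∀ q, X'.mate q ≠ q → X.up (e q) = X'.up q) : Emb e σ' X' σ X where
  inj := e.injective
  ret q := by rw [hσ]; exact .refl _
  reach z := ⟨e.symm z, by rw [e.apply_symm_apply]; exact .refl _⟩
  mate := mate
  dummy z hz := (hz (e.surjective z)).elim
  ε := ε
  up := up

end Crossings

/-! ### Cycles of a permutation as cyclic words -/

open List in
/-- The word `w` is read along a cycle of `σ`. -/
def Cyc {P : Type} (σ : P → P) (w : List P) : Prop :=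
  ∀ x l, w ~r (x :: l) → σ x = l.headD x

/-- The list `W` consists of the cycles of `σ`, each read from some point. -/
structure Words {P : Type} (σ : P → P) (W : List (List P)) : Prop where
  nodup : W.flatten.Nodup
  complete : ∀ x, x ∈ W.flatten
  ne : [] ∉ W
  cyc : ∀ w ∈ W, Cyc σ w

section Cyc

open List

variable {P Q : Type} {σ : P → P} {w : List P}

lemma Cyc.rotated {w' : List P} (h : Cyc σ w) (hw : w ~r w') : Cyc σ w' :=
  fun x l hx => h x l (hw.trans hx)

lemma exists_isRotated_cons {x : P} (h : x ∈ w) : ∃ l, w ~r (x :: l) := by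
  obtain ⟨l₁, l₂, rfl⟩ := List.append_of_mem h
  exact ⟨l₂ ++ l₁, List.isRotated_append⟩

lemma cyc_of_formPerm [DecidableEq P] (hn : w.Nodup) (h : ∀ x ∈ w, σ x = w.formPerm x) :
    Cyc σ w := by
  intro x l hx
  rw [h x (hx.mem_iff.2 (by simp)), List.formPerm_eq_of_isRotated hn hx]
  have hn' := hx.nodup_iff.1 hn
  rcases l with _ | ⟨y, l⟩
  · simp
  · exact List.formPerm_apply_head x y l hn'

lemma Cyc.apply {l₁ l₂ : List P} {y : P} (h : Cyc σ (l₁ ++ y :: l₂)) :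
    σ y = (l₂ ++ l₁).headD y := h y _ List.isRotated_append

lemma Cyc.mem (h : Cyc σ w) {x : P} (hx : x ∈ w) : σ x ∈ w := by
  obtain ⟨l, hl⟩ := exists_isRotated_cons hx
  rw [h x l hl, hl.mem_iff]
  cases l <;> simp

lemma Cyc.walk_mem (h : Cyc σ w) {A : P → Prop} {x y : P} (hx : x ∈ w) (hw : Walk σ A x y) :
    y ∈ w :=
  hw.tail_induction hx fun _ _ _ ih => h.mem ih

/-- The next letter with the property `K`. -/
lemma Cyc.walk_filter {K : P → Bool} {x : P} {l : List P} (h : Cyc σ (x :: l)) :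
    Walk σ (fun z => ¬ K z = true) (σ x) ((l.filter K).headD x) := by
  suffices key : ∀ (l₂ l₁ : List P) (y : P), x :: l = l₁ ++ y :: l₂ →
      Walk σ (fun z => ¬ K z = true) (σ y) ((l₂.filter K).headD x) from key l [] x rfl
  intro l₂
  induction l₂ with
  | nil =>
    intro l₁ y hy
    have h' : σ y = ([] ++ l₁).headD y := (hy ▸ h : Cyc σ (l₁ ++ y :: [])).apply
    rw [h']
    rcases l₁ with _ | ⟨z, l₁⟩
    · simp at hy; simp [hy.1]; exact .refl _
    · simp at hy; simp [hy.1]; exact .refl _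
  | cons a l₂ ih =>
    intro l₁ y hy
    have h' : σ y = a := (hy ▸ h : Cyc σ (l₁ ++ y :: a :: l₂)).apply
    rw [h']
    by_cases ha : K a = true
    · simp [ha]; exact .refl _
    · have := ih (l₁ ++ [y]) a (by simpa using hy)
      simpa [ha] using Walk.head (A := fun z => ¬ K z = true) ha this

lemma cyc_walk {x y : P} (h : Cyc σ w) (hx : x ∈ w) (hy : y ∈ w) :
    Walk σ (fun _ => True) x y := by
  classical
  by_cases hxy : x = y
  · subst hxy; exact .refl _
  obtain ⟨l, hl⟩ := exists_isRotated_cons hx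
  have hy' : y ∈ l := by
    have := hl.mem_iff.1 hy
    simpa [Ne.symm hxy] using this
  have hw := (h.rotated hl).walk_filter (K := fun z => z = y)
  have hh : (l.filter fun z => z = y).headD x = y := by
    have : y ∈ l.filter fun z => z = y := by simp [hy']
    obtain ⟨a, m, hm⟩ := List.exists_cons_of_ne_nil (List.ne_nil_of_mem this)
    have ha : a ∈ l.filter fun z => z = y := by rw [hm]; simp
    rw [hm]; simpa using (List.mem_filter.1 ha).2
  rw [hh] at hw
  exact (hw.mono fun _ _ => trivial).head trivial

lemma cyc_unique {w' : List P} {x : P} (hn : w.Nodup) (hn' : w'.Nodup) (h : Cyc σ w)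
    (h' : Cyc σ w') (hx : x ∈ w) (hx' : x ∈ w') : w ~r w' := by
  obtain ⟨l, hl⟩ := exists_isRotated_cons hx
  obtain ⟨l', hl'⟩ := exists_isRotated_cons hx'
  -- Both words are read from `x` on. They agree letter by letter, and neither can end before the
  -- other because `σ` comes back to `x` only at the end of a word.
  suffices key : ∀ (l₂ l₂' l₁ : List P) (y : P), x :: l = l₁ ++ y :: l₂ →
      x :: l' = l₁ ++ y :: l₂' → l₂ = l₂' by
    rw [key l l' [] x rfl rfl] at hl
    exact hl.trans hl'.symm
  have hc := h.rotated hl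
  have hc' := h'.rotated hl'
  have hN := hl.nodup_iff.1 hn
  have hN' := hl'.nodup_iff.1 hn'
  have aux : ∀ {l l₁ : List P} {y : P}, x :: l = l₁ ++ [y] → Cyc σ (x :: l) → σ y = x := by
    intro l l₁ y hy hc
    have h1 : σ y = ([] ++ l₁).headD y := (hy ▸ hc : Cyc σ (l₁ ++ y :: [])).apply
    rw [h1]
    rcases l₁ with _ | ⟨z, l₁⟩
    · simp at hy; simp [hy.1]
    · simp at hy; simp [hy.1]
  have aux' : ∀ {l l₁ l₂ : List P} {y a : P}, x :: l = l₁ ++ y :: a :: l₂ → (x :: l).Nodup →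
      a ≠ x := by
    rintro l l₁ l₂ y a hy hN rfl
    rcases l₁ with _ | ⟨z, l₁⟩
    · simp at hy; rw [hy.2] at hN; simp at hN
    · simp at hy; rw [hy.2] at hN; simp at hN
  intro l₂
  induction l₂ with
  | nil =>
    intro l₂' l₁ y hy hy'
    rcases l₂' with _ | ⟨a, l₂'⟩
    · rfl
    · have h1 := aux hy hc
      have h2 : σ y = a := (hy' ▸ hc' : Cyc σ (l₁ ++ y :: a :: l₂')).apply
      exact (aux' hy' hN' (h2.symm.trans h1)).elim
  | cons a l₂ ih =>
    intro l₂' l₁ y hy hy'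
    have h2 : σ y = a := (hy ▸ hc : Cyc σ (l₁ ++ y :: a :: l₂)).apply
    rcases l₂' with _ | ⟨a', l₂'⟩
    · exact (aux' hy hN (h2.symm.trans (aux hy' hc'))).elim
    · have h3 : σ y = a' := (hy' ▸ hc' : Cyc σ (l₁ ++ y :: a' :: l₂')).apply
      have : a = a' := h2.symm.trans h3
      subst this
      rw [ih l₂' (l₁ ++ [y]) a (by simpa using hy) (by simpa using hy')]

/-- In a word without repetitions the first letter determines the rotation. -/
lemma eq_of_isRotated_cons {x : P} {l l' : List P} (hn : (x :: l).Nodup)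
    (h : (x :: l) ~r (x :: l')) : l = l' := by
  obtain ⟨n, h⟩ := h
  rw [← List.rotate_mod] at h
  have h1 : n % (x :: l).length < (x :: l).length := Nat.mod_lt _ (by simp)
  have h0 : (x :: l).rotate (n % (x :: l).length) = (x :: l) := by
    rw [hn.rotate_eq_self_iff]
    left
    rw [Nat.mod_mod]
    have h2 : ((x :: l).rotate (n % (x :: l).length)).head? = some x := by rw [h]; rfl
    rw [List.head?_rotate h1, List.getElem?_eq_getElem h1] at h2
    have h3 : (x :: l)[n % (x :: l).length] = (x :: l)[0] := by simpa using h2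
    exact (hn.getElem_inj_iff).1 h3
  rw [h0] at h
  simpa using h

lemma IsRotated.filter (K : P → Bool) {w w' : List P} (h : w ~r w') :
    (w.filter K) ~r (w'.filter K) := by
  obtain ⟨n, hn, rfl⟩ := List.isRotated_iff_mod.1 h
  rw [List.rotate_eq_drop_append_take hn, List.filter_append]
  conv_lhs => rw [← List.take_append_drop n w, List.filter_append]
  exact List.isRotated_append

namespace Words

variable {W : List (List P)}

lemma exists_mem (h : Words σ W) (x : P) : ∃ w ∈ W, x ∈ w := List.mem_flatten.1 (h.complete x)

lemma nodup_of_mem (h : Words σ W) {w : List P} (hw : w ∈ W) : w.Nodup :=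
  (List.nodup_flatten.1 h.nodup).1 w hw

/-- A version of `unique` for lists that need not exhaust the points, so that a cycle can be removed
from both lists in the induction. -/
lemma rel_of_subset {W' : List (List P)} : ∀ {W : List (List P)}, W.flatten.Nodup →
    W'.flatten.Nodup → (∀ x, x ∈ W.flatten ↔ x ∈ W'.flatten) → [] ∉ W → [] ∉ W' →
    (∀ w ∈ W, Cyc σ w) → (∀ w ∈ W', Cyc σ w) →
    ∃ L, W.Perm L ∧ List.Forall₂ List.IsRotated L W' := by
  induction W' with
  | nil =>
    intro W hn hn' hm h0 h0' hc hc'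
    rcases W with _ | ⟨w, W⟩
    · exact ⟨[], .refl _, .nil⟩
    · rcases w with _ | ⟨x, w⟩
      · simp at h0
      · have := (hm x).1 (by simp)
        simp at this
  | cons w' W' ih =>
    intro W hn hn' hm h0 h0' hc hc'
    rcases w' with _ | ⟨x, l⟩
    · simp at h0'
    obtain ⟨w, hw, hxw⟩ := List.mem_flatten.1 ((hm x).2 (by simp))
    obtain ⟨A, B, rfl⟩ := List.append_of_mem hw
    have hp : (A ++ w :: B).Perm (w :: (A ++ B)) := List.perm_middle
    have hn1 : (w ++ (A ++ B).flatten).Nodup := by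
      have := (hp.flatten.nodup_iff).1 hn
      simpa using this
    have hn2 : ((x :: l) ++ W'.flatten).Nodup := by simpa using hn'
    rw [List.nodup_append] at hn1 hn2
    have hr : w ~r (x :: l) := cyc_unique hn1.1 hn2.1 (hc w (by simp)) (hc' _ (by simp)) hxw (by simp)
    have hm' : ∀ y, y ∈ (A ++ B).flatten ↔ y ∈ W'.flatten := by
      intro y
      have h1 : y ∈ (A ++ w :: B).flatten ↔ y ∈ w ∨ y ∈ (A ++ B).flatten := by
        rw [hp.flatten.mem_iff]; simp
      have h2 := hm y
      rw [h1, List.flatten_cons, List.mem_append, ← hr.mem_iff] at h2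
      by_cases hy : y ∈ w
      · have h3 : y ∉ (A ++ B).flatten := fun h => hn1.2.2 y hy y h rfl
        have h4 : y ∉ W'.flatten := fun h => hn2.2.2 y (hr.mem_iff.1 hy) y h rfl
        simp only [h3, h4]
      · simpa [hy] using h2
    obtain ⟨L, hL1, hL2⟩ := ih (W := A ++ B) hn1.2.1 hn2.2.1 hm'
      (fun h => h0 (hp.symm.subset (List.mem_cons_of_mem _ h))) (fun h => h0' (by simp [h]))
      (fun v hv => hc v (hp.symm.subset (List.mem_cons_of_mem _ hv)))
      (fun v hv => hc' v (List.mem_cons_of_mem _ hv))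
    exact ⟨w :: L, hp.trans (hL1.cons w), .cons hr hL2⟩

/-- The list of the cycles is unique up to order and rotations. -/
lemma unique {W' : List (List P)} (h : Words σ W) (h' : Words σ W') :
    ∃ L, W.Perm L ∧ List.Forall₂ List.IsRotated L W' :=
  rel_of_subset h.nodup h'.nodup (fun x => ⟨fun _ => h'.complete x, fun _ => h.complete x⟩) h.ne
    h'.ne h.cyc h'.cyc

/-- Cycles exist. -/
lemma exists_words [Finite P] (σ : Perm P) : ∃ W, Words σ W := by
  classical
  have := Fintype.ofFinite P
  -- `Perm.toList` is empty at a fixed point, so fixed points need a word of their own.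
  let wd : P → List P := fun x => if σ x = x then [x] else σ.toList x
  have hmem : ∀ x y, y ∈ wd x ↔ σ.SameCycle x y := by
    intro x y
    by_cases hx : σ x = x
    · simp only [wd, hx, if_true, List.mem_singleton]
      constructor
      · rintro rfl; exact .refl _ _
      · rintro ⟨i, rfl⟩; exact Perm.zpow_apply_eq_self_of_apply_eq_self hx i
    · simp only [wd, hx, if_false, Perm.mem_toList_iff, Perm.mem_support]
      simp [hx]
  have hnd : ∀ x, (wd x).Nodup := by
    intro x
    by_cases hx : σ x = x
    · simp [wd, hx]
    · simp only [wd, hx, if_false]; exact Perm.nodup_toList _ _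
  let W := (Finset.univ : Finset (Quotient (Perm.SameCycle.setoid σ))).toList.map
    fun c => wd c.out
  refine ⟨W, ?_, ?_, ?_, ?_⟩
  · rw [List.nodup_flatten]
    refine ⟨fun w hw => ?_, ?_⟩
    · obtain ⟨c, -, rfl⟩ := List.mem_map.1 hw
      exact hnd _
    · refine List.pairwise_map.2 ((Finset.nodup_toList _).imp ?_)
      intro c d hcd
      rw [List.disjoint_left]
      intro y hy hy'
      rw [hmem] at hy hy'
      refine hcd ?_
      rw [← Quotient.out_eq c, ← Quotient.out_eq d]
      exact Quotient.sound (hy.trans hy'.symm)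
  · intro x
    refine List.mem_flatten.2 ⟨wd (Quotient.mk _ x).out, List.mem_map.2 ⟨_, by simp, rfl⟩, ?_⟩
    rw [hmem]
    exact Quotient.exact (Quotient.out_eq (s := Perm.SameCycle.setoid σ) (Quotient.mk _ x))
  · intro h
    obtain ⟨c, -, hc⟩ := List.mem_map.1 h
    have := (hmem c.out c.out).2 (.refl _ _)
    rw [hc] at this
    simp at this
  · intro w hw
    obtain ⟨c, -, rfl⟩ := List.mem_map.1 hw
    refine cyc_of_formPerm (hnd _) fun x hx => ?_
    have hx' := (hmem _ _).1 hx
    by_cases hc : σ c.out = c.out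
    · simp only [wd, hc, if_true, List.mem_singleton] at hx ⊢
      rw [hx]; simpa using hc
    · simp only [wd, hc, if_false]
      rw [Perm.formPerm_toList, hx'.cycleOf_apply]

end Words

end Cyc

open Classical in
/-- Keep the letters with the property `K`. -/
noncomputable def sift {P : Type} (K : P → Prop) (W : List (List P)) : List (List P) :=
  W.map (List.filter fun z => decide (K z))

section

open List Classical

variable {P Q : Type} {ι : Q → P} {σ : Perm P} {σ' : Perm Q} {W : List (List P)}
  {W' : List (List Q)}

lemma Cyc.walk_ret {w : List P} {w' : List Q} {q : Q} (hn : w.Nodup) (hc : Cyc σ w)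
    (hι : Function.Injective ι)
    (hf : w'.map ι = w.filter fun z => decide (z ∈ Set.range ι)) {l' : List Q}
    (hq : w' ~r (q :: l')) : Walk σ (· ∉ Set.range ι) (σ (ι q)) (ι (l'.headD q)) := by
  have h1 : ι q ∈ w := by
    have : ι q ∈ w'.map ι := List.mem_map.2 ⟨q, hq.mem_iff.2 (by simp), rfl⟩
    rw [hf] at this
    exact (List.mem_filter.1 this).1
  obtain ⟨l, hl⟩ := exists_isRotated_cons h1
  have h2 : (ι q :: l.filter fun z => decide (z ∈ Set.range ι)) ~r (ι q :: l'.map ι) := by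
    have h3 := IsRotated.filter (fun z => decide (z ∈ Set.range ι)) hl
    rw [List.filter_cons_of_pos (by simp), ← hf] at h3
    exact h3.symm.trans (hq.map ι)
  have h3 : (ι q :: l.filter fun z => decide (z ∈ Set.range ι)).Nodup :=
    ((hl.nodup_iff.1 hn).sublist (List.Sublist.cons_cons _ (List.filter_sublist)))
  have h4 := eq_of_isRotated_cons h3 h2
  have h5 := (hc.rotated hl).walk_filter (K := fun z => decide (z ∈ Set.range ι))
  rw [h4] at h5
  have h6 : (l'.map ι).headD (ι q) = ι (l'.headD q) := by cases l' <;> rfl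
  rw [h6] at h5
  simpa using h5

/-- Filtering the words computes the first return map. Each cycle meets the range because `W'`
contains no empty word. -/
lemma Words.embeds (h : Words σ W) (h' : Words σ' W') (hι : Function.Injective ι)
    (hf : W'.map (List.map ι) = sift (· ∈ Set.range ι) W) : Embeds ι σ' σ where
  inj := hι
  ret q := by
    obtain ⟨w', hw', hq⟩ := h'.exists_mem q
    have : w'.map ι ∈ sift (· ∈ Set.range ι) W := hf ▸ List.mem_map.2 ⟨w', hw', rfl⟩
    obtain ⟨w, hw, hww'⟩ := List.mem_map.1 this
    obtain ⟨l', hl'⟩ := exists_isRotated_cons hq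
    rw [h'.cyc w' hw' q l' hl']
    exact (h.cyc w hw).walk_ret (h.nodup_of_mem hw) hι hww'.symm hl'
  reach z := by
    obtain ⟨w, hw, hz⟩ := h.exists_mem z
    have : w.filter (fun z => decide (z ∈ Set.range ι)) ∈ W'.map (List.map ι) :=
      hf ▸ List.mem_map.2 ⟨w, hw, rfl⟩
    obtain ⟨w', hw', hww'⟩ := List.mem_map.1 this
    rcases w' with _ | ⟨q, l⟩
    · exact (h'.ne hw').elim
    · have : ι q ∈ w := by
        have h1 : ι q ∈ (q :: l).map ι := by simp
        rw [hww'] at h1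
        exact (List.mem_filter.1 h1).1
      exact ⟨q, cyc_walk (h.cyc w hw) this hz⟩

lemma exists_map_eq (l : List P) (h : ∀ z ∈ l, z ∈ Set.range ι) : ∃ l' : List Q, l'.map ι = l := by
  induction l with
  | nil => exact ⟨[], rfl⟩
  | cons z l ih =>
    obtain ⟨q, rfl⟩ := h z (by simp)
    obtain ⟨l', rfl⟩ := ih fun z hz => h z (by simp [hz])
    exact ⟨q :: l', rfl⟩

lemma exists_map_map_eq (W : List (List P)) (h : ∀ w ∈ W, ∀ z ∈ w, z ∈ Set.range ι) :
    ∃ W' : List (List Q), W'.map (List.map ι) = W := by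
  induction W with
  | nil => exact ⟨[], rfl⟩
  | cons w W ih =>
    obtain ⟨w', hw'⟩ := exists_map_eq w (h w (by simp))
    obtain ⟨W', rfl⟩ := ih fun w hw => h w (by simp [hw])
    exact ⟨w' :: W', by simp [hw']⟩

lemma sift_range (K : P → Prop) (W : List (List P)) : ∀ w ∈ sift K W, ∀ z ∈ w, K z := by
  intro w hw z hz
  obtain ⟨v, -, rfl⟩ := List.mem_map.1 hw
  simpa using (List.mem_filter.1 hz).2

lemma flatten_sift (K : P → Prop) (W : List (List P)) :
    (sift K W).flatten = W.flatten.filter fun z => decide (K z) := by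
  unfold sift; rw [List.filter_flatten]

lemma mem_flatten_map_map {f : Q → P} {W : List (List Q)} {z : P} :
    z ∈ (W.map (List.map f)).flatten ↔ ∃ q ∈ W.flatten, f q = z := by
  rw [← List.map_flatten, List.mem_map]

lemma Embeds.words [Finite P] (he : Embeds ι σ' σ) (h : Words σ W) :
    ∃ W' : List (List Q), Words σ' W' ∧ W'.map (List.map ι) = sift (· ∈ Set.range ι) W := by
  obtain ⟨W', hW'⟩ := exists_map_map_eq (ι := ι) (sift (· ∈ Set.range ι) W) (sift_range _ _)
  have hfl : W'.flatten.map ι = W.flatten.filter fun z => decide (z ∈ Set.range ι) := by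
    rw [List.map_flatten, hW', flatten_sift]
  have hnd : W'.flatten.Nodup := by
    refine List.Nodup.of_map ι ?_
    rw [hfl]; exact h.nodup.filter _
  refine ⟨W', ⟨hnd, fun q => ?_, fun h0 => ?_, fun w' hw' q l' hl' => ?_⟩, hW'⟩
  · have : ι q ∈ W'.flatten.map ι := by
      rw [hfl]; exact List.mem_filter.2 ⟨h.complete _, by simp⟩
    obtain ⟨q', h1, h2⟩ := List.mem_map.1 this
    rwa [← he.inj h2]
  · have : ([] : List P) ∈ sift (· ∈ Set.range ι) W := hW' ▸ List.mem_map.2 ⟨[], h0, rfl⟩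
    obtain ⟨w, hw, hw0⟩ := List.mem_map.1 this
    rcases w with _ | ⟨z, w⟩
    · exact h.ne hw
    · obtain ⟨q, hq⟩ := he.reach z
      have h1 := (h.cyc _ hw).walk_mem (by simp) hq.symm_of_perm
      have h2 : ι q ∈ (z :: w).filter fun z => decide (z ∈ Set.range ι) :=
        List.mem_filter.2 ⟨h1, by simp⟩
      rw [hw0] at h2
      simp at h2
  · have : w'.map ι ∈ sift (· ∈ Set.range ι) W := hW' ▸ List.mem_map.2 ⟨w', hw', rfl⟩
    obtain ⟨w, hw, hww'⟩ := List.mem_map.1 this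
    have h1 := (h.cyc w hw).walk_ret (h.nodup_of_mem hw) he.inj hww'.symm hl'
    exact he.inj (walk_unique (by simp) (by simp) (he.ret q) h1)

lemma sift_sift (K K' : P → Prop) (W : List (List P)) (h : ∀ z, K z → K' z) :
    sift K (sift K' W) = sift K W := by
  unfold sift
  rw [List.map_map]
  refine List.map_congr_left fun w _ => ?_
  rw [Function.comp, List.filter_filter]
  exact List.filter_congr fun z _ => by grind

lemma sift_map (K : P → Prop) (f : Q → P) (W : List (List Q)) :
    sift K (W.map (List.map f)) = (sift (fun q => K (f q)) W).map (List.map f) := by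
  unfold sift
  rw [List.map_map, List.map_map]
  refine List.map_congr_left fun w _ => ?_
  simp [List.filter_map, Function.comp_def]

/-- The permutation with given cycles. -/
noncomputable def permOfWords (W : List (List P)) : Perm P := (W.map List.formPerm).prod

lemma prod_formPerm_apply {P : Type} [DecidableEq P] : ∀ {W : List (List P)}, W.flatten.Nodup →
    ∀ {w : List P}, w ∈ W → ∀ {x : P}, x ∈ w → (W.map List.formPerm).prod x = w.formPerm x := by
  intro W
  have hout : ∀ {W : List (List P)} {x : P}, x ∉ W.flatten → (W.map List.formPerm).prod x = x := by
    intro W x hx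
    induction W with
    | nil => rfl
    | cons v W ih =>
      rw [List.map_cons, List.prod_cons, Perm.mul_apply]
      rw [List.flatten_cons, List.mem_append, not_or] at hx
      rw [ih hx.2, List.formPerm_apply_of_notMem hx.1]
  induction W with
  | nil => intro _ w hw; simp at hw
  | cons v W ih =>
    intro hn w hw x hx
    rw [List.flatten_cons, List.nodup_append] at hn
    rw [List.map_cons, List.prod_cons, Perm.mul_apply]
    rcases List.mem_cons.1 hw with rfl | hw
    · rw [hout (by grind)]
    · rw [ih hn.2.1 hw hx, List.formPerm_apply_of_notMem]
      exact fun h => hn.2.2 _ h _ (List.mem_flatten.2 ⟨w, hw, List.formPerm_apply_mem_of_mem hx⟩) rfl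

lemma words_permOfWords (hn : W.flatten.Nodup) (hc : ∀ x, x ∈ W.flatten) (h0 : [] ∉ W) :
    Words (permOfWords W) W where
  nodup := hn
  complete := hc
  ne := h0
  cyc w hw := cyc_of_formPerm ((List.nodup_flatten.1 hn).1 w hw) fun _ hx =>
    prod_formPerm_apply hn hw hx

end

/-! ### Planarity: every flow is the boundary of a function on the faces -/

namespace Crossings

open Classical

variable {P Q : Type}

/-- The edge at `p` in the direction `a`; edges are named by the points they enter. -/
def edge (σ : Perm P) (p : P) (a : ℤˣ) : P := if a = 1 then σ p else p

@[simp] lemma edge_one (σ : Perm P) (p : P) : edge σ p 1 = σ p := rfl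

@[simp] lemma edge_neg_one (σ : Perm P) (p : P) : edge σ p (-1) = p := rfl

/-- A flow on the edges of the diagram. -/
def Flow (σ : Perm P) (X : Crossings P) (x : P → ℚ) : Prop :=
  ∀ p, x p + x (X.mate p) = x (σ p) + x (σ (X.mate p))

/-- The flow `x` is the boundary of a function on the faces; `H p 1` and `H p (-1)` are its values
to the left and to the right of the edge that enters `p`. -/
structure Heights (σ : Perm P) (X : Crossings P) (x : P → ℚ) (H : P → ℤˣ → ℚ) : Prop where
  jump : ∀ p, x p = H p 1 - H p (-1)
  dummy : ∀ p, X.mate p = p → H (σ p) = H p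
  corner : ∀ p, X.mate p ≠ p → ∀ a b : ℤˣ,
    H (edge σ p a) (X.ε p * b) = H (edge σ (X.mate p) b) (-(X.ε p * a))

/-- Every flow is a boundary. -/
def Planar (σ : Perm P) (X : Crossings P) : Prop :=
  ∀ x, Flow σ X x → ∃ H, Heights σ X x H

lemma Flow.dummy {σ : Perm P} {X : Crossings P} {x : P → ℚ} (h : Flow σ X x) {p : P}
    (hp : X.mate p = p) : x (σ p) = x p := by
  have := h p
  grind

lemma height_ext {H : P → ℤˣ → ℚ} {x : P → ℚ} (jump : ∀ p, x p = H p 1 - H p (-1)) {p q : P}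
    (hx : x p = x q) {s : ℤˣ} (h : H p s = H q s) : H p = H q := by
  have h1 := jump p
  have h2 := jump q
  funext t
  rcases units_eq s with rfl | rfl <;> rcases units_eq t with rfl | rfl <;> linarith

lemma Heights.jump' {σ : Perm P} {X : Crossings P} {x : P → ℚ} {H : P → ℤˣ → ℚ}
    (h : Heights σ X x H) (p : P) (s : ℤˣ) : H p s - H p (-s) = ((s : ℤ) : ℚ) * x p := by
  have := h.jump p
  rcases units_eq s with rfl | rfl
  · simp; grind
  · simp; grind

/-- Heights when a strand is crossed. -/
lemma Heights.cross {σ : Perm P} {X : Crossings P} {x : P → ℚ} {H : P → ℤˣ → ℚ}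
    (h : Heights σ X x H) {p : P} (hp : X.mate p ≠ p) (hx : x (σ (X.mate p)) = x (X.mate p))
    (c : ℤˣ) : H (σ p) c = H p c - ((X.ε p : ℤ) : ℚ) * x (X.mate p) := by
  have h1 := h.corner p hp 1 (X.ε p * c)
  have h2 := h.corner p hp (-1) (X.ε p * c)
  rw [← mul_assoc, Int.units_mul_self, one_mul] at h1 h2
  rw [edge_one, mul_one] at h1
  rw [edge_neg_one, mul_neg, mul_one, neg_neg] at h2
  have h3 := h.jump' (edge σ (X.mate p) (X.ε p * c)) (X.ε p)
  have h4 : x (edge σ (X.mate p) (X.ε p * c)) = x (X.mate p) := by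
    unfold edge; grind
  grind

lemma planar_congr {σ : Perm P} {X Y : Crossings P} (hm : X.mate = Y.mate)
    (hε : ∀ p, X.mate p ≠ p → X.ε p = Y.ε p) (h : Planar σ X) : Planar σ Y := by
  intro x hx
  obtain ⟨H, hH⟩ := h x fun p => by rw [hm]; exact hx p
  refine ⟨H, hH.jump, fun p hp => hH.dummy p (by grind), fun p hp a b => ?_⟩
  rw [← hm] at hp ⊢
  rw [← hε p hp]
  exact hH.corner p hp a b

lemma Planar.cc {σ : Perm P} {X : Crossings P} (h : Planar σ X) (p : P) :
    Planar σ (X.cc p) := planar_congr (X := X) (Y := X.cc p) rfl (fun _ _ => rfl) h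

lemma Planar.rev {σ : Perm P} {X : Crossings P} (h : Planar σ X) : Planar σ X.rev := by
  intro x hx
  obtain ⟨H, hH⟩ := h x hx
  refine ⟨fun p s => -H p (-s), fun p => ?_, fun p hp => ?_, fun p hp a b => ?_⟩
  · have := hH.jump p
    simp; grind
  · funext s; exact congrArg Neg.neg (congrFun (hH.dummy p hp) (-s))
  · have := hH.corner p hp a b
    show -H (edge σ p a) (-(-X.ε p * b)) = -H (edge σ (X.mate p) b) (-(-(-X.ε p * a)))
    simp only [neg_mul, neg_neg]
    grind

lemma del_facts (X : Crossings P) (p : P) : (X.del p).mate p = p ∧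
    (X.del p).mate (X.mate p) = X.mate p ∧ ∀ z, z ≠ p → z ≠ X.mate p →
      (X.del p).mate z = X.mate z ∧ X.mate z ≠ p ∧ X.mate z ≠ X.mate p := by
  have := X.mate_mate
  simp only [del_mate]; grind

/-- Smoothing a crossing. -/
lemma Planar.smooth {σ : Perm P} {X : Crossings P} (h : Planar σ X) {p : P}
    (hp : X.mate p ≠ p) : Planar (σ * swap p (X.mate p)) (X.del p) := by
  intro x hx
  obtain ⟨m1, m2, m3⟩ := X.del_facts p
  have s1 : (σ * swap p (X.mate p)) p = σ (X.mate p) := by simp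
  have s2 : (σ * swap p (X.mate p)) (X.mate p) = σ p := by simp
  have s3 : ∀ z, z ≠ p → z ≠ X.mate p → (σ * swap p (X.mate p)) z = σ z := by
    intro z hz hz'
    rw [Perm.mul_apply, swap_apply_of_ne_of_ne hz hz']
  have x1 := hx.dummy m1
  have x2 := hx.dummy m2
  -- A flow on the smoothed diagram is a flow on `X` with equal values on the edges that the
  -- smoothing joins; therefore its heights agree on these edges too (`e1`, `e2`).
  obtain ⟨H, hH⟩ := h x fun z => by have := hx z; have := X.mate_mate; by_cases z = p <;> by_cases z = X.mate p <;> grind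
  have c1 := hH.corner p hp (-1) 1
  have c2 := hH.corner p hp 1 (-1)
  simp only [edge_one, edge_neg_one, mul_one, mul_neg, neg_neg] at c1 c2
  have e1 := height_ext (p := p) (q := σ (X.mate p)) hH.jump (by grind) c1
  have e2 := height_ext (p := σ p) (q := X.mate p) hH.jump (by grind) c2
  refine ⟨H, hH.jump, fun z hz => ?_, fun z hz a b => ?_⟩
  · have := hH.dummy z
    by_cases z = p <;> by_cases z = X.mate p <;> grind
  · have hzp : z ≠ p := by grind
    have hzp' : z ≠ X.mate p := by grind
    have := m3 z hzp hzp'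
    have := hH.corner z (by grind) a b
    show H _ (X.ε z * b) = H _ (-(X.ε z * a))
    unfold edge at this ⊢
    grind

/-- Removing a kink. -/
lemma Planar.kink {σ : Perm P} {X : Crossings P} (h : Planar σ X) {p : P}
    (hp : X.mate p ≠ p) (hσ : σ p = X.mate p) : Planar σ (X.del p) := by
  intro x hx
  obtain ⟨m1, m2, m3⟩ := X.del_facts p
  have x1 := hx.dummy m1
  have x2 := hx.dummy m2
  obtain ⟨H, hH⟩ := h x fun z => by have := hx z; have := X.mate_mate; by_cases z = p <;> by_cases z = X.mate p <;> grind
  have c1 := hH.corner p hp 1 1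
  have c2 := hH.corner p hp (-1) (-1)
  simp only [edge_one, edge_neg_one, mul_one, mul_neg, neg_neg, hσ] at c1 c2
  have e1 := height_ext (p := σ (X.mate p)) (q := p) hH.jump (by grind) (c1.symm.trans c2.symm)
  have hne : ∀ z, σ z = X.mate p ↔ z = p := fun z => by rw [← hσ, σ.injective.eq_iff]
  -- The edge inside the kink, which enters `X.mate p`, gets the heights of the strand on which it
  -- lies.
  refine ⟨fun z => if z = X.mate p then H p else H z, fun z => ?_, fun z hz => ?_,
    fun z hz a b => ?_⟩
  · have := hH.jump
    grind
  · have := hH.dummy z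
    grind
  · have := m3 z (by grind) (by grind)
    have := hH.corner z (by grind) a b
    rw [show (X.del p).ε = X.ε from rfl]
    unfold edge at this ⊢
    grind

/-- Removing a bigon. -/
lemma Planar.bigon {σ : Perm P} {X : Crossings P} (h : Planar σ X) {p₁ p₂ q₁ q₂ : P}
    (hB : Bigon σ X p₁ p₂ q₁ q₂) : Planar σ ((X.del p₁).del p₂) := by
  intro x hx
  obtain ⟨hn, h1, h2, h3, h4, h5, h6⟩ := hB
  simp only [List.nodup_cons, List.mem_cons, List.not_mem_nil, or_false, not_or] at hn
  have mm := X.mate_mate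
  have m1 : ((X.del p₁).del p₂).mate p₁ = p₁ := by simp [del_mate]
  have m2 : ((X.del p₁).del p₂).mate p₂ = p₂ := by simp [del_mate]
  have m1' : ((X.del p₁).del p₂).mate q₁ = q₁ := by simp only [del_mate]; grind
  have m2' : ((X.del p₁).del p₂).mate q₂ = q₂ := by simp only [del_mate]; grind
  have m3 : ∀ z, z ≠ p₁ → z ≠ p₂ → z ≠ q₁ → z ≠ q₂ → (X.mate z ≠ p₁ ∧ X.mate z ≠ p₂ ∧
      X.mate z ≠ q₁ ∧ X.mate z ≠ q₂) ∧ ((X.del p₁).del p₂).mate z = X.mate z := by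
    simp only [del_mate]; grind
  have x1 := hx.dummy m1
  have x2 := hx.dummy m2
  have x1' := hx.dummy m1'
  have x2' := hx.dummy m2'
  obtain ⟨H, hH⟩ := h x fun z => by
    have := hx z; by_cases z = p₁ <;> by_cases z = p₂ <;> by_cases z = q₁ <;> by_cases z = q₂ <;> grind
  have hε : ((X.ε p₂ : ℤ) : ℚ) = -((X.ε p₁ : ℤ) : ℚ) := by rw [h6]; simp
  have hε' : ((X.ε q₂ : ℤ) : ℚ) = -((X.ε q₁ : ℤ) : ℚ) := by
    rw [← h1, ← h2, X.ε_mate p₁ (by grind), X.ε_mate p₂ (by grind), h6]; simp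
  have k1 : ∀ c, _ := hH.cross (p := p₁) (by grind) (by grind)
  have k2 : ∀ c, _ := hH.cross (p := p₂) (by grind) (by grind)
  have k1' : ∀ c, _ := hH.cross (p := q₁) (by grind) (by grind)
  have k2' : ∀ c, _ := hH.cross (p := q₂) (by grind) (by grind)
  -- `qs` and `qm` are the first and the second point of the other side of the bigon in the
  -- direction of that side. The opposite signs of the crossings make the heights return to their
  -- old values behind the bigon.
  obtain ⟨qs, qm, hq, hqm, hqe, hxq⟩ : ∃ qs qm, (qs = q₁ ∧ qm = q₂ ∨ qs = q₂ ∧ qm = q₁) ∧ σ qs = qm ∧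
      H (σ qm) = H qs ∧ x qm = x qs := by
    grind
  have hpe : H (σ p₂) = H p₁ := by grind
  have i1 : ∀ z, σ z = p₂ ↔ z = p₁ := fun z => by rw [← h3, σ.injective.eq_iff]
  have i2 : ∀ z, σ z = qm ↔ z = qs := fun z => by rw [← hqm, σ.injective.eq_iff]
  refine ⟨fun z => if z = p₂ then H p₁ else if z = qm then H qs else H z, fun z => ?_,
    fun z hz => ?_, fun z hz a b => ?_⟩
  · have := hH.jump
    grind
  · have := hH.dummy z
    grind
  · have := m3 z (by grind) (by grind) (by grind) (by grind)
    have := hH.corner z (by grind) a b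
    rw [show ((X.del p₁).del p₂).ε = X.ε from rfl]
    unfold edge at this ⊢
    grind

section Emb

variable {ι : Q → P} {σ' : Perm Q} {σ : Perm P} {X' : Crossings Q} {X : Crossings P}

/-- The first point of the range that is reached. -/
lemma _root_.Embeds.exists_walk (h : Embeds ι σ' σ) (z : P) :
    ∃ q, Walk σ (· ∉ Set.range ι) z (ι q) := by
  by_cases hz : z ∈ Set.range ι
  · obtain ⟨q, rfl⟩ := hz; exact ⟨q, .refl _⟩
  · obtain ⟨q, hq⟩ := h.reach' hz
    rcases hq.total (h.ret q) with h1 | h1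
    · grind
    · exact (hz ⟨_, h1.eq_of_not (by simp)⟩).elim

/-- Flows and heights do not change at points without crossings, so both are transported along
`nxt`, the first point of the range that is reached. -/
lemma Emb.planar_iff (h : Emb ι σ' X' σ X) : Planar σ' X' ↔ Planar σ X := by
  choose nxt hnxt using h.toEmbeds.exists_walk
  have hu : ∀ {z q}, Walk σ (· ∉ Set.range ι) z (ι q) → nxt z = q := fun {z q} hw =>
    h.inj (walk_unique (by simp) (by simp) (hnxt z) hw)
  have n1 : ∀ q, nxt (ι q) = q := fun q => hu (.refl _)
  have n2 : ∀ z, z ∉ Set.range ι → nxt (σ z) = nxt z := fun z hz =>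
    (hu ((hnxt (σ z)).head hz)).symm
  have n3 : ∀ q, nxt (σ (ι q)) = σ' q := fun q => hu (h.ret q)
  have hmate : ∀ q, X.mate (ι q) = ι q ↔ X'.mate q = q := fun q => by
    rw [h.mate, h.inj.eq_iff]
  have hdum : ∀ {α : Type} {f : P → α}, (∀ z, X.mate z = z → f (σ z) = f z) →
      ∀ z, f (ι (nxt z)) = f z := by
    intro α f hf z
    exact (hnxt z).tail_induction (motive := fun w => f w = f z) rfl
      fun w hw _ ih => (hf w (h.dummy w hw)).trans ih
  have he : ∀ q a, nxt (edge σ (ι q) a) = edge σ' q a := fun q a => by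
    unfold edge; grind
  constructor
  · intro hP x hx
    have hxd : ∀ z, x (ι (nxt z)) = x z := hdum fun z hz => hx.dummy hz
    obtain ⟨H, hH⟩ := hP (fun q => x (ι q)) (by
      intro q
      have := hx (ι q)
      rw [h.mate, ← hxd (σ (ι q)), ← hxd (σ (ι (X'.mate q))), n3, n3] at this
      grind)
    refine ⟨fun z => H (nxt z), fun z => ?_, fun z hz => ?_, fun z hz a b => ?_⟩
    · rw [← hxd z]; exact hH.jump _
    · by_cases hzr : z ∈ Set.range ι
      · obtain ⟨q, rfl⟩ := hzr
        show H (nxt _) = H (nxt _)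
        rw [n3, n1]; exact hH.dummy q ((hmate q).1 hz)
      · grind
    · by_cases hzr : z ∈ Set.range ι
      · obtain ⟨q, rfl⟩ := hzr
        have hq : X'.mate q ≠ q := fun h' => hz ((hmate q).2 h')
        show H (nxt _) _ = H (nxt _) _
        rw [h.mate, he, he, h.ε q hq]
        exact hH.corner q hq a b
      · exact (hz (h.dummy z hzr)).elim
  · intro hP x hx
    obtain ⟨H, hH⟩ := hP (fun z => x (nxt z)) (by
      intro z
      show x (nxt _) + x (nxt _) = x (nxt _) + x (nxt _)
      by_cases hzr : z ∈ Set.range ι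
      · obtain ⟨q, rfl⟩ := hzr
        rw [h.mate, n1, n1, n3, n3]; exact hx q
      · rw [h.dummy z hzr, n2 z hzr])
    have hHd : ∀ z, H (ι (nxt z)) = H z := hdum hH.dummy
    have hHe : ∀ q a, H (ι (edge σ' q a)) = H (edge σ (ι q) a) := fun q a => by
      grind
    refine ⟨fun q => H (ι q), fun q => ?_, fun q hq => ?_, fun q hq a b => ?_⟩
    · have := hH.jump (ι q)
      grind
    · show H (ι _) = H (ι _)
      rw [← n3 q, hHd]; exact hH.dummy _ ((hmate q).2 hq)
    · show H (ι _) _ = H (ι _) _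
      rw [hHe, hHe, ← h.ε q hq, ← h.mate]
      exact hH.corner _ (fun h' => hq ((hmate q).1 h')) a b

end Emb

end Crossings

/-! ### Planarity under the third Reidemeister move -/

namespace Crossings

open Classical

variable {P : Type} {σ : Perm P} {X : Crossings P}

lemma units_eq_or_neg (a x : ℤˣ) : a = x ∨ a = -x := by
  rcases units_eq a with rfl | rfl <;> rcases units_eq x with rfl | rfl <;> simp

lemma units_ne_neg (x : ℤˣ) : x ≠ -x := by
  rcases units_eq x with rfl | rfl <;> decide

lemma Nb.edge_eq {p q : P} {s : ℤˣ} (h : Nb σ p q s) : edge σ p s = edge σ q (-s) := by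
  rcases h with ⟨rfl, h⟩ | ⟨rfl, h⟩ <;> simp [h]

lemma edge_eq_iff_same {p z : P} {s : ℤˣ} : edge σ z s = edge σ p s ↔ z = p := by
  rcases units_eq s with rfl | rfl <;> simp

/-- The two ends of an edge. -/
lemma Nb.edge_iff {p q z : P} {s d : ℤˣ} (h : Nb σ p q s) :
    edge σ z d = edge σ p s ↔ z = p ∧ d = s ∨ z = q ∧ d = -s := by
  rcases units_eq_or_neg d s with rfl | rfl
  · simp [edge_eq_iff_same]
  · rw [h.edge_eq, edge_eq_iff_same]
    simp [(units_ne_neg s).symm]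

lemma corner_symm {σ : Perm P} {X : Crossings P} {H : P → ℤˣ → ℚ} {p : P}
    (hp : X.mate p ≠ p)
    (h : ∀ a b : ℤˣ, H (edge σ p a) (X.ε p * b) = H (edge σ (X.mate p) b) (-(X.ε p * a)))
    (a b : ℤˣ) : H (edge σ (X.mate p) a) (X.ε (X.mate p) * b) =
      H (edge σ (X.mate (X.mate p)) b) (-(X.ε (X.mate p) * a)) := by
  rw [X.mate_mate, X.ε_mate p hp]
  have := h b a
  simp only [neg_mul, neg_neg]
  exact this.symm

/-- The flow condition in terms of directions. -/
lemma Flow.edge {x : P → ℚ} (h : Flow σ X x) (p : P) (a b : ℤˣ) :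
    (((X.ε p * b : ℤˣ) : ℤ) : ℚ) * (x (edge σ p a) - x (edge σ p (-a))) +
      (((X.ε p * a : ℤˣ) : ℤ) : ℚ) * (x (edge σ (X.mate p) b) - x (edge σ (X.mate p) (-b))) = 0 := by
  have := h p
  rcases units_eq a with rfl | rfl <;> rcases units_eq b with rfl | rfl <;>
    rcases units_eq (X.ε p) with h | h <;> simp [h] <;> linarith

lemma Flow.of_edge {x : P → ℚ} {p : P} (a b : ℤˣ)
    (h : (((X.ε p * b : ℤˣ) : ℤ) : ℚ) * (x (Crossings.edge σ p a) - x (Crossings.edge σ p (-a))) +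
      (((X.ε p * a : ℤˣ) : ℤ) : ℚ) *
        (x (Crossings.edge σ (X.mate p) b) - x (Crossings.edge σ (X.mate p) (-b))) = 0) :
    x p + x (X.mate p) = x (σ p) + x (σ (X.mate p)) := by
  revert h
  rcases units_eq a with rfl | rfl <;> rcases units_eq b with rfl | rfl <;>
    rcases units_eq (X.ε p) with h | h <;> simp [h] <;> intros <;> linarith

lemma jump_of {K : P → ℤˣ → ℚ} {t : ℚ} {z : P} (u : ℤˣ)
    (h : K z u - K z (-u) = ((u : ℤ) : ℚ) * t) : t = K z 1 - K z (-1) := by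
  rcases units_eq u with rfl | rfl <;> simp at h <;> linarith

/-- The four corners are listed relative to chosen directions `α`, `β` of the two strands, which
spares a case distinction over the orientations of the strands of a triangle. -/
lemma corner_iff {K : P → ℤˣ → ℚ} {p p' : P} {α β S R : ℤˣ} (hp : X.mate p = p')
    (hS : S = X.ε p * β) (hR : R = X.ε p * α) :
    (∀ i j : ℤˣ, K (edge σ p i) (X.ε p * j) = K (edge σ (X.mate p) j) (-(X.ε p * i))) ↔
      K (edge σ p α) S = K (edge σ p' β) (-R) ∧ K (edge σ p α) (-S) = K (edge σ p' (-β)) (-R) ∧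
      K (edge σ p (-α)) S = K (edge σ p' β) R ∧ K (edge σ p (-α)) (-S) = K (edge σ p' (-β)) R := by
  subst hp hS hR
  refine ⟨fun h => ⟨h .., by simpa using h α (-β), by simpa using h (-α) β,
    by simpa using h (-α) (-β)⟩, fun ⟨h1, h2, h3, h4⟩ i j => ?_⟩
  rcases units_eq_or_neg i α with rfl | rfl <;> rcases units_eq_or_neg j β with rfl | rfl <;>
    simpa only [mul_neg, neg_neg]

lemma exists_three {β : Type} {A M B : P} (h : M ≠ A ∧ B ≠ A ∧ B ≠ M) (f : P → β) (u v w : β) :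
    ∃ g : P → β, g A = u ∧ g M = v ∧ g B = w ∧ ∀ z, z ≠ A ∧ z ≠ M ∧ z ≠ B → g z = f z :=
  ⟨fun z => if z = A then u else if z = M then v else if z = B then w else f z, by grind⟩

lemma exists_signed (s : ℤˣ) (u v : ℚ) : ∃ f : ℤˣ → ℚ, f s = u ∧ f (-s) = v :=
  ⟨fun t => if t = s then u else v, by simp [(units_ne_neg s).symm]⟩

lemma triangle_signs : ∀ x y w A C E : ℤˣ, y * A = w * C → x * C = y * E → A * x = E * w := by
  decide

namespace Triangle

variable {a a' c c' e e' : P} {x y w : ℤˣ}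

/-- The sign relations express that the three sides border a common face: it lies on the side `s` of
the first strand, `-r` of the second and `q` of the third. -/
lemma signs (T : Triangle σ X a a' c c' e e' x y w) : ∃ s q r, s = X.ε a * y ∧ s = X.ε c * w ∧
    q = X.ε c * x ∧ q = X.ε e * y ∧ r = X.ε a * x ∧ r = X.ε e * w :=
  ⟨_, _, _, rfl, by rw [mul_comm, T.h₁, mul_comm], rfl, by rw [mul_comm, T.h₂, mul_comm], rfl,
    triangle_signs _ _ _ _ _ _ T.h₁ T.h₂⟩

/-- The third Reidemeister move preserves planarity. -/
lemma planar (T : Triangle σ X a a' c c' e e' x y w) (h : Planar σ X) :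
    Planar σ (X.map (triPerm a a' c c' e e')) := by
  intro ξ hξ
  have hn := T.ne
  have hm := T.mate_facts
  have hπ := T.perm_values
  have hπn := fun z => T.perm_of_notMem (z := z)
  have hYm := T.map_mate
  have hYε : ∀ z, (X.map (triPerm a a' c c' e e')).ε z = X.ε (triPerm a a' c c' e e' z) :=
    fun z => by conv_rhs => rw [← T.perm_symm]
                rfl
  obtain ⟨s, q, r, hs1, hs2, hq1, hq2, hr1, hr2⟩ := T.signs
  generalize X.map (triPerm a a' c c' e e') = Y at *
  generalize triPerm a a' c c' e e' = π at *
  have Yn : ∀ z, (z ≠ a ∧ z ≠ a' ∧ z ≠ c ∧ z ≠ c' ∧ z ≠ e ∧ z ≠ e') →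
      Y.mate z = X.mate z ∧ Y.ε z = X.ε z := by
    intro z hz
    rw [hYm, hYε, hπn z hz, hπn _ (T.mate_notMem hz)]; simp
  have E₁ := fun z d => T.hx.edge_iff (z := z) (d := d)
  have E₂ := fun z d => T.hy.edge_iff (z := z) (d := d)
  have E₃ := fun z d => T.hw.edge_iff (z := z) (d := d)
  have ec := T.hx.edge_eq
  have ee := T.hy.edge_eq
  have ee' := T.hw.edge_eq
  -- `A`, `M`, `B` are the sides of the triangle on the first, second and third strand. Flow and
  -- heights are changed only there; `out` shows that no other half-edge belongs to one of them.
  obtain ⟨A, hA⟩ : ∃ A, A = edge σ a x := ⟨_, rfl⟩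
  obtain ⟨M, hM⟩ : ∃ M, M = edge σ a' y := ⟨_, rfl⟩
  obtain ⟨B, hB⟩ : ∃ B, B = edge σ c' w := ⟨_, rfl⟩
  have out : ∀ z d, ¬ ((z = a ∧ d = x) ∨ (z = c ∧ d = -x) ∨ (z = a' ∧ d = y) ∨ (z = e ∧ d = -y) ∨
      (z = c' ∧ d = w) ∨ (z = e' ∧ d = -w)) → edge σ z d ≠ A ∧ edge σ z d ≠ M ∧ edge σ z d ≠ B := by
    intro z d hz
    simp only [ne_eq, E₁, E₂, E₃, hA, hM, hB]
    grind
  have i1 : M ≠ A ∧ B ≠ A ∧ B ≠ M := by simp only [ne_eq, E₁, E₂, hA, hM, hB]; grind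
  have uy := units_ne_neg y
  have ux := units_ne_neg x
  have uw := units_ne_neg w
  have o1 := out a (-x) (by grind)
  have o2 := out c x (by grind)
  have o3 := out a' (-y) (by grind)
  have o4 := out e y (by grind)
  have o5 := out c' (-w) (by grind)
  have o6 := out e' w (by grind)
  have far : ∀ z, (z ≠ a ∧ z ≠ a' ∧ z ≠ c ∧ z ≠ c' ∧ z ≠ e ∧ z ≠ e') → ∀ d, _ :=
    fun z hz d => out z d (by grind)
  rw [← hA] at ec
  rw [← hM] at ee
  rw [← hB] at ee'
  -- the flow before the move
  obtain ⟨ζ, ζ1, ζ2, ζ3, ζo⟩ := exists_three i1 ξ (ξ (edge σ a (-x)) + ξ (edge σ c x) - ξ A)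
    (ξ (edge σ a' (-y)) + ξ (edge σ e y) - ξ M) (ξ (edge σ c' (-w)) + ξ (edge σ e' w) - ξ B)
  have f1 := hξ.edge c x y
  have f2 := hξ.edge a x w
  have f3 := hξ.edge a' y w
  have Ya : Y.mate a = e' ∧ Y.ε a = X.ε c := by grind
  have Yc : Y.mate c = e ∧ Y.ε c = X.ε a := by grind
  have Ya' : Y.mate a' = c' ∧ Y.ε a' = X.ε e := by grind
  rw [Yc.1, Yc.2, ← hs1, ← hr1, ← ec, ← ee] at f1
  rw [Ya.1, Ya.2, ← hs2, ← hq1, ← ee', ← hA] at f2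
  rw [Ya'.1, Ya'.2, ← hr2, ← hq2, ← hM, ← hB] at f3
  have hflow : Flow σ X ζ := by
    have ga : ζ a + ζ (X.mate a) = ζ (σ a) + ζ (σ (X.mate a)) := by
      apply Flow.of_edge x y
      rw [hm.1, ← hs1, ← hr1, ← hA, ← hM, ζ1, ζ2, ζo _ o1, ζo _ o3]
      linarith
    have gc : ζ c + ζ (X.mate c) = ζ (σ c) + ζ (σ (X.mate c)) := by
      apply Flow.of_edge x w
      rw [hm.2.2.1, ← hs2, ← hq1, ← hB, ζ3, ← ec, ζ1, ζo _ o2, ζo _ o5]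
      linarith
    have ge : ζ e + ζ (X.mate e) = ζ (σ e) + ζ (σ (X.mate e)) := by
      apply Flow.of_edge y w
      rw [hm.2.2.2.2.1, ← hr2, ← hq2, ← ee', ζ3, ← ee, ζ2, ζo _ o4, ζo _ o6]
      linarith
    intro z
    by_cases hz : z ≠ a ∧ z ≠ a' ∧ z ≠ c ∧ z ≠ c' ∧ z ≠ e ∧ z ≠ e'
    · have := hξ z
      have hz' := T.mate_notMem hz
      have e1 := far z hz 1
      have e2 := far z hz (-1)
      have e3 := far _ hz' 1
      have e4 := far _ hz' (-1)
      simp only [edge_one, edge_neg_one] at e1 e2 e3 e4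
      rw [ζo _ e1, ζo _ e2, ζo _ e3, ζo _ e4]
      grind
    · rcases eq_or_of_not_ne hz with rfl | rfl | rfl | rfl | rfl | rfl <;> grind
  obtain ⟨H, hH⟩ := h ζ hflow
  have ha := (corner_iff hm.1 hs1 hr1).1 (hH.corner a (by grind))
  have hc := (corner_iff hm.2.2.1 hs2 hq1).1 (hH.corner c (by grind))
  have he := (corner_iff hm.2.2.2.2.1 hr2 hq2).1 (hH.corner e (by grind))
  have j1 := ζo _ o1 ▸ hH.jump' (edge σ a (-x)) s
  have j2 := ζo _ o2 ▸ hH.jump' (edge σ c x) s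
  have j3 := ζo _ o3 ▸ hH.jump' (edge σ a' (-y)) r
  have j4 := ζo _ o4 ▸ hH.jump' (edge σ e y) r
  have j5 := ζo _ o5 ▸ hH.jump' (edge σ c' (-w)) q
  have j6 := ζo _ o6 ▸ hH.jump' (edge σ e' w) q
  -- the heights after the move
  obtain ⟨k₁, _, _⟩ := exists_signed s (H (edge σ e y) r) (H (edge σ e y) r - ((s : ℤ) : ℚ) * ξ A)
  obtain ⟨k₂, _, _⟩ :=
    exists_signed r (H (edge σ c x) (-s) + ((r : ℤ) : ℚ) * ξ M) (H (edge σ c x) (-s))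
  obtain ⟨k₃, _, _⟩ :=
    exists_signed q (H (edge σ a (-x)) (-s)) (H (edge σ a (-x)) (-s) - ((q : ℤ) : ℚ) * ξ B)
  obtain ⟨K, K1, K2, K3, Ko⟩ := exists_three i1 H k₁ k₂ k₃
  have Ko' := fun z h u => congrFun (Ko z h) u
  have Ca := (corner_iff (σ := σ) (K := K) (α := x) (β := w) (S := s) (R := q) Ya.1 (by grind)
    (by grind)).2 (by grind)
  have Cc := (corner_iff (σ := σ) (K := K) (α := x) (β := y) (S := s) (R := r) Yc.1 (by grind)
    (by grind)).2 (by grind)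
  have Ca' := (corner_iff (σ := σ) (K := K) (α := y) (β := w) (S := r) (R := q) Ya'.1 (by grind)
    (by grind)).2 (by grind)
  refine ⟨K, fun z => ?_, fun z hz => ?_, fun z hz => ?_⟩
  · by_cases z1 : z = A
    · subst z1; exact jump_of s (by grind)
    by_cases z2 : z = M
    · subst z2; exact jump_of r (by grind)
    by_cases z3 : z = B
    · subst z3; exact jump_of q (by grind)
    · rw [Ko z ⟨z1, z2, z3⟩, ← ζo z ⟨z1, z2, z3⟩]; exact hH.jump z
  · have hz' : z ≠ a ∧ z ≠ a' ∧ z ≠ c ∧ z ≠ c' ∧ z ≠ e ∧ z ≠ e' := by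
      by_contra hcon
      rcases eq_or_of_not_ne hcon with rfl | rfl | rfl | rfl | rfl | rfl <;> grind
    have k1 := Ko _ (far z hz' 1)
    have k2 := Ko _ (far z hz' (-1))
    rw [edge_one] at k1
    rw [edge_neg_one] at k2
    rw [k1, k2]
    exact hH.dummy z (by grind)
  · by_cases hz' : z ≠ a ∧ z ≠ a' ∧ z ≠ c ∧ z ≠ c' ∧ z ≠ e ∧ z ≠ e'
    · rw [(Yn z hz').1] at hz
      rw [(Yn z hz').1, (Yn z hz').2]
      intro i j
      rw [Ko _ (far z hz' i), Ko _ (far _ (T.mate_notMem hz') j)]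
      exact hH.corner z hz i j
    · rcases eq_or_of_not_ne hz' with rfl | rfl | rfl | rfl | rfl | rfl
      · exact Ca
      · exact Ca'
      · exact Cc
      · have := corner_symm (by grind) Ca'
        rwa [Ya'.1] at this
      · have := corner_symm (by grind) Cc
        rwa [Yc.1] at this
      · have := corner_symm (by grind) Ca
        rwa [Ya.1] at this

end Triangle

end Crossings

/-! ### Planarity when a bigon is created next to a triangle -/

namespace Crossings

open Classical

variable {P : Type} {σ : Perm P} {X : Crossings P}

lemma edge_neg_of_dummy {α : Type} {f : P → α} {p : P} (h : f (σ p) = f p) (d : ℤˣ) :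
    f (edge σ p (-d)) = f (edge σ p d) := by
  rcases units_eq d with rfl | rfl <;> simp [h]

lemma dummy_of_edge {α : Type} {f : P → α} {p : P} (d : ℤˣ)
    (h : f (edge σ p (-d)) = f (edge σ p d)) : f (σ p) = f p := by
  rcases units_eq d with rfl | rfl <;> simpa [eq_comm] using h

lemma units_sq_cast (u : ℤˣ) : ((u : ℤ) : ℚ) * ((u : ℤ) : ℚ) = 1 := by
  rcases units_eq u with rfl | rfl <;> simp

lemma exists_five {β : Type} {t1 t2 b1 b2 m1 : P} (h : [t1, t2, b1, b2, m1].Nodup) (f : P → β)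
    (u v w x y : β) : ∃ g : P → β, g t1 = u ∧ g t2 = v ∧ g b1 = w ∧ g b2 = x ∧ g m1 = y ∧
      ∀ z, z ≠ t1 ∧ z ≠ t2 ∧ z ≠ b1 ∧ z ≠ b2 ∧ z ≠ m1 → g z = f z :=
  ⟨fun z => if z = t1 then u else if z = t2 then v else if z = b1 then w else if z = b2 then x else
    if z = m1 then y else f z, by simp at h; grind⟩

namespace Triangle

variable {a a' c c' e e' n m : P} {y w : ℤˣ}

set_option maxHeartbeats 1000000 in
/-- Planarity of a bigon next to a triangle. -/
lemma planar_of_bigon (T : Triangle σ X a a' c c' e e' 1 y w)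
    (hn : n ≠ a ∧ n ≠ a' ∧ n ≠ c ∧ n ≠ c' ∧ n ≠ e ∧ n ≠ e')
    (hm : m ≠ a ∧ m ≠ a' ∧ m ≠ c ∧ m ≠ c' ∧ m ≠ e ∧ m ≠ e') (hnm : n ≠ m)
    (hcn : σ c = n) (hcm : Nb σ c' m (-w)) (hmate : X.mate n = m) (hε : X.ε n = -X.ε c)
    (h : Planar σ ((X.del c).del n)) : Planar σ X := by
  intro ξ hξ
  have hN := T.ne
  have hM := T.mate_facts
  have hmm := X.mate_mate
  have hmate' : X.mate m = n := by rw [← hmate, X.mate_mate]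
  obtain ⟨s, q, r, hs1, hs2, hq1, hq2, hr1, hr2⟩ := T.signs
  have hs3 : -s = X.ε n * w := by rw [hε, hs2, neg_mul]
  have hq3 : -q = X.ε n * 1 := by rw [hε, hq1, neg_mul]
  have hnc : Nb σ c n 1 := Or.inl ⟨rfl, hcn⟩
  have E₁ := fun z d => T.hx.edge_iff (z := z) (d := d)
  have E₂ := fun z d => hnc.edge_iff (z := z) (d := d)
  have E₃ := fun z d => T.hw.edge_iff (z := z) (d := d)
  have E₄ := fun z d => hcm.edge_iff (z := z) (d := d)
  have E₅ := fun z d => T.hy.edge_iff (z := z) (d := d)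
  have x₁ := T.hx.edge_eq
  have x₂ := hnc.edge_eq
  have x₃ := T.hw.edge_eq
  have x₄ := hcm.edge_eq
  have x₅ := T.hy.edge_eq
  rw [neg_neg] at x₄
  have uw := units_ne_neg w
  have uy := units_ne_neg y
  have u1 := units_ne_neg 1
  -- Creating a bigon keeps a diagram planar only if its strands border a common face; the crossings
  -- `a, a'` and `e, e'`, joined by the edge `m1`, provide one. On the strand of `c`, `t1` leads
  -- from `a` to `c` and `t2` from `c` to `n`; on the strand of `c'`, `b1` joins `c'` to `e'` and
  -- `b2` joins it to `m`.
  obtain ⟨t1, ht1⟩ : ∃ t, t = edge σ a 1 := ⟨_, rfl⟩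
  obtain ⟨t2, ht2⟩ : ∃ t, t = edge σ c 1 := ⟨_, rfl⟩
  obtain ⟨b1, hb1⟩ : ∃ t, t = edge σ c' w := ⟨_, rfl⟩
  obtain ⟨b2, hb2⟩ : ∃ t, t = edge σ c' (-w) := ⟨_, rfl⟩
  obtain ⟨m1, hm1⟩ : ∃ t, t = edge σ a' y := ⟨_, rfl⟩
  simp only [← ht1, ← ht2, ← hb1, ← hb2, ← hm1] at E₁ E₂ E₃ E₄ E₅ x₁ x₂ x₃ x₄ x₅
  have hd : [t1, t2, b1, b2, m1].Nodup := by
    simp only [List.nodup_cons, List.mem_cons, List.not_mem_nil, or_false, not_or]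
    grind
  have out : ∀ z d, ¬ ((z = a ∧ d = 1) ∨ z = c ∨ (z = n ∧ d = -1) ∨ z = c' ∨ (z = e' ∧ d = -w) ∨
      (z = m ∧ d = w) ∨ (z = a' ∧ d = y) ∨ (z = e ∧ d = -y)) →
      edge σ z d ≠ t1 ∧ edge σ z d ≠ t2 ∧ edge σ z d ≠ b1 ∧ edge σ z d ≠ b2 ∧ edge σ z d ≠ m1 := by
    intro z d hz
    simp only [ne_eq, E₁, E₂, E₃, E₄, E₅, neg_neg]
    grind
  have o1 := out a (-1) (by grind)
  have o2 := out n 1 (by grind)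
  have o3 := out m (-w) (by grind)
  have o4 := out e' w (by grind)
  have o5 := out a' (-y) (by grind)
  have o6 := out e y (by grind)
  have far : ∀ z, (z ≠ a ∧ z ≠ a' ∧ z ≠ c ∧ z ≠ c' ∧ z ≠ e ∧ z ≠ e') → z ≠ n → z ≠ m → ∀ d, _ :=
    fun z h1 h2 h3 d => out z d (by grind)
  -- the flow without the bigon
  obtain ⟨t3, ht3⟩ : ∃ t, t = edge σ n 1 := ⟨_, rfl⟩
  obtain ⟨b3, hb3⟩ : ∃ t, t = edge σ m (-w) := ⟨_, rfl⟩
  rw [← ht3] at o2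
  rw [← hb3] at o3
  obtain ⟨sQ, hsQ⟩ : ∃ t : ℚ, t = ((s : ℤ) : ℚ) := ⟨_, rfl⟩
  obtain ⟨qQ, hqQ⟩ : ∃ t : ℚ, t = ((q : ℤ) : ℚ) := ⟨_, rfl⟩
  obtain ⟨rQ, hrQ⟩ : ∃ t : ℚ, t = ((r : ℤ) : ℚ) := ⟨_, rfl⟩
  have sq3 : rQ * rQ = 1 := hrQ ▸ units_sq_cast r
  have sq1 : sQ * sQ = 1 := hsQ ▸ units_sq_cast s
  -- `μ` and `ν` are signed differences of the flow along the strand of `c`. They correct the flow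
  -- on `m1` and the heights around the bigon.
  obtain ⟨μ, hμ⟩ : ∃ μ, μ = sQ * (ξ t1 - ξ t3) := ⟨_, rfl⟩
  obtain ⟨ν, hν⟩ : ∃ ν, ν = sQ * (ξ t3 - ξ t2) := ⟨_, rfl⟩
  obtain ⟨ζ, ζ1, ζ2, ζ3, ζ4, ζ5, ζo⟩ :=
    exists_five hd ξ (ξ t3) (ξ t3) (ξ b3) (ξ b3) (ξ m1 + rQ * μ)
  have f1 := hξ.edge a 1 y
  have f2 := hξ.edge c 1 w
  have f3 := hξ.edge n 1 w
  have f4 := hξ.edge e y w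
  rw [hM.1, ← hs1, ← hr1, ← ht1, ← hm1, ← hsQ, ← hrQ] at f1
  rw [hM.2.2.1, ← hs2, ← hq1, ← ht2, ← hb1, ← hb2, ← x₁, ← hsQ, ← hqQ] at f2
  rw [hmate, ← hs3, ← hq3, ← x₂, ← x₄, ← ht3, ← hb3] at f3
  rw [hM.2.2.2.2.1, ← hr2, ← hq2, ← x₃, ← x₅, ← hrQ, ← hqQ] at f4
  push_cast [Units.val_neg] at f3
  rw [← hsQ, ← hqQ] at f3
  have dm : ∀ z, ((X.del c).del n).mate z =
      if z = c ∨ z = n ∨ z = c' ∨ z = m then z else X.mate z := by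
    simp only [del_mate]
    grind
  have hflow : Flow σ ((X.del c).del n) ζ := by
    have fd : ∀ z (d : ℤˣ), ((X.del c).del n).mate z = z → ζ (edge σ z (-d)) = ζ (edge σ z d) →
        ζ z + ζ (((X.del c).del n).mate z) = ζ (σ z) + ζ (σ (((X.del c).del n).mate z)) := by
      intro z d h1 h2
      rw [h1, dummy_of_edge d h2]
    have ga : ζ a + ζ (X.mate a) = ζ (σ a) + ζ (σ (X.mate a)) := by
      apply Flow.of_edge 1 y
      rw [hM.1, ← hs1, ← hr1, ← ht1, ← hm1, ζ1, ζ5, ζo _ o1, ζo _ o5, ← hsQ, ← hrQ, hμ]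
      linear_combination f1 + sQ * (ξ t1 - ξ t3) * sq3
    have ge : ζ e + ζ (X.mate e) = ζ (σ e) + ζ (σ (X.mate e)) := by
      apply Flow.of_edge y w
      rw [hM.2.2.2.2.1, ← hr2, ← hq2, ← x₃, ← x₅, ζ3, ζ5, ζo _ o4, ζo _ o6, ← hqQ, ← hrQ, hμ]
      linear_combination f4 - sQ * (ξ t1 - ξ t3) * sq3 + f2 - f3
    intro z
    by_cases z1 : z = c
    · subst z1; exact fd z 1 (by grind) (by grind)
    by_cases z2 : z = n
    · subst z2; exact fd z 1 (by grind) (by grind)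
    by_cases z3 : z = c'
    · subst z3; exact fd z w (by grind) (by grind)
    by_cases z4 : z = m
    · subst z4; exact fd z w (by grind) (by grind)
    rw [dm, if_neg (by grind)]
    by_cases hz : z ≠ a ∧ z ≠ a' ∧ z ≠ c ∧ z ≠ c' ∧ z ≠ e ∧ z ≠ e'
    · have h1 := far z hz z2 z4
      have h2 := far _ (T.mate_notMem hz) (by grind) (by grind)
      have e1 := ζo _ (h1 1)
      have e2 := ζo _ (h1 (-1))
      have e3 := ζo _ (h2 1)
      have e4 := ζo _ (h2 (-1))
      simp only [edge_one, edge_neg_one] at e1 e2 e3 e4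
      rw [e1, e2, e3, e4]
      exact hξ z
    · rcases eq_or_of_not_ne hz with rfl | rfl | rfl | rfl | rfl | rfl <;> grind
  obtain ⟨H, hH⟩ := h ζ hflow
  have Hd : ∀ z d, ((X.del c).del n).mate z = z → H (edge σ z (-d)) = H (edge σ z d) :=
    fun z d hz => edge_neg_of_dummy (f := H) (hH.dummy z hz) d
  have H1 := Hd c 1 (by grind)
  have H2 := Hd n 1 (by grind)
  have H3 := Hd c' w (by grind)
  have H4 := Hd m w (by grind)
  have ma : ((X.del c).del n).mate a = a' := by grind
  have me : ((X.del c).del n).mate e = e' := by grind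
  have ha := (corner_iff ma hs1 hr1).1 (hH.corner a (by grind))
  have he := (corner_iff me hr2 hq2).1 (hH.corner e (by grind))
  -- the heights with the bigon
  obtain ⟨k₁, _, _⟩ := exists_signed s (H t3 s + μ) (H t3 (-s))
  obtain ⟨k₂, _, _⟩ := exists_signed s (H t3 s - qQ * ξ b3) (H t3 (-s) - qQ * ξ b3 + ν)
  obtain ⟨k₃, _, _⟩ := exists_signed q (H b3 q + μ) (H b3 (-q))
  obtain ⟨k₄, _, _⟩ := exists_signed q (H b3 q - sQ * ξ t3) (H b3 (-q) - sQ * ξ t3 + ν)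
  obtain ⟨k₅, _, _⟩ := exists_signed r (H m1 r) (H m1 (-r) + μ)
  obtain ⟨K, K1, K2, K3, K4, K5, Ko⟩ := exists_five hd H k₁ k₂ k₃ k₄ k₅
  have j1 : H t3 s - H t3 (-s) = sQ * ξ t3 := by rw [hH.jump', ζo _ o2, hsQ]
  have j2 : H b3 q - H b3 (-q) = qQ * ξ b3 := by rw [hH.jump', ζo _ o3, hqQ]
  have j3 : H m1 r - H m1 (-r) = rQ * (ξ m1 + rQ * μ) := by rw [hH.jump', ζ5, hrQ]
  have tb : H t3 s = H b3 q := by grind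
  have Ht1 : H t1 = H t3 := by grind
  have Hb1 : H b1 = H b3 := by grind
  have Ca := (corner_iff (σ := σ) (K := K) hM.1 hs1 hr1).2 (by grind)
  have Ce := (corner_iff (σ := σ) (K := K) hM.2.2.2.2.1 hr2 hq2).2 (by grind)
  have Cc := (corner_iff (σ := σ) (K := K) hM.2.2.1 hs2 hq1).2 (by grind)
  have Cn := (corner_iff (σ := σ) (K := K) hmate hs3 hq3).2 (by
    simp only [neg_neg, ← ht3, ← hb3, ← x₂, ← x₄, Ko _ o2, Ko _ o3, K2, K4]; grind)
  refine ⟨K, fun z => ?_, fun z hz => ?_, fun z hz => ?_⟩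
  · by_cases z1 : z = t1
    · subst z1; exact jump_of s (by grind)
    by_cases z2 : z = t2
    · subst z2; exact jump_of s (by grind)
    by_cases z3 : z = b1
    · subst z3; exact jump_of q (by grind)
    by_cases z4 : z = b2
    · subst z4; exact jump_of q (by grind)
    by_cases z5 : z = m1
    · subst z5; exact jump_of r (by grind)
    · rw [Ko z ⟨z1, z2, z3, z4, z5⟩, ← ζo z ⟨z1, z2, z3, z4, z5⟩]; exact hH.jump z
  · have hz' : z ≠ a ∧ z ≠ a' ∧ z ≠ c ∧ z ≠ c' ∧ z ≠ e ∧ z ≠ e' := by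
      by_contra hcon
      rcases eq_or_of_not_ne hcon with rfl | rfl | rfl | rfl | rfl | rfl <;> grind
    have k1 := Ko _ (far z hz' (by grind) (by grind) 1)
    have k2 := Ko _ (far z hz' (by grind) (by grind) (-1))
    rw [edge_one] at k1
    rw [edge_neg_one] at k2
    rw [k1, k2]
    exact hH.dummy z (by grind)
  · by_cases z2 : z = n
    · subst z2; exact Cn
    by_cases z4 : z = m
    · subst z4
      have := corner_symm (by grind) Cn
      rwa [hmate] at this
    by_cases hz' : z ≠ a ∧ z ≠ a' ∧ z ≠ c ∧ z ≠ c' ∧ z ≠ e ∧ z ≠ e'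
    · intro i j
      rw [Ko _ (far z hz' z2 z4 i), Ko _ (far _ (T.mate_notMem hz') (by grind) (by grind) j)]
      have hd : ((X.del c).del n).mate z = X.mate z := by grind
      have := hH.corner z (by grind) i j
      rwa [hd] at this
    · rcases eq_or_of_not_ne hz' with rfl | rfl | rfl | rfl | rfl | rfl
      · exact Ca
      · have := corner_symm (by grind) Ca
        rwa [hM.1] at this
      · exact Cc
      · have := corner_symm (by grind) Cc
        rwa [hM.2.2.1] at this
      · exact Ce
      · have := corner_symm (by grind) Ce
        rwa [hM.2.2.2.2.1] at this

end Triangle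

end Crossings

/-! ### Inserting and deleting points, adding crossings -/

namespace Crossings

open Classical

variable {P : Type} {σ : Perm P} {X : Crossings P}

/-- Insert a point after `z`. -/
noncomputable def insertAfter (σ : Perm P) (z : P) : Perm (Option P) :=
  Equiv.optionCongr σ * swap none (some z)

lemma insertAfter_self (σ : Perm P) (z : P) : insertAfter σ z (some z) = none := by
  simp [insertAfter]

lemma insertAfter_none (σ : Perm P) (z : P) : insertAfter σ z none = some (σ z) := by
  simp [insertAfter]

lemma insertAfter_of_ne (σ : Perm P) {z w : P} (h : w ≠ z) :
    insertAfter σ z (some w) = some (σ w) := by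
  rw [insertAfter, Perm.mul_apply, swap_apply_of_ne_of_ne (by simp) (by simpa using h)]
  simp

/-- The crossings after a point has been added. -/
def addPoint (X : Crossings P) : Crossings (Option P) where
  mate := Option.map X.mate
  ε z := z.elim 1 X.ε
  up z := z.elim true X.up
  mate_mate z := by cases z <;> simp [X.mate_mate]
  ε_mate z h := by
    cases z
    exacts [(h rfl).elim, X.ε_mate _ fun h' => h (congrArg some h')]
  up_mate z h := by
    cases z
    exacts [(h rfl).elim, X.up_mate _ fun h' => h (congrArg some h')]

lemma emb_insertAfter (σ : Perm P) (X : Crossings P) (z : P) :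
    Emb some σ X (insertAfter σ z) X.addPoint where
  inj := Option.some_injective P
  ret q := by
    by_cases h : q = z
    · subst h
      rw [insertAfter_self]
      exact Walk.head (by simp) (by rw [insertAfter_none]; exact .refl _)
    · rw [insertAfter_of_ne σ h]; exact .refl _
  reach w := by
    cases w with
    | none => exact ⟨z, Walk.head trivial (by rw [insertAfter_self]; exact .refl _)⟩
    | some w => exact ⟨w, .refl _⟩
  mate q := rfl
  dummy w hw := by
    cases w
    exacts [rfl, (hw ⟨_, rfl⟩).elim]
  ε q _ := rfl
  up q _ := rfl

lemma skip_apply_self (σ : Perm P) (z : P) : (swap z (σ z) * σ) z = z := by simp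

/-- The permutation of the points other than `z`. -/
noncomputable def skip (σ : Perm P) (z : P) : Perm {w // w ≠ z} :=
  (swap z (σ z) * σ).subtypePerm fun w => by
    have h := skip_apply_self σ z
    rw [ne_eq, ne_eq, not_iff_not]
    constructor
    · intro h'; exact (swap z (σ z) * σ).injective (h'.trans h.symm)
    · rintro rfl; exact h

lemma skip_apply (σ : Perm P) (z : P) (w : {w // w ≠ z}) :
    (skip σ z w : P) = if σ w = z then σ z else σ w := by
  show (swap z (σ z) * σ) w = _
  have := w.2
  grind [Perm.mul_apply, σ.injective.eq_iff]

/-- The crossings without a dummy. -/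
def deletePoint (X : Crossings P) {z : P} (hz : X.mate z = z) : Crossings {w // w ≠ z} where
  mate w := ⟨X.mate w, fun h => w.2 (by rw [X.mate_eq_iff.1 h, hz])⟩
  ε w := X.ε w
  up w := X.up w
  mate_mate w := Subtype.ext (X.mate_mate w)
  ε_mate w h := X.ε_mate w fun h' => h (Subtype.ext h')
  up_mate w h := X.up_mate w fun h' => h (Subtype.ext h')

lemma emb_deletePoint {z : P} (hz : X.mate z = z) (hσ : σ z ≠ z) :
    Emb Subtype.val (skip σ z) (X.deletePoint hz) σ X where
  inj := Subtype.val_injective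
  ret q := by
    rw [skip_apply]
    split_ifs with h
    · rw [h]
      exact Walk.head (by simp) (.refl _)
    · exact .refl _
  reach w := by
    by_cases h : w = z
    · subst h
      refine ⟨⟨σ.symm w, fun h => hσ ?_⟩, Walk.head trivial (by simp; exact .refl _)⟩
      nth_rw 1 [← h]; simp
    · exact ⟨⟨w, h⟩, .refl _⟩
  mate q := rfl
  dummy w hw := by
    have : w = z := by_contra fun h => hw ⟨⟨w, h⟩, rfl⟩
    rw [this, hz]
  ε q _ := rfl
  up q _ := rfl

/-- Add a crossing at the dummies `p` and `q`. -/
noncomputable def addCrossing (X : Crossings P) (p q : P) (hpq : p ≠ q) (hp : X.mate p = p)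
    (hq : X.mate q = q) (s : ℤˣ) (t : Bool) : Crossings P where
  mate z := if z = p then q else if z = q then p else X.mate z
  ε z := if z = p then s else if z = q then -s else X.ε z
  up z := if z = p then t else if z = q then !t else X.up z
  mate_mate z := by
    have := X.mate_mate
    grind
  ε_mate z := by
    have := X.mate_mate
    have := X.ε_mate z
    have := neg_neg s
    grind
  up_mate z := by
    have := X.mate_mate
    have := X.up_mate z
    grind

end Crossings

/-! ### Planar curves up to Reidemeister moves and crossing changes -/

/-- A link diagram on the sphere. -/
structure PlanarCurve where
  P : Type
  finite : Finite P
  σ : Perm P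
  X : Crossings P
  planar : X.Planar σ

namespace PlanarCurve

open Crossings

/-- Deletion of dummies, Reidemeister moves and crossing changes. -/
inductive Move : PlanarCurve → PlanarCurve → Prop
  | emb {D D' : PlanarCurve} (ι : D.P → D'.P) : Emb ι D.σ D.X D'.σ D'.X → Move D D'
  | kink {P : Type} (hf : Finite P) {σ : Perm P} {X : Crossings P} {p : P}
      (hp : X.mate p ≠ p) (hσ : σ p = X.mate p) (h : X.Planar σ) (h' : (X.del p).Planar σ) :
      Move ⟨P, hf, σ, X, h⟩ ⟨P, hf, σ, X.del p, h'⟩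
  | bigon {P : Type} (hf : Finite P) {σ : Perm P} {X : Crossings P} {p₁ p₂ q₁ q₂ : P}
      (hB : Bigon σ X p₁ p₂ q₁ q₂) (h : X.Planar σ) (h' : ((X.del p₁).del p₂).Planar σ) :
      Move ⟨P, hf, σ, X, h⟩ ⟨P, hf, σ, (X.del p₁).del p₂, h'⟩
  | triangle {P : Type} (hf : Finite P) {σ : Perm P} {X : Crossings P} {a a' c c' e e' : P}
      {x y w : ℤˣ} (T : Triangle σ X a a' c c' e e' x y w)
      (hl : Triangle.Layered (X.up a) (X.up c) (X.up e)) (h : X.Planar σ)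
      (h' : (X.map (triPerm a a' c c' e e')).Planar σ) :
      Move ⟨P, hf, σ, X, h⟩ ⟨P, hf, σ, X.map (triPerm a a' c c' e e'), h'⟩
  | cc {P : Type} (hf : Finite P) {σ : Perm P} {X : Crossings P} {p : P}
      (hp : X.mate p ≠ p) (h : X.Planar σ) (h' : (X.cc p).Planar σ) :
      Move ⟨P, hf, σ, X, h⟩ ⟨P, hf, σ, X.cc p, h'⟩

/-- Equivalence up to homotopy of the components. -/
def Equiv : PlanarCurve → PlanarCurve → Prop := Relation.EqvGen Move

lemma Equiv.refl (D : PlanarCurve) : Equiv D D := Relation.EqvGen.refl D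

lemma Equiv.symm {D D' : PlanarCurve} (h : Equiv D D') : Equiv D' D := Relation.EqvGen.symm _ _ h

lemma Equiv.trans {D D' D'' : PlanarCurve} (h : Equiv D D') (h' : Equiv D' D'') : Equiv D D'' :=
  Relation.EqvGen.trans _ _ _ h h'

lemma Move.equiv {D D' : PlanarCurve} (h : Move D D') : Equiv D D' := Relation.EqvGen.rel _ _ h

end PlanarCurve

/-! ### Loops and their insides -/

namespace Crossings

open Classical

variable {P Q : Type} {σ : Perm P} {X : Crossings P}

lemma Nb.insertAfter {a c z : P} {x : ℤˣ} (h : Nb σ a c x) (hz : σ z ≠ edge σ a x) :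
    Nb (insertAfter σ z) (some a) (some c) x := by
  rcases h with ⟨rfl, h⟩ | ⟨rfl, h⟩
  · exact Or.inl ⟨rfl, by rw [insertAfter_of_ne σ (by rintro rfl; exact hz rfl), h]⟩
  · exact Or.inr ⟨rfl, by rw [insertAfter_of_ne σ (by rintro rfl; exact hz h), h]⟩

lemma edge_insertAfter {f : P → Bool} {z w : P} {d : ℤˣ} :
    (edge (insertAfter σ z) (some w) d).elim (f (σ z)) f = f (edge σ w d) := by
  rcases units_eq d with rfl | rfl <;> by_cases h : w = z <;>
    simp_all [insertAfter_self, insertAfter_of_ne]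

lemma edge_insertAfter_none {f : P → Bool} {z : P} {d : ℤˣ} :
    (edge (insertAfter σ z) none d).elim (f (σ z)) f = f (σ z) := by
  rcases units_eq d with rfl | rfl <;> simp [insertAfter_none]

lemma mem_next {u : List P} {p q z : P} (h : (p :: u).map σ = u ++ [q]) :
    σ z ∈ u ++ [q] ↔ z ∈ p :: u := by
  rw [← h, List.mem_map_of_injective σ.injective]

/-- The indicator of the path from `p` to `q` is conserved along `σ` except at the two ends, where
the path joins other edges. -/
lemma indicator_next {u : List P} {p q : P} (h : (p :: u).map σ = u ++ [q]) (hp : p ∉ u)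
    (hq : q ∉ u) (z : P) : ((if σ z ∈ u ++ [q] then 1 else 0 : ℚ)) - (if z ∈ u ++ [q] then 1 else 0) =
      (if z = p then 1 else 0) - (if z = q then 1 else 0) := by
  have := mem_next (z := z) h
  grind

lemma map_next_middle {A B C : List P} {p q k k' : P}
    (h : (p :: (A ++ k :: (B ++ k' :: C))).map σ = A ++ k :: (B ++ k' :: C) ++ [q]) :
    (k :: B).map σ = B ++ [k'] := by
  have h : (p :: A).map σ ++ ((k :: B).map σ ++ (k' :: C).map σ) =
      (A ++ [k]) ++ ((B ++ [k']) ++ (C ++ [q])) := by simpa using h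
  exact (List.append_inj (List.append_inj h (by simp)).2 (by simp)).1

/-- A loop `p, u, q` of the curve without self-crossings; `h` marks the edges inside, which are to
the left of the loop if `δ = 1` and to the right if `δ = -1`. -/
structure Loop (σ : Perm P) (X : Crossings P) (p q : P) (u : List P) (δ : ℤˣ)
    (h : P → Bool) : Prop where
  next : (p :: u).map σ = u ++ [q]
  nodup : (p :: u).Nodup
  notMem : q ∉ u
  mate : X.mate p = q
  free : ∀ k ∈ u, X.mate k ∈ u → X.mate k = k
  cross : ∀ k ∈ u, X.mate k ≠ k → ∀ b, h (edge σ (X.mate k) b) = decide (b = X.ε k * δ)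
  off : ∀ z, z ∉ p :: u → X.mate z ∉ p :: u → ∀ a b, h (edge σ z a) = h (edge σ (X.mate z) b)
  outside : ∀ z ∈ p :: u ++ [q], h z = false
  outside_next : p ≠ q → h (σ q) = false

/-- The crossings off the loop. -/
def offLoop (X : Crossings P) (L : List P) : Set P :=
  {z | X.mate z ≠ z ∧ z ∉ L ∧ X.mate z ∉ L}

namespace Loop

variable {p q : P} {u : List P} {δ : ℤˣ} {h : P → Bool}

lemma next_mem (L : Loop σ X p q u δ h) {z : P} (hz : z ∈ p :: u) : σ z ∈ u ++ [q] :=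
  (Crossings.mem_next L.next).2 hz

lemma mem_of_next (L : Loop σ X p q u δ h) {z : P} (hz : σ z ∈ u ++ [q]) : z ∈ p :: u :=
  (Crossings.mem_next L.next).1 hz

lemma outside_of_mem (L : Loop σ X p q u δ h) {z : P} (hz : z ∈ p :: u) : h (σ z) = false :=
  L.outside _ (List.mem_cons_of_mem _ (L.next_mem hz))

/-- Inserting a dummy. -/
lemma insertAfter (L : Loop σ X p q u δ h) (z : P) :
    ∃ u', Loop (insertAfter σ z) X.addPoint (some p) (some q) u' δ (fun y => y.elim (h (σ z)) h) ∧
      (∀ w, some w ∈ u' ↔ w ∈ u) ∧ (none ∈ u' ↔ z ∈ p :: u) := by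
  obtain ⟨u', hnext, hnodup, hmem, hnone⟩ : ∃ u' : List (Option P),
      (some p :: u').map (Crossings.insertAfter σ z) = u' ++ [some q] ∧ (some p :: u').Nodup ∧
      (∀ w, some w ∈ u' ↔ w ∈ u) ∧ (none ∈ u' ↔ z ∈ p :: u) := by
    have hmap : ∀ l : List P, z ∉ l → (l.map some).map (Crossings.insertAfter σ z) =
        (l.map σ).map some := by
      intro l hl
      rw [List.map_map, List.map_map]
      refine List.map_congr_left fun w hw => ?_
      exact insertAfter_of_ne σ fun h => hl (h ▸ hw)
    have hn := L.nodup
    have hx := L.next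
    have hsn : ∀ l : List P, (l.map some).Nodup ↔ l.Nodup := fun l =>
      List.nodup_map_iff (Option.some_injective P)
    by_cases hz : z ∈ p :: u
    · rcases List.mem_cons.1 hz with rfl | hzu
      · refine ⟨none :: u.map some, ?_, ?_, ?_, ?_⟩
        · rw [List.map_cons, List.map_cons, insertAfter_self, insertAfter_none,
            hmap u (List.nodup_cons.1 hn).1]
          have : σ z :: u.map σ = u ++ [q] := hx
          rw [← List.map_cons, this]; simp
        · have : (some z :: u.map some).Nodup := (hsn (z :: u)).2 hn
          simp only [List.nodup_cons] at this ⊢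
          simp [this]
        · simp
        · simp
      · obtain ⟨A, B, rfl⟩ := List.append_of_mem hzu
        have hn' : z ∉ p :: A ∧ z ∉ B := by grind
        have hx1 : (p :: A).map σ ++ (σ z :: B.map σ) = (A ++ [z]) ++ (B ++ [q]) := by
          simpa using hx
        obtain ⟨x1, x2⟩ := List.append_inj hx1 (by simp)
        refine ⟨A.map some ++ some z :: none :: B.map some, ?_, ?_, ?_, ?_⟩
        · have : (some p :: (A.map some ++ some z :: none :: B.map some)) =
              (p :: A).map some ++ some z :: none :: B.map some := rfl
          rw [this, List.map_append, hmap _ hn'.1, x1, List.map_cons, List.map_cons,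
            insertAfter_self, insertAfter_none, hmap _ hn'.2]
          rw [← List.map_cons, x2]; simp
        · simp [List.nodup_append] at hn ⊢
          grind
        · simp
        · simp
    · refine ⟨u.map some, ?_, ?_, by simp, by simpa using hz⟩
      · rw [← List.map_cons, hmap _ hz, hx]; simp
      · exact (hsn (p :: u)).2 hn
  refine ⟨u', ⟨hnext, hnodup, ?_, congrArg some L.mate, ?_, ?_, ?_, ?_, ?_⟩, hmem, hnone⟩
  · rw [hmem]; exact L.notMem
  · intro k hk hk'
    cases k with
    | none => rfl
    | some k => exact congrArg some (L.free k ((hmem k).1 hk) ((hmem _).1 hk'))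
  · intro k hk hk' b
    cases k with
    | none => exact (hk' rfl).elim
    | some k =>
      have := L.cross k ((hmem k).1 hk) (fun h => hk' (congrArg some h)) b
      exact edge_insertAfter.trans this
  · intro y hy hy' a b
    cases y with
    | none => exact edge_insertAfter_none.trans edge_insertAfter_none.symm
    | some y =>
      have h1 : ∀ w, some w ∈ some p :: u' ↔ w ∈ p :: u := by simp [hmem]
      have := L.off y (fun h => hy ((h1 y).2 h)) (fun h => hy' ((h1 _).2 h)) a b
      exact edge_insertAfter.trans (this.trans edge_insertAfter.symm)
  · intro y hy
    cases y with
    | none =>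
      have : z ∈ p :: u := hnone.1 (by simpa using hy)
      exact L.outside_of_mem this
    | some y => exact L.outside y (by simpa [hmem] using hy)
  · intro hpq
    have := L.outside_next fun h => hpq (congrArg some h)
    exact (edge_insertAfter (d := 1)).trans this

/-- Deleting a dummy. -/
lemma deletePoint (L : Loop σ X p q u δ h) {z : P} (hz : X.mate z = z) (hp : p ≠ z)
    (hq : q ≠ z) : ∃ u', Loop (skip σ z) (X.deletePoint hz) ⟨p, hp⟩ ⟨q, hq⟩ u' δ (fun w => h w) ∧
      ∀ w : {w // w ≠ z}, w ∈ u' ↔ (w : P) ∈ u := by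
  obtain ⟨u', hu'⟩ := exists_map_eq (ι := (Subtype.val : {w // w ≠ z} → P)) (u.filter (· ≠ z))
    fun w hw => ⟨⟨w, by simpa using (List.mem_filter.1 hw).2⟩, rfl⟩
  have hmem : ∀ w : {w // w ≠ z}, w ∈ u' ↔ (w : P) ∈ u := by
    intro w
    have : (w : P) ∈ u'.map Subtype.val ↔ (w : P) ∈ u := by
      rw [hu', List.mem_filter]; simp [w.2]
    rw [← this, List.mem_map]
    grind
  have hmem' : ∀ w : {w // w ≠ z}, w ∈ (⟨p, hp⟩ :: u' : List {w // w ≠ z}) ↔ (w : P) ∈ p :: u := by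
    intro w
    simp only [List.mem_cons, hmem, Subtype.ext_iff]
  have hn := L.nodup
  have hx := L.next
  have hhz : ∀ w, w ≠ z → h (if σ w = z then σ z else σ w) = h (σ w) := by
    intro w hw
    split_ifs with h'
    · by_cases hzu : z ∈ u
      · rw [L.outside_of_mem (by simp [hzu]), L.outside_of_mem]
        exact L.mem_of_next (by simp [h', hzu])
      · have h1 : z ∉ p :: u := by simp [hzu, hp.symm]
        have := L.off z h1 (by rwa [hz]) 1 (-1)
        rw [hz] at this
        rw [h']; exact this
    · rfl
  have hedge : ∀ (w : {w // w ≠ z}) d, h (edge (skip σ z) w d : {w // w ≠ z}) = h (edge σ w d) := by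
    intro w d
    rcases units_eq d with rfl | rfl
    · simp only [edge_one, skip_apply]
      exact hhz w w.2
    · rfl
  have hmapv : ((⟨p, hp⟩ :: u' : List {w // w ≠ z}).map Subtype.val) = (p :: u).filter (· ≠ z) := by
    rw [List.map_cons, hu', List.filter_cons_of_pos (by simpa using hp)]
  refine ⟨u', ⟨?_, ?_, ?_, Subtype.ext L.mate, ?_, ?_, ?_, ?_, ?_⟩, hmem⟩
  · apply List.map_injective_iff.2 Subtype.val_injective
    rw [List.map_map]
    have h1 : Subtype.val ∘ skip σ z = (fun w => if σ w = z then σ z else σ w) ∘ Subtype.val := by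
      funext w; exact skip_apply σ z w
    rw [h1, ← List.map_map, hmapv, List.map_append, hu']
    change _ = _ ++ [q]
    by_cases hzu : z ∈ u
    · obtain ⟨A, B, rfl⟩ := List.append_of_mem hzu
      have hn' : z ∉ p :: A ∧ z ∉ B := by grind
      have hx1 : (p :: A).map σ ++ (σ z :: B.map σ) = (A ++ [z]) ++ (B ++ [q]) := by
        simpa using hx
      obtain ⟨x1, x2⟩ := List.append_inj hx1 (by simp)
      have f1 : ∀ l : List P, z ∉ l → l.filter (· ≠ z) = l := fun l hl =>
        List.filter_eq_self.2 fun w hw => by simpa using fun h : w = z => hl (h ▸ hw)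
      have g1 : (p :: A).map (fun w => if σ w = z then σ z else σ w) = A ++ [σ z] := by
        have : (fun w => if σ w = z then σ z else σ w) = (fun y => if y = z then σ z else y) ∘ σ :=
          rfl
        rw [this, ← List.map_map, x1, List.map_append]
        simp only [List.map_cons, if_true, List.map_nil]
        congr 1
        conv_rhs => rw [← List.map_id A]
        refine List.map_congr_left fun w hw => ?_
        grind
      have g2 : σ z :: B.map (fun w => if σ w = z then σ z else σ w) = B ++ [q] := by
        rw [← x2]
        congr 1
        refine List.map_congr_left fun w hw => if_neg fun h' => ?_
        have : σ w ∈ B ++ [q] := by rw [← x2]; simp [List.mem_map_of_mem hw]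
        grind
      have h2 : (p :: (A ++ z :: B)).filter (· ≠ z) = (p :: A) ++ B := by
        rw [← List.cons_append, List.filter_append, f1 _ hn'.1, List.filter_cons_of_neg (by simp),
          f1 _ hn'.2]
      have h3 : (A ++ z :: B).filter (· ≠ z) = A ++ B := by
        rw [List.filter_append, f1 _ fun h => hn'.1 (List.mem_cons_of_mem _ h),
          List.filter_cons_of_neg (by simp), f1 _ hn'.2]
      rw [h2, h3, List.map_append, g1, List.append_assoc, List.append_assoc]
      simp [g2]
    · have f2 : ∀ w ∈ p :: u, w ≠ z := by grind
      rw [List.filter_eq_self.2 fun w hw => by simpa using f2 w hw,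
        List.filter_eq_self.2 fun w hw => by simpa using f2 w (List.mem_cons_of_mem _ hw), ← hx]
      refine List.map_congr_left fun w hw => if_neg fun h' => ?_
      have := L.next_mem hw
      grind
  · apply List.Nodup.of_map Subtype.val
    rw [hmapv]; exact hn.filter _
  · rw [hmem]; exact L.notMem
  · intro k hk hk'
    exact Subtype.ext (L.free k ((hmem k).1 hk) ((hmem _).1 hk'))
  · intro k hk hk' b
    exact (hedge _ b).trans (L.cross k ((hmem k).1 hk) (fun h => hk' (Subtype.ext h)) b)
  · intro w hw hw' a b
    exact (hedge _ a).trans ((L.off w (fun h => hw ((hmem' w).2 h)) (fun h => hw' ((hmem' _).2 h))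
      a b).trans (hedge ((X.deletePoint hz).mate w) b).symm)
  · intro w hw
    refine L.outside w ?_
    grind
  · intro hpq
    have := L.outside_next fun h => hpq (Subtype.ext h)
    exact (hedge ⟨q, hq⟩ 1).trans this

end Loop

lemma Emb.offLoop_eq_image {ι : Q → P} {σ' : Perm Q} {X' : Crossings Q} (E : Emb ι σ' X' σ X)
    {L : List P} {L' : List Q} (hL : ∀ w, ι w ∈ L ↔ w ∈ L') :
    offLoop X L = ι '' offLoop X' L' := by
  ext z
  constructor
  · rintro ⟨h1, h2, h3⟩
    have hz : z ∈ Set.range ι := by_contra fun h => h1 (E.dummy z h)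
    obtain ⟨w, rfl⟩ := hz
    rw [E.mate] at h1 h3
    exact ⟨w, ⟨fun h => h1 (by rw [h]), fun h => h2 ((hL w).2 h), fun h => h3 ((hL _).2 h)⟩, rfl⟩
  · rintro ⟨w, ⟨h1, h2, h3⟩, rfl⟩
    refine ⟨?_, fun h => h2 ((hL w).1 h), ?_⟩
    · rw [E.mate]; exact fun h => h1 (E.inj h)
    · rw [E.mate]; exact fun h => h3 ((hL _).1 h)

end Crossings

/-! ### Removing bigons at a loop and pushing a loop over a crossing -/

namespace Crossings

open Classical

variable {P Q : Type} {σ : Perm P} {X : Crossings P}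

/-- The inner edges that enter crossings off the loop. -/
def insideLoop (X : Crossings P) (L : List P) (h : P → Bool) : Set P :=
  {z | z ∈ offLoop X L ∧ h z = true}

namespace Loop

variable {p q : P} {u : List P} {δ : ℤˣ} {h : P → Bool}

/-- Deleting a bigon between the loop and another strand. -/
lemma bigon (L : Loop σ X p q u δ h) {k k' : P} (hk : k ∈ u) (hk' : k' ∈ u) (hkk : k ≠ k')
    (hm : X.mate k ≠ k) (hm' : X.mate k' ≠ k') (hε : X.ε k' = -X.ε k)
    (hN : Nb σ (X.mate k) (X.mate k') (X.ε k * δ)) :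
    ∃ h', Loop σ ((X.del k).del k') p q u δ h' ∧
      offLoop ((X.del k).del k') (p :: u) = offLoop X (p :: u) ∧
      insideLoop ((X.del k).del k') (p :: u) h' = insideLoop X (p :: u) h := by
  have hs : X.mate k ∉ u := fun h => hm (L.free k hk h)
  have hs' : X.mate k' ∉ u := fun h => hm' (L.free k' hk' h)
  have mm := X.mate_mate
  have hpu := (List.nodup_cons.1 L.nodup).1
  have hp := L.notMem
  have hq := L.mate
  have dm : ∀ z, ((X.del k).del k').mate z =
      if z = k ∨ z = k' ∨ z = X.mate k ∨ z = X.mate k' then z else X.mate z := by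
    simp only [del_mate]; grind
  have E := fun z d => hN.edge_iff (z := z) (d := d)
  have hc := fun b => L.cross k hk hm b
  have hc' := fun b => L.cross k' hk' hm' b
  have he : X.ε k' * δ = -(X.ε k * δ) := by rw [hε, neg_mul]
  have far : ∀ z, z ≠ X.mate k → z ≠ X.mate k' → ∀ d,
      (if edge σ z d = edge σ (X.mate k) (X.ε k * δ) then false else h (edge σ z d)) =
        h (edge σ z d) := by grind
  have hoff : offLoop ((X.del k).del k') (p :: u) = offLoop X (p :: u) := by
    ext z
    show (_ ∧ _) ↔ (_ ∧ _)
    grind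
  -- Without the bigon the other strand no longer enters the loop here, so the edge between the two
  -- crossings becomes an outer one.
  refine ⟨fun z => if z = edge σ (X.mate k) (X.ε k * δ) then false else h z,
    ⟨L.next, L.nodup, L.notMem, by grind, fun z hz => ?_, fun z hz hz' b => ?_,
      fun z hz hz' a b => ?_, fun z hz => ?_, fun hpq => ?_⟩, hoff, ?_⟩
  · have := L.free z hz
    grind
  · have e1 := L.cross z hz (by grind) b
    have e2 := far (X.mate z) (by grind) (by grind) b
    rw [show ((X.del k).del k').mate z = X.mate z by grind]
    exact e2.trans e1
  · by_cases h1 : z = X.mate k ∨ z = X.mate k'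
    · suffices H : ∀ d, (if edge σ z d = edge σ (X.mate k) (X.ε k * δ) then false
          else h (edge σ z d)) = false by grind
      rcases h1 with rfl | rfl <;> grind
    · have e1 := far z (by grind) (by grind) a
      have e2 := far (X.mate z) (by grind) (by grind) b
      have := L.off z hz (by grind) a b
      grind
  · have := L.outside z hz
    grind
  · have := L.outside_next hpq
    grind
  · ext z
    show (_ ∧ _) ↔ (_ ∧ _)
    rw [hoff]
    refine and_congr_right fun ⟨_, _, hz⟩ => ?_
    have := far z (by grind) (by grind) (-1)
    rw [edge_neg_one] at this
    grind

end Loop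

/-- Position of a strand that is to be pushed over a crossing `v, t` next to the crossing `k, s`. -/
structure Push (σ : Perm P) (X : Crossings P) (k s v t n₀ n₁ m₀ m₁ : P) (α : ℤˣ) :
    Prop where
  nodup : [k, s, n₀, m₀, v, t, n₁, m₁].Nodup
  mate_k : X.mate k = s
  mate_v : X.mate v = t
  mate_n₀ : X.mate n₀ = n₀
  mate_n₁ : X.mate n₁ = n₁
  mate_m₀ : X.mate m₀ = m₀
  mate_m₁ : X.mate m₁ = m₁
  next_k : σ k = n₀
  next_n : σ n₀ = n₁
  nb_v : Nb σ s v α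
  nb_m₀ : Nb σ t m₀ (-(X.ε k * X.ε v))
  nb_m₁ : Nb σ m₀ m₁ (-(X.ε k * X.ε v))

namespace Push

variable {k s v t n₀ n₁ m₀ m₁ : P} {α : ℤˣ}

lemma ne (H : Push σ X k s v t n₀ n₁ m₀ m₁ α) :
    (k ≠ s ∧ k ≠ n₀ ∧ k ≠ m₀ ∧ k ≠ v ∧ k ≠ t ∧ k ≠ n₁ ∧ k ≠ m₁) ∧
    (s ≠ n₀ ∧ s ≠ m₀ ∧ s ≠ v ∧ s ≠ t ∧ s ≠ n₁ ∧ s ≠ m₁) ∧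
    (n₀ ≠ m₀ ∧ n₀ ≠ v ∧ n₀ ≠ t ∧ n₀ ≠ n₁ ∧ n₀ ≠ m₁) ∧
    (m₀ ≠ v ∧ m₀ ≠ t ∧ m₀ ≠ n₁ ∧ m₀ ≠ m₁) ∧ (v ≠ t ∧ v ≠ n₁ ∧ v ≠ m₁) ∧ (t ≠ n₁ ∧ t ≠ m₁) ∧
    n₁ ≠ m₁ := by
  have := H.nodup
  grind

/-- The first half of the push creates a bigon. -/
noncomputable def create (H : Push σ X k s v t n₀ n₁ m₀ m₁ α) : Crossings P :=
  (X.addCrossing n₀ m₀ H.ne.2.2.1.1 H.mate_n₀ H.mate_m₀ (α * X.ε v) (X.up k)).addCrossing n₁ m₁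
    H.ne.2.2.2.2.2.2
    (by
      have := H.ne
      have := H.mate_n₁
      simp only [addCrossing]; grind)
    (by
      have := H.ne
      have := H.mate_m₁
      simp only [addCrossing]; grind)
    (-(α * X.ε v)) (X.up k)

lemma create_mate (H : Push σ X k s v t n₀ n₁ m₀ m₁ α) (z : P) :
    H.create.mate z = if z = n₁ then m₁ else if z = m₁ then n₁ else if z = n₀ then m₀ else
      if z = m₀ then n₀ else X.mate z := rfl

lemma create_ε (H : Push σ X k s v t n₀ n₁ m₀ m₁ α) (z : P) :
    H.create.ε z = if z = n₁ then -(α * X.ε v) else if z = m₁ then -(-(α * X.ε v)) else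
      if z = n₀ then α * X.ε v else if z = m₀ then -(α * X.ε v) else X.ε z := rfl

lemma create_up (H : Push σ X k s v t n₀ n₁ m₀ m₁ α) (z : P) :
    H.create.up z = if z = n₁ then X.up k else if z = m₁ then !X.up k else
      if z = n₀ then X.up k else if z = m₀ then !X.up k else X.up z := rfl

/-- The sides of the triangle run along the loop from `k` to `n₀`, along the crossed strand between
`s` and `v`, and along the strand through `t` between `t` and `m₀`. -/
lemma triangle (H : Push σ X k s v t n₀ n₁ m₀ m₁ α) :
    Triangle σ H.create k s n₀ m₀ v t 1 α (X.ε k * X.ε v) := by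
  have hn := H.ne
  obtain ⟨-, h1, h2, h3, h4, h5, h6, h7, h8, h9, h10, h11⟩ := id H
  refine ⟨by grind, ?_, ?_, ?_, Or.inl ⟨rfl, h7⟩, h9, by simpa using h10.symm, ?_, ?_⟩
  · rw [create_mate]; grind
  · rw [create_mate]; grind
  · rw [create_mate]; grind
  · have e1 : H.create.ε k = X.ε k := by rw [create_ε]; grind
    have e2 : H.create.ε n₀ = α * X.ε v := by rw [create_ε]; grind
    rw [e1, e2]
    generalize X.ε k = A; generalize X.ε v = B
    clear * -
    revert A B α; decide
  · have e1 : H.create.ε v = X.ε v := by rw [create_ε]; grind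
    have e2 : H.create.ε n₀ = α * X.ε v := by rw [create_ε]; grind
    grind

lemma bigon (H : Push σ X k s v t n₀ n₁ m₀ m₁ α) : Bigon σ H.create n₀ n₁ m₀ m₁ := by
  have hn := H.ne
  obtain ⟨-, h1, h2, h3, h4, h5, h6, h7, h8, h9, h10, h11⟩ := id H
  refine ⟨by grind, ?_, ?_, h8, ?_, ?_, ?_⟩
  · rw [create_mate]; grind
  · rw [create_mate]; grind
  · rcases h11 with h | h
    · grind
    · grind
  · rw [create_up, create_up]; grind
  · rw [create_ε, create_ε]; grind

/-- In the new crossings the loop is on the level that it has at `k`, so it runs over or under both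
other strands of the triangle. -/
lemma layered (H : Push σ X k s v t n₀ n₁ m₀ m₁ α) :
    Triangle.Layered (H.create.up k) (H.create.up n₀) (H.create.up v) := by
  have hn := H.ne
  left
  rw [create_up, create_up]; grind

/-- Together with `delete_eq`: deleting the created bigon gives back `X`, except for the meaningless
values of `ε` and `up` at points without crossings. -/
lemma delete_mate (H : Push σ X k s v t n₀ n₁ m₀ m₁ α) (z : P) :
    ((H.create.del n₀).del n₁).mate z = X.mate z := by
  have hn := H.ne
  have i1 := X.mate_eq_iff (p := z) (q := n₀)
  have i2 := X.mate_eq_iff (p := z) (q := n₁)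
  rw [H.mate_n₀] at i1
  rw [H.mate_n₁] at i2
  have h3 := H.mate_n₀
  have h4 := H.mate_n₁
  have h5 := H.mate_m₀
  have h6 := H.mate_m₁
  simp only [del_mate, create_mate]
  grind

lemma delete_eq (H : Push σ X k s v t n₀ n₁ m₀ m₁ α) (z : P) (hz : X.mate z ≠ z) :
    ((H.create.del n₀).del n₁).ε z = X.ε z ∧ ((H.create.del n₀).del n₁).up z = X.up z := by
  have h3 := H.mate_n₀
  have h4 := H.mate_n₁
  have h5 := H.mate_m₀
  have h6 := H.mate_m₁
  show H.create.ε z = _ ∧ H.create.up z = _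
  rw [create_ε, create_up]
  grind

lemma planar_delete (H : Push σ X k s v t n₀ n₁ m₀ m₁ α) (h : Planar σ X) :
    Planar σ ((H.create.del n₀).del n₁) :=
  planar_congr (funext fun z => (H.delete_mate z).symm) (fun z hz => (H.delete_eq z hz).1.symm) h

lemma planar_create (H : Push σ X k s v t n₀ n₁ m₀ m₁ α) (h : Planar σ X) :
    Planar σ H.create := by
  have hn := H.ne
  refine H.triangle.planar_of_bigon (n := n₁) (m := m₁) (by grind) (by grind) (by grind) H.next_n
    H.nb_m₁ H.bigon.mate₂ ?_ (H.planar_delete h)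
  rw [create_ε, create_ε]; grind

/-- The result of the push. -/
noncomputable def result (H : Push σ X k s v t n₀ n₁ m₀ m₁ α) : Crossings P :=
  H.create.map (triPerm k s n₀ m₀ v t)

lemma equiv [hf : Finite P] (H : Push σ X k s v t n₀ n₁ m₀ m₁ α) (h : Planar σ X) :
    PlanarCurve.Equiv ⟨P, hf, σ, X, h⟩
      ⟨P, hf, σ, H.result, H.triangle.planar (H.planar_create h)⟩ := by
  have h1 : PlanarCurve.Move ⟨P, hf, σ, X, h⟩
      ⟨P, hf, σ, (H.create.del n₀).del n₁, H.planar_delete h⟩ :=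
    .emb id (Emb.ofEquiv (Equiv.refl P) (fun _ => rfl) H.delete_mate
      (fun z hz => (H.delete_eq z hz).1) fun z hz => (H.delete_eq z hz).2)
  have h2 := PlanarCurve.Move.bigon hf H.bigon (H.planar_create h) (H.planar_delete h)
  have h3 := PlanarCurve.Move.triangle hf H.triangle H.layered (H.planar_create h)
    (H.triangle.planar (H.planar_create h))
  exact h1.equiv.trans (h2.equiv.symm.trans h3.equiv)

lemma result_mate (H : Push σ X k s v t n₀ n₁ m₀ m₁ α) (z : P) :
    H.result.mate z = if z = k then t else if z = t then k else if z = n₀ then v else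
      if z = v then n₀ else if z = s then m₀ else if z = m₀ then s else if z = n₁ then m₁ else
      if z = m₁ then n₁ else X.mate z := by
  have hn := H.ne
  have T := H.triangle
  show (H.create.map _).mate z = _
  rw [T.map_mate]
  have hv := T.perm_values
  have hm := T.mate_facts
  by_cases hz : z ≠ k ∧ z ≠ s ∧ z ≠ n₀ ∧ z ≠ m₀ ∧ z ≠ v ∧ z ≠ t
  · rw [T.perm_of_notMem hz, T.perm_of_notMem (T.mate_notMem hz), create_mate]
    grind
  · grind

lemma result_ε (H : Push σ X k s v t n₀ n₁ m₀ m₁ α) (z : P) (h1 : z ≠ s) (h2 : z ≠ v)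
    (h3 : z ≠ t) (h4 : z ≠ m₀) (h5 : z ≠ m₁) :
    H.result.ε z = if z = k then α * X.ε v else if z = n₀ then X.ε k else
      if z = n₁ then -(α * X.ε v) else X.ε z := by
  have hn := H.ne
  show H.create.ε ((triPerm k s n₀ m₀ v t).symm z) = _
  rw [H.triangle.perm_symm, H.triangle.perm_apply, create_ε]
  grind

end Push

set_option maxHeartbeats 400000 in
/-- Pushing the loop over an adjacent crossing. -/
lemma Loop.push {p q : P} {u : List P} {δ : ℤˣ} {h : P → Bool} [Finite P]
    (L : Loop σ X p q u δ h) {k s v t n₀ n₁ m₀ m₁ : P}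
    {α : ℤˣ} (hα : α = X.ε k * δ) (H : Push σ X k s v t n₀ n₁ m₀ m₁ α) (hk : k ∈ u) (hn₀ : n₀ ∈ u) (hn₁ : n₁ ∈ u)
    (hv : v ∉ p :: u) (ht : t ∉ p :: u) (hm₀ : m₀ ∉ p :: u) (hm₁ : m₁ ∉ p :: u) :
    ∃ h', Loop σ H.result p q u δ h' ∧
      (offLoop H.result (p :: u)).ncard ≤ (offLoop X (p :: u)).ncard ∧
      (insideLoop H.result (p :: u) h').ncard < (insideLoop X (p :: u) h).ncard := by
  have hN := H.ne
  have hM := H.result_mate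
  obtain ⟨-, g1, g2, g3, g4, g5, g6, g7, g8, g9, g10, g11⟩ := id H
  obtain ⟨b, hb⟩ : ∃ b, b = -(X.ε k * X.ε v) := ⟨_, rfl⟩
  rw [← hb] at g10 g11
  have hs : s ∉ u := fun hs => hN.1.1 (by rw [← g1, L.free k hk (by grind)])
  have g1' : X.mate s = k := by rw [← g1, X.mate_mate]
  have g2' : X.mate t = v := by rw [← g2, X.mate_mate]
  have hpu := (List.nodup_cons.1 L.nodup).1
  have hsp : s ≠ p := by
    rintro rfl
    exact L.notMem (by rw [← L.mate, g1']; grind)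
  have hs' : s ∉ p :: u := by grind
  have hkp : k ≠ p := fun h => hpu (h ▸ hk)
  have hcr := fun d => L.cross k hk (by grind) d
  rw [g1, ← hα] at hcr
  have E₁ := fun z d => g9.edge_iff (z := z) (d := d)
  have E₂ := fun z d => g10.edge_iff (z := z) (d := d)
  have E₃ := fun z d => g11.edge_iff (z := z) (d := d)
  have hvt : ∀ d, h (edge σ v d) = true ∧ h (edge σ t d) = true := by
    have h1 : h (edge σ v (-α)) = true := by grind
    have h2 : ∀ a b, h (edge σ v a) = h (edge σ t b) := fun a b => by
      rw [← g2]; exact L.off v hv (by grind) a b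
    grind
  have hm0 : ∀ d, h (edge σ m₀ d) = true := by
    have h1 : h (edge σ m₀ (-b)) = true := by grind
    intro d
    have := L.off m₀ hm₀ (by grind) d (-b)
    grind
  have hm1 : ∀ d, h (edge σ m₁ d) = true := by
    have h1 : h (edge σ m₁ (-b)) = true := by grind
    intro d
    have := L.off m₁ hm₁ (by grind) d (-b)
    grind
  have ua := units_ne_neg α
  have ub := units_ne_neg b
  -- The loop sweeps over these three edges, which become outer ones; every other edge keeps its
  -- side.
  let f : P → Bool := fun z =>
    if z = edge σ s α ∨ z = edge σ t b ∨ z = edge σ m₀ b then false else h z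
  have fspec : ∀ z d, f (edge σ z d) = if (z = s ∧ d = α ∨ z = v ∧ d = -α) ∨
      (z = t ∧ d = b ∨ z = m₀ ∧ d = -b) ∨ (z = m₀ ∧ d = b ∨ z = m₁ ∧ d = -b) then false
      else h (edge σ z d) := fun z d => by grind
  have ffar : ∀ z d, z ≠ s → z ≠ v → z ≠ t → z ≠ m₀ → z ≠ m₁ → f (edge σ z d) = h (edge σ z d) := by
    grind
  have fs : ∀ d, f (edge σ s d) = false := by
    grind
  have fm : ∀ d, f (edge σ m₀ d) = false := by
    intro d
    rw [fspec, if_pos]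
    have := units_eq_or_neg d b
    grind
  have mem_ne : ∀ z ∈ u, z ≠ s ∧ z ≠ v ∧ z ≠ t ∧ z ≠ m₀ ∧ z ≠ m₁ := by
    grind
  have hpne : p ≠ k ∧ p ≠ s ∧ p ≠ n₀ ∧ p ≠ m₀ ∧ p ≠ v ∧ p ≠ t ∧ p ≠ n₁ ∧ p ≠ m₁ := by
    grind
  have mp : H.result.mate p = q := by rw [hM, ← L.mate]; grind
  have key : ∀ z, z ∉ p :: u → H.result.mate z ∉ p :: u → z = s ∨ z = m₀ ∨
      (z ≠ s ∧ z ≠ v ∧ z ≠ t ∧ z ≠ m₀ ∧ z ≠ m₁ ∧ H.result.mate z = X.mate z ∧ X.mate z ≠ s ∧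
        X.mate z ≠ v ∧ X.mate z ≠ t ∧ X.mate z ≠ m₀ ∧ X.mate z ≠ m₁) := by
    intro z hz hz'
    have := X.mate_mate z
    have hMz := hM z
    grind
  have hinside : insideLoop H.result (p :: u) f ⊂ insideLoop X (p :: u) h := by
    rw [Set.ssubset_iff_of_subset]
    -- After the push `v` is paired with `n₀`, a point of the loop, and so is no longer off the
    -- loop.
    · refine ⟨v, ⟨⟨by grind, hv, by grind⟩, by simpa using (hvt (-1)).1⟩, ?_⟩
      rintro ⟨⟨-, -, h3⟩, -⟩
      grind
    · rintro z ⟨⟨h1, h2, h3⟩, h4⟩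
      have h4' : f (edge σ z (-1)) = true := h4
      have := key z h2 h3
      exact ⟨⟨by grind, h2, by grind⟩, show h (edge σ z (-1)) = true by grind⟩
  -- The crossing `v, t` reappears outside the loop at the points `s, m₀`, so the number of points
  -- at crossings off the loop does not increase.
  have hoff : offLoop H.result (p :: u) ⊆ insert s (insert m₀ (offLoop X (p :: u) \ {v, t})) := by
    rintro z ⟨h1, h2, h3⟩
    rcases key z h2 h3 with rfl | rfl | ⟨k1, k2, k3, k4, k5, k6, -⟩
    · simp
    · simp
    · exact Or.inr (Or.inr ⟨⟨by grind, h2, by grind⟩, by simp [k2, k3]⟩)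
  refine ⟨f, ⟨L.next, L.nodup, L.notMem, mp, ?_, ?_, ?_, ?_, ?_⟩, ?_, Set.ncard_lt_ncard hinside⟩
  · intro z hz hz'
    have := mem_ne z hz
    have h1 := mem_ne _ hz'
    rw [hM] at h1 hz' ⊢
    have := L.free z hz
    grind
  · intro z hz hz' d
    obtain ⟨i1, i2, i3, i4, i5⟩ := mem_ne z hz
    have hε := H.result_ε z i1 i2 i3 i4 i5
    by_cases zk : z = k
    · subst zk
      rw [hM, if_pos rfl, hε, if_pos rfl, fspec]
      have hbα : α * X.ε v * δ = -b := by
        rw [hb, hα]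
        generalize X.ε z = A; generalize X.ε v = B
        clear * -
        revert A B δ; decide
      rw [hbα]
      have h1 := (hvt d).2
      have h2 := units_eq_or_neg d b
      grind
    by_cases zn : z = n₀
    · subst zn
      have : H.result.mate z = v := by grind
      rw [this, hε, if_neg zk, if_pos rfl, ← hα, fspec, (hvt d).1]
      have h2 := units_eq_or_neg d α
      grind
    by_cases zn' : z = n₁
    · subst zn'
      have : H.result.mate z = m₁ := by grind
      rw [this, hε, if_neg zk, if_neg zn, if_pos rfl, fspec, hm1]
      have hbα : -(α * X.ε v) * δ = b := by
        rw [hb, hα]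
        generalize X.ε k = A; generalize X.ε v = B
        clear * -
        revert A B δ; decide
      rw [hbα]
      have h2 := units_eq_or_neg d b
      grind
    · have hmz : H.result.mate z = X.mate z := by grind
      rw [hmz] at hz' ⊢
      rw [hε, if_neg zk, if_neg zn, if_neg zn', ← L.cross z hz hz' d]
      have := X.mate_mate z
      simp only [List.mem_cons, not_or] at hv ht hm₀ hm₁
      apply ffar <;> grind
  · intro z hz hz' c d
    have := L.off z hz
    rcases key z hz hz' with rfl | rfl | h <;> grind
  · intro z hz
    have := L.outside z hz
    grind
  · intro hpq
    have := L.outside_next hpq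
    grind
  · have hv' : v ∈ offLoop X (p :: u) := ⟨by grind, hv, by grind⟩
    have ht' : t ∈ offLoop X (p :: u) := ⟨by grind, ht, by grind⟩
    have h1 : ({v, t} : Set P) ⊆ offLoop X (p :: u) := by
      grind
    have h2 := Set.ncard_sdiff h1 (Set.toFinite _)
    have h3 := Set.ncard_le_ncard h1 (Set.toFinite _)
    rw [Set.ncard_pair hN.2.2.2.2.1.1] at h2 h3
    have h4 := Set.ncard_le_ncard hoff (Set.toFinite _)
    have h5 := Set.ncard_insert_le s (insert m₀ (offLoop X (p :: u) \ {v, t}))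
    have h6 := Set.ncard_insert_le m₀ (offLoop X (p :: u) \ {v, t})
    omega

end Crossings

/-! ### Loops in planar diagrams: the inside and its chords -/

namespace Crossings

open Classical

variable {P Q : Type} {σ : Perm P} {X : Crossings P}

lemma forall_next {α : Type} {f : P → α} : ∀ {u : List P} {p q : P}, (p :: u).map σ = u ++ [q] →
    (∀ z ∈ u, f (σ z) = f z) → ∀ z ∈ u ++ [q], f z = f (σ p)
  | [], p, q, h, _, z, hz => by simp at h hz; rw [hz, h]
  | a :: u, p, q, h, hf, z, hz => by
    rw [List.map_cons, List.cons_append, List.cons.injEq] at h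
    rw [List.cons_append, List.mem_cons] at hz
    rcases hz with rfl | hz
    · rw [h.1]
    · rw [forall_next h.2 (fun z hz => hf z (by simp [hz])) z hz, hf a (by simp), h.1]

lemma edge_notMem {l l' : List P} (hl : ∀ z, σ z ∈ l' → z ∈ l) {w : P} (hw : w ∉ l)
    (hw' : w ∉ l') (d : ℤˣ) : edge σ w d ∉ l' := by
  rcases units_eq d with rfl | rfl
  · exact fun h => hw (hl _ h)
  · exact hw'

lemma units_cast_ne {x y : ℚ} {s : ℤˣ} (h : x - y = ((s : ℤ) : ℚ) * 1) : y ≠ x := by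
  rintro rfl
  rcases units_eq s with rfl | rfl <;> simp at h

lemma Heights.eq_of_zero {x : P → ℚ} {H : P → ℤˣ → ℚ} (hH : Heights σ X x H) {z : P}
    (hz : x z = 0) (s t : ℤˣ) : H z s = H z t := by
  have := hH.jump z
  rw [hz] at this
  rcases units_eq s with rfl | rfl <;> rcases units_eq t with rfl | rfl <;> linarith

/-- In a planar diagram the edges inside a loop can be found. -/
lemma Planar.exists_loop (hP : Planar σ X) {p q : P} {u : List P} (next : (p :: u).map σ = u ++ [q])
    (nodup : (p :: u).Nodup) (notMem : q ∉ u) (mate : X.mate p = q)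
    (free : ∀ k ∈ u, X.mate k ∈ u → X.mate k = k) : ∃ δ h, Loop σ X p q u δ h := by
  have hpu := (List.nodup_cons.1 nodup).1
  have mate' : X.mate q = p := by rw [← mate, X.mate_mate]
  have hmem := fun z => mem_next (z := z) next
  -- The loop is closed, so its indicator is a flow. The heights of this flow do not change along or
  -- across the edges off the loop, and they jump by one across the loop; this replaces the Jordan
  -- curve theorem.
  obtain ⟨H, hH⟩ := hP (fun z => if z ∈ u ++ [q] then 1 else 0) (by
    intro z
    have := indicator_next next hpu notMem
    have := X.mate_mate
    grind)
  have h0 : ∀ {z}, z ∉ u ++ [q] → (if z ∈ u ++ [q] then 1 else 0 : ℚ) = 0 := fun h => if_neg h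
  have hw : ∀ w, w ∉ p :: u → w ≠ q → ∀ d, edge σ w d ∉ u ++ [q] := fun w h1 h2 =>
    edge_notMem (fun z => (hmem z).1) h1 (by grind)
  have hku : ∀ k ∈ u, X.mate k ≠ k → X.mate k ∉ p :: u ∧ X.mate k ≠ q := by
    have := X.mate_mate
    grind
  have hconst : ∀ z ∈ u ++ [q], H z = H (σ p) := by
    refine forall_next next fun z hz => ?_
    by_cases hd : X.mate z = z
    · exact hH.dummy z hd
    · obtain ⟨h1, h2⟩ := hku z hz hd
      funext s
      have c1 := hH.corner z hd 1 (X.ε z * s)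
      have c2 := hH.corner z hd (-1) (X.ε z * s)
      rw [← mul_assoc, Int.units_mul_self, one_mul] at c1 c2
      rw [edge_one] at c1
      rw [edge_neg_one] at c2
      rw [c1, c2]
      exact hH.eq_of_zero (h0 (hw _ h1 h2 _)) _ _
  -- The inside must not contain the edges by which the curve enters and leaves the loop at the
  -- crossing `p, q`. If the loop is an entire circle, either side may be taken.
  let δ : ℤˣ := if p = q then 1 else -X.ε p
  have hjump : H (σ p) δ - H (σ p) (-δ) = ((δ : ℤ) : ℚ) * 1 := by
    rw [hH.jump', if_pos ((hmem p).2 (by simp))]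
  have hne := units_cast_ne hjump
  refine ⟨δ, fun z => decide (z ∉ u ++ [q] ∧ H z 1 = H (σ p) δ), next, nodup, notMem, mate, free,
    ?_, ?_, ?_, ?_⟩
  · intro k hk hk' b
    obtain ⟨h1, h2⟩ := hku k hk hk'
    have hn := hw _ h1 h2 b
    have c := hH.corner k hk' (-1) b
    rw [edge_neg_one, hconst k (by simp [hk]), hH.eq_of_zero (h0 hn) _ 1] at c
    simp only [hn, not_false_iff, true_and, ← c]
    congr 1
    rw [eq_iff_iff]
    constructor
    · intro h
      rcases units_eq_or_neg b (X.ε k * δ) with h' | h'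
      · exact h'
      · rw [h', mul_neg, ← mul_assoc, Int.units_mul_self, one_mul] at h
        exact (hne h).elim
    · rintro rfl
      rw [← mul_assoc, Int.units_mul_self, one_mul]
  · intro z hz hz' a b
    have := X.mate_mate
    have hzq : z ≠ q := by grind
    have hzq' : X.mate z ≠ q := by grind
    have n1 := hw z hz hzq a
    have n2 := hw _ hz' hzq' b
    simp only [n1, n2, not_false_iff, true_and]
    suffices h : H (edge σ z a) 1 = H (edge σ (X.mate z) b) 1 by rw [h]
    by_cases hd : X.mate z = z
    · have hd' := hH.dummy z hd
      rw [hd]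
      rcases units_eq a with rfl | rfl <;> rcases units_eq b with rfl | rfl <;> simp [hd']
    · have c := hH.corner z hd a b
      rwa [hH.eq_of_zero (h0 n1) _ 1, hH.eq_of_zero (h0 n2) _ 1] at c
  · intro z hz
    simp only [decide_eq_false_iff_not, not_and]
    intro hz'
    have hzp : z = p := by grind
    subst hzp
    have hpq : z ≠ q := by rintro rfl; exact hz' (by simp)
    have hδ : δ = -X.ε z := if_neg hpq
    have c := hH.corner z (by rw [mate]; exact hpq.symm) (-1) (-1)
    rw [edge_neg_one, mate, edge_neg_one, hconst q (by simp), mul_neg, mul_one, neg_neg,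
      hH.eq_of_zero (h0 hz') _ 1] at c
    rw [c]
    rw [hδ, neg_neg] at hne
    rw [hδ]; exact hne
  · intro hpq
    have hn : σ q ∉ u ++ [q] := by grind
    simp only [decide_eq_false_iff_not, not_and]
    intro _
    have hδ : δ = -X.ε p := if_neg hpq
    have c := hH.corner p (by rw [mate]; exact fun h => hpq h.symm) 1 1
    rw [edge_one, mate, edge_one, mul_one, hH.eq_of_zero (h0 hn) _ 1] at c
    rw [← c]
    rw [hδ, neg_neg] at hne
    rw [hδ]; exact hne

namespace Loop

variable {p q : P} {u : List P} {δ : ℤˣ} {h : P → Bool}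

lemma next_ne (L : Loop σ X p q u δ h) {z : P} (hz : z ∈ u) : σ z ≠ z := by
  intro h
  obtain ⟨A, B, rfl⟩ := List.append_of_mem hz
  have hn := L.nodup
  rw [← List.cons_append, List.nodup_append] at hn
  have hx1 : (p :: A).map σ ++ (σ z :: B.map σ) = (A ++ [z]) ++ (B ++ [q]) := by
    simpa using L.next
  obtain ⟨x1, -⟩ := List.append_inj hx1 (by simp)
  have : z ∈ (p :: A).map σ := by rw [x1]; simp
  obtain ⟨w, hw, e⟩ := List.mem_map.1 this
  have : w = z := σ.injective (e.trans h.symm)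
  exact hn.2.2 z (this ▸ hw) z (by simp) rfl

lemma mate_notMem (L : Loop σ X p q u δ h) {k : P} (hk : k ∈ u) (hm : X.mate k ≠ k) :
    X.mate k ∉ p :: u ∧ X.mate k ≠ q := by
  have := L.mate
  have := L.free
  have := L.nodup
  have := L.notMem
  have := X.mate_mate
  grind

/-- The end of an inner edge that starts at the loop. -/
lemma inner_end (L : Loop σ X p q u δ h) {k v : P} (hk : k ∈ u) (hm : X.mate k ≠ k)
    (hv : Nb σ (X.mate k) v (X.ε k * δ)) : v ∉ p :: u ∧ v ≠ q ∧ X.mate k ≠ v := by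
  have h1 : h (edge σ v (-(X.ε k * δ))) = true := by
    rw [← hv.edge_eq, L.cross k hk hm]; simp
  have := L.outside_of_mem (z := v)
  have := L.outside v
  have := L.outside_next
  have h2 : v ∉ p :: u ∧ v ≠ q := by
    rcases units_eq (-(X.ε k * δ)) with h' | h' <;> simp only [h', edge_one, edge_neg_one] at h1 <;>
      grind
  refine ⟨h2.1, h2.2, ?_⟩
  rintro rfl
  rw [L.cross k hk hm] at h1
  exact units_ne_neg (X.ε k * δ) (of_decide_eq_true h1).symm

/-- Two crossings of the loop with another strand that are joined by an inner edge. -/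
structure Chord (σ : Perm P) (X : Crossings P) (u : List P) (δ : ℤˣ) (k k' : P) : Prop where
  mem : k ∈ u
  mem' : k' ∈ u
  ne : k ≠ k'
  mate : X.mate k ≠ k
  mate' : X.mate k' ≠ k'
  ε : X.ε k' = -X.ε k
  nb : Nb σ (X.mate k) (X.mate k') (X.ε k * δ)

lemma Chord.symm {k k' : P} (h : Chord σ X u δ k k') : Chord σ X u δ k' k := by
  obtain ⟨h1, h2, h3, h4, h5, h6, h7⟩ := h
  refine ⟨h2, h1, h3.symm, h5, h4, by rw [h6, neg_neg], ?_⟩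
  rw [h6, neg_mul]
  exact h7.symm

lemma chord (L : Loop σ X p q u δ h) {k k' : P} (hk : k ∈ u) (hk' : k' ∈ u)
    (hm : X.mate k ≠ k) (hm' : X.mate k' ≠ k') (hN : Nb σ (X.mate k) (X.mate k') (X.ε k * δ)) :
    Chord σ X u δ k k' := by
  refine ⟨hk, hk', ?_, hm, hm', ?_, hN⟩
  · rintro rfl
    exact (L.inner_end hk hm hN).2.2 rfl
  · have h1 : h (edge σ (X.mate k') (-(X.ε k * δ))) = true := by
      rw [← hN.edge_eq, L.cross k hk hm]; simp
    rw [L.cross k' hk' hm'] at h1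
    have h2 := of_decide_eq_true h1
    rw [← neg_mul] at h2
    exact (mul_right_cancel h2).symm

/-- Chords of a planar diagram do not cross. -/
lemma chord_mem (L : Loop σ X p q u δ h) (hP : Planar σ X) {A B C : List P} {k k' l l' : P}
    (hu : u = A ++ k :: (B ++ k' :: C)) (hk : Chord σ X u δ k k') (hl : Chord σ X u δ l l')
    (hlB : l ∈ B) : l' ∈ B := by
  by_contra hl'B
  have hn := (List.nodup_cons.1 L.nodup).2
  have hBu : ∀ z ∈ B, z ∈ u := fun z hz => by rw [hu]; simp [hz]
  obtain ⟨n1, n2, n3⟩ : k ∉ B ∧ k' ∉ B ∧ k ≠ k' := by grind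
  have hnext := map_next_middle (hu ▸ L.next)
  obtain ⟨α, hα⟩ : ∃ α, α = X.ε k * δ := ⟨_, rfl⟩
  have hN := hk.nb
  rw [← hα] at hN
  have hss : X.mate k ≠ X.mate k' := fun h => n3 (X.mate_inj.1 h)
  have E := fun z d => hN.edge_iff (z := z) (d := d)
  obtain ⟨e, he⟩ : ∃ e, e = edge σ (X.mate k) α := ⟨_, rfl⟩
  rw [← he] at E
  have heu : e ∉ p :: u := by
    have := L.outside e
    have := L.cross k hk.mem hk.mate α
    grind
  -- The arc from `k` to `k'`, closed by the chord `e`, is a flow. Its heights on the outer side of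
  -- the loop are constant (`hout`), and on the inner side they agree at `l` and `l'`, which are
  -- joined by a chord without flow. But the jump across the loop is nonzero at `l`, on the arc, and
  -- zero at `l'`, off it.
  obtain ⟨x, hx⟩ : ∃ x : P → ℚ, x = fun z => (if z ∈ B ++ [k'] then 1 else 0) +
      (if z = e then -((α : ℤ) : ℚ) else 0) := ⟨_, rfl⟩
  have hflow : Flow σ X x := by
    have key : ∀ z, x (σ z) - x z = (if z = k then 1 else 0) - (if z = k' then 1 else 0) +
        ((if z = X.mate k' then 1 else 0) - (if z = X.mate k then 1 else 0)) := by
      intro z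
      have k1 := indicator_next hnext n1 n2 z
      have k2 : ((if σ z = e then -((α : ℤ) : ℚ) else 0)) - (if z = e then -((α : ℤ) : ℚ) else 0) =
          (if z = X.mate k' then 1 else 0) - (if z = X.mate k then 1 else 0) := by
        have E1 := E z 1
        have E2 := E z (-1)
        rw [edge_one] at E1
        rw [edge_neg_one] at E2
        rcases units_eq α with h | h <;> simp [h] at E1 E2 ⊢ <;> grind
      rw [← k1, ← k2, hx]
      ring
    intro z
    have k1 := key z
    have k2 := key (X.mate z)
    rw [if_congr X.mate_eq_iff rfl rfl, if_congr X.mate_eq_iff rfl rfl, if_congr X.mate_inj rfl rfl,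
      if_congr X.mate_inj rfl rfl] at k2
    linarith
  have hBk : ∀ z ∈ B ++ [k'], z ∈ u := by grind
  have x0 : ∀ w, w ∉ p :: u → ∀ d, ¬ (w = X.mate k ∧ d = α ∨ w = X.mate k' ∧ d = -α) →
      x (edge σ w d) = 0 := by
    intro w hw d hd
    have h1 : edge σ w d ∉ B ++ [k'] := by
      exact edge_notMem (l := k :: B) (fun z => (mem_next hnext).1) (by grind) (by grind) d
    have h2 : edge σ w d ≠ e := fun h => hd ((E w d).1 h)
    simp only [hx, if_neg h1, if_neg h2, add_zero]
  obtain ⟨H, hH⟩ := hP x hflow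
  have hout : ∀ z ∈ u ++ [q], H z (-δ) = H (σ p) (-δ) := by
    refine forall_next (f := fun z => H z (-δ)) L.next fun z hz => ?_
    by_cases hd : X.mate z = z
    · exact congrFun (hH.dummy z hd) _
    · have hw := L.mate_notMem hz hd
      have c1 := hH.corner z hd 1 (-(X.ε z * δ))
      have c2 := hH.corner z hd (-1) (-(X.ε z * δ))
      rw [mul_neg, ← mul_assoc, Int.units_mul_self, one_mul] at c1 c2
      rw [edge_one] at c1
      rw [edge_neg_one] at c2
      show H (σ z) (-δ) = H z (-δ)
      rw [c1, c2]
      refine hH.eq_of_zero (x0 _ hw.1 _ ?_) _ _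
      rintro (⟨e1, e2⟩ | ⟨e1, e2⟩)
      · rw [X.mate_inj.1 e1, hα] at e2
        exact units_ne_neg _ e2.symm
      · rw [X.mate_inj.1 e1, hα, hk.ε, neg_mul, neg_neg] at e2
        exact units_ne_neg _ e2
  have hlk : l ≠ k ∧ l ≠ k' := ⟨fun h => n1 (h ▸ hlB), fun h => n2 (h ▸ hlB)⟩
  have hlw := L.mate_notMem hl.mem hl.mate
  have hc : ∀ z, X.mate z ≠ z → H z δ = H (edge σ (X.mate z) (X.ε z * δ)) (X.ε z) := by
    intro z hz
    have := hH.corner z hz (-1) (X.ε z * δ)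
    rwa [← mul_assoc, Int.units_mul_self, one_mul, edge_neg_one, mul_neg, neg_neg,
      mul_one] at this
  have hnotl : ¬ (X.mate l = X.mate k ∧ X.ε l * δ = α ∨ X.mate l = X.mate k' ∧ X.ε l * δ = -α) := by
    have := X.mate_mate
    grind
  have hxe := x0 _ hlw.1 _ hnotl
  have hee : edge σ (X.mate l) (X.ε l * δ) = edge σ (X.mate l') (X.ε l' * δ) := by
    rw [hl.nb.edge_eq, hl.ε, neg_mul]
  have hl'k : l' ≠ k' := by
    rintro rfl
    apply hnotl
    rw [← E, hee, he, hN.edge_eq, hk.ε, neg_mul, hα]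
  have e1 : H l δ = H l' δ := by
    rw [hc l hl.mate, hc l' hl.mate', ← hee]
    exact hH.eq_of_zero hxe _ _
  have e2 := hH.jump' l δ
  have e3 := hH.jump' l' δ
  have xl : x l = 1 := by grind
  have xl' : x l' = 0 := by
    have h1 : l' ∉ B ++ [k'] := by simp [hl'B, hl'k]
    have h2 : l' ≠ e := fun h => heu (by rw [← h]; simp [hl.mem'])
    simp only [hx, if_neg h1, if_neg h2, add_zero]
  rw [hout l (by simp [hl.mem]), xl] at e2
  rw [hout l' (by simp [hl.mem']), xl', mul_zero, ← e1, sub_eq_zero] at e3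
  exact units_cast_ne e2 e3.symm

/-- If every inner edge that starts at the loop is a chord, some chord cuts off an edge. -/
lemma exists_chord (L : Loop σ X p q u δ h) (hP : Planar σ X)
    (tight : ∀ z ∈ u, X.mate z ≠ z) (hC : ∀ k ∈ u, ∃ k', Chord σ X u δ k k') (hu : u ≠ []) :
    ∃ k, Chord σ X u δ k (σ k) := by
  -- Induction on the number of points that the chord cuts off. By `chord_mem` the chord from the
  -- point `l` next to `k` is nested inside; when nothing is left in between, `k'` is `σ k`.
  have main : ∀ n (A B C : List P) (k k' : P), B.length = n → u = A ++ k :: (B ++ k' :: C) →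
      Chord σ X u δ k k' → ∃ k, Chord σ X u δ k (σ k) := by
    intro n
    induction n using Nat.strong_induction_on with
    | _ n ih =>
      intro A B C k k' hn hu hk
      have hnext := map_next_middle (hu ▸ L.next)
      cases B with
      | nil => exact ⟨k, by simp at hnext; rwa [hnext]⟩
      | cons l B =>
        obtain ⟨l', hl⟩ := hC l (by rw [hu]; simp)
        have hl' := L.chord_mem hP hu hk hl (by simp)
        rcases List.mem_cons.1 hl' with h | h
        · exact (hl.ne h.symm).elim
        · obtain ⟨B₁, B₂, rfl⟩ := List.append_of_mem h
          refine ih B₁.length ?_ (A ++ [k]) B₁ (B₂ ++ k' :: C) l l' rfl ?_ hl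
          · rw [← hn]; simp
          · rw [hu]; simp
  obtain ⟨k, hk⟩ := List.exists_mem_of_ne_nil u hu
  obtain ⟨k', hk'⟩ := hC k hk
  obtain ⟨A, B, rfl⟩ := List.append_of_mem hk
  rcases List.mem_append.1 hk'.mem' with h | h
  · obtain ⟨A₁, A₂, rfl⟩ := List.append_of_mem h
    exact main _ A₁ A₂ B k' k rfl (by simp) hk'.symm
  · rcases List.mem_cons.1 h with h | h
    · exact (hk'.ne h.symm).elim
    · obtain ⟨B₁, B₂, rfl⟩ := List.append_of_mem h
      exact main _ A B₁ B₂ k k' rfl rfl hk'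

end Loop

end Crossings

namespace Crossings

open Classical

variable {P Q : Type} {σ : Perm P} {X : Crossings P}

lemma Emb.ncard_offLoop {ι : Q → P} {σ' : Perm Q} {X' : Crossings Q}
    (E : Emb ι σ' X' σ X) {L : List P} {L' : List Q} (hL : ∀ w, ι w ∈ L ↔ w ∈ L') :
    (offLoop X L).ncard = (offLoop X' L').ncard := by
  rw [E.offLoop_eq_image hL, Set.ncard_image_of_injective _ E.inj]

lemma Emb.ncard_insideLoop {ι : Q → P} {σ' : Perm Q} {X' : Crossings Q}
    (E : Emb ι σ' X' σ X) {L : List P} {L' : List Q} (hL : ∀ w, ι w ∈ L ↔ w ∈ L') {h : P → Bool}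
    {h' : Q → Bool} (hh : ∀ w, h (ι w) = h' w) :
    (insideLoop X L h).ncard = (insideLoop X' L' h').ncard := by
  have : insideLoop X L h = ι '' insideLoop X' L' h' := by
    unfold insideLoop
    rw [E.offLoop_eq_image hL]
    grind
  rw [this, Set.ncard_image_of_injective _ E.inj]

end Crossings

/-! ### Removing all crossings of a planar curve -/

namespace PlanarCurve

open Crossings Classical

/-- Insert a dummy. -/
noncomputable def addPoint (D : PlanarCurve) (z : D.P) : PlanarCurve where
  P := Option D.P
  finite := by have := D.finite; infer_instance
  σ := insertAfter D.σ z
  X := D.X.addPoint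
  planar := (emb_insertAfter D.σ D.X z).planar_iff.1 D.planar

lemma equiv_addPoint (D : PlanarCurve) (z : D.P) : Equiv D (D.addPoint z) :=
  (Move.emb (D := D) (D' := D.addPoint z) some (emb_insertAfter D.σ D.X z)).equiv

/-- Delete a dummy. -/
noncomputable def deletePoint (D : PlanarCurve) {z : D.P} (hz : D.X.mate z = z) (hσ : D.σ z ≠ z) :
    PlanarCurve where
  P := {w // w ≠ z}
  finite := by have := D.finite; infer_instance
  σ := skip D.σ z
  X := D.X.deletePoint hz
  planar := (emb_deletePoint hz hσ).planar_iff.2 D.planar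

lemma equiv_deletePoint (D : PlanarCurve) {z : D.P} (hz : D.X.mate z = z) (hσ : D.σ z ≠ z) :
    Equiv D (D.deletePoint hz hσ) :=
  (Move.emb (D := D.deletePoint hz hσ) (D' := D) Subtype.val (emb_deletePoint hz hσ)).equiv.symm

/-- Insert two dummies. -/
lemma exists_addPoints (D : PlanarCurve) (z : D.P) {p q : D.P} {u : List D.P} {δ : ℤˣ}
    {h : D.P → Bool} (L : Loop D.σ D.X p q u δ h) :
    ∃ (D' : PlanarCurve) (ι : D.P → D'.P) (A B : D'.P) (u' : List D'.P) (h' : D'.P → Bool),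
      Equiv D D' ∧ Function.Injective ι ∧ (A ≠ B ∧ (∀ w, ι w ≠ A) ∧ ∀ w, ι w ≠ B) ∧
      (D'.σ (ι z) = A ∧ D'.σ A = B ∧ D'.σ B = ι (D.σ z)) ∧
      (∀ a c x, Nb D.σ a c x → D.σ z ≠ edge D.σ a x → Nb D'.σ (ι a) (ι c) x) ∧
      ((∀ w, D'.X.mate (ι w) = ι (D.X.mate w)) ∧ D'.X.mate A = A ∧ D'.X.mate B = B) ∧
      (∀ w, D'.X.ε (ι w) = D.X.ε w) ∧ Loop D'.σ D'.X (ι p) (ι q) u' δ h' ∧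
      ((∀ w, ι w ∈ u' ↔ w ∈ u) ∧ (A ∈ u' ↔ z ∈ p :: u) ∧ (B ∈ u' ↔ z ∈ p :: u)) ∧
      (offLoop D'.X (ι p :: u')).ncard = (offLoop D.X (p :: u)).ncard ∧
      (insideLoop D'.X (ι p :: u') h').ncard = (insideLoop D.X (p :: u) h).ncard := by
  obtain ⟨u₁, L₁, h1, h2⟩ := L.insertAfter z
  obtain ⟨u₂, L₂, h3, h4⟩ := L₁.insertAfter none
  have s1 : insertAfter (insertAfter D.σ z) none (some (some z)) = some none := by
    rw [insertAfter_of_ne _ (by simp), insertAfter_self]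
  have c1 : ∀ w, some w ∈ some p :: u₁ ↔ w ∈ p :: u := fun w => by grind
  have c2 : ∀ w, some w ∈ some (some p) :: u₂ ↔ w ∈ some p :: u₁ := fun w => by grind
  have n1 : (some none : Option (Option D.P)) ≠ none := by simp
  have n2 : ∀ w : D.P, some (some w) ≠ (some none : Option (Option D.P)) := by simp
  have n3 : ∀ w : D.P, some (some w) ≠ (none : Option (Option D.P)) := by simp
  refine ⟨(D.addPoint z).addPoint (none : Option D.P), fun w => some (some w),
    (some none : Option (Option D.P)), (none : Option (Option D.P)), u₂, _,
    (D.equiv_addPoint z).trans (equiv_addPoint _ _), fun a b hab =>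
      Option.some_injective _ (Option.some_injective _ hab),
    ⟨n1, n2, n3⟩, ⟨s1, insertAfter_self _ _, ?_⟩, ?_, ⟨fun w => rfl, rfl, rfl⟩,
    fun w => rfl, L₂, ⟨fun w => (h3 _).trans (h1 w), (h3 _).trans h2, h4.trans (by grind)⟩,
    ?_, ?_⟩
  · show insertAfter (insertAfter D.σ z) none none = _
    rw [insertAfter_none, insertAfter_none]
    rfl
  · intro a c x hN hz
    have := hN.insertAfter hz
    refine this.insertAfter ?_
    rw [insertAfter_none]
    rcases units_eq x with rfl | rfl
    · rw [edge_one, insertAfter_of_ne]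
      · exact fun h => hz (by simpa using h)
      · rintro rfl; exact hz rfl
    · exact fun h => hz (by simpa using h)
  · exact ((emb_insertAfter (insertAfter D.σ z) D.X.addPoint none).ncard_offLoop c2).trans
      ((emb_insertAfter D.σ D.X z).ncard_offLoop c1)
  · exact ((emb_insertAfter (insertAfter D.σ z) D.X.addPoint none).ncard_insideLoop c2
      (h' := fun y => y.elim (h (D.σ z)) h) fun _ => rfl).trans
      ((emb_insertAfter D.σ D.X z).ncard_insideLoop c1 fun _ => rfl)

/-- Pushing a loop over a crossing inside. -/
lemma exists_push (D : PlanarCurve) {p q : D.P} {u : List D.P} {δ : ℤˣ} {h : D.P → Bool}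
    (L : Loop D.σ D.X p q u δ h) {k v : D.P} (hk : k ∈ u) (hm : D.X.mate k ≠ k)
    (hN : Nb D.σ (D.X.mate k) v (D.X.ε k * δ)) (hv : D.X.mate v ≠ v) (hvu : D.X.mate v ∉ p :: u) :
    ∃ (D' : PlanarCurve) (p' q' : D'.P) (u' : List D'.P) (h' : D'.P → Bool), Equiv D D' ∧
      Loop D'.σ D'.X p' q' u' δ h' ∧
      (offLoop D'.X (p' :: u')).ncard ≤ (offLoop D.X (p :: u)).ncard ∧
      (insideLoop D'.X (p' :: u') h').ncard < (insideLoop D.X (p :: u) h).ncard := by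
  obtain ⟨i1, i2, i3⟩ := L.inner_end hk hm hN
  obtain ⟨hs, -⟩ := L.mate_notMem hk hm
  have hkv : k ≠ v := fun h => i1 (h ▸ List.mem_cons_of_mem _ hk)
  have hks : k ≠ D.X.mate k := hm.symm
  have hkt : k ≠ D.X.mate v := fun h => hvu (h ▸ List.mem_cons_of_mem _ hk)
  have hsv : D.X.mate k ≠ v := i3
  have hst : D.X.mate k ≠ D.X.mate v := fun h => hkv (D.X.mate_inj.1 h)
  have E := fun z d => hN.edge_iff (z := z) (d := d)
  obtain ⟨D₁, ι, n₀, n₁, u₁, h₁, e1, inj1, ⟨a1, a2, a3⟩, ⟨b1, b2, b3⟩, c1, ⟨d1, d2, d3⟩, f1, L₁,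
    ⟨g1, g2, g3⟩, o1, j1⟩ := D.exists_addPoints k L
  have N₁ := c1 _ _ _ hN (by
    rw [ne_eq, ← edge_one, E]
    grind)
  have E₁ := fun z d => N₁.edge_iff (z := z) (d := d)
  obtain ⟨b, hb⟩ : ∃ b, b = -(D.X.ε k * D.X.ε v) := ⟨_, rfl⟩
  -- `insertAfter` puts a point behind a given one. Since `m₀` and `m₁` have to follow `D.X.mate v`
  -- in direction `b`, they are inserted behind this point or behind its predecessor.
  obtain ⟨z, hz, hzk⟩ : ∃ z, (b = 1 ∧ z = ι (D.X.mate v) ∨ b = -1 ∧ D₁.σ z = ι (D.X.mate v)) ∧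
      z ∉ ι p :: u₁ := by
    have ht : ι (D.X.mate v) ∉ ι p :: u₁ := by grind
    rcases units_eq b with h' | h'
    · grind
    · refine ⟨D₁.σ.symm (ι (D.X.mate v)), Or.inr ⟨h', by simp⟩, fun hz => ?_⟩
      have := L₁.next_mem hz
      rw [_root_.Equiv.apply_symm_apply] at this
      rcases List.mem_append.1 this with h2 | h2
      · grind
      · have h3 := inj1 (List.mem_singleton.1 h2)
        rw [← L.mate, D.X.mate_inj] at h3
        grind
  obtain ⟨D₂, κ, A, B, u₂, h₂, e2, inj2, ⟨a1', a2', a3'⟩, ⟨b1', b2', b3'⟩, c2, ⟨d1', d2', d3'⟩, f2,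
    L₂, ⟨g1', g2', g3'⟩, o2, j2⟩ := D₁.exists_addPoints z L₁
  have hze : ∀ a x, (a ≠ ι (D.X.mate v)) → (∀ d, edge D₁.σ (ι (D.X.mate v)) d ≠ edge D₁.σ a x) →
      D₁.σ z ≠ edge D₁.σ a x := by
    intro a x _ h
    rcases hz with ⟨-, rfl⟩ | ⟨-, hz⟩
    · exact h 1
    · rw [hz]; exact h (-1)
  have N₂ := c2 _ _ _ N₁ (hze _ _ (fun h => hst (inj1 h)) fun d => by
    rw [ne_eq, E₁]
    grind)
  have hσk : D₂.σ (κ (ι k)) = κ n₀ := by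
    have : Nb D₁.σ (ι k) n₀ 1 := Or.inl ⟨rfl, b1⟩
    rcases c2 _ _ _ this (by
      rcases hz with ⟨-, rfl⟩ | ⟨-, hz⟩
      · rw [edge_one, ne_eq, D₁.σ.injective.eq_iff]; grind
      · rw [hz, edge_one, b1]; grind) with h | h
    · grind
    · exact absurd h.1 (by decide)
  have hσn : D₂.σ (κ n₀) = κ n₁ := by
    have : Nb D₁.σ n₀ n₁ 1 := Or.inl ⟨rfl, b2⟩
    rcases c2 _ _ _ this (by
      rcases hz with ⟨-, rfl⟩ | ⟨-, hz⟩
      · rw [edge_one, ne_eq, D₁.σ.injective.eq_iff]; grind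
      · rw [hz, edge_one, b2]; grind) with h | h
    · grind
    · exact absurd h.1 (by decide)
  have hεk : D₂.X.ε (κ (ι k)) = D.X.ε k := by grind
  have hεv : D₂.X.ε (κ (ι v)) = D.X.ε v := by grind
  obtain ⟨m₀, m₁, hmm, hAB, M₀, M₁⟩ : ∃ m₀ m₁, (m₀ = A ∧ m₁ = B ∨ m₀ = B ∧ m₁ = A) ∧ m₀ ≠ m₁ ∧
      Nb D₂.σ (κ (ι (D.X.mate v))) m₀ b ∧ Nb D₂.σ m₀ m₁ b := by
    rcases hz with ⟨h', rfl⟩ | ⟨h', hz⟩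
    · exact ⟨A, B, Or.inl ⟨rfl, rfl⟩, a1', Or.inl ⟨h', b1'⟩, Or.inl ⟨h', b2'⟩⟩
    · exact ⟨B, A, Or.inr ⟨rfl, rfl⟩, a1'.symm, Or.inr ⟨h', by grind⟩, Or.inr ⟨h', b2'⟩⟩
  have hm : (∀ w, κ w ≠ m₀ ∧ κ w ≠ m₁) ∧ D₂.X.mate m₀ = m₀ ∧ D₂.X.mate m₁ = m₁ ∧
      m₀ ∉ κ (ι p) :: u₂ ∧ m₁ ∉ κ (ι p) :: u₂ := by
    have hA : A ∉ κ (ι p) :: u₂ := by grind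
    have hB : B ∉ κ (ι p) :: u₂ := by grind
    rcases hmm with ⟨rfl, rfl⟩ | ⟨rfl, rfl⟩ <;> grind
  have hmate : ∀ w, D₂.X.mate (κ (ι w)) = κ (ι (D.X.mate w)) := fun w => by grind
  have κi : ∀ w w', κ (ι w) = κ (ι w') ↔ w = w' := fun w w' => by grind
  have H : Push D₂.σ D₂.X (κ (ι k)) (κ (ι (D.X.mate k))) (κ (ι v)) (κ (ι (D.X.mate v))) (κ n₀) (κ n₁)
      m₀ m₁ (D.X.ε k * δ) := by
    refine ⟨?_, hmate k, hmate v, by grind, by grind, hm.2.1, hm.2.2.1, hσk, hσn, N₂,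
      ?_, ?_⟩
    · simp only [List.nodup_cons, List.mem_cons, List.not_mem_nil, or_false, not_or, κi,
        inj2.eq_iff, List.nodup_nil, and_true, not_false_iff]
      grind
    · grind
    · grind
  have hfin := D₂.finite
  have hu2 : ∀ w, κ (ι w) ∈ κ (ι p) :: u₂ ↔ w ∈ p :: u := by grind
  obtain ⟨h₃, L₃, o3, j3⟩ := L₂.push (by grind) H
    ((g1' _).2 ((g1 _).2 hk)) ((g1' _).2 (g2.2 (by grind))) ((g1' _).2 (g3.2 (by grind)))
    (by grind) (by grind) hm.2.2.2.1 hm.2.2.2.2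
  refine ⟨⟨D₂.P, hfin, D₂.σ, H.result, H.triangle.planar (H.planar_create D₂.planar)⟩, κ (ι p),
    κ (ι q), u₂, h₃, e1.trans (e2.trans (H.equiv D₂.planar)), L₃, ?_, ?_⟩
  · grind
  · grind

/-- All crossings of a loop can be removed. -/
lemma exists_of_loop (δ : ℤˣ) (I : ℕ) : ∀ (M : ℕ) (D : PlanarCurve) (p q : D.P) (u : List D.P)
    (h : D.P → Bool), Loop D.σ D.X p q u δ h → (insideLoop D.X (p :: u) h).ncard = I →
    Nat.card D.P + (offLoop D.X []).ncard = M → ∃ D' : PlanarCurve, Equiv D D' ∧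
      (offLoop D'.X []).ncard ≤ (offLoop D.X (p :: u)).ncard := by
  -- Lexicographic induction, first on the points off the loop entered by inner edges, then on all
  -- points plus the points at crossings. Deleting a dummy or a bigon lowers the second number and
  -- keeps the first; a push lowers the first.
  induction I using Nat.strong_induction_on with
  | _ I ihI =>
  intro M
  induction M using Nat.strong_induction_on with
  | _ M ihM =>
  intro D p q u h L hI hM
  have hfin := D.finite
  by_cases hA : ∃ z, D.X.mate z = z ∧ D.σ z ≠ z ∧ p ≠ z ∧ q ≠ z
  · obtain ⟨z, hz, hσ, hp, hq⟩ := hA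
    obtain ⟨u', L', hu'⟩ := L.deletePoint hz hp hq
    have E := emb_deletePoint hz hσ
    have c : ∀ w : {w // w ≠ z}, (w : D.P) ∈ p :: u ↔ w ∈ (⟨p, hp⟩ :: u' : List {w // w ≠ z}) := by
      grind
    obtain ⟨D', e, hD'⟩ := ihM _ (by
      rw [← hM]
      have h1 : (offLoop (D.X.deletePoint hz) []).ncard = (offLoop D.X []).ncard :=
        (E.ncard_offLoop (by simp)).symm
      have h2 : Nat.card {w // w ≠ z} < Nat.card D.P := Finite.card_subtype_lt (x := z) (by simp)
      show Nat.card {w // w ≠ z} + (offLoop (D.X.deletePoint hz) []).ncard < _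
      omega) (D.deletePoint hz hσ) ⟨p, hp⟩ ⟨q, hq⟩ u' _ L'
      ((E.ncard_insideLoop c fun _ => rfl).symm.trans hI) rfl
    refine ⟨D', (D.equiv_deletePoint hz hσ).trans e, hD'.trans_eq ?_⟩
    exact (E.ncard_offLoop c).symm
  push Not at hA
  have tight : ∀ z, z ≠ p → z ≠ q → D.σ z ≠ z → D.X.mate z ≠ z := fun z h1 h2 h3 h4 =>
    h2 (hA z h4 h3 h1.symm).symm
  have hpu := (List.nodup_cons.1 L.nodup).1
  have tightu : ∀ z ∈ u, D.X.mate z ≠ z := fun z hz =>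
    tight z (by grind) (by rintro rfl; exact L.notMem hz) (L.next_ne hz)
  -- Either every inner edge that starts at the loop returns to it directly, and then an innermost
  -- chord bounds a bigon unless the loop is empty; or some inner edge leads to a crossing off the
  -- loop, and the loop is pushed over it.
  by_cases hC : ∀ k ∈ u, ∃ k', Loop.Chord D.σ D.X u δ k k'
  · by_cases hu : u = []
    · subst hu
      have hpq : D.σ p = q := by simpa using L.next
      by_cases hpm : p = q
      · refine ⟨D, .refl D, Set.ncard_le_ncard ?_ (Set.toFinite _)⟩
        rintro z ⟨h1, -, -⟩
        have hmp : D.X.mate p = p := by rw [L.mate, hpm]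
        refine ⟨h1, ?_, ?_⟩
        · grind
        · rw [List.mem_singleton, D.X.mate_eq_iff, hmp]; grind
      · have hm : D.X.mate p ≠ p := by rw [L.mate]; grind
        have hσp : D.σ p = D.X.mate p := by rw [hpq, L.mate]
        refine ⟨⟨D.P, hfin, D.σ, D.X.del p, D.planar.kink hm hσp⟩,
          (Move.kink hfin hm hσp D.planar (D.planar.kink hm hσp)).equiv,
          Set.ncard_le_ncard ?_ (Set.toFinite _)⟩
        rintro z ⟨h1, -, -⟩
        have h2 : (D.X.del p).mate z ≠ z := h1
        rw [del_mate] at h2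
        split_ifs at h2 with h3
        · exact ⟨h2, by grind, by grind⟩
        · grind
    · obtain ⟨k, hk⟩ := L.exists_chord D.planar tightu hC hu
      -- A crossing change puts the loop on the same level in both crossings of the bigon; nothing
      -- else in the configuration depends on over and under.
      obtain ⟨X', hX', hmate, hε, hup, hP'⟩ : ∃ X' : Crossings D.P,
          (∀ hP' : X'.Planar D.σ, Equiv D ⟨D.P, hfin, D.σ, X', hP'⟩) ∧ X'.mate = D.X.mate ∧
          X'.ε = D.X.ε ∧ X'.up k = X'.up (D.σ k) ∧ X'.Planar D.σ := by
        by_cases h' : D.X.up k = D.X.up (D.σ k)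
        · exact ⟨D.X, fun _ => .refl D, rfl, rfl, h', D.planar⟩
        · refine ⟨D.X.cc k, fun hP' => (Move.cc hfin hk.mate D.planar hP').equiv, rfl, rfl, ?_,
            D.planar.cc k⟩
          have h1 : D.σ k ≠ k := fun h => hk.ne h.symm
          have h2 : D.σ k ≠ D.X.mate k := fun h => (L.mate_notMem hk.mem hk.mate).1
            (List.mem_cons_of_mem _ (h ▸ hk.mem'))
          simp only [cc, true_or, if_true, h1, h2, or_self, if_false]
          grind
      have L' : Loop D.σ X' p q u δ h := by
        refine ⟨L.next, L.nodup, L.notMem, ?_, ?_, ?_, ?_, L.outside, L.outside_next⟩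
        · rw [hmate]; exact L.mate
        · rw [hmate]; exact L.free
        · rw [hmate, hε]; exact L.cross
        · rw [hmate]; exact L.off
      have hoff : ∀ l, offLoop X' l = offLoop D.X l := fun l => by unfold offLoop; grind
      have hin : insideLoop X' (p :: u) h = insideLoop D.X (p :: u) h := by
        unfold insideLoop; grind
      obtain ⟨h', L₁, o1, j1⟩ := L'.bigon hk.mem hk.mem' hk.ne (by rw [hmate]; exact hk.mate)
        (by rw [hmate]; exact hk.mate') (by rw [hε]; exact hk.ε) (by rw [hmate, hε]; exact hk.nb)
      have hB : Bigon D.σ X' k (D.σ k) (X'.mate k) (X'.mate (D.σ k)) := by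
        refine ⟨?_, rfl, rfl, rfl, ?_, hup, by rw [hε]; exact hk.ε⟩
        · have h1 := (L.mate_notMem hk.mem hk.mate).1
          have h2 := (L.mate_notMem hk.mem' hk.mate').1
          have h3 := hk.mem
          have h4 := hk.mem'
          have h5 := hk.ne
          simp only [List.mem_cons, not_or] at h1 h2
          rw [hmate]
          simp only [List.nodup_cons, List.mem_cons, List.not_mem_nil, or_false, not_or,
            List.nodup_nil, and_true, not_false_iff, D.X.mate_inj]
          grind
        · rw [hmate]
          rcases hk.nb with h | h <;> grind
      have hP₁ := hP'.bigon hB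
      obtain ⟨D', e, hD'⟩ := ihM _ (by
        rw [← hM]
        refine Nat.add_lt_add_left (Set.ncard_lt_ncard ?_ (Set.toFinite _)) (Nat.card D.P)
        show offLoop ((X'.del k).del (D.σ k)) [] ⊂ _
        rw [Set.ssubset_iff_of_subset]
        · refine ⟨k, ⟨hk.mate, by simp, by simp⟩, fun h => h.1 ?_⟩
          simp [del_mate]
        · rintro z ⟨h1, -, -⟩
          refine ⟨fun h => h1 ?_, by simp, by simp⟩
          simp [del_mate, hmate, h]) ⟨D.P, hfin, D.σ, (X'.del k).del (D.σ k), hP₁⟩ p q u h' L₁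
        (by
          grind) rfl
      refine ⟨D', (hX' hP').trans ((Move.bigon hfin hB hP' hP₁).equiv.trans e), hD'.trans_eq ?_⟩
      grind
  · push Not at hC
    obtain ⟨k, hk, hC⟩ := hC
    have hkm := tightu k hk
    obtain ⟨v, hv⟩ : ∃ v, Nb D.σ (D.X.mate k) v (D.X.ε k * δ) := by
      rcases units_eq (D.X.ε k * δ) with h' | h'
      · exact ⟨_, Or.inl ⟨h', rfl⟩⟩
      · exact ⟨D.σ.symm (D.X.mate k), Or.inr ⟨h', by simp⟩⟩
    obtain ⟨v1, v2, v3⟩ := L.inner_end hk hkm hv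
    have hvm : D.X.mate v ≠ v := by
      refine tight v (by grind) v2 fun hσ => v3 ?_
      rcases hv with ⟨-, h'⟩ | ⟨-, h'⟩
      · exact D.σ.injective (h'.trans hσ.symm)
      · grind
    have hvu : D.X.mate v ∉ p :: u := by
      intro h'
      rcases List.mem_cons.1 h' with h' | h'
      · rw [D.X.mate_eq_iff, L.mate] at h'; grind
      · refine hC _ (L.chord hk h' hkm ?_ ?_)
        · grind
        · rwa [D.X.mate_mate]
    obtain ⟨D₁, p₁, q₁, u₁, h₁, e1, L₁, o1, j1⟩ := D.exists_push L hk hkm hv hvm hvu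
    obtain ⟨D', e, hD'⟩ := ihI _ (hI ▸ j1) _ D₁ p₁ q₁ u₁ h₁ L₁ rfl rfl
    exact ⟨D', e1.trans e, hD'.trans o1⟩

/-- The arc between two points. -/
lemma exists_arc {P : Type} (σ : _root_.Equiv.Perm P) (p : P) (j : ℕ) (hret : ∀ r, 0 < r → r < j →
    (σ ^ r) p ≠ p) : ∃ u : List P, (0 < j → (p :: u).map σ = u ++ [(σ ^ j) p]) ∧ (p :: u).Nodup ∧
      (∀ z, z ∈ u ↔ ∃ r, 0 < r ∧ r < j ∧ z = (σ ^ r) p) := by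
  refine ⟨(List.range (j - 1)).map fun r => (σ ^ (r + 1)) p, fun hj => ?_, ?_, fun z => ?_⟩
  · have : p :: ((List.range (j - 1)).map fun r => (σ ^ (r + 1)) p) =
        (List.range (j - 1 + 1)).map fun r => (σ ^ r) p := by
      rw [List.range_succ_eq_map]; simp [Function.comp_def]
    rw [this, List.map_map, List.range_succ]
    have hj' : j = j - 1 + 1 := by omega
    conv_rhs => rw [hj']
    simp [Function.comp_def, pow_succ']
  · rw [List.nodup_cons]
    constructor
    · grind
    · refine List.Nodup.map_on ?_ List.nodup_range
      have key : ∀ r s, r < s → s < j - 1 → (σ ^ (r + 1)) p ≠ (σ ^ (s + 1)) p := by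
        intro r s hrs hs e
        refine hret (s - r) (by omega) (by omega) ?_
        have : s + 1 = (r + 1) + (s - r) := by omega
        rw [this, pow_add σ (r + 1) (s - r), Perm.mul_apply] at e
        exact ((σ ^ (r + 1)).injective e).symm
      grind
  · rw [List.mem_map]
    constructor
    · grind
    · rintro ⟨r, h1, h2, rfl⟩
      exact ⟨r - 1, List.mem_range.2 (by omega), by grind⟩

/-- If some circle crosses itself, a shortest return from a point to its mate is a loop without
self-crossings. Otherwise every circle is simple, and the circle of the dummy `d`, read from `d`, is
a loop that passes through the crossing at `z`. -/
lemma exists_initial_loop {P : Type} [Finite P] {σ : _root_.Equiv.Perm P} {X : Crossings P}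
    (hP : X.Planar σ) {z d : P} (hσ : σ z = d) (hz : X.mate z ≠ z) (hd : X.mate d = d) :
    ∃ p q u δ h, Loop σ X p q u δ h ∧ ∃ y, X.mate y ≠ y ∧ y ∈ p :: u := by
  have pw : ∀ (r s : ℕ) (p : P), r ≤ s → (σ ^ (s - r)) ((σ ^ r) p) = (σ ^ s) p := by
    intro r s p h
    rw [← Perm.mul_apply, ← pow_add, Nat.sub_add_cancel h]
  have hfree : ∀ (p : P) (j : ℕ), (∀ i, 0 < i → i < j → ∀ p, (σ ^ i) p = X.mate p → X.mate p = p) →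
      ∀ r s, r < j → s < j → 0 < r → 0 < s → X.mate ((σ ^ r) p) = (σ ^ s) p →
        X.mate ((σ ^ r) p) = (σ ^ r) p := by
    intro p j hj r s hr hs hr0 hs0 e
    rcases lt_trichotomy r s with h | rfl | h
    · exact hj (s - r) (by omega) (by omega) _ (by grind)
    · grind
    · have e' : (σ ^ r) p = X.mate ((σ ^ s) p) := X.mate_eq_iff.1 e
      have := hj (r - s) (by omega) (by omega) _ (by rw [← e', pw s r p h.le])
      grind
  by_cases h : ∃ j, 0 < j ∧ ∃ p, (σ ^ j) p = X.mate p ∧ X.mate p ≠ p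
  · obtain ⟨h1, p, h2, h3⟩ := Nat.find_spec h
    have hmin : ∀ i, 0 < i → i < Nat.find h → ∀ p, (σ ^ i) p = X.mate p → X.mate p = p := by
      intro i hi hi' p hp
      by_contra hc
      exact Nat.find_min h hi' ⟨hi, p, hp, hc⟩
    generalize Nat.find h = j at h1 h2 hmin
    obtain ⟨u, u1, u2, u3⟩ := exists_arc σ p j fun r hr hr' e => h3 (hmin (j - r) (by omega) (by omega) p (by rw [← h2, ← pw r j p hr'.le, e]))
    obtain ⟨δ, h, L⟩ := hP.exists_loop (u1 h1) u2 (fun h => by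
      obtain ⟨r, hr, hr', e⟩ := (u3 _).1 h
      grind) h2.symm (fun k hk hk' => by
      obtain ⟨r, hr, hr', rfl⟩ := (u3 _).1 hk
      obtain ⟨s, hs, hs', e⟩ := (u3 _).1 hk'
      exact hfree p j hmin r s hr' hs' hr hs e)
    grind
  · push Not at h
    have hret : ∃ j, 0 < j ∧ (σ ^ j) d = d := by
      have := isOfFinOrder_of_finite σ
      exact ⟨orderOf σ, this.orderOf_pos, by rw [pow_orderOf_eq_one]; rfl⟩
    obtain ⟨h1, h2⟩ := Nat.find_spec hret
    have hmin : ∀ r, 0 < r → r < Nat.find hret → (σ ^ r) d ≠ d := fun r hr hr' e =>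
      Nat.find_min hret hr' ⟨hr, e⟩
    generalize Nat.find hret = j at h1 h2 hmin
    obtain ⟨u, u1, u2, u3⟩ := exists_arc σ d j hmin
    obtain ⟨δ, h, L⟩ := hP.exists_loop (u1 h1) u2 (by
      grind) (hd.trans h2.symm) (fun k hk hk' => by
      obtain ⟨r, hr, hr', rfl⟩ := (u3 _).1 hk
      obtain ⟨s, hs, hs', e⟩ := (u3 _).1 hk'
      exact hfree d j (fun i hi _ => h i hi) r s hr' hs' hr hs e)
    exact ⟨_, _, _, _, _, L, z, hz, L.mem_of_next (by grind)⟩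

/-- Every planar diagram is equivalent to one without crossings. -/
lemma exists_trivial (D : PlanarCurve) : ∃ D' : PlanarCurve, Equiv D D' ∧
    ∀ z, D'.X.mate z = z := by
  obtain ⟨n, hn⟩ : ∃ n, (offLoop D.X []).ncard = n := ⟨_, rfl⟩
  induction n using Nat.strong_induction_on generalizing D with
  | _ n ih =>
  by_cases h0 : ∀ z, D.X.mate z = z
  · exact ⟨D, .refl D, h0⟩
  push Not at h0
  obtain ⟨z, hz⟩ := h0
  have hfin : Finite (D.addPoint z).P := (D.addPoint z).finite
  have hoff : (offLoop (D.addPoint z).X []).ncard = n :=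
    ((emb_insertAfter D.σ D.X z).ncard_offLoop (L' := [])
      fun w => iff_of_false List.not_mem_nil List.not_mem_nil).trans hn
  suffices H : ∃ (p q : (D.addPoint z).P) (u : List (D.addPoint z).P) (δ : ℤˣ) (h : _ → Bool),
      Loop (D.addPoint z).σ (D.addPoint z).X p q u δ h ∧ ∃ y, (D.addPoint z).X.mate y ≠ y ∧
        (y ∈ p :: u) by
    obtain ⟨p, q, u, δ, h, L, y, hy, hyu⟩ := H
    -- The number of crossings decreases because at least one crossing lies on the loop.
    obtain ⟨D', e, hD'⟩ := exists_of_loop δ _ _ (D.addPoint z) p q u h L rfl rfl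
    have hlt : (offLoop (D.addPoint z).X (p :: u)).ncard < n := by
      rw [← hoff]
      refine Set.ncard_lt_ncard ?_ (Set.toFinite _)
      rw [Set.ssubset_iff_of_subset]
      · exact ⟨y, ⟨hy, by simp, by simp⟩, fun h => h.2.1 hyu⟩
      · rintro w ⟨h1, -, -⟩; exact ⟨h1, by simp, by simp⟩
    obtain ⟨D'', e', hD''⟩ := ih _ (hD'.trans_lt hlt) D' rfl
    exact ⟨D'', (D.equiv_addPoint z).trans (e.trans e'), hD''⟩
  exact exists_initial_loop (D.addPoint z).planar (z := (some z : Option D.P))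
    (d := (none : Option D.P)) (insertAfter_self _ _) (fun h => hz (Option.some_injective _ h)) rfl

end PlanarCurve

/-! ### Genus zero is equivalent to planarity -/

namespace GaussDiagram

open ArrowDiagram

variable {α : Type}

/-- The crossings of a Gauss diagram, on the set of endpoints of arrows. -/
def crossings (G : GaussDiagram α) : Crossings (α × Bool) where
  mate := ArrowDiagram.flip
  ε p := if p.2 then G.sign p.1 else -G.sign p.1
  up p := p.2
  mate_mate p := by simp [ArrowDiagram.flip]
  ε_mate p _ := by rcases p with ⟨a, _ | _⟩ <;> simp [ArrowDiagram.flip]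
  up_mate p _ := rfl

lemma crossings_mate_ne (G : GaussDiagram α) (p : α × Bool) : G.crossings.mate p ≠ p := by
  intro h
  have := congrArg Prod.snd h
  simp [crossings, ArrowDiagram.flip] at this

@[simp] lemma crossings_sgn (G : GaussDiagram α) (p : α × Bool) : G.crossings.sgn p = G.sign p.1 := by
  rcases p with ⟨a, _ | _⟩ <;> simp [crossings, Crossings.sgn]

variable [DecidableEq α] (G : GaussDiagram α)

lemma opposite_opposite (d : (α × Bool) × Bool) : G.opposite (G.opposite d) = d := by
  rcases d with ⟨p, _ | _⟩ <;> simp [opposite]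

/-- The faces of the surface of a Gauss diagram. -/
abbrev Face : Type := Quot fun d e : (α × Bool) × Bool => e = G.rotate (G.opposite d)

/-- The components of the graph of a Gauss diagram. -/
abbrev Component : Type := Quot fun a b : α => ∃ x y : Bool, G.next (a, x) = (b, y)

lemma rotate_eq (p : α × Bool) (x : Bool) : G.rotate (p, x) =
    (ArrowDiagram.flip p, if G.crossings.ε p = 1 then x else !x) := by
  rcases p with ⟨a, _ | _⟩ <;> rcases units_eq (G.sign a) with h | h <;>
    simp [rotate, ArrowDiagram.flip, crossings, h]

lemma face_rotate {S : Type} {f : (α × Bool) × Bool → S} :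
    (∀ d e, e = G.rotate (G.opposite d) → f d = f e) ↔ ∀ d, f (G.rotate d) = f (G.opposite d) := by
  have := G.opposite_opposite
  grind

/-- Functions on the faces are the heights of the faces. -/
lemma face_corner {f : (α × Bool) × Bool → ℚ} {H : α × Bool → ℤˣ → ℚ}
    (h1 : ∀ p, f (p, false) = H p 1) (h2 : ∀ p, f (p, true) = H (G.next p) (-1)) :
    (∀ d, f (G.rotate d) = f (G.opposite d)) ↔ ∀ p, ∀ a b : ℤˣ,
      H (Crossings.edge G.next p a) (G.crossings.ε p * b) =
        H (Crossings.edge G.next (G.crossings.mate p) b) (-(G.crossings.ε p * a)) := by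
  have key : (∀ d, f (G.rotate d) = f (G.opposite d)) ↔ ∀ p, ∀ a : ℤˣ,
      H (Crossings.edge G.next (G.crossings.mate p) (G.crossings.ε p * a)) (-(G.crossings.ε p * a)) =
        H (Crossings.edge G.next p a) a := by
    have ho1 : ∀ p, f (G.opposite (p, true)) = H (G.next p) 1 := fun p => h1 _
    have ho2 : ∀ p, f (G.opposite (p, false)) = H p (-1) := fun p => by
      show f (G.next.symm p, true) = _
      rw [h2, Equiv.apply_symm_apply]
    have hk : ∀ p, f (G.rotate (p, true)) = H (Crossings.edge G.next (G.crossings.mate p)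
        (G.crossings.ε p * 1)) (-(G.crossings.ε p * 1)) ∧ f (G.rotate (p, false)) =
        H (Crossings.edge G.next (G.crossings.mate p) (G.crossings.ε p * -1))
          (-(G.crossings.ε p * -1)) := by
      intro p
      rw [rotate_eq, rotate_eq]
      rcases units_eq (G.crossings.ε p) with h | h <;> rw [h] <;>
        simp [h1, h2] <;> exact ⟨rfl, rfl⟩
    constructor
    · intro h p a
      rcases units_eq a with rfl | rfl
      exacts [(hk p).1 ▸ (h _).trans (ho1 p), (hk p).2 ▸ (h _).trans (ho2 p)]
    · rintro h ⟨p, _ | _⟩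
      exacts [((hk p).2.trans (h p _)).trans (ho2 p).symm, ((hk p).1.trans (h p _)).trans (ho1 p).symm]
  rw [key]
  have hm := G.crossings.mate_mate
  have hε := fun p => G.crossings.ε_mate p (G.crossings_mate_ne p)
  constructor
  · intro h p a b
    have h1 := h p a
    have h2 := h (G.crossings.mate p) b
    rw [hm, hε] at h2
    rcases units_eq a with rfl | rfl <;> rcases units_eq b with rfl | rfl <;>
      rcases units_eq (G.crossings.ε p) with h | h <;> simp_all
  · intro h p a
    have := h p a (G.crossings.ε p * a)
    rw [← mul_assoc, Int.units_mul_self, one_mul] at this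
    exact this.symm

/-- `rotate` permutes the four half-edges at a crossing cyclically. -/
lemma rotate_const {f : (α × Bool) × Bool → ℚ} (h : ∀ d, f (G.rotate d) = f d) (a : α) (b x : Bool) :
    f ((a, b), x) = f ((a, true), true) := by
  have h1 := h ((a, true), false)
  have h2 := h ((a, true), true)
  have h3 := h ((a, false), false)
  have h4 := h ((a, false), true)
  rcases units_eq (G.sign a) with h | h <;> simp [rotate, h] at h1 h2 h3 h4 <;>
    cases b <;> cases x <;> grind

variable [Fintype α]

/-- The boundary of a function on the faces. -/
def boundary : (G.Face → ℚ) →ₗ[ℚ] (α × Bool → ℚ) where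
  toFun f p := f (Quot.mk _ (p, false)) - f (Quot.mk _ (G.next.symm p, true))
  map_add' f g := by ext p; simp; ring
  map_smul' c f := by ext p; simp; ring

lemma exists_face_iff {x : α × Bool → ℚ} : x ∈ LinearMap.range G.boundary ↔
    ∃ H, Crossings.Heights G.next G.crossings x H := by
  constructor
  · rintro ⟨f, rfl⟩
    refine ⟨fun p s => if s = 1 then f (Quot.mk _ (p, false)) else
      f (Quot.mk _ (G.next.symm p, true)), fun p => rfl,
      fun p hp => (G.crossings_mate_ne p hp).elim, fun p _ => ?_⟩
    refine (G.face_corner (f := fun d => f (Quot.mk _ d)) (H := fun p s => if s = 1 then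
      f (Quot.mk _ (p, false)) else f (Quot.mk _ (G.next.symm p, true))) (fun p => rfl)
      (fun p => ?_)).1 ?_ p
    · rw [if_neg (by decide), Equiv.symm_apply_apply]
    · exact G.face_rotate.1 fun d e h => congrArg f (Quot.sound h)
  · rintro ⟨H, hH⟩
    have h := G.face_rotate (f := fun d : (α × Bool) × Bool =>
      if d.2 then H (G.next d.1) (-1) else H d.1 1).2 ((G.face_corner
      (f := fun d => if d.2 then H (G.next d.1) (-1) else H d.1 1) (H := H) (fun p => rfl)
      (fun p => rfl)).2 fun p => hH.corner p (G.crossings_mate_ne p))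
    refine ⟨Quot.lift _ h, ?_⟩
    funext p
    rw [hH.jump p]
    simp [boundary]

/-- The matrix of the flow equations. -/
def flowMatrix : Matrix α (α × Bool) ℚ :=
  fun a p => (if p.1 = a then 1 else 0) - if (G.next.symm p).1 = a then 1 else 0

lemma flow_iff {x : α × Bool → ℚ} : Crossings.Flow G.next G.crossings x ↔
    x ∈ LinearMap.ker G.flowMatrix.mulVecLin := by
  have hs : ∀ (g : α × Bool → ℚ) a, ∑ p, (if p.1 = a then g p else 0) = g (a, true) + g (a, false) := by
    intro g a
    rw [Fintype.sum_prod_type, Finset.sum_eq_single a]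
    · simp
    · intro b _ hb; simp [hb]
    · simp
  have h : ∀ a, (G.flowMatrix.mulVec x) a =
      x (a, true) + x (a, false) - (x (G.next (a, true)) + x (G.next (a, false))) := by
    intro a
    rw [← hs x a, ← hs (fun p => x (G.next p)) a]
    simp only [Matrix.mulVec, dotProduct, flowMatrix, sub_mul, ite_mul, one_mul, zero_mul,
      Finset.sum_sub_distrib]
    congr 1
    rw [← Equiv.sum_comp G.next]
    simp
  rw [LinearMap.mem_ker, Matrix.mulVecLin_apply]
  constructor
  · intro hx
    funext a
    rw [h]
    have := hx (a, true)
    simp only [crossings, ArrowDiagram.flip, Bool.not_true] at this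
    simp; linarith
  · intro hx p
    have := h p.1
    rw [hx] at this
    rcases p with ⟨a, _ | _⟩ <;> simp [crossings, ArrowDiagram.flip] at this ⊢ <;> linarith

/-- The boundary of a boundary is zero: the four faces around a crossing cancel in the flow equation
there. -/
lemma boundary_le : LinearMap.range G.boundary ≤ LinearMap.ker G.flowMatrix.mulVecLin := by
  intro x hx
  rw [← flow_iff]
  obtain ⟨H, hH⟩ := (G.exists_face_iff).1 hx
  intro p
  have h1 := hH.corner p (G.crossings_mate_ne p) 1 1
  have h2 := hH.corner p (G.crossings_mate_ne p) 1 (-1)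
  have h3 := hH.corner p (G.crossings_mate_ne p) (-1) 1
  have h4 := hH.corner p (G.crossings_mate_ne p) (-1) (-1)
  rw [hH.jump, hH.jump, hH.jump, hH.jump]
  simp only [Crossings.edge_one, Crossings.edge_neg_one] at h1 h2 h3 h4
  rcases units_eq (G.crossings.ε p) with h | h <;> simp [h] at h1 h2 h3 h4 <;> linarith

/-- The transpose of the incidence matrix has as its kernel the functions on the crossings that are
constant on components. So the matrix has rank `V - c`, and its kernel has dimension `2V - (V - c)`.
-/
lemma finrank_ker_flow : Module.finrank ℚ (LinearMap.ker G.flowMatrix.mulVecLin) =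
    Fintype.card α + G.numGraphComponents := by
  have h1 := LinearMap.finrank_range_add_finrank_ker G.flowMatrix.mulVecLin
  have h2 := LinearMap.finrank_range_add_finrank_ker G.flowMatrix.transpose.mulVecLin
  have h3 := G.flowMatrix.rank_transpose
  unfold Matrix.rank at h3
  have h4 : Module.finrank ℚ (LinearMap.ker G.flowMatrix.transpose.mulVecLin) =
      G.numGraphComponents := by
    have : Fintype G.Component := Fintype.ofFinite _
    have hr : LinearMap.ker G.flowMatrix.transpose.mulVecLin =
        LinearMap.range (LinearMap.funLeft ℚ ℚ (Quot.mk _ : α → G.Component)) := by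
      ext y
      rw [LinearMap.mem_ker, Matrix.mulVecLin_apply]
      have h : ∀ p, (G.flowMatrix.transpose.mulVec y) p = y p.1 - y (G.next.symm p).1 := by
        intro p
        simp [Matrix.mulVec, dotProduct, flowMatrix, sub_mul, Finset.sum_sub_distrib]
      constructor
      · intro hy
        refine ⟨Quot.lift y ?_, rfl⟩
        rintro a b ⟨s, t, hst⟩
        have := h (b, t)
        rw [hy, ← hst, Equiv.symm_apply_apply, hst] at this
        simp at this; linarith
      · rintro ⟨g, rfl⟩
        funext p
        rw [h]
        show g _ - g _ = 0
        rw [sub_eq_zero]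
        congr 1
        exact (Quot.sound ⟨(G.next.symm p).2, p.2, by simp⟩).symm
    rw [hr, LinearMap.finrank_range_of_inj
      (LinearMap.funLeft_injective_of_surjective _ _ _ Quot.mk_surjective),
      Module.finrank_fintype_fun_eq_card, numGraphComponents, Nat.card_eq_fintype_card]
  rw [Module.finrank_fintype_fun_eq_card] at h1 h2
  rw [Fintype.card_prod, Fintype.card_bool] at h1
  omega

/-- A function on the faces has boundary zero if and only if neighbouring faces have equal values,
that is, if it is constant on components. -/
lemma finrank_range_boundary :
    Module.finrank ℚ (LinearMap.range G.boundary) + G.numGraphComponents = G.numFaces := by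
  have hF : Fintype G.Face := Fintype.ofFinite _
  have hC : Fintype G.Component := Fintype.ofFinite _
  have h1 := LinearMap.finrank_range_add_finrank_ker G.boundary
  rw [Module.finrank_fintype_fun_eq_card] at h1
  have hf0 : ∀ d : (α × Bool) × Bool, (G.rotate d).1.1 = d.1.1 := fun d => rfl
  have hadj : ∀ d : (α × Bool) × Bool,
      (Quot.mk _ (G.opposite d).1.1 : G.Component) = Quot.mk _ d.1.1 := by
    rintro ⟨p, _ | _⟩
    · exact Quot.sound ⟨(G.next.symm p).2, p.2, by simp [opposite]⟩
    · exact (Quot.sound ⟨p.2, (G.next p).2, by simp [opposite]⟩).symm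
  let c : G.Face → G.Component := Quot.lift (fun d => Quot.mk _ d.1.1) fun d e h => by
    rw [h, hf0, hadj]
  have hc : Function.Surjective c := by
    rintro ⟨a⟩
    exact ⟨Quot.mk _ ((a, true), true), rfl⟩
  have hr : LinearMap.ker G.boundary = LinearMap.range (LinearMap.funLeft ℚ ℚ c) := by
    ext f
    rw [LinearMap.mem_ker]
    constructor
    · intro hf
      have ho : ∀ d, f (Quot.mk _ (G.opposite d)) = f (Quot.mk _ d) := by
        have : ∀ p, f (Quot.mk _ (p, false)) = f (Quot.mk _ (G.next.symm p, true)) := fun p => by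
          have := congrFun hf p
          simp [boundary] at this; linarith
        rintro ⟨p, _ | _⟩
        · exact (this p).symm
        · show f (Quot.mk _ (G.next p, false)) = _
          rw [this, Equiv.symm_apply_apply]
      have hrot : ∀ d, f (Quot.mk _ (G.rotate d)) = f (Quot.mk _ d) := by
        intro d
        rw [← ho d]
        exact congrArg f (Quot.sound (by rw [opposite_opposite])).symm
      have hall := G.rotate_const (f := fun d => f (Quot.mk _ d)) hrot
      refine ⟨Quot.lift (fun a => f (Quot.mk _ ((a, true), true))) ?_, ?_⟩
      · rintro a b ⟨x, y, hxy⟩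
        have := ho ((a, x), true)
        show f _ = f _
        rw [← hall a x true, ← this, ← hall b y false]
        exact congrArg (fun d => f (Quot.mk _ (d, false))) hxy
      · funext d
        induction d using Quot.ind
        exact (hall _ _ _).symm
    · rintro ⟨g, rfl⟩
      funext p
      show g _ - g _ = 0
      rw [sub_eq_zero]
      exact congrArg g (hadj (p, false)).symm
  rw [hr, LinearMap.finrank_range_of_inj (LinearMap.funLeft_injective_of_surjective _ _ _ hc),
    Module.finrank_fintype_fun_eq_card] at h1
  rw [numGraphComponents, numFaces, Nat.card_eq_fintype_card, Nat.card_eq_fintype_card]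
  exact h1

/-- Boundaries have dimension `F - c` and flows `V + c`. As boundaries are flows, the two spaces
coincide exactly if `V - 2V + F = 2c`. -/
lemma isClassical_iff : G.IsClassical ↔ Crossings.Planar G.next G.crossings := by
  have h1 := G.finrank_ker_flow
  have h2 := G.finrank_range_boundary
  have h3 : Crossings.Planar G.next G.crossings ↔
      LinearMap.ker G.flowMatrix.mulVecLin ≤ LinearMap.range G.boundary := by
    refine forall_congr' fun x => ?_
    rw [flow_iff, exists_face_iff]
  have h4 := Submodule.finrank_mono G.boundary_le
  unfold IsClassical
  rw [h3]
  constructor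
  · intro h
    rw [Submodule.eq_of_le_of_finrank_le G.boundary_le (by omega)]
  · intro h
    rw [le_antisymm h G.boundary_le] at h1
    omega

end GaussDiagram

/-! ### Rotations of words and starting points of circles -/

section Lists

open List

variable {P Q : Type}

/-- To rotate the filtered word by one letter, the full word is rotated past the discarded letters
together with the first kept one. -/
lemma exists_filter_rotated (K : P → Bool) {w : List P} {c : List P} (h : w.filter K ~r c) :
    ∃ w', w ~r w' ∧ w'.filter K = c := by
  obtain ⟨n, rfl⟩ := h
  induction n generalizing w with
  | zero => exact ⟨w, .refl _, by simp⟩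
  | succ n ih =>
    rcases hw : w.filter K with _ | ⟨x, t⟩
    · exact ⟨w, .refl _, by simp [hw]⟩
    obtain ⟨u, v, rfl, hu, -, hv⟩ := List.filter_eq_cons_iff.1 hw
    have hK : K x = true := by
      have : x ∈ (u ++ x :: v).filter K := by rw [hw]; simp
      exact (List.mem_filter.1 this).2
    have hu' : u.filter K = [] := by simpa using hu
    obtain ⟨w', h1, h2⟩ := ih (w := v ++ (u ++ [x]))
    refine ⟨w', .trans ?_ h1, ?_⟩
    · rw [← List.append_assoc, List.append_cons]
      simpa using List.isRotated_append (l := u ++ [x]) (l' := v)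
    · rw [h2, List.filter_append, List.filter_append, hv, hu']
      simp [hK]

lemma exists_filter_reordered (K : P → Bool) {W L M : List (List P)}
    (h : (W.map (List.filter K)).Perm L) (h' : Forall₂ IsRotated L M) :
    ∃ W', (∃ L', W.Perm L' ∧ Forall₂ IsRotated L' W') ∧ W'.map (List.filter K) = M := by
  have h1 : Relation.Comp (Forall₂ fun w v => w.filter K = v) Perm W L :=
    ⟨_, by rw [List.forall₂_map_right_iff, List.forall₂_same]; simp, h⟩
  rw [List.forall₂_comp_perm_eq_perm_comp_forall₂] at h1
  obtain ⟨L', h2, h3⟩ := h1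
  suffices ∀ {L' L M : List (List P)}, Forall₂ (fun w v => w.filter K = v) L' L →
      Forall₂ IsRotated L M → ∃ W', Forall₂ IsRotated L' W' ∧ W'.map (List.filter K) = M by
    obtain ⟨W', h4, h5⟩ := this h3 h'
    exact ⟨W', ⟨L', h2, h4⟩, h5⟩
  intro L' L M h3 h'
  induction h3 generalizing M with
  | nil => cases h'; exact ⟨[], .nil, rfl⟩
  | cons ha _ ih =>
    rcases h' with _ | ⟨hb, ht⟩
    subst ha
    obtain ⟨w', h5, h6⟩ := exists_filter_rotated K hb
    obtain ⟨W', h7, h8⟩ := ih ht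
    exact ⟨w' :: W', .cons h5 h7, by simp [h6, h8]⟩

lemma isRotated_of_map {f : Q → P} (hf : Function.Injective f) {l l' : List Q}
    (h : l.map f ~r l'.map f) : l ~r l' := by
  obtain ⟨n, hn⟩ := h
  rw [← List.map_rotate] at hn
  exact ⟨n, hf.list_map hn⟩

lemma Words.reordered {σ : P → P} {W L W' : List (List P)} (h : Words σ W) (hL : W.Perm L)
    (h' : Forall₂ IsRotated L W') : Words σ W' := by
  have hp : ∀ {L W' : List (List P)}, Forall₂ IsRotated L W' → L.flatten.Perm W'.flatten ∧
      ∀ w' ∈ W', ∃ w ∈ L, w ~r w' := by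
    intro L W' h'
    induction h' with
    | nil => simp
    | cons hr _ ih =>
      refine ⟨hr.perm.append ih.1, fun w' hw' => ?_⟩
      rcases List.mem_cons.1 hw' with rfl | hw'
      · exact ⟨_, by simp, hr⟩
      · obtain ⟨w, h1, h2⟩ := ih.2 w' hw'
        exact ⟨w, by simp [h1], h2⟩
  obtain ⟨hp, hr⟩ := hp h'
  have hp := hL.flatten.trans hp
  refine ⟨hp.nodup_iff.1 h.nodup, fun x => hp.mem_iff.1 (h.complete x), fun h0 => ?_, fun w' hw' => ?_⟩
  · obtain ⟨w, h1, h2⟩ := hr _ h0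
    rw [List.isRotated_nil_iff.1 h2] at h1
    exact h.ne (hL.mem_iff.2 h1)
  · obtain ⟨w, h1, h2⟩ := hr _ hw'
    exact (h.cyc w (hL.mem_iff.2 h1)).rotated h2

/-- The cycle of `b` can be listed first, from `b` on. -/
lemma Words.exists_head {σ : P → P} {W : List (List P)} (h : Words σ W) (b : P) :
    ∃ w W', Words σ ((b :: w) :: W') := by
  obtain ⟨w, hw, hb⟩ := h.exists_mem b
  obtain ⟨A, B, rfl⟩ := List.append_of_mem hw
  obtain ⟨l, hl⟩ := exists_isRotated_cons hb
  exact ⟨l, A ++ B, h.reordered List.perm_middle (.cons hl (forall₂_same.2 fun _ _ => .refl _))⟩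

/-- Words that do not begin with prescribed points. -/
lemma Words.exists_avoid {σ : Perm P} {W : List (List P)} (h : Words σ W) (T : P → Prop)
    (hT : ∀ z, T (σ z) → ¬ T z) : ∃ W', Words σ W' ∧ ∀ w ∈ W', ∀ z l, w = z :: l → ¬ T z := by
  suffices ∀ W : List (List P), (∀ w ∈ W, Cyc σ w) → ∃ W', Forall₂ IsRotated W W' ∧
      ∀ w ∈ W', ∀ z l, w = z :: l → ¬ T z by
    obtain ⟨W', h1, h2⟩ := this W h.cyc
    exact ⟨W', h.reordered (.refl _) h1, h2⟩
  intro W hW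
  induction W with
  | nil => exact ⟨[], .nil, by simp⟩
  | cons w W ih =>
    obtain ⟨W', h1, h2⟩ := ih fun w hw => hW w (by simp [hw])
    obtain ⟨w', hr, hw'⟩ : ∃ w', w ~r w' ∧ ∀ z l, w' = z :: l → ¬ T z := by
      rcases w with _ | ⟨z, l⟩
      · exact ⟨[], .refl _, by simp⟩
      -- If the word starts in `T`, it is read from the predecessor of its first letter instead,
      -- which by `hT` is not in `T`.
      by_cases hz : T z
      · have hc := hW (z :: l) (by simp)
        have hm : σ.symm z ∈ z :: l := by
          rcases List.eq_nil_or_concat' l with rfl | ⟨l', y, rfl⟩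
          · have := hc z [] (.refl _)
            simp only [List.headD_nil] at this
            simp [Equiv.symm_apply_eq, this]
          · have := hc y (z :: l') (by simpa using List.isRotated_append (l := z :: l') (l' := [y]))
            simp only [List.headD_cons] at this
            simp [← this]
        obtain ⟨l', hl'⟩ := exists_isRotated_cons hm
        refine ⟨_, hl', fun y m hy => ?_⟩
        rw [← (List.cons.inj hy).1]
        exact hT _ (by simpa using hz)
      · refine ⟨_, .refl _, fun y m hy => ?_⟩
        rwa [← (List.cons.inj hy).1]
    refine ⟨w' :: W', .cons hr h1, fun v hv => ?_⟩
    rcases List.mem_cons.1 hv with rfl | hv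
    · exact hw'
    · exact h2 v hv

/-- `Adjacent` does not see the step from the end of a word to its start. Consecutive points are
adjacent if no word starts with the second one. -/
lemma Words.infix {σ : Perm P} {W : List (List P)} (h : Words σ W) {p q : P} (hq : σ p = q)
    (hh : ∀ w ∈ W, ∀ z l, w = z :: l → z ≠ q) : ∃ w ∈ W, [p, q] <:+: w := by
  obtain ⟨w, hw, hp⟩ := h.exists_mem p
  obtain ⟨l₁, l₂, rfl⟩ := List.append_of_mem hp
  have := h.cyc _ hw p (l₂ ++ l₁) List.isRotated_append
  rw [hq] at this
  rcases l₂ with _ | ⟨y, l₂⟩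
  · rcases l₁ with _ | ⟨y, l₁⟩
    · exact (hh _ hw p [] rfl (by simpa using this.symm)).elim
    · exact (hh _ hw y _ rfl (by simpa using this.symm)).elim
  · obtain rfl : q = y := by simpa using this
    exact ⟨_, hw, l₁, l₂, by simp⟩

end Lists

/-! ### Gauss diagrams of curves with marked points -/

namespace Crossings

variable {P : Type}

/-- Add points without crossings. -/
def sumDummy (X : Crossings P) (V : Type) : Crossings (P ⊕ V) where
  mate := Sum.map X.mate id
  ε := Sum.elim X.ε 1
  up := Sum.elim X.up fun _ => true
  mate_mate p := by rcases p with p | p <;> simp [X.mate_mate]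
  ε_mate p h := by
    rcases p with p | p
    exacts [X.ε_mate p fun h' => h (congrArg Sum.inl h'), (h rfl).elim]
  up_mate p h := by
    rcases p with p | p
    exacts [X.up_mate p fun h' => h (congrArg Sum.inl h'), (h rfl).elim]

/-- A flow along a circle without crossings is always a boundary: its value on one side, zero on the
other. -/
lemma planar_sumDummy {V : Type} (σ : Perm P) (ρ : Perm V) (X : Crossings P) :
    Planar (Equiv.sumCongr σ ρ) (X.sumDummy V) ↔ Planar σ X := by
  have he : ∀ p a, edge (Equiv.sumCongr σ ρ) (Sum.inl p) a = Sum.inl (edge σ p a) := by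
    intro p a; unfold edge; split_ifs <;> rfl
  constructor
  · intro h x hx
    obtain ⟨H, hH⟩ := h (Sum.elim x 0) (by rintro (p | p); exacts [hx p, rfl])
    refine ⟨fun p => H (Sum.inl p), fun p => hH.jump (Sum.inl p),
      fun p hp => hH.dummy (Sum.inl p) (congrArg Sum.inl hp), fun p hp a b => ?_⟩
    have := hH.corner (Sum.inl p) (fun h => hp (Sum.inl_injective h)) a b
    rw [he] at this
    exact this.trans (congrArg (fun z => H z _) (he _ _))
  · intro h x hx
    obtain ⟨H, hH⟩ := h (fun p => x (Sum.inl p)) fun p => hx (Sum.inl p)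
    refine ⟨Sum.elim H fun v s => if s = 1 then x (Sum.inr v) else 0, ?_, ?_, ?_⟩
    · rintro (p | v)
      · exact hH.jump p
      · simp
    · rintro (p | v) hp
      · exact hH.dummy p (Sum.inl_injective hp)
      · funext s
        have : x (Sum.inr (ρ v)) = x (Sum.inr v) := hx.dummy hp
        simp [this]
    · rintro (p | v) hp a b
      · have := hH.corner p (fun h => hp (congrArg Sum.inl h)) a b
        rw [he]
        exact this.trans (congrArg (fun z => Sum.elim H _ z _) (he (X.mate p) b).symm)
      · exact (hp rfl).elim

end Crossings

namespace GaussDiagram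

open Crossings ArrowDiagram

variable {P : Type} {α β : Type}

/-- The Gauss diagram `G` of the link diagram `σ, X`, whose circles are read as the words `W`. -/
structure Rep (σ : Perm P) (X : Crossings P) (W : List (List P)) (G : GaussDiagram α)
    (ι : α × Bool → P) : Prop where
  words : Words σ W
  inj : Function.Injective ι
  dummy : ∀ z, z ∉ Set.range ι → X.mate z = z
  mate : ∀ p, X.mate (ι p) = ι (ArrowDiagram.flip p)
  ε : ∀ p, X.ε (ι p) = G.crossings.ε p
  up : ∀ p, X.up (ι p) = p.2
  circles : G.circles.map (List.map ι) = sift (· ∈ Set.range ι) W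

variable {σ : Perm P} {X Y : Crossings P} {W W' : List (List P)} {G : GaussDiagram α}
  {G' : GaussDiagram β} {ι : α × Bool → P} {ι' : β × Bool → P}

namespace Rep

lemma mem_range (h : Rep σ X W G ι) {z : P} : z ∈ Set.range ι ↔ X.mate z ≠ z := by
  refine ⟨?_, fun hz => by_contra fun h' => hz (h.dummy z h')⟩
  rintro ⟨p, rfl⟩ h'
  rw [h.mate] at h'
  exact G.crossings_mate_ne p (h.inj h')

lemma sgn (h : Rep σ X W G ι) (p : α × Bool) : X.sgn (ι p) = G.sign p.1 := by
  rw [← G.crossings_sgn p, Crossings.sgn, Crossings.sgn, h.up, h.ε]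
  rfl

lemma mem_circles (h : Rep σ X W G ι) {w' : List (α × Bool)} (hw' : w' ∈ G.circles) :
    ∃ w ∈ W, w'.map ι = w.filter fun z => @decide _ (propDecidable (z ∈ Set.range ι)) := by
  have : w'.map ι ∈ sift (· ∈ Set.range ι) W := h.circles ▸ List.mem_map.2 ⟨w', hw', rfl⟩
  obtain ⟨w, hw, hww'⟩ := List.mem_map.1 this
  exact ⟨w, hw, hww'.symm⟩

lemma base_eq {b : P} {w : List P} (h : Rep σ X ((b :: w) :: W') G ι) :
    G.base.map ι = (b :: w).filter fun z =>
      @decide _ (propDecidable (z ∈ Set.range ι)) :=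
  (List.cons.inj h.circles).1

lemma others_eq {v : List P} (h : Rep σ X (v :: W') G ι) :
    G.others.map (List.map ι) = sift (· ∈ Set.range ι) W' :=
  (List.cons.inj h.circles).2

lemma ret [DecidableEq α] (h : Rep σ X W G ι) (p : α × Bool) :
    Walk σ (· ∉ Set.range ι) (σ (ι p)) (ι (G.next p)) := by
  obtain ⟨w', hw', hp⟩ := List.mem_flatten.1 (G.complete p)
  obtain ⟨w, hw, hww'⟩ := h.mem_circles hw'
  obtain ⟨l', hl'⟩ := exists_isRotated_cons hp
  have hc : Cyc G.next w' := cyc_of_formPerm ((List.nodup_flatten.1 G.nodup).1 w' hw') fun x hx =>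
    prod_formPerm_apply G.nodup hw' hx
  rw [hc p l' hl']
  exact (h.words.cyc w hw).walk_ret (h.words.nodup_of_mem hw) h.inj hww' hl'

/-- Realizability in terms of the points. -/
lemma planar_iff [Finite P] [DecidableEq α] [Fintype α] (h : Rep σ X W G ι) :
    X.Planar σ ↔ G.IsClassical := by
  -- `R z` says that the circle of `z` carries an arrow. The remaining circles do not occur in
  -- `G.next` and are added as dummies.
  let R : P → Prop := fun z => ∃ p, Walk σ (fun _ => True) (ι p) z
  have hR : ∀ z, R (σ z) ↔ R z := fun z =>
    ⟨fun ⟨p, hp⟩ => ⟨p, hp.trans (Walk.head trivial (.refl _)).symm_of_perm⟩,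
      fun ⟨p, hp⟩ => ⟨p, hp.tail trivial⟩⟩
  rw [isClassical_iff, ← planar_sumDummy G.next (σ.subtypePerm (p := fun z => ¬ R z) fun z => not_congr (hR z))]
  have hι : ∀ p, R (ι p) := fun p => ⟨p, .refl _⟩
  refine (Emb.planar_iff (ι := Sum.elim ι Subtype.val) ⟨⟨?_, ?_, ?_⟩, ?_, ?_, ?_, ?_⟩).symm
  · rintro (p | p) (q | q) hpq
    · exact congrArg _ (h.inj hpq)
    · exact (q.2 ((show ι p = q from hpq) ▸ hι p)).elim
    · exact (p.2 ((show ι q = p from hpq.symm) ▸ hι q)).elim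
    · exact congrArg _ (Subtype.ext hpq)
  · rintro (p | p)
    · refine ((h.ret p).tail_induction (motive := fun z => R z ∧ Walk σ (· ∉ Set.range
        (Sum.elim ι Subtype.val)) (σ (ι p)) z) ⟨(hR _).2 (hι p), .refl _⟩
        fun z hz _ ih => ⟨(hR z).2 ih.1, ih.2.tail ?_⟩).2
      rintro ⟨q | q, rfl⟩
      · exact hz ⟨q, rfl⟩
      · exact q.2 ih.1
    · exact .refl _
  · intro z
    by_cases hz : R z
    · obtain ⟨p, hp⟩ := hz
      exact ⟨Sum.inl p, hp⟩
    · exact ⟨Sum.inr ⟨z, hz⟩, .refl _⟩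
  · rintro (p | p)
    · exact h.mate p
    · exact h.dummy p fun ⟨q, hq⟩ => p.2 (hq ▸ hι q)
  · exact fun z hz => h.dummy z fun ⟨p, hp⟩ => hz ⟨Sum.inl p, hp⟩
  · rintro (p | p) hp
    exacts [h.ε p, (hp rfl).elim]
  · rintro (p | p) hp
    exacts [h.up p, (hp rfl).elim]

lemma map_map_injective {Q : Type} {f : Q → P} (hf : Function.Injective f) :
    Function.Injective (List.map (List.map f)) := hf.list_map.list_map

/-- Every diagram has a Gauss diagram. -/
lemma _root_.Words.exists_rep [Finite P] [Nonempty P] (X : Crossings P) (hW : Words σ W) :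
    ∃ (n : ℕ) (G : GaussDiagram (Fin n)) (ι : Fin n × Bool → P), Rep σ X W G ι := by
  let T := {p // X.mate p ≠ p ∧ X.up p = true}
  obtain ⟨n, ⟨e⟩⟩ := Finite.exists_equiv_fin T
  let ι : Fin n × Bool → P := fun p => if p.2 then (e.symm p.1 : P) else X.mate (e.symm p.1)
  have hup : ∀ p, X.up (ι p) = p.2 := by
    rintro ⟨i, _ | _⟩
    · show X.up (X.mate _) = _
      rw [X.up_mate _ (e.symm i).2.1, (e.symm i).2.2]; rfl
    · exact (e.symm i).2.2
  have hinj : Function.Injective ι := by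
    rintro ⟨i, s⟩ ⟨j, t⟩ h
    have h1 := congrArg X.up h
    rw [hup, hup] at h1
    obtain rfl : s = t := h1
    have : (e.symm i : P) = e.symm j := by
      cases s
      · exact X.mate_inj.1 h
      · exact h
    rw [e.symm.injective (Subtype.ext this)]
  have hr : ∀ z, X.mate z ≠ z → z ∈ Set.range ι := by
    intro z hz
    have := X.up_mate z hz
    have := X.mate_mate z
    rcases hu : X.up z with _ | _
    · exact ⟨(e ⟨X.mate z, by grind⟩, false), by simp [ι, this]⟩
    · exact ⟨(e ⟨z, hz, hu⟩, true), by simp [ι]⟩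
  obtain ⟨C, hC⟩ := exists_map_map_eq (ι := ι) (sift (· ∈ Set.range ι) W) (sift_range _ _)
  have hfl : C.flatten.map ι = W.flatten.filter fun z =>
      @decide _ (propDecidable (z ∈ Set.range ι)) := by
    rw [List.map_flatten, hC, flatten_sift]
  rcases C with _ | ⟨b, C⟩
  · obtain ⟨z⟩ := ‹Nonempty P›
    obtain ⟨w, hw, -⟩ := hW.exists_mem z
    rw [List.map_nil, sift, eq_comm, List.map_eq_nil_iff] at hC
    simp [hC] at hw
  refine ⟨n, ⟨⟨b, C, ?_, fun p => ?_⟩, fun i => X.sgn (e.symm i)⟩, ι, hW, hinj, fun z hz => ?_, ?_, ?_, hup, hC⟩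
  · exact List.Nodup.of_map ι (hfl ▸ hW.nodup.filter _)
  · have : ι p ∈ (b :: C).flatten.map ι := by
      rw [hfl]; exact List.mem_filter.2 ⟨hW.complete _, by simp⟩
    obtain ⟨q, h1, h2⟩ := List.mem_map.1 this
    rwa [← hinj h2]
  · exact not_not.1 fun h => hz (hr z h)
  · rintro ⟨i, _ | _⟩
    · exact X.mate_mate _
    · rfl
  · rintro ⟨i, _ | _⟩ <;> have h1 := (e.symm i).2.1 <;> have h2 := (e.symm i).2.2
    · show X.ε (X.mate _) = -X.sgn _
      rw [X.ε_mate _ h1, Crossings.sgn, if_pos h2]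
    · show X.ε _ = X.sgn _
      rw [Crossings.sgn, if_pos h2]
      rfl

/-- Comparison of the labels of two Gauss diagrams with crossings in common. -/
lemma exists_labels (h : Rep σ X W G ι) {σ' : Perm P} (h' : Rep σ' Y W' G' ι')
    (hY : ∀ z, Y.mate z ≠ z → X.mate z = Y.mate z ∧ X.ε z = Y.ε z ∧ X.up z = Y.up z) :
    ∃ κ : β ↪ α, (∀ b, G'.sign b = G.sign (κ b)) ∧ ∀ p, ι (Prod.map κ id p) = ι' p := by
  have hr : ∀ p, Y.mate (ι' p) ≠ ι' p := fun p => h'.mem_range.1 ⟨p, rfl⟩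
  have : ∀ b, ∃ a, ι (a, true) = ι' (b, true) := by
    intro b
    obtain ⟨h1, -, h3⟩ := hY _ (hr (b, true))
    obtain ⟨⟨a, s⟩, ha⟩ := h.mem_range.2 (h1 ▸ hr (b, true))
    have := h.up (a, s)
    rw [ha, h3, h'.up] at this
    exact ⟨a, by rw [← ha, show s = true from this.symm]⟩
  choose κ hκ using this
  have hκ' : ∀ p, ι (Prod.map κ id p) = ι' p := by
    rintro ⟨b, _ | _⟩
    · have h1 := h.mate (κ b, true)
      have h2 := h'.mate (b, true)
      rw [hκ, (hY _ (hr _)).1, h2] at h1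
      exact h1.symm
    · exact hκ b
  refine ⟨⟨κ, fun b c hbc => ?_⟩, fun b => ?_, hκ'⟩
  · have h1 := (hκ b).symm.trans ((congrArg (fun a => ι (a, true)) hbc).trans (hκ c))
    exact congrArg Prod.fst (h'.inj h1)
  · have h1 := hr (b, true)
    have h2 := hY _ h1
    rw [← h'.sgn (b, true)]
    show _ = G.sign (κ b)
    rw [← h.sgn (κ b, true), hκ, Crossings.sgn, Crossings.sgn, h2.2.1, h2.2.2]

/-- The circles of a diagram with fewer crossings. -/
lemma circles_of_labels (h : Rep σ X W G ι) {σ' : Perm P} (h' : Rep σ' Y W' G' ι')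
    {κ : β → α} (hκ : ∀ p, ι (Prod.map κ id p) = ι' p) {C : List (List (α × Bool))}
    (hC : sift (· ∈ Set.range ι') (C.map (List.map ι)) = sift (· ∈ Set.range ι') W') :
    G'.circles.map (List.map (Prod.map κ id)) = sift (fun p => ι p ∈ Set.range ι') C := by
  refine map_map_injective h.inj ?_
  rw [List.map_map, ← sift_map, hC, ← h'.circles]
  refine List.map_congr_left fun w _ => ?_
  rw [Function.comp, List.map_map]
  exact List.map_congr_left fun p _ => hκ p

lemma sift_circles (h : Rep σ X W G ι) (h' : Set.range ι' ⊆ Set.range ι) :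
    sift (· ∈ Set.range ι') (G.circles.map (List.map ι)) = sift (· ∈ Set.range ι') W := by
  rw [h.circles, sift_sift _ _ _ fun z hz => h' hz]

lemma sift_eq_self {Q : Type} {K : Q → Prop} {C : List (List Q)} (h : ∀ w ∈ C, ∀ z ∈ w, K z) :
    sift K C = C := by
  unfold sift
  conv_rhs => rw [← List.map_id C]
  exact List.map_congr_left fun w hw => List.filter_eq_self.2 fun z hz => by simpa using h w hw z hz

/-- Gauss diagrams of the same diagram. -/
lemma sameUnbased (h : Rep σ X W G ι) (h' : Rep σ X W' G' ι') : G.SameUnbased G' := by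
  obtain ⟨κ, h1, h2⟩ := h'.exists_labels h fun z _ => ⟨rfl, rfl, rfl⟩
  have hr : Set.range ι = Set.range ι' := by ext z; rw [h.mem_range, h'.mem_range]
  have hκ : Function.Surjective κ := by
    intro b
    obtain ⟨p, hp⟩ : ι' (b, true) ∈ Set.range ι := hr ▸ ⟨_, rfl⟩
    exact ⟨p.1, congrArg Prod.fst (h'.inj ((h2 p).trans hp))⟩
  refine ⟨Equiv.ofBijective κ ⟨κ.injective, hκ⟩, fun a => (h1 a).symm, ?_⟩
  obtain ⟨L, hL1, hL2⟩ := h.words.unique h'.words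
  obtain ⟨L', hL'⟩ := exists_map_map_eq (ι := ι') (sift (· ∈ Set.range ι') L) (sift_range _ _)
  refine ⟨L', ?_, ?_⟩
  · rw [← List.map_perm_map_iff h'.inj.list_map, List.map_map]
    have : (List.map ι' ∘ List.map (Prod.map κ id)) = List.map ι := by
      funext w
      rw [Function.comp, List.map_map]
      exact List.map_congr_left fun p _ => h2 p
    show ((List.map (List.map ι' ∘ List.map (Prod.map κ id)) _).Perm _)
    rw [this, h.circles, hL', hr]
    exact hL1.map _
  · have h3 : List.Forall₂ List.IsRotated (L'.map (List.map ι')) (G'.circles.map (List.map ι')) := by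
      rw [hL', h'.circles]
      unfold sift
      rw [List.forall₂_map_left_iff, List.forall₂_map_right_iff]
      exact hL2.imp fun _ _ hr => IsRotated.filter _ hr
    rw [List.forall₂_map_left_iff, List.forall₂_map_right_iff] at h3
    exact h3.imp fun _ _ hr => isRotated_of_map h'.inj hr

/-- Diagrams that agree up to labels and base points are Gauss diagrams of the same diagram. -/
lemma of_sameUnbased (h : Rep σ X W G ι) (hG : G.SameUnbased G') :
    ∃ W' ι', Rep σ X W' G' ι' := by
  obtain ⟨e, hs, L, hL1, hL2⟩ := hG
  let ι' : β × Bool → P := fun p => ι (Prod.map e.symm id p)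
  have hi : Function.Injective (Prod.map e.symm (id : Bool → Bool)) :=
    Function.Injective.prodMap e.symm.injective Function.injective_id
  have hr : Set.range ι' = Set.range ι := by
    refine subset_antisymm ?_ ?_ <;> rintro _ ⟨p, rfl⟩
    exacts [⟨_, rfl⟩, ⟨(e p.1, p.2), by simp [ι']⟩]
  have h1 : (List.map (List.map ι') (G.circles.map (List.map (Prod.map e id)))) =
      sift (· ∈ Set.range ι) W := by
    rw [← h.circles, List.map_map]
    refine List.map_congr_left fun w _ => ?_
    rw [Function.comp, List.map_map]
    exact List.map_congr_left fun p _ => congrArg ι (by simp [Prod.map])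
  have h2 := hL1.map (List.map ι')
  rw [h1] at h2
  have h3 : List.Forall₂ List.IsRotated (L.map (List.map ι')) (G'.circles.map (List.map ι')) := by
    rw [List.forall₂_map_left_iff, List.forall₂_map_right_iff]
    exact hL2.imp fun _ _ hr => hr.map ι'
  obtain ⟨W', ⟨L', hL', hW'⟩, hf⟩ := exists_filter_reordered _ h2 h3
  refine ⟨W', ι', h.words.reordered hL' hW', h.inj.comp hi, fun z hz => h.dummy z (hr ▸ hz),
    fun p => h.mate _, fun p => ?_, fun p => h.up _, ?_⟩
  · show X.ε (ι _) = _
    rw [h.ε]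
    have := hs (e.symm p.1)
    simp only [Equiv.apply_symm_apply] at this
    simp [crossings, this]
  · rw [hr]; exact hf.symm

/-- Deleting points without crossings. -/
lemma of_emb {Q : Type} [Finite P] {j : Q → P} {σ' : Perm Q} {X' : Crossings Q}
    (h : Rep σ X W G ι) (hj : Emb j σ' X' σ X) : ∃ W' ι', Rep σ' X' W' G ι' := by
  have : ∀ p, ∃ q, j q = ι p := fun p => by
    by_contra h'
    exact h.mem_range.1 ⟨p, rfl⟩ (hj.dummy _ fun ⟨q, hq⟩ => h' ⟨q, hq⟩)
  choose ι' hι' using this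
  obtain ⟨W', hW', hf⟩ := hj.toEmbeds.words h.words
  have hm : ∀ p, X'.mate (ι' p) = ι' (ArrowDiagram.flip p) := fun p => hj.inj (by
    rw [← hj.mate, hι', h.mate, hι'])
  have hr : ∀ q, j q ∈ Set.range ι ↔ q ∈ Set.range ι' := by
    exact fun q => ⟨fun ⟨p, hp⟩ => ⟨p, hj.inj ((hι' p).trans hp)⟩,
      fun ⟨p, hp⟩ => ⟨p, hp ▸ (hι' p).symm⟩⟩
  have hi : Function.Injective ι' := fun p q hpq => h.inj (by rw [← hι', hpq, hι'])
  have hne : ∀ p, X'.mate (ι' p) ≠ ι' p := fun p h' => G.crossings_mate_ne p (hi (by rw [← h', hm]; rfl))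
  refine ⟨W', ι', hW', hi, fun q hq => ?_, hm, fun p => ?_, fun p => ?_, ?_⟩
  · have := h.dummy _ fun h' => hq ((hr q).1 h')
    rw [hj.mate] at this
    exact hj.inj this
  · rw [← hj.ε _ (hne p), hι', h.ε]
  · rw [← hj.up _ (hne p), hι', h.up]
  · refine map_map_injective hj.inj ?_
    have h1 : sift (· ∈ Set.range ι') W' = sift (fun q => j q ∈ Set.range ι) W' := by
      congr 1; funext q; exact propext (hr q).symm
    rw [h1, ← sift_map, hf, sift_sift _ _ _ fun z ⟨p, hp⟩ => ⟨ι' p, (hι' p).trans hp⟩, ← h.circles,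
      List.map_map]
    refine List.map_congr_left fun w _ => ?_
    rw [Function.comp, List.map_map]
    exact List.map_congr_left fun p _ => hι' p

end Rep

end GaussDiagram

/-! ### Exchanging over and under: ascending and descending together -/

namespace Crossings

/-- The crossings, or the crossings with over and under exchanged. -/
def turn {P : Type} (X : Crossings P) : Bool → Crossings P
  | true => X
  | false => X.rev

variable {P : Type} (X : Crossings P) (t : Bool)

@[simp] lemma turn_mate : (X.turn t).mate = X.mate := by cases t <;> rfl

@[simp] lemma turn_sgn (p : P) : (X.turn t).sgn p = X.sgn p := by
  cases t
  · exact X.rev_sgn p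
  · rfl

lemma turn_up (p : P) : (X.turn t).up p = (X.up p == t) := by
  cases t <;> cases h : X.up p <;> simp [turn, rev, h]

@[simp] lemma turn_flip (S : Finset P) : (X.turn t).flip S = X.flip S := by cases t <;> rfl

lemma mem_turn_tails [Fintype P] {z : P} :
    z ∈ (X.turn t).tails ↔ X.mate z ≠ z ∧ X.up z = t := by
  rw [mem_tails, turn_mate, turn_up]
  simp

end Crossings

/-! ### Smoothing all arrows: boundary components and ascending diagrams -/

namespace GaussDiagram

open Crossings ArrowDiagram

lemma Rep.mem_tails {P α : Type} [Fintype P] {σ : Perm P} {X : Crossings P}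
    {W : List (List P)} {G : GaussDiagram α} {ι : α × Bool → P} (h : Rep σ X W G ι) {t : Bool}
    {z : P} : z ∈ (X.turn t).tails ↔ ∃ a, ι (a, t) = z := by
  rw [mem_turn_tails]
  constructor
  · rintro ⟨h1, h2⟩
    obtain ⟨⟨a, s⟩, rfl⟩ := h.mem_range.2 h1
    rw [h.up] at h2
    exact ⟨a, by rw [← h2]⟩
  · rintro ⟨a, rfl⟩
    exact ⟨h.mem_range.1 ⟨_, rfl⟩, h.up _⟩

variable {P : Type} {β : Type} [DecidableEq β] [Fintype β] [Fintype P] {σ : Perm P}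
  {Y : Crossings P} {W' : List (List P)} {A : GaussDiagram β} {ι : β × Bool → P} {b : P}
  {w : List P}

/-- Ascending diagrams for `t = true`, descending diagrams for `t = false`. -/
def Monotone {α : Type} [DecidableEq α] (t : Bool) (A : ArrowDiagram α) : Prop :=
  ∀ p ∈ A.base.head?, ∀ (a : α) (k : ℕ),
    A.trace^[k] p = (a, t) → ∃ j < k, A.trace^[j] p = (a, !t)

/-- The trace as a permutation. -/
def tracePerm {α : Type} [DecidableEq α] (A : ArrowDiagram α) : Perm (α × Bool) :=
  A.next * Function.Involutive.toPerm ArrowDiagram.flip fun p => by simp [ArrowDiagram.flip]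

lemma walk_trace_iff {p q : β × Bool} :
    Walk A.trace (fun _ => True) p q ↔
      (Quot.mk _ p : Quot fun p q : β × Bool => q = A.trace p) = Quot.mk _ q := by
  constructor
  · intro h
    exact h.tail_induction (motive := fun z => (Quot.mk _ p : Quot fun p q => q = A.trace p) =
      Quot.mk _ z) rfl fun z _ _ ih => ih.trans (Quot.sound rfl)
  · intro h
    let f : (Quot fun p q : β × Bool => q = A.trace p) → Prop :=
      Quot.lift (fun z => Walk A.trace (fun _ => True) p z) (by
        rintro z _ rfl
        refine propext ⟨fun h => h.tail trivial, fun h => h.trans ?_⟩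
        exact (Walk.head (τ := tracePerm A.toArrowDiagram) trivial (.refl _)).symm_of_perm)
    have : f (Quot.mk _ p) := .refl p
    rwa [h] at this

namespace Rep

lemma walk_smooth (h : Rep σ Y ((b :: w) :: W') A ι) {x y : P}
    (hw : Walk σ (· ∉ Set.range ι) x y) :
    Walk (fun z => σ (Y.mate z)) (· ∉ Set.range ι) x y :=
  hw.tail_induction (.refl _) fun z hz _ ih => by
    have := ih.tail hz
    rwa [h.dummy z hz] at this

/-- The boundary of the ribbon surface is the curve with all crossings smoothed; `trace` is its
first return map to the endpoints of arrows. -/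
lemma ret_smooth (h : Rep σ Y ((b :: w) :: W') A ι) (p : β × Bool) :
    Walk (fun z => σ (Y.mate z)) (· ∉ Set.range ι) (σ (Y.mate (ι p))) (ι (A.trace p)) := by
  rw [h.mate]
  exact h.walk_smooth (h.ret _)

lemma walk_head (h : Rep σ Y ((b :: w) :: W') A ι) {p : β × Bool} {l : List (β × Bool)}
    (hp : A.base = p :: l) : Walk (fun z => σ (Y.mate z)) (· ∉ Set.range ι) b (ι p) := by
  refine h.walk_smooth ?_
  have h1 := h.base_eq
  rw [hp, List.map_cons] at h1
  by_cases hb : b ∈ Set.range ι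
  · rw [List.filter_cons_of_pos (by simpa using hb)] at h1
    rw [(List.cons.inj h1).1]
    exact .refl _
  · rw [List.filter_cons_of_neg (by simpa using hb)] at h1
    have := (h.words.cyc _ List.mem_cons_self).walk_filter
      (K := fun z => @decide _ (propDecidable (z ∈ Set.range ι)))
    rw [← h1] at this
    exact Walk.head hb (by simpa using this)

lemma flip_tails (t : Bool) : (σ * (Y.turn t).flip (Y.turn t).tails : Perm P) =
    (fun z => σ (Y.mate z) : P → P) := by
  funext z
  rw [turn_flip, Perm.mul_apply, flip_apply]
  split_ifs with h
  · rfl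
  · have := Y.up_mate z
    cases t <;> grind [mem_turn_tails, Y.mate_mate]

/-- The components of the smoothed curve are the cycles of `trace` and the circles without arrows,
which are the two kinds counted by `numBoundary`. -/
lemma conn_iff (h : Rep σ Y ((b :: w) :: W') A ι) :
    Conn (fun z => σ (Y.mate z)) b ↔ A.numBoundary = 1 := by
  classical
  have hperm : (fun z => σ (Y.mate z)) = ((σ * Function.Involutive.toPerm Y.mate Y.mate_mate :
    Perm P) : P → P) := rfl
  have hclosed : ∀ v ∈ (b :: w) :: W', (v.filter fun z => @decide _ (propDecidable
      (z ∈ Set.range ι))) = [] → ∀ x ∈ v, ∀ y, Walk (fun z => σ (Y.mate z)) (fun _ => True) x y →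
      y ∈ v ∧ y ∉ Set.range ι := by
    intro v hv h0 x hx y hw
    have hd : ∀ y ∈ v, y ∉ Set.range ι := fun y hy => by
      have := List.filter_eq_nil_iff.1 h0 y hy
      simpa using this
    have : y ∈ v := hw.tail_induction hx fun z _ _ hz => by
      rw [h.dummy z (hd z hz)]; exact (h.words.cyc v hv).mem hz
    exact ⟨this, hd y this⟩
  have hq : Nonempty (β × Bool) →
      0 < Nat.card (Quot fun p q : β × Bool => q = A.trace p) := by
    rintro ⟨p⟩
    exact Nat.card_pos_iff.2 ⟨⟨Quot.mk _ p⟩, inferInstance⟩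
  have hempty : [] ∈ A.circles → ∃ v ∈ (b :: w) :: W', (v.filter fun z =>
      @decide _ (propDecidable (z ∈ Set.range ι))) = [] := fun h0 => by
    obtain ⟨v, hv, hv0⟩ := h.mem_circles h0
    exact ⟨v, hv, hv0.symm⟩
  unfold numBoundary
  -- If the based circle has no arrows, it is already a component, and both sides say that there is
  -- nothing else.
  rcases hbase : A.base with _ | ⟨p₀, l⟩
  · have hb0 : ((b :: w).filter fun z => @decide _ (propDecidable (z ∈ Set.range ι))) = [] := by
      rw [← h.base_eq, hbase]; rfl
    have hcount : A.circles.count [] = A.others.count [] + 1 := by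
      rw [ArrowDiagram.circles, hbase, List.count_cons_self]
    constructor
    · intro hc
      have hall : ∀ y, y ∈ b :: w ∧ y ∉ Set.range ι := fun y =>
        hclosed _ List.mem_cons_self hb0 b List.mem_cons_self y (hc y)
      have hW' : W' = [] := by
        rcases W' with _ | ⟨v, W'⟩
        · rfl
        · rcases v with _ | ⟨x, v⟩
          · exact (h.words.ne (by simp)).elim
          · have := h.words.nodup
            rw [List.flatten_cons, List.nodup_append] at this
            exact (this.2.2 x (hall x).1 x (by simp) rfl).elim
      have ho : A.others = [] := by
        simpa [sift, hW'] using h.others_eq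
      have : IsEmpty (β × Bool) := ⟨fun p => (hall (ι p)).2 ⟨p, rfl⟩⟩
      rw [hcount, ho, Nat.card_of_isEmpty]; rfl
    · intro hn y
      have h1 : IsEmpty (β × Bool) := by
        by_contra h1
        have := hq (not_isEmpty_iff.1 h1)
        omega
      have ho : A.others = [] := by
        rcases ho : A.others with _ | ⟨v, o⟩
        · rfl
        · rcases v with _ | ⟨p, v⟩
          · rw [hcount, ho, List.count_cons_self] at hn; omega
          · exact h1.elim p
      have hW' : W' = [] := by
        simpa [sift, ho] using h.others_eq.symm
      subst hW'
      have hy : y ∈ b :: w := by simpa using h.words.complete y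
      have := cyc_walk (h.words.cyc _ List.mem_cons_self) (List.mem_cons_self (a := b)) hy
      have hσ : (fun z => σ (Y.mate z)) = σ := funext fun z => by
        rw [h.dummy z fun ⟨p, _⟩ => h1.elim p]
      rwa [hσ]
  · have hp₀ := h.walk_head hbase
    have hwr : ∀ p q, Walk (fun z => σ (Y.mate z)) (fun _ => True) (ι p) (ι q) ↔
        Walk A.trace (fun _ => True) p q := fun p q =>
      walk_ret (A := fun _ => True) h.inj h.ret_smooth fun _ _ => trivial
    constructor
    · intro hc
      have h0 : [] ∉ A.circles := fun h0 => by
        obtain ⟨v, hv, hv0⟩ := hempty h0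
        rcases v with _ | ⟨x, v⟩
        · exact h.words.ne hv
        have h1 := hc x
        rw [hperm] at h1
        refine (hclosed _ hv hv0 x List.mem_cons_self (ι p₀) ?_).2 ⟨_, rfl⟩
        exact (h1.symm_of_perm).trans (hp₀.mono fun _ _ => trivial)
      rw [List.count_eq_zero_of_not_mem h0, add_zero]
      refine Nat.card_eq_one_iff_unique.2 ⟨⟨?_⟩, ⟨Quot.mk _ p₀⟩⟩
      have : ∀ c : Quot fun p q : β × Bool => q = A.trace p, Quot.mk _ p₀ = c := by
        rintro ⟨q⟩
        refine walk_trace_iff.1 ((hwr p₀ q).1 ?_)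
        have h1 := hp₀.mono (B := fun _ => True) fun _ _ => trivial
        have h2 := hc (ι q)
        rw [hperm] at h1 h2 ⊢
        exact h1.symm_of_perm.trans h2
      exact fun c d => (this c).symm.trans (this d)
    · intro hn
      have h1 := hq ⟨p₀⟩
      have h0 : [] ∉ A.circles := fun h0 => by
        have := List.count_pos_iff.2 h0
        omega
      have h2 := (Nat.card_eq_one_iff_unique.1 (show Nat.card (Quot fun p q : β × Bool =>
        q = A.trace p) = 1 by omega)).1
      have hr : ∀ q, Walk (fun z => σ (Y.mate z)) (fun _ => True) b (ι q) := fun q =>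
        (hp₀.mono fun _ _ => trivial).trans ((hwr p₀ q).2 (walk_trace_iff.2 (h2.allEq _ _)))
      have hA : Words A.next A.circles := ⟨A.nodup, A.complete, h0, fun v hv =>
        cyc_of_formPerm ((List.nodup_flatten.1 A.nodup).1 v hv) fun x hx =>
          prod_formPerm_apply A.nodup hv hx⟩
      intro z
      by_cases hz : z ∈ Set.range ι
      · obtain ⟨q, rfl⟩ := hz; exact hr q
      · obtain ⟨q, hq⟩ := (h.words.embeds hA h.inj h.circles).reach' hz
        refine (hr (ArrowDiagram.flip q)).trans (Walk.head trivial ?_)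
        rw [h.mate, show ArrowDiagram.flip (ArrowDiagram.flip q) = q by simp [ArrowDiagram.flip]]
        exact (h.walk_smooth hq).mono fun _ _ => trivial

/-- Only the empty diagram is connected without endpoints on the based circle. -/
lemma exists_base (h : Rep σ Y ((b :: w) :: W') A ι) (hc : Conn (fun z => σ (Y.mate z)) b)
    (p : β × Bool) : ∃ p₀ l, A.base = p₀ :: l := by
  rcases hbase : A.base with _ | ⟨p₀, l⟩
  · have hb0 := h.base_eq
    rw [hbase, List.map_nil, eq_comm, List.filter_eq_nil_iff] at hb0
    have hb0 : ∀ z ∈ b :: w, z ∉ Set.range ι := fun z hz => by simpa using hb0 z hz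
    have := (hc (ι p)).tail_induction (motive := (· ∈ b :: w)) List.mem_cons_self
      fun y _ _ hy => by
        rw [h.dummy y (hb0 y hy)]
        exact (h.words.cyc _ List.mem_cons_self).mem hy
    exact (hb0 _ this ⟨p, rfl⟩).elim
  · exact ⟨p₀, l, rfl⟩

/-- Smoothing all crossings. -/
lemma good_iff (h : Rep σ Y ((b :: w) :: W') A ι) (t : Bool) :
    (Y.turn t).Good σ b (Y.turn t).tails ↔ A.numBoundary = 1 ∧ Monotone t A.toArrowDiagram := by
  unfold Good
  rw [flip_tails, h.conn_iff]
  refine and_congr_right fun hn => ?_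
  rcases hbase : A.base with _ | ⟨p₀, l⟩
  · refine iff_of_true (fun z hz => ?_) fun p hp => ?_
    · obtain ⟨a, -⟩ := h.mem_tails.1 hz
      obtain ⟨p₀, l, h1⟩ := h.exists_base (h.conn_iff.2 hn) (a, t)
      rw [hbase] at h1; simp at h1
    · rw [hbase] at hp; simp at hp
  · have hp₀ := h.walk_head hbase
    have hb : ∀ a, Before (fun z => σ (Y.mate z)) b (Y.mate (ι (a, t))) (ι (a, t)) ↔
        Before A.trace p₀ (a, !t) (a, t) := by
      intro a
      rw [h.mate]
      show (¬ _) ↔ ¬ _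
      refine not_congr ?_
      have h1 := walk_ret (A := fun z => z ≠ ι (a, !t)) (x := p₀) (y := (a, t)) h.inj h.ret_smooth
        fun z hz h => hz ⟨_, Eq.symm h⟩
      have h2 : Walk A.trace (fun q => ι q ≠ ι (a, !t)) p₀ (a, t) ↔
          Walk A.trace (fun q => q ≠ (a, !t)) p₀ (a, t) := by
        simp only [ne_eq, h.inj.eq_iff]
      rw [← h2, ← h1]
      have h3 := hp₀.mono (B := fun z => z ≠ ι (a, !t)) fun z hz h => hz ⟨_, Eq.symm h⟩
      refine ⟨fun h4 => ?_, fun h4 => h3.trans h4⟩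
      obtain ⟨r, hr, h5, h6⟩ := h4.first (· ∈ Set.range ι) ⟨_, rfl⟩
      have h7 : r = ι p₀ := walk_unique (A := (· ∉ Set.range ι)) (not_not.2 hr) (by simp)
        (h5.mono fun _ h => h.2) hp₀
      rwa [h7] at h6
    unfold Monotone
    simp only [hbase, List.head?_cons, Option.mem_some_iff, forall_eq', turn_mate, h.mem_tails,
      forall_exists_index, forall_apply_eq_imp_iff]
    exact forall_congr' fun a => (hb a).trans before_iff_iterate

end Rep

end GaussDiagram

/-! ### Isomorphisms of arrow diagrams -/

section Matching

open List

variable {P : Type}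

lemma index_unique {W : List (List P)} (hn : W.flatten.Nodup) {i j : Fin W.length} {x : P}
    (hi : x ∈ W.get i) (hj : x ∈ W.get j) : i = j := by
  have h := List.pairwise_iff_get.1 (List.nodup_flatten.1 hn).2
  rcases lt_trichotomy i j with hij | hij | hij
  · exact (h i j hij hi hj).elim
  · exact hij
  · exact (h j i hij hj hi).elim

lemma isRotated_of_eq {l l' : List P} (h : l = l') : l ~r l' := h ▸ .refl _

lemma get_of_map_eq {A B C : Type} {l : List A} {l' : List B} {f : A → C} {g : B → C}
    (h : l.map f = l'.map g) (hl : l.length = l'.length) (i : Fin l.length) :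
    f (l.get i) = g (l'.get (Fin.cast hl i)) := by
  have := List.get_of_eq h ⟨i, by simp⟩
  simpa using this

lemma exists_matching {A B : List (List P)} (hA : A.flatten.Nodup) (hB : B.flatten.Nodup)
    (hA0 : [] ∉ A) (hB0 : [] ∉ B) (h : ∀ w ∈ A, ∃ v ∈ B, w ~r v) (h' : ∀ v ∈ B, ∃ w ∈ A, v ~r w) :
    ∃ e : Fin A.length ≃ Fin B.length, ∀ i, A.get i ~r B.get (e i) := by
  have h1 : ∀ i, ∃ j, A.get i ~r B.get j := fun i => by
    obtain ⟨v, hv, hr⟩ := h _ (List.get_mem A i)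
    obtain ⟨j, rfl⟩ := List.get_of_mem hv
    exact ⟨j, hr⟩
  have h2 : ∀ j, ∃ i, B.get j ~r A.get i := fun j => by
    obtain ⟨v, hv, hr⟩ := h' _ (List.get_mem B j)
    obtain ⟨i, rfl⟩ := List.get_of_mem hv
    exact ⟨i, hr⟩
  choose f hf using h1
  choose g hg using h2
  have key : ∀ {A : List (List P)}, A.flatten.Nodup → [] ∉ A → ∀ i j, A.get i ~r A.get j → j = i := by
    intro A hA hA0 i j hr
    obtain ⟨x, hx⟩ := List.exists_mem_of_ne_nil (A.get i) fun h0 => hA0 (h0 ▸ List.get_mem A i)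
    exact index_unique hA (hr.mem_iff.1 hx) hx
  exact ⟨⟨f, g, fun i => key hA hA0 i _ ((hf i).trans (hg _)),
    fun j => key hB hB0 j _ ((hg j).trans (hf _))⟩, hf⟩

end Matching

namespace ArrowDiagram

variable {k : ℕ} {A B C : ArrowDiagram (Fin k)}

/-- An injection of `Fin k` into itself is bijective, so the filters in `Hom` keep everything. -/
lemma iso_iff : Iso A B ↔ ∃ (e : Perm (Fin k)) (c : Fin A.others.length ≃ Fin B.others.length),
    A.base.map (Prod.map e id) = B.base ∧
      ∀ i, List.IsRotated ((A.others.get i).map (Prod.map e id)) (B.others.get (c i)) := by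
  have hf : ∀ (e : Fin k ↪ Fin k) (inst : DecidablePred fun p : Fin k × Bool => ∃ a, e a = p.1)
      (l : List (Fin k × Bool)), l.filter (fun p => ∃ a, e a = p.1) = l := fun e _ l => by
    have := Finite.surjective_of_injective e.injective
    exact List.filter_eq_self.2 fun p _ => by simpa using this p.1
  constructor
  · rintro ⟨φ⟩
    refine ⟨Equiv.ofBijective φ.arrow (Finite.injective_iff_bijective.1 φ.arrow.injective), φ.circle,
      ?_, fun i => ?_⟩
    · exact φ.map_base.trans (hf _ _ _)
    · exact (φ.map_others i).trans (isRotated_of_eq (hf _ _ _))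
  · rintro ⟨e, c, h1, h2⟩
    refine ⟨⟨e.toEmbedding, c, ?_, fun i => ?_⟩⟩
    · exact h1.trans (hf _ _ _).symm
    · exact (h2 i).trans (isRotated_of_eq (hf _ _ _).symm)

lemma Iso.symm (h : Iso A B) : Iso B A := by
  obtain ⟨e, c, h1, h2⟩ := iso_iff.1 h
  have he : ∀ l : List (Fin k × Bool), (l.map (Prod.map e id)).map (Prod.map e.symm id) = l := by
    intro l; rw [List.map_map]; convert List.map_id l; ext p <;> simp [Prod.map]
  refine iso_iff.2 ⟨e.symm, c.symm, by rw [← h1, he], fun i => ?_⟩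
  have := ((h2 (c.symm i)).map (Prod.map e.symm id)).symm
  rwa [he, Equiv.apply_symm_apply] at this

/-- An isomorphism followed by a homomorphism. -/
lemma Iso.exists_comp {β : Type} [DecidableEq β] {D : ArrowDiagram β} (h : Iso A B) (ψ : Hom B D) :
    ∃ φ : Hom A D, ∃ e : Perm (Fin k), ∀ a, φ.arrow a = ψ.arrow (e a) := by
  obtain ⟨e, c, h1, h2⟩ := iso_iff.1 h
  have hf : ∀ (l : List (β × Bool)) (i₁ : DecidablePred fun p : β × Bool => ∃ a, ψ.arrow (e a) = p.1)
      (i₂ : DecidablePred fun p : β × Bool => ∃ a, ψ.arrow a = p.1),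
      l.filter (fun p => ∃ a, ψ.arrow a = p.1) = l.filter (fun p => ∃ a, ψ.arrow (e a) = p.1) :=
    fun l _ _ => List.filter_congr fun p _ => by
      rw [decide_eq_decide, e.symm.exists_congr_left]; simp
  have hm : ∀ l : List (Fin k × Bool), l.map (Prod.map (fun a => ψ.arrow (e a)) id) =
      (l.map (Prod.map e id)).map (Prod.map ψ.arrow id) := fun l => by simp [Prod.map]
  refine ⟨⟨e.toEmbedding.trans ψ.arrow, c.trans ψ.circle, ?_, fun i => ?_⟩, e, fun a => rfl⟩
  · refine (hm _).trans ?_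
    rw [h1]
    exact ψ.map_base.trans (hf _ _ _)
  · have := (((h2 i).map (Prod.map ψ.arrow id)).trans (ψ.map_others (c i)))
    rw [← hm] at this
    exact this.trans (isRotated_of_eq (hf _ _ _))

lemma Iso.trans (h : Iso A B) (h' : Iso B C) : Iso A C := by
  obtain ⟨ψ⟩ := h'
  exact ⟨(h.exists_comp ψ).choose⟩

lemma Iso.refl (A : ArrowDiagram (Fin k)) : Iso A A :=
  iso_iff.2 ⟨.refl _, .refl _, by simp, fun i => by simp [List.IsRotated.refl]⟩

/-- `Iso` is an equivalence relation, so the quotient makes no further identifications. -/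
lemma iso_of_mk_eq (h : (Quot.mk _ A : Class k) = Quot.mk _ B) : Iso A B := by
  have key : ∀ {A B : ArrowDiagram (Fin k)}, Relation.EqvGen Iso A B → Iso A B := by
    intro A B h
    induction h with
    | rel _ _ h => exact h
    | refl A => exact .refl A
    | symm _ _ _ ih => exact ih.symm
    | trans _ _ _ _ _ ih ih' => exact ih.trans ih'
  exact key (Quot.eqvGen_exact h)

end ArrowDiagram

namespace Crossings

lemma turn_keep {P : Type} (X : Crossings P) (R : P → Prop) (t : Bool) :
    (X.turn t).keep R = (X.keep R).turn t := by cases t <;> rfl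

lemma good_keep {P : Type} {X : Crossings P} {R : P → Prop} {S : Finset P}
    (hS : ∀ p ∈ S, R p ∧ R (X.mate p)) (σ : Perm P) (b : P) :
    (X.keep R).Good σ b S ↔ X.Good σ b S := by
  have hm : ∀ p ∈ S, (X.keep R).mate p = X.mate p := fun p hp => by
    rw [keep_mate, if_pos (hS p hp)]
  have hf : (X.keep R).flip S = X.flip S := by
    ext z
    rw [flip_apply, flip_apply, keep_mate]
    by_cases h : R z ∧ R (X.mate z)
    · rw [if_pos h]
    · have h1 : z ∉ S := fun hz => h (hS z hz)
      have h2 : X.mate z ∉ S := fun hz => h (by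
        have := hS _ hz
        rw [X.mate_mate] at this
        exact this.symm)
      simp [h, h1, h2]
  unfold Good
  rw [hf]
  exact and_congr_right fun _ => forall₂_congr fun p hp => by rw [hm p hp]

end Crossings

/-! ### Homomorphisms correspond to sets of crossings -/

namespace GaussDiagram

open Crossings ArrowDiagram

lemma filter_iff {γ : Type} {K K' : γ → Prop} {d : DecidablePred K} {d' : DecidablePred K'}
    (h : ∀ p, K p ↔ K' p) (l : List γ) : l.filter (fun p => @decide _ (d p)) =
      l.filter fun p => @decide _ (d' p) :=
  List.filter_congr fun p _ => by simp only [h]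

variable {P : Type} {α : Type} [DecidableEq α] {σ : Perm P}
  {X : Crossings P} {W W' : List (List P)} {G : GaussDiagram α} {ι : α × Bool → P} {b : P}
  {w : List P} {k : ℕ} {A A' : ArrowDiagram (Fin k)}

/-- The endpoints in the image of a homomorphism. -/
def image (ι : α × Bool → P) (φ : Hom A G.toArrowDiagram) (p : Fin k × Bool) : P :=
  ι (Prod.map φ.arrow id p)

/-- A diagram that is mapped to a Gauss diagram, with the induced signs. -/
def pullback (φ : Hom A G.toArrowDiagram) : GaussDiagram (Fin k) :=
  { A with sign := fun i => G.sign (φ.arrow i) }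

lemma image_injective (hι : Function.Injective ι) (φ : Hom A G.toArrowDiagram) :
    Function.Injective (image ι φ) :=
  hι.comp (Function.Injective.prodMap φ.arrow.injective Function.injective_id)

lemma image_mem (hι : Function.Injective ι) (φ : Hom A G.toArrowDiagram) (p : α × Bool) :
    ι p ∈ Set.range (image ι φ) ↔ ∃ a, φ.arrow a = p.1 := by
  exact ⟨fun ⟨q, hq⟩ => ⟨q.1, congrArg Prod.fst (hι hq)⟩,
    fun ⟨a, ha⟩ => ⟨(a, p.2), congrArg ι (Prod.ext ha rfl)⟩⟩

lemma filter_image (hι : Function.Injective ι) (φ : Hom A G.toArrowDiagram) {v : List (α × Bool)}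
    {u : List P} (h : v.map ι = u.filter fun z => @decide _ (propDecidable (z ∈ Set.range ι)))
    {d : DecidablePred fun p : α × Bool => ∃ a, φ.arrow a = p.1} :
    (v.filter fun p => @decide _ (d p)).map ι =
      u.filter fun z => @decide _ (propDecidable (z ∈ Set.range (image ι φ))) := by
  classical
  have h1 : sift (· ∈ Set.range (image ι φ)) [v.map ι] = sift (· ∈ Set.range (image ι φ)) [u] := by
    rw [h]
    refine sift_sift _ (· ∈ Set.range ι) [u] fun z hz => ?_
    obtain ⟨q, rfl⟩ := hz
    exact ⟨_, rfl⟩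
  refine Eq.trans ?_ (List.cons.inj h1).1
  rw [List.filter_map]
  exact congrArg _ (filter_iff (fun p => (image_mem hι φ p).symm) v)

/-- A homomorphism selects some crossings. -/
lemma Rep.of_hom (h : Rep σ X ((b :: w) :: W') G ι) (φ : Hom A G.toArrowDiagram) :
    ∃ W'', Rep σ (X.keep (· ∈ Set.range (image ι φ))) ((b :: w) :: W'') (pullback φ)
      (image ι φ) := by
  have hl : G.others.length = W'.length := by
    have := congrArg List.length h.others_eq
    simpa [sift] using this
  have hg : ∀ j : Fin G.others.length, (G.others.get j).map ι = (W'.get (Fin.cast hl j)).filter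
      fun z => @decide _ (propDecidable (z ∈ Set.range ι)) := by
    exact fun j => get_of_map_eq h.others_eq hl j
  let e : Fin A.others.length ≃ Fin W'.length := φ.circle.trans (finCongr hl)
  have hv : ∀ i, ∃ v, List.IsRotated (W'.get (e i)) v ∧
      v.filter (fun z => @decide _ (propDecidable (z ∈ Set.range (image ι φ)))) =
        (A.others.get i).map (image ι φ) := by
    intro i
    refine exists_filter_rotated _ ?_
    have h1 := (φ.map_others i).map ι
    rw [List.map_map] at h1
    exact (h1.trans (isRotated_of_eq (filter_image h.inj φ (hg (φ.circle i))))).symm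
  choose v hv1 hv2 using hv
  have hL : W'.Perm (List.ofFn fun i => W'.get (e i)) := by
    have h1 : ((List.finRange _).map e).Perm (List.finRange W'.length) :=
      (List.perm_ext_iff_of_nodup ((List.nodup_finRange _).map e.injective)
        (List.nodup_finRange _)).2 fun j => by simp [e.surjective j]
    have h2 := (h1.map W'.get).symm
    rwa [List.map_map, ← List.ofFn_eq_map, ← List.ofFn_eq_map, List.ofFn_get] at h2
  have hrange : ∀ p, image ι φ p ∈ Set.range (image ι φ) := fun p => ⟨p, rfl⟩
  have hmate : ∀ p, X.mate (image ι φ p) = image ι φ (ArrowDiagram.flip p) := fun p => h.mate _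
  refine ⟨List.ofFn v, h.words.reordered (hL.cons _) (.cons (.refl _) ?_), image_injective h.inj φ,
    fun z hz => ?_, fun p => ?_, fun p => h.ε _, fun p => h.up _, ?_⟩
  · rw [List.ofFn_eq_map, List.ofFn_eq_map, List.forall₂_map_left_iff, List.forall₂_map_right_iff,
      List.forall₂_same]
    exact fun i _ => hv1 i
  · rw [keep_mate, if_neg fun h => hz h.1]
  · rw [keep_mate, if_pos ⟨hrange p, hmate p ▸ hrange _⟩, hmate]
  · show (A.base.map (image ι φ)) :: A.others.map (List.map (image ι φ)) = _
    have h1 : A.others.map (List.map (image ι φ)) = sift (· ∈ Set.range (image ι φ)) (List.ofFn v) := by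
      conv_lhs => rw [← List.ofFn_get A.others]
      rw [sift, List.map_ofFn, List.map_ofFn]
      exact congrArg _ (funext fun i => (hv2 i).symm)
    have h2 : A.base.map (image ι φ) =
        (b :: w).filter fun z => @decide _ (propDecidable (z ∈ Set.range (image ι φ))) := by
      refine Eq.trans ?_ ((congrArg (List.map ι) φ.map_base).trans (filter_image h.inj φ h.base_eq))
      rw [List.map_map]
      rfl
    rw [h1, h2]
    rfl

variable [Fintype P]

open Classical in
/-- The crossings in the image of a homomorphism. -/
noncomputable def imageTails (ι : α × Bool → P) (t : Bool) (φ : Hom A G.toArrowDiagram) : Finset P :=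
  Finset.univ.image fun a => image ι φ (a, t)

lemma mem_imageTails {t : Bool} {φ : Hom A G.toArrowDiagram} {z : P} :
    z ∈ imageTails ι t φ ↔ ∃ a, image ι φ (a, t) = z := by simp [imageTails]

lemma Rep.mate_image (h : Rep σ X W G ι) (φ : Hom A G.toArrowDiagram) (p : Fin k × Bool) :
    X.mate (image ι φ p) = image ι φ (ArrowDiagram.flip p) := h.mate _

/-- The selected crossings are all the crossings of the pulled back diagram, to which `good_iff`
applies. -/
lemma Rep.good_image (h : Rep σ X ((b :: w) :: W') G ι) (φ : Hom A G.toArrowDiagram) (t : Bool) :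
    (X.turn t).Good σ b (imageTails ι t φ) ↔ A.numBoundary = 1 ∧ Monotone t A := by
  obtain ⟨W'', h'⟩ := h.of_hom φ
  have h1 : (((X.keep (· ∈ Set.range (image ι φ))).turn t).tails) = imageTails ι t φ := by
    ext z; rw [h'.mem_tails, mem_imageTails]
  rw [show A.numBoundary = (pullback φ).numBoundary from rfl,
    show Monotone t A = Monotone t (pullback φ).toArrowDiagram from rfl, ← h'.good_iff t, h1,
    ← turn_keep]
  refine (good_keep (fun z hz => ?_) σ b).symm
  obtain ⟨a, rfl⟩ := mem_imageTails.1 hz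
  rw [turn_mate, h.mate_image]
  exact ⟨⟨_, rfl⟩, ⟨_, rfl⟩⟩

/-- Every set of crossings is selected by a homomorphism. -/
lemma Rep.exists_hom (h : Rep σ X ((b :: w) :: W') G ι) {t : Bool} {S : Finset P}
    (hS : S ⊆ (X.turn t).tails) (hk : S.card = k) :
    ∃ (A : ArrowDiagram (Fin k)) (φ : Hom A G.toArrowDiagram), imageTails ι t φ = S := by
  have : Nonempty P := ⟨b⟩
  let R : P → Prop := fun z => z ∈ S ∨ X.mate z ∈ S
  have hm : ∀ z, R z → (X.keep R).mate z = X.mate z := fun z hz => by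
    rw [keep_mate, if_pos ⟨hz, hz.symm.imp id fun h => by
      rwa [X.mate_mate]⟩]
  have hne : ∀ z, (X.keep R).mate z ≠ z → R z := fun z hz => by
    by_contra h'
    exact hz (by rw [keep_mate, if_neg fun h => h' h.1])
  obtain ⟨n, G', ι', h'⟩ := h.words.exists_rep (X.keep R)
  have hT : ((X.keep R).turn t).tails = S := by
    ext z
    rw [mem_turn_tails]
    constructor
    · rintro ⟨h1, h2⟩
      refine (hne z h1).resolve_right fun h3 => ?_
      have h4 := (mem_turn_tails _ _).1 (hS h3)
      rw [X.mate_mate, X.up_mate z h4.1.symm] at h4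
      exact absurd (h4.2.trans h2.symm) (Bool.not_ne_self _)
    · intro hz
      have h4 := (mem_turn_tails _ _).1 (hS hz)
      exact ⟨by rw [hm z (Or.inl hz)]; exact h4.1, h4.2⟩
  have hn : n = k := by
    classical
    have : Finset.univ.image (fun a => ι' (a, t)) = S := by
      ext z; rw [← hT, h'.mem_tails]; simp
    rw [← hk, ← this, Finset.card_image_of_injective, Finset.card_fin]
    exact fun a c hac => congrArg Prod.fst (h'.inj hac)
  subst hn
  obtain ⟨κ, -, hκ⟩ := h.exists_labels h' fun z hz => ⟨(hm z (hne z hz)).symm, rfl, rfl⟩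
  have hsub : Set.range ι' ⊆ Set.range ι := by
    rintro _ ⟨p, rfl⟩; exact ⟨_, hκ p⟩
  have hc := h.circles_of_labels h' hκ (h.sift_circles hsub)
  have hK : ∀ p, ι p ∈ Set.range ι' ↔ ∃ a, κ a = p.1 := by
    exact fun p => ⟨fun ⟨q, hq⟩ => ⟨q.1, congrArg Prod.fst (h.inj ((hκ q).trans hq))⟩,
      fun ⟨a, ha⟩ => ⟨(a, p.2), (hκ _).symm.trans (congrArg ι (Prod.ext ha rfl))⟩⟩
  obtain ⟨hc1, hc2⟩ := List.cons.inj hc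
  have hl : G'.others.length = G.others.length := by simpa using congrArg List.length hc2
  refine ⟨G'.toArrowDiagram, ⟨κ, finCongr hl, hc1.trans (filter_iff hK _), fun i => ?_⟩, ?_⟩
  · have h1 : (G'.others.get i).map (Prod.map κ id) = (G.others.get (finCongr hl i)).filter
        fun p => @decide _ (propDecidable (ι p ∈ Set.range ι')) :=
      get_of_map_eq hc2 hl i
    exact isRotated_of_eq (h1.trans (filter_iff hK _))
  · ext z
    rw [mem_imageTails, ← hT, h'.mem_tails]
    exact exists_congr fun a => by rw [← hκ]; rfl

lemma range_image {t : Bool} (h : Rep σ X W G ι) (φ : Hom A G.toArrowDiagram) :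
    Set.range (image ι φ) = {z | z ∈ imageTails ι t φ ∨ X.mate z ∈ imageTails ι t φ} := by
  ext z
  simp only [Set.mem_setOf_eq, mem_imageTails, Set.mem_range]
  constructor
  · rintro ⟨⟨a, s⟩, rfl⟩
    rw [h.mate_image]
    by_cases hs : s = t
    · exact Or.inl ⟨a, by rw [hs]⟩
    · exact Or.inr ⟨a, by rw [ArrowDiagram.flip, ← Bool.eq_not_of_ne (Ne.symm hs)]⟩
  · rintro (⟨a, rfl⟩ | ⟨a, ha⟩)
    · exact ⟨_, rfl⟩
    · refine ⟨(a, !t), ?_⟩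
      have := h.mate_image φ (a, t)
      rw [ha, X.mate_mate] at this
      exact this.symm

/-- A circle without arrows is a boundary component by itself, and the based circle always accounts
for another one. -/
lemma get_others_ne_nil (hA : A.numBoundary = 1) (i : Fin A.others.length) : A.others.get i ≠ [] := by
  intro h0
  have h1 : 0 < A.others.count [] := List.count_pos_iff.2 (h0 ▸ List.get_mem _ _)
  unfold numBoundary at hA
  rw [ArrowDiagram.circles] at hA
  rcases hb : A.base with _ | ⟨p, l⟩
  · rw [hb, List.count_cons_self] at hA; omega
  · have h2 : 0 < Nat.card (Quot fun p q : Fin k × Bool => q = A.trace p) :=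
      Nat.card_pos_iff.2 ⟨⟨Quot.mk _ p⟩, inferInstance⟩
    rw [List.count_cons] at hA; omega

/-- The diagram that selects given crossings. -/
lemma Rep.iso_of_image (h : Rep σ X ((b :: w) :: W') G ι) {t : Bool} (φ : Hom A G.toArrowDiagram)
    (φ' : Hom A' G.toArrowDiagram) (hφ : imageTails ι t φ = imageTails ι t φ') : Iso A A' := by
  have hr : Set.range (image ι φ') = Set.range (image ι φ) := by
    rw [range_image (t := t) h φ, range_image (t := t) h φ', hφ]
  obtain ⟨W₁, h₁⟩ := h.of_hom φ
  obtain ⟨W₂, h₂⟩ := h.of_hom φ'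
  rw [hr] at h₂
  obtain ⟨κ, -, hκ⟩ := h₂.exists_labels h₁ fun _ _ => ⟨rfl, rfl, rfl⟩
  have hmap : ∀ l : List (Fin k × Bool), (l.map (Prod.map κ id)).map (image ι φ') =
      l.map (image ι φ) := fun l => by
    rw [List.map_map]; exact List.map_congr_left fun p _ => hκ p
  have n₁ := List.nodup_append.1 h₁.words.nodup
  have n₂ := List.nodup_append.1 h₂.words.nodup
  have hmatch : ∀ {W₁ W₂ : List (List P)}, Words σ ((b :: w) :: W₁) → Words σ ((b :: w) :: W₂) →
      ∀ u ∈ W₁, ∃ v ∈ W₂, List.IsRotated u v := by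
    intro W₁ W₂ h₁ h₂ u hu
    obtain ⟨x, hx⟩ := List.exists_mem_of_ne_nil u fun h0 => h₁.ne (by simp [← h0, hu])
    have hxb : x ∉ b :: w := fun hxb =>
      (List.nodup_append.1 h₁.nodup).2.2 x hxb x (List.mem_flatten.2 ⟨u, hu, hx⟩) rfl
    obtain ⟨v, hv, hxv⟩ := h₂.exists_mem x
    rcases List.mem_cons.1 hv with rfl | hv'
    · exact (hxb hxv).elim
    · exact ⟨v, hv', cyc_unique (h₁.nodup_of_mem (by simp [hu])) (h₂.nodup_of_mem hv)
        (h₁.cyc u (by simp [hu])) (h₂.cyc v hv) hx hxv⟩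
  obtain ⟨e, he⟩ := exists_matching n₁.2.1 n₂.2.1 (fun h0 => h₁.words.ne (by simp [h0]))
    (fun h0 => h₂.words.ne (by simp [h0])) (hmatch h₁.words h₂.words) (hmatch h₂.words h₁.words)
  have hg : ∀ {A : GaussDiagram (Fin k)} {j : Fin k × Bool → P} {Y : Crossings P} {W₁ : List (List P)},
      Rep σ Y ((b :: w) :: W₁) A j → ∃ hl : A.others.length = W₁.length, ∀ i, (A.others.get i).map j =
        (W₁.get (Fin.cast hl i)).filter
          fun z => @decide _ (propDecidable (z ∈ Set.range j)) := by
    intro A j Y W₁ h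
    have hl : A.others.length = W₁.length := by
      simpa [sift] using congrArg List.length h.others_eq
    exact ⟨hl, fun i => get_of_map_eq h.others_eq hl i⟩
  obtain ⟨l₁, g₁⟩ := hg h₁
  obtain ⟨l₂, g₂⟩ := hg h₂
  refine iso_iff.2 ⟨Equiv.ofBijective κ (Finite.injective_iff_bijective.1 κ.injective),
    (finCongr l₁).trans (e.trans (finCongr l₂.symm)), ?_, fun i => ?_⟩
  · refine h₂.inj.list_map ((hmap _).trans ?_)
    refine h₁.base_eq.trans (Eq.trans ?_ h₂.base_eq.symm)
    rw [hr]
  · refine isRotated_of_map h₂.inj ?_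
    refine List.IsRotated.trans (l' := (A.others.get i).map (image ι φ)) ?_ ?_
    · rw [← hmap]; exact .refl _
    · have r₁ := g₁ i
      have r₂ := g₂ (Fin.cast l₂.symm (e (Fin.cast l₁ i)))
      rw [hr] at r₂
      exact (isRotated_of_eq r₁).trans
        ((IsRotated.filter _ (he (Fin.cast l₁ i))).trans (isRotated_of_eq r₂.symm))

/-- A homomorphism from a connected diagram is determined by its image. -/
lemma Rep.hom_unique (h : Rep σ X ((b :: w) :: W') G ι) {t : Bool} {φ φ' : Hom A G.toArrowDiagram}
    (hφ : imageTails ι t φ = imageTails ι t φ') (hA : A.numBoundary = 1) : φ = φ' := by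
  have hr : Set.range (image ι φ') = Set.range (image ι φ) := by
    rw [range_image (t := t) h φ, range_image (t := t) h φ', hφ]
  obtain ⟨W₁, h₁⟩ := h.of_hom φ
  obtain ⟨W₂, h₂⟩ := h.of_hom φ'
  rw [hr] at h₂
  -- The base point determines the image of the first endpoint, and following the trace determines
  -- the images of all others, since a single boundary component passes every endpoint.
  have heq : ∀ p, image ι φ p = image ι φ' p := by
    intro p
    have hc := h₁.conn_iff.2 hA
    obtain ⟨p₀, l, hp₀⟩ := h₁.exists_base hc p
    have h3 : Walk A.trace (fun _ => True) p₀ p := by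
      refine (walk_trace_iff (A := pullback φ)).2 ?_
      unfold numBoundary at hA
      have h4 : 0 < Nat.card (Quot fun p q : Fin k × Bool => q = A.trace p) :=
        Nat.card_pos_iff.2 ⟨⟨Quot.mk _ p⟩, inferInstance⟩
      exact (Nat.card_eq_one_iff_unique.1 (show Nat.card (Quot fun p q : Fin k × Bool =>
        q = A.trace p) = 1 by omega)).1.allEq _ _
    refine h3.tail_induction (motive := fun q => image ι φ q = image ι φ' q) ?_ fun q _ _ hq => ?_
    · have h5 := h₂.walk_head hp₀
      rw [hr] at h5
      exact walk_unique (by simp) (by rw [← hr]; simp) (h₁.walk_head hp₀) h5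
    · have h5 := h₂.ret_smooth q
      rw [hr, ← hq] at h5
      exact walk_unique (by simp) (by rw [← hr]; simp) (h₁.ret_smooth q) h5
  have harrow : φ.arrow = φ'.arrow := by
    ext a
    exact congrArg Prod.fst (h.inj (heq (a, true)))
  have hcircle : φ.circle = φ'.circle := by
    ext i
    obtain ⟨q, hq⟩ := List.exists_mem_of_ne_nil _ (get_others_ne_nil hA i)
    have hm : ∀ φ : Hom A G.toArrowDiagram, Prod.map φ.arrow id q ∈ G.others.get (φ.circle i) :=
      fun φ => (List.mem_filter.1 ((φ.map_others i).mem_iff.1 (List.mem_map.2 ⟨q, hq, rfl⟩))).1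
    have hn : G.others.flatten.Nodup := (List.nodup_append.1 G.nodup).2.1
    have h2 := hm φ'
    rw [← harrow] at h2
    exact congrArg Fin.val (index_unique hn (hm φ) h2)
  cases φ; cases φ'
  simp only [Hom.mk.injEq]
  exact ⟨harrow, hcircle⟩

end GaussDiagram

/-! ### The counts are state sums -/

namespace GaussDiagram

open Crossings ArrowDiagram

/-- The classes of the ascending or descending diagrams with one boundary component. -/
def monotoneClasses (t : Bool) (k m : ℕ) : Set (Class k) :=
  Quot.mk _ '' {A : ArrowDiagram (Fin k) | A.numCircles = m ∧ A.numBoundary = 1 ∧ Monotone t A}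

/-- The number of ascending states for `t = true`, of descending states for `t = false`. -/
noncomputable def count {α : Type} [DecidableEq α] (t : Bool) (G : GaussDiagram α) (k : ℕ) : ℤ :=
  ∑ᶠ c ∈ monotoneClasses t k G.numCircles, pairing (Quot.out c) G

variable {P : Type} {α : Type} [DecidableEq α] [Fintype P] {σ : Perm P}
  {X : Crossings P} {W' : List (List P)} {G : GaussDiagram α} {ι : α × Bool → P} {b : P}
  {w : List P}

lemma imageTails_comp {k : ℕ} {A B : ArrowDiagram (Fin k)} {φ : Hom A G.toArrowDiagram}
    {φ' : Hom B G.toArrowDiagram} {e : Perm (Fin k)} {t : Bool}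
    (he : ∀ a, φ'.arrow a = φ.arrow (e a)) : imageTails ι t φ' = imageTails ι t φ := by
  ext z
  rw [mem_imageTails, mem_imageTails]
  constructor
  · rintro ⟨a, rfl⟩
    exact ⟨e a, congrArg (fun a => ι (a, t)) (he a).symm⟩
  · rintro ⟨a, rfl⟩
    exact ⟨e.symm a, congrArg (fun a => ι (a, t)) ((he _).trans (by simp))⟩

open Classical in
/-- Diagrams are counted by the states of the points. -/
lemma Rep.count_eq (h : Rep σ X ((b :: w) :: W') G ι) (t : Bool) (k : ℕ) :
    count t G k = stateSum k σ (X.turn t) b := by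
  let s := monotoneClasses t k G.numCircles
  -- Pairs of a class and a homomorphism from its representative correspond to the good states by
  -- taking images.
  let Z := Σ c : s, Hom (Quot.out c.1) G.toArrowDiagram
  let f : Z → Finset P := fun z => imageTails ι t z.2
  have hprop : ∀ z : Z, (Quot.out z.1.1).numBoundary = 1 ∧ Monotone t (Quot.out z.1.1) := by
    rintro ⟨⟨c, A, ⟨-, hA1, hA2⟩, hc⟩, φ⟩
    obtain ⟨φ', e, he⟩ := (iso_of_mk_eq (hc.trans (Quot.out_eq c).symm)).exists_comp φ
    rw [← h.good_image φ t, ← imageTails_comp he, h.good_image φ' t]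
    exact ⟨hA1, hA2⟩
  have hinj : Function.Injective f := by
    rintro ⟨c, φ⟩ ⟨c', φ'⟩ hff
    have hcc : c = c' := by
      have := Quot.sound (h.iso_of_image (t := t) φ φ' hff)
      exact Subtype.ext ((Quot.out_eq c.1).symm.trans (this.trans (Quot.out_eq c'.1)))
    subst hcc
    exact congrArg (Sigma.mk c) (h.hom_unique (t := t) hff (hprop ⟨c, φ⟩).1)
  have hZ : Fintype Z := @Fintype.ofFinite _ (Finite.of_injective f hinj)
  have hHom : ∀ c : s, Fintype (Hom (Quot.out c.1) G.toArrowDiagram) := fun c =>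
    @Fintype.ofFinite _ (Finite.of_injective (fun φ => (⟨c, φ⟩ : Z)) fun _ _ h => by simpa using h)
  have hcard : ∀ z : Z, f z ⊆ (X.turn t).tails ∧ (f z).card = k := by
    intro z
    constructor
    · intro p hp
      obtain ⟨a, rfl⟩ := mem_imageTails.1 hp
      rw [h.mem_tails]
      exact ⟨z.2.arrow a, rfl⟩
    · show (Finset.image _ _).card = k
      rw [Finset.card_image_of_injective _ fun a c hac =>
        congrArg Prod.fst (image_injective h.inj z.2 hac), Finset.card_univ, Fintype.card_fin]
  have h1 : stateSum k σ (X.turn t) b = ∑ z : Z, ∏ i, (G.sign (z.2.arrow i) : ℤ) := by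
    unfold stateSum
    rw [← Finset.sum_filter]
    symm
    refine Finset.sum_bij (fun z _ => f z) (fun z _ => ?_) (fun z _ z' _ hz => hinj hz)
      (fun S hS => ?_) fun z _ => ?_
    · rw [Finset.mem_filter, Finset.mem_powersetCard]
      exact ⟨hcard z, (h.good_image z.2 t).2 (hprop z)⟩
    · rw [Finset.mem_filter, Finset.mem_powersetCard] at hS
      obtain ⟨A, φ, hφ⟩ := h.exists_hom hS.1.1 hS.1.2
      have hA := (h.good_image φ t).1 (hφ ▸ hS.2)
      have hm : A.numCircles = G.numCircles := by
        have := Fintype.card_congr φ.circle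
        rw [Fintype.card_fin, Fintype.card_fin] at this
        show A.others.length + 1 = G.others.length + 1
        rw [this]
      obtain ⟨φ', e, he⟩ := (iso_of_mk_eq (Quot.out_eq (Quot.mk _ A : Class k))).exists_comp φ
      refine ⟨⟨⟨Quot.mk _ A, A, ⟨hm, hA⟩, rfl⟩, φ'⟩, Finset.mem_univ _, ?_⟩
      exact (imageTails_comp he).trans hφ
    · show _ = ∏ p ∈ Finset.image _ _, _
      rw [Finset.prod_image fun a _ c _ hac =>
        congrArg Prod.fst (image_injective h.inj z.2 hac)]
      refine Finset.prod_congr rfl fun a _ => ?_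
      rw [turn_sgn]
      exact congrArg _ (h.sgn (z.2.arrow a, t)).symm
  have h2 : count t G k = ∑ᶠ c : s, pairing (Quot.out c.1) G :=
    (finsum_set_coe_eq_finsum_mem s).symm
  let T : Finset s := Finset.univ.image fun z : Z => z.1
  rw [h1, h2, finsum_eq_sum_of_support_subset (s := T)]
  · have h3 : ∀ c : s, pairing (Quot.out c.1) G =
        ∑ φ : Hom (Quot.out c.1) G.toArrowDiagram, ∏ i, (G.sign (φ.arrow i) : ℤ) := fun c =>
      finsum_eq_sum_of_fintype _
    simp only [h3]
    rw [Finset.sum_sigma']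
    refine Finset.sum_congr ?_ fun _ _ => rfl
    ext z
    simp only [Finset.mem_sigma, Finset.mem_univ, and_true, iff_true]
    exact Finset.mem_image.2 ⟨z, Finset.mem_univ _, rfl⟩
  · intro c hc
    by_contra hcT
    refine hc ?_
    have : IsEmpty (Hom (Quot.out c.1) G.toArrowDiagram) := ⟨fun φ =>
      hcT (Finset.mem_coe.2 (Finset.mem_image.2 ⟨⟨c, φ⟩, Finset.mem_univ _, rfl⟩))⟩
    exact finsum_of_isEmpty _

end GaussDiagram

/-! ### Independence of the base point -/

namespace Crossings

open Classical

variable {P : Type} {σ : Perm P} {X Y : Crossings P}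

/-- The state sums of planar diagrams do not depend on the base point. -/
def BaseFree (k : ℕ) : Prop :=
  ∀ (P : Type) [Fintype P] (σ : Perm P) (X : Crossings P), X.Planar σ →
    ∀ b b', stateSum k σ X b = stateSum k σ X b'

/-- The state sums of planar diagrams do not change when the base point moves along its circle. -/
def ShiftFree (k : ℕ) : Prop :=
  ∀ (P : Type) [Fintype P] (σ : Perm P) (X : Crossings P), X.Planar σ →
    ∀ b, stateSum k σ X (σ b) = stateSum k σ X b

/-- `stateSum_shift` requires independence of the base point only for the smoothed diagram, one
degree lower. -/
lemma BaseFree.shiftFree_succ {k : ℕ} (h : BaseFree k) : ShiftFree (k + 1) := by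
  intro P _ σ X hX b
  by_cases hb : X.mate b = b
  · exact stateSum_shift_dummy _ σ hb
  · exact stateSum_shift k σ b fun c c' => h P _ _ (hX.smooth hb) c c'

lemma ShiftFree.walk {k : ℕ} (h : ShiftFree k) [Fintype P] (hX : X.Planar σ) {b b' : P}
    (hw : Walk σ (fun _ => True) b b') : stateSum k σ X b' = stateSum k σ X b :=
  hw.tail_induction rfl fun _ _ _ ih => (h P σ X hX _).trans ih

lemma del_addPoint (X : Crossings P) (p : P) : (X.del p).addPoint = X.addPoint.del (some p) := by
  refine Crossings.ext (funext fun z => ?_) rfl rfl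
  cases z with
  | none => simp [addPoint, del_mate]
  | some z =>
    show some ((X.del p).mate z) = _
    rw [del_mate, del_mate]
    simp only [addPoint, Option.map_some, ne_eq, Option.some.injEq]
    split_ifs <;> rfl

lemma map_addPoint (X : Crossings P) (e : Perm P) :
    (X.map e).addPoint = X.addPoint.map (Equiv.optionCongr e) :=
  Crossings.ext (funext fun z => by cases z <;> rfl) (funext fun z => by cases z <;> rfl)
    (funext fun z => by cases z <;> rfl)

lemma optionCongr_triPerm (a a' c c' e e' : P) : Equiv.optionCongr (triPerm a a' c c' e e') =
    triPerm (some a) (some a') (some c) (some c') (some e) (some e') := by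
  have h : ∀ x y : P, Equiv.optionCongr (swap x y) =
      @swap _ (fun _ _ => propDecidable _) (some x) (some y) := fun x y => by
    rw [Equiv.optionCongr_swap]
    congr!
  unfold triPerm
  rw [← h, ← h, ← h]
  ext1 z
  cases z <;> rfl

/-- To compare state sums, the base point may be assumed to be a new point. -/
lemma ShiftFree.eq_of_addPoint {k : ℕ} (h : ShiftFree k) [Fintype P] (hX : X.Planar σ)
    (hY : Y.Planar σ) (T : P → Prop) (hT : ∀ z, T z → ¬ T (σ z))
    (H : ∀ z, ¬ T (σ z) → stateSum k (insertAfter σ z) X.addPoint none =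
      stateSum k (insertAfter σ z) Y.addPoint none) (b : P) :
    stateSum k σ X b = stateSum k σ Y b := by
  -- `T` marks the points in front of which a new point would separate the neighbours of a move. If
  -- `σ b` is marked, the base point first moves on to `σ b`, whose successor is not marked.
  suffices ∀ z, ¬ T (σ z) → stateSum k σ X z = stateSum k σ Y z by
    by_cases hb : T (σ b)
    · rw [← h P σ X hX, ← h P σ Y hY]
      exact this _ (hT _ hb)
    · exact this b hb
  intro z hz
  have key : ∀ X : Crossings P, X.Planar σ → stateSum k σ X z =
      stateSum k (insertAfter σ z) X.addPoint none := fun X hX => by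
    have := h _ _ _ ((emb_insertAfter σ X z).planar_iff.1 hX) (some z)
    rw [insertAfter_self] at this
    rw [this, (emb_insertAfter σ X z).stateSum_eq]
  rw [key X hX, key Y hY, H z hz]

lemma ShiftFree.kink {k : ℕ} (h : ShiftFree k) [Fintype P] (hX : X.Planar σ) {p : P}
    (hp : X.mate p ≠ p) (hσ : σ p = X.mate p) (b : P) :
    stateSum k σ X b = stateSum k σ (X.del p) b := by
  by_cases hb : b = X.mate p
  · rw [hb, ← hσ, h P σ X hX, h P σ _ (hX.kink hp hσ), stateSum_kink k σ hp hσ hp.symm]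
  · exact stateSum_kink k σ hp hσ hb

/-- The second points of the two sides of a bigon. -/
lemma Bigon.exists_second {p₁ p₂ q₁ q₂ : P} (hB : Bigon σ X p₁ p₂ q₁ q₂) :
    ∃ T : P → Prop, (∀ z, T z → ¬ T (σ z)) ∧ T p₂ ∧ (σ q₁ = q₂ ∧ T q₂ ∨ σ q₂ = q₁ ∧ T q₁) := by
  have hn := hB.nodup
  simp only [List.nodup_cons, List.mem_cons, List.not_mem_nil, or_false, not_or] at hn
  have h1 := hB.next_p
  have h2 := hB.next_q
  have hi := σ.injective
  refine ⟨fun z => z = p₂ ∨ z = q₁ ∧ σ q₂ = q₁ ∧ σ q₁ ≠ q₂ ∨ z = q₂ ∧ σ q₁ = q₂, ?_, by grind, by grind⟩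
  rintro z (rfl | ⟨rfl, h2, h3⟩ | ⟨rfl, h2⟩) (h4 | ⟨h4, h5, h6⟩ | ⟨h4, h5⟩) <;> grind

/-- The second points of the three sides of a triangle. -/
lemma Triangle.second {a a' c c' e e' : P} {x y w : ℤˣ} (T : Triangle σ X a a' c c' e e' x y w)
    (z : P) : (z = edge σ a x ∨ z = edge σ a' y ∨ z = edge σ c' w) →
      ¬ (σ z = edge σ a x ∨ σ z = edge σ a' y ∨ σ z = edge σ c' w) := by
  have hn := T.ne
  have hi := σ.injective
  have he : ∀ {p q : P} {s : ℤˣ}, Nb σ p q s → edge σ p s = p ∧ σ q = p ∨ edge σ p s = q ∧ σ p = q := by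
    rintro p q s (⟨rfl, h⟩ | ⟨rfl, h⟩)
    · exact Or.inr ⟨h, h⟩
    · exact Or.inl ⟨rfl, h⟩
  have h1 := he T.hx
  have h2 := he T.hy
  have h3 := he T.hw
  intro h4 h5
  grind

lemma ShiftFree.bigon {k : ℕ} (h : ShiftFree k) [Fintype P] (hX : X.Planar σ) {p₁ p₂ q₁ q₂ : P}
    (hB : Bigon σ X p₁ p₂ q₁ q₂) (hY : ((X.del p₁).del p₂).Planar σ) (b : P) :
    stateSum k σ X b = stateSum k σ ((X.del p₁).del p₂) b := by
  obtain ⟨T, hT, h2, h3⟩ := hB.exists_second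
  refine h.eq_of_addPoint hX hY T hT (fun z hz => ?_) b
  · rw [del_addPoint, del_addPoint]
    refine Bigon.stateSum_eq (q₁ := some q₁) (q₂ := some q₂) ⟨?_, ?_, ?_, ?_, ?_, hB.up_eq, hB.ε_neg⟩
      (by simp) k
    · simpa using hB.nodup
    · exact congrArg some hB.mate₁
    · exact congrArg some hB.mate₂
    · rw [insertAfter_of_ne σ (by rintro rfl; exact hz (hB.next_p ▸ h2)), hB.next_p]
    · rcases h3 with ⟨h3, h4⟩ | ⟨h3, h4⟩
      · exact Or.inl (by rw [insertAfter_of_ne σ (by rintro rfl; exact hz (h3 ▸ h4)), h3])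
      · exact Or.inr (by rw [insertAfter_of_ne σ (by rintro rfl; exact hz (h3 ▸ h4)), h3])

lemma ShiftFree.triangle {k : ℕ} (h : ShiftFree k) [Fintype P] (hX : X.Planar σ)
    {a a' c c' e e' : P} {x y w : ℤˣ} (T : Triangle σ X a a' c c' e e' x y w)
    (hl : Triangle.Layered (X.up a) (X.up c) (X.up e))
    (hY : (X.map (triPerm a a' c c' e e')).Planar σ) (b : P) :
    stateSum k σ X b = stateSum k σ (X.map (triPerm a a' c c' e e')) b := by
  refine h.eq_of_addPoint hX hY _ T.second (fun z hz => ?_) b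
  · rw [not_or, not_or] at hz
    rw [map_addPoint, optionCongr_triPerm]
    refine (Triangle.stateSum_eq (a' := some a') (c' := some c') (e' := some e') (b := none)
      (x := x) (y := y) (w := w) ⟨?_, ?_, ?_, ?_, ?_, ?_, ?_, T.h₁, T.h₂⟩
      (by simp) hl k).symm
    · simpa using T.nodup
    · exact congrArg some T.ma
    · exact congrArg some T.mc
    · exact congrArg some T.me
    · exact T.hx.insertAfter hz.1
    · exact T.hy.insertAfter hz.2.1
    · exact T.hw.insertAfter hz.2.2

lemma baseFree_zero : BaseFree 0 := by
  intro P _ σ X _ b b'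
  rw [stateSum_zero, stateSum_zero]
  have : ∀ {b b' : P}, Conn σ b → Conn σ b' := fun h q => (h _).symm_of_perm.trans (h q)
  rw [if_congr ⟨this, this⟩ rfl rfl]

lemma stateSum_of_dummy [Fintype P] (k : ℕ) (hX : ∀ z, X.mate z = z) (b : P) :
    stateSum (k + 1) σ X b = 0 := by
  have : X.tails = ∅ := by
    ext z; simp [mem_tails, hX]
  rw [stateSum, this, Finset.powersetCard_eq_empty.2 (by simp)]
  rfl

/-- The state sums of a planar diagram. -/
noncomputable def _root_.PlanarCurve.sum (D : PlanarCurve) (k : ℕ) (b : D.P) : ℤ :=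
  have := D.finite
  let _ := Fintype.ofFinite D.P
  stateSum k D.σ D.X b

lemma _root_.PlanarCurve.sum_mk {Q : Type} [Fintype Q] (hf : Finite Q) {σ : Perm Q}
    {X : Crossings Q} (h : X.Planar σ) (k : ℕ) (b : Q) :
    PlanarCurve.sum ⟨Q, hf, σ, X, h⟩ k b = stateSum k σ X b := by
  unfold PlanarCurve.sum
  congr!

/-- The sums of degree `k + 1` are invariant under the Reidemeister moves, since the base point can
be shifted out of their way along its circle. A crossing change alters them by a sum of degree `k`
of the smoothed diagram, up to sign, which is the same for all base points. -/
lemma _root_.PlanarCurve.Move.sum_const_iff {k : ℕ} (h : BaseFree k) {D D' : PlanarCurve}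
    (hm : PlanarCurve.Move D D') :
    (∀ b b', D.sum (k + 1) b = D.sum (k + 1) b') ↔ ∀ b b', D'.sum (k + 1) b = D'.sum (k + 1) b' := by
  have hs := h.shiftFree_succ
  cases hm with
  | emb ι E =>
    have := D.finite
    have := D'.finite
    let _ := Fintype.ofFinite D.P
    let _ := Fintype.ofFinite D'.P
    have h1 : ∀ b, D'.sum (k + 1) (ι b) = D.sum (k + 1) b := fun b => E.stateSum_eq (k + 1) b
    have h2 : ∀ b', ∃ b, D'.sum (k + 1) b' = D.sum (k + 1) b := fun b' => by
      obtain ⟨b, hb⟩ := E.reach b'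
      exact ⟨b, (hs.walk D'.planar hb).trans (h1 b)⟩
    constructor
    · intro H b b'
      obtain ⟨c, hc⟩ := h2 b
      obtain ⟨c', hc'⟩ := h2 b'
      rw [hc, hc', H c c']
    · intro H b b'
      rw [← h1, ← h1, H]
  | @kink P hf σ X p hp hσ h1 h2 =>
    let _ := Fintype.ofFinite P
    simp only [PlanarCurve.sum_mk, hs.kink h1 hp hσ]
  | @bigon P hf σ X p₁ p₂ q₁ q₂ hB h1 h2 =>
    let _ := Fintype.ofFinite P
    simp only [PlanarCurve.sum_mk, hs.bigon h1 hB h2]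
  | @triangle P hf σ X a a' c c' e e' x y w T hl h1 h2 =>
    let _ := Fintype.ofFinite P
    simp only [PlanarCurve.sum_mk, hs.triangle h1 T hl h2]
  | @cc P hf σ X p hp h1 h2 =>
    let _ := Fintype.ofFinite P
    simp only [PlanarCurve.sum_mk]
    have h3 := fun b => skein k σ b hp
    have h4 := h P _ _ (h1.smooth hp)
    refine forall₂_congr fun b b' => ?_
    have h5 := h3 b
    have h6 := h3 b'
    rw [h4 b b'] at h5
    constructor <;> intro <;> linarith

/-- The state sums of a planar diagram do not depend on the base point. -/
lemma baseFree (k : ℕ) : BaseFree k := by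
  induction k with
  | zero => exact baseFree_zero
  | succ k ih =>
    intro P _ σ X hX
    let D : PlanarCurve := ⟨P, inferInstance, σ, X, hX⟩
    suffices ∀ b b', D.sum (k + 1) b = D.sum (k + 1) b' by
      intro b b'
      have := this b b'
      rwa [PlanarCurve.sum_mk, PlanarCurve.sum_mk] at this
    -- Once all crossings are gone, the sums of positive degree are zero for every base point.
    obtain ⟨D', hD, h0⟩ := D.exists_trivial
    have key : ∀ {D D' : PlanarCurve}, PlanarCurve.Equiv D D' →
        ((∀ b b', D.sum (k + 1) b = D.sum (k + 1) b') ↔ ∀ b b', D'.sum (k + 1) b = D'.sum (k + 1) b') := by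
      intro D D' h
      induction h with
      | rel _ _ h => exact h.sum_const_iff ih
      | refl => exact Iff.rfl
      | symm _ _ _ ih => exact ih.symm
      | trans _ _ _ _ _ ih ih' => exact ih.trans ih'
    refine (key hD).2 fun b b' => ?_
    have := D'.finite
    let _ := Fintype.ofFinite D'.P
    exact (stateSum_of_dummy k h0 b).trans (stateSum_of_dummy k h0 b').symm

lemma shiftFree (k : ℕ) : ShiftFree k := fun P _ σ X hX b => baseFree k P σ X hX _ _

end Crossings

/-! ### Smoothings in terms of words -/

section Lists

open List Classical

variable {P : Type} {σ : Perm P} {p q : P} {u v w A B : List P} {R : List (List P)}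

lemma cyc_iff {σ : P → P} {w : List P} : Cyc σ w ↔ w.map σ = w.rotate 1 := by
  constructor
  · intro h
    refine List.ext_getElem (by simp) fun i h1 h2 => ?_
    have h1' : i < w.length := by simpa using h1
    have h3 := (⟨i, rfl⟩ : w ~r w.rotate i)
    have h4 : w.drop i ++ w.take i = w.rotate i := (List.rotate_eq_drop_append_take h1'.le).symm
    rw [← h4, List.drop_eq_getElem_cons h1'] at h3
    rw [List.getElem_map, h _ _ h3, List.getElem_rotate]
    rcases Nat.lt_or_ge (i + 1) w.length with h5 | h5
    · simp only [List.drop_eq_getElem_cons h5, Nat.mod_eq_of_lt h5]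
      rfl
    · obtain rfl | h6 : i = 0 ∨ 0 < i := Nat.eq_zero_or_pos i
      · have : w.length = 1 := by omega
        simp [this, List.drop_eq_nil_of_le h5]
      · have h7 : i + 1 = w.length := by omega
        simp only [List.drop_eq_nil_of_le h5, h7, Nat.mod_self, List.nil_append]
        rcases w with _ | ⟨y, w⟩
        · simp at h1'
        · rcases i with _ | i
          · omega
          · simp
  · rintro h x l ⟨n, hn⟩
    have : (x :: l).map σ = (x :: l).rotate 1 := by
      rw [← hn, List.map_rotate, h, List.rotate_rotate, List.rotate_rotate, add_comm]
    rw [List.rotate_cons_succ, List.rotate_zero] at this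
    rcases l with _ | ⟨y, l⟩
    · simpa using this
    · exact (List.cons.inj this).1

lemma cyc_cons_iff {σ : P → P} {p : P} {u : List P} : Cyc σ (p :: u) ↔ (p :: u).map σ = u ++ [p] := by
  rw [cyc_iff, List.rotate_cons_succ, List.rotate_zero]

lemma path_append {σ : P → P} {p q r : P} {u v : List P} :
    (p :: u ++ q :: v).map σ = u ++ q :: v ++ [r] ↔
      (p :: u).map σ = u ++ [q] ∧ (q :: v).map σ = v ++ [r] := by
  have : u ++ q :: v ++ [r] = (u ++ [q]) ++ (v ++ [r]) := by simp
  rw [List.map_append, this]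
  exact ⟨fun h => List.append_inj h (by simp), fun ⟨h, h'⟩ => by rw [h, h']⟩

/-- The smoothing exchanges the successors of `p` and `q` and leaves the rest of the arc behind `p`
unchanged. -/
lemma path_smooth {r : P} (h : (p :: u).map σ = u ++ [r]) (hp : p ∉ u) (hq : q ∉ u) :
    (q :: u).map (σ * swap p q : Perm P) = u ++ [r] := by
  rw [← h]
  simp only [List.map_cons, Perm.mul_apply, swap_apply_right, List.cons.injEq, true_and]
  exact List.map_congr_left fun z hz => by
    rw [Perm.mul_apply, swap_apply_of_ne_of_ne (by grind) (by grind)]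

lemma Cyc.smooth_notMem (h : Cyc σ w) (hp : p ∉ w) (hq : q ∉ w) :
    Cyc (σ * swap p q : Perm P) w := by
  rw [cyc_iff] at h ⊢
  rw [← h]
  exact List.map_congr_left fun z hz => by
    rw [Perm.mul_apply, swap_apply_of_ne_of_ne (by grind) (by grind)]

/-- Smoothing of a self-crossing. -/
lemma Words.split (h : Words σ ((A ++ p :: u ++ q :: v) :: R)) :
    Words (σ * swap p q : Perm P) ((q :: u) :: (A ++ p :: v) :: R) := by
  have hp : ((A ++ p :: u ++ q :: v) :: R).flatten.Perm ((q :: u) :: (A ++ p :: v) :: R).flatten := by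
    rw [List.perm_iff_count]
    intro z
    simp only [List.flatten_cons, List.count_append, List.count_cons]
    omega
  have hn := h.nodup
  have hc : Cyc σ (p :: u ++ q :: (v ++ A)) :=
    (h.cyc _ List.mem_cons_self).rotated
      (by simpa using List.isRotated_append (l := A) (l' := p :: u ++ q :: v))
  rw [List.cons_append, cyc_cons_iff, ← List.cons_append, path_append] at hc
  simp only [List.flatten_cons, List.append_assoc, List.cons_append, List.nodup_append,
    List.nodup_cons, List.mem_append, List.mem_cons] at hn
  refine ⟨hp.nodup_iff.1 h.nodup, fun x => hp.mem_iff.1 (h.complete x), ?_, ?_⟩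
  · have := h.ne
    simp_all
  · intro w hw
    rcases List.mem_cons.1 hw with rfl | hw
    · exact cyc_cons_iff.2 (path_smooth hc.1 (by grind) (by grind))
    rcases List.mem_cons.1 hw with rfl | hw
    · have : Cyc (σ * swap p q : Perm P) (p :: (v ++ A)) := by
        rw [Equiv.swap_comm]
        exact cyc_cons_iff.2 (path_smooth hc.2 (by grind) (by grind))
      exact this.rotated (by simpa using List.isRotated_append (l := p :: v) (l' := A))
    · have : ∀ z ∈ w, z ∈ R.flatten := fun z hz => List.mem_flatten.2 ⟨w, hw, hz⟩
      exact (h.cyc w (by simp [hw])).smooth_notMem (fun hz => by have := this p hz; grind)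
        fun hz => by have := this q hz; grind

/-- Smoothing of a crossing of two components. -/
lemma Words.merge (h : Words σ ((A ++ p :: u) :: (B ++ q :: v) :: R)) :
    Words (σ * swap p q : Perm P) ((B ++ q :: u ++ A ++ p :: v) :: R) := by
  have hp : ((A ++ p :: u) :: (B ++ q :: v) :: R).flatten.Perm
      ((B ++ q :: u ++ A ++ p :: v) :: R).flatten := by
    rw [List.perm_iff_count]
    intro z
    simp only [List.flatten_cons, List.count_append, List.count_cons]
    omega
  have hn := h.nodup
  have h1 : Cyc σ (p :: (u ++ A)) :=
    (h.cyc _ List.mem_cons_self).rotated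
      (by simpa using List.isRotated_append (l := A) (l' := p :: u))
  have h2 : Cyc σ (q :: (v ++ B)) :=
    (h.cyc _ (List.mem_cons_of_mem _ List.mem_cons_self)).rotated
      (by simpa using List.isRotated_append (l := B) (l' := q :: v))
  rw [cyc_cons_iff] at h1 h2
  simp only [List.flatten_cons, List.append_assoc, List.cons_append, List.nodup_append,
    List.nodup_cons, List.mem_append, List.mem_cons] at hn
  refine ⟨hp.nodup_iff.1 h.nodup, fun x => hp.mem_iff.1 (h.complete x), ?_, ?_⟩
  · have := h.ne
    simp_all
  · intro w hw
    rcases List.mem_cons.1 hw with rfl | hw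
    · have h3 := path_smooth (q := q) h1 (by grind) (by grind)
      have h4 := path_smooth (q := p) h2 (by grind) (by grind)
      rw [Equiv.swap_comm] at h4
      have : Cyc (σ * swap p q : Perm P) (q :: (u ++ A ++ p :: (v ++ B))) :=
        cyc_cons_iff.2 ((path_append (u := u ++ A)).2 ⟨h3, h4⟩)
      exact this.rotated (by simpa using List.isRotated_append (l := q :: u ++ A ++ p :: v) (l' := B))
    · have : ∀ z ∈ w, z ∈ R.flatten := fun z hz => List.mem_flatten.2 ⟨w, hw, hz⟩
      exact (h.cyc w (by simp [hw])).smooth_notMem (fun hz => by have := this p hz; grind)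
        fun hz => by have := this q hz; grind

end Lists

/-! ### Curves for given Gauss diagrams, and deletion of arrows -/

namespace GaussDiagram

open Crossings ArrowDiagram

variable {P : Type} {α β : Type} {σ : Perm P} {X Y : Crossings P} {W W' : List (List P)}
  {G : GaussDiagram α} {G' : GaussDiagram β} {ι : α × Bool → P} {ι' : β × Bool → P}

lemma exists_mem_circles (G : GaussDiagram α) (p : α × Bool) : ∃ c ∈ G.circles, p ∈ c :=
  List.mem_flatten.1 (G.complete p)

/-- Every Gauss diagram is the Gauss diagram of a curve with a point before each word. -/
lemma exists_rep [Finite α] (G : GaussDiagram α) : ∃ (P : Type) (_ : Finite P) (σ : Perm P)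
    (X : Crossings P) (W : List (List P)) (ι : α × Bool → P), Rep σ X W G ι ∧
    ∀ p q, G.Adjacent p q → σ (ι p) = ι q := by
  classical
  -- The additional point in front of each word keeps circles without arrows from having empty
  -- words.
  let P := (α × Bool) ⊕ Fin G.circles.length
  let f : Fin G.circles.length → List P := fun i => Sum.inr i :: (G.circles.get i).map Sum.inl
  let W : List (List P) := List.ofFn f
  have hW : ∀ w, w ∈ W ↔ ∃ i, f i = w := fun w => List.mem_ofFn
  obtain ⟨hn1, hn2⟩ := List.nodup_flatten.1 G.nodup
  have hwn : W.flatten.Nodup := by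
    refine List.nodup_flatten.2 ⟨fun w hw => ?_, ?_⟩
    · obtain ⟨i, rfl⟩ := (hW w).1 hw
      exact List.nodup_cons.2 ⟨by simp, (hn1 _ (List.get_mem _ i)).map Sum.inl_injective⟩
    · refine List.pairwise_ofFn.2 fun i j hij => ?_
      have := List.pairwise_iff_get.1 hn2 i j hij
      simp only [f, List.disjoint_cons_left, List.disjoint_cons_right]
      refine ⟨by simpa [P] using hij.ne', by simp, ?_⟩
      exact List.disjoint_map Sum.inl_injective this
  have hwc : ∀ x, x ∈ W.flatten := by
    rintro (p | i)
    · obtain ⟨c, hc, hp⟩ := G.exists_mem_circles p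
      obtain ⟨i, rfl⟩ := List.get_of_mem hc
      exact List.mem_flatten.2 ⟨f i, (hW _).2 ⟨i, rfl⟩, 
        List.mem_cons_of_mem _ (List.mem_map.2 ⟨p, hp, rfl⟩)⟩
    · exact List.mem_flatten.2 ⟨f i, (hW _).2 ⟨i, rfl⟩, by simp [f]⟩
  have hw0 : [] ∉ W := fun h => by
    obtain ⟨i, hi⟩ := (hW _).1 h
    simp [f] at hi
  have hw := words_permOfWords hwn hwc hw0
  refine ⟨P, inferInstance, permOfWords W, G.crossings.sumDummy _, W, Sum.inl,
    ⟨hw, Sum.inl_injective, ?_, fun p => rfl, fun p => rfl, fun p => rfl, ?_⟩, fun p q h => ?_⟩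
  · rintro (p | i) hp
    · exact (hp ⟨p, rfl⟩).elim
    · rfl
  · unfold sift
    rw [List.map_ofFn]
    have : ∀ g : Fin G.circles.length → List P, (∀ i, g i = (G.circles.get i).map Sum.inl) →
        G.circles.map (List.map Sum.inl) = List.ofFn g := fun g hg => by
      obtain rfl := funext hg
      exact List.ext_getElem (by simp) fun i _ _ => by simp
    refine this _ fun i => ?_
    simp only [Function.comp, f]
    rw [List.filter_cons_of_neg (by simp), List.filter_eq_self.2 fun z hz => ?_]
    obtain ⟨p, -, rfl⟩ := List.mem_map.1 hz
    exact decide_eq_true ⟨p, rfl⟩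
  · obtain ⟨c, hc, s, t, hst⟩ := h
    obtain ⟨i, rfl⟩ := List.get_of_mem hc
    have h1 := hw.cyc (f i) ((hW _).2 ⟨i, rfl⟩)
    have h2 : f i = (Sum.inr i :: s.map Sum.inl) ++ Sum.inl p :: Sum.inl q :: t.map Sum.inl := by
      simp only [f, ← hst]
      simp
    rw [h2] at h1
    exact h1.apply

lemma range_subset {κ : β → α} (hκ : ∀ p, ι (Prod.map κ id p) = ι' p) :
    Set.range ι' ⊆ Set.range ι := by
  rintro _ ⟨p, rfl⟩
  exact ⟨_, hκ p⟩

namespace Rep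

lemma exists_head (h : Rep σ X W G ι) : ∃ b w W', W = (b :: w) :: W' := by
  have hc := h.circles
  rcases W with _ | ⟨_ | ⟨b, w⟩, W'⟩
  · exact (List.cons_ne_nil _ _ hc).elim
  · exact (h.words.ne (by simp)).elim
  · exact ⟨b, w, W', rfl⟩

/-- Diagrams with fewer crossings. -/
lemma restrict (h : Rep σ X W G ι) {σ' : Perm P} (κ : β ↪ α)
    (hs : ∀ b, G'.sign b = G.sign (κ b)) (hW : Words σ' W')
    (hm : ∀ p, Y.mate (ι (Prod.map κ id p)) = X.mate (ι (Prod.map κ id p)))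
    (hd : ∀ z, z ∉ Set.range (fun p => ι (Prod.map κ id p)) → Y.mate z = z) (hε : Y.ε = X.ε)
    (hu : Y.up = X.up) (hC : (G'.circles.map (List.map (Prod.map κ id))).map (List.map ι) =
      sift (· ∈ Set.range (fun p => ι (Prod.map κ id p))) W') :
    Rep σ' Y W' G' (fun p => ι (Prod.map κ id p)) := by
  refine ⟨hW, h.inj.comp (κ.injective.prodMap Function.injective_id), hd, fun p => ?_, fun p => ?_,
    fun p => ?_, ?_⟩
  · rw [hm, h.mate]; rfl
  · rw [hε, h.ε]
    simp [crossings, hs]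
  · rw [hu, h.up]; rfl
  · rw [← hC, List.map_map]
    refine List.map_congr_left fun w _ => ?_
    rw [Function.comp, List.map_map]
    rfl

/-- Deletion of crossings. -/
lemma of_deletesTo (h : Rep σ X W G ι) {keep : α → Prop} [DecidablePred keep]
    (hG : G.DeletesTo keep G') (hm : ∀ p, keep p.1 → Y.mate (ι p) = X.mate (ι p))
    (hd : ∀ p, ¬ keep p.1 → Y.mate (ι p) = ι p) (hd' : ∀ z, X.mate z = z → Y.mate z = z)
    (hε : Y.ε = X.ε) (hu : Y.up = X.up) : ∃ ι', Rep σ Y W G' ι' := by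
  obtain ⟨κ, hs, hC⟩ := hG
  have hκ : ∀ a, keep a ↔ ∃ b, κ b = a := by
    intro a
    constructor
    · intro ha
      obtain ⟨c, hc, hp⟩ := G.exists_mem_circles (a, true)
      have : c.filter (fun p => keep p.1) ∈ G'.circles.map (List.map (Prod.map κ id)) :=
        hC ▸ List.mem_map.2 ⟨c, hc, rfl⟩
      obtain ⟨c', -, hc'⟩ := List.mem_map.1 this
      have : (a, true) ∈ c'.map (Prod.map κ id) := hc' ▸ List.mem_filter.2 ⟨hp, by simpa⟩
      obtain ⟨p, -, hp⟩ := List.mem_map.1 this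
      exact ⟨p.1, congrArg Prod.fst hp⟩
    · rintro ⟨b, rfl⟩
      obtain ⟨c', hc', hp⟩ := G'.exists_mem_circles (b, true)
      have : c'.map (Prod.map κ id) ∈ G.circles.map (List.filter fun p => keep p.1) :=
        hC ▸ List.mem_map.2 ⟨c', hc', rfl⟩
      obtain ⟨c, -, hc⟩ := List.mem_map.1 this
      have : (κ b, true) ∈ c.filter (fun p => keep p.1) := hc ▸ List.mem_map.2 ⟨_, hp, rfl⟩
      simpa using (List.mem_filter.1 this).2
  have hr : ∀ p, ι p ∈ Set.range (fun p => ι (Prod.map κ id p)) ↔ keep p.1 := by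
    intro p
    rw [hκ]
    constructor
    · rintro ⟨q, hq⟩
      exact ⟨q.1, congrArg Prod.fst (h.inj hq)⟩
    · rintro ⟨b, hb⟩
      exact ⟨(b, p.2), congrArg ι (Prod.ext hb rfl)⟩
  refine ⟨_, h.restrict κ hs h.words (fun p => hm _ ((hκ _).2 ⟨_, rfl⟩)) (fun z hz => ?_) hε hu ?_⟩
  · by_cases hz' : z ∈ Set.range ι
    · obtain ⟨p, rfl⟩ := hz'
      exact hd p fun hk => hz ((hr p).2 hk)
    · exact hd' z (h.dummy z hz')
  · rw [← h.sift_circles (range_subset fun _ => rfl), hC, sift_map]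
    congr 1
    unfold sift
    exact List.map_congr_left fun c _ => List.filter_congr fun p _ => by simp only [hr]

lemma exists_deletesTo [Finite P] (h : Rep σ X W G ι) (keep : α → Prop) [DecidablePred keep]
    (hm : ∀ p, keep p.1 → Y.mate (ι p) = X.mate (ι p))
    (hd : ∀ p, ¬ keep p.1 → Y.mate (ι p) = ι p) (hd' : ∀ z, X.mate z = z → Y.mate z = z)
    (hε : Y.ε = X.ε) (hu : Y.up = X.up) : ∃ (n : ℕ) (G' : GaussDiagram (Fin n)) (ι' : _),
      Rep σ Y W G' ι' ∧ G.DeletesTo keep G' := by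
  obtain ⟨b, w, W', rfl⟩ := h.exists_head
  have : Nonempty P := ⟨b⟩
  obtain ⟨n, G', ι', h'⟩ := h.words.exists_rep Y
  have hr : ∀ p, Y.mate (ι p) ≠ ι p ↔ keep p.1 := fun p => by
    constructor
    · intro hp
      by_contra hk
      exact hp (hd p hk)
    · intro hk
      rw [hm p hk]
      exact h.mem_range.1 ⟨p, rfl⟩
  obtain ⟨κ, h1, h2⟩ := h.exists_labels h' fun z hz => by
    have hz' : X.mate z ≠ z := fun h' => hz (hd' z h')
    obtain ⟨p, rfl⟩ := h.mem_range.2 hz'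
    exact ⟨(hm p ((hr p).1 hz)).symm, by rw [hε], by rw [hu]⟩
  refine ⟨n, G', ι', h', κ, h1, ?_⟩
  rw [h.circles_of_labels h' h2 (h.sift_circles (range_subset h2))]
  unfold sift
  exact List.map_congr_left fun c _ => List.filter_congr fun p _ => by
    simp only [h'.mem_range, hr]

/-- Diagrams on the same words. -/
lemma relabel (h : Rep σ X W G ι) {G' : GaussDiagram α} (π : Perm (α × Bool))
    (hC : G'.circles = G.circles.map (List.map π)) (hπ : ∀ p, π (π p) = p)
    (hd : ∀ z, X.mate z = z → Y.mate z = z)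
    (hm : ∀ p, Y.mate (ι (π p)) = ι (π (ArrowDiagram.flip p)))
    (hε : ∀ p, Y.ε (ι (π p)) = G'.crossings.ε p) (hu : ∀ p, Y.up (ι (π p)) = p.2) :
    Rep σ Y W G' (fun p => ι (π p)) := by
  have hr : Set.range (fun p => ι (π p)) = Set.range ι := by
    ext z
    exact ⟨fun ⟨p, hp⟩ => ⟨_, hp⟩, fun ⟨p, hp⟩ => ⟨π p, by simp [hπ, hp]⟩⟩
  refine ⟨h.words, h.inj.comp π.injective, fun z hz => hd z (h.dummy z (hr ▸ hz)), hm, hε, hu, ?_⟩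
  rw [hr, ← h.circles, hC, List.map_map]
  refine List.map_congr_left fun w _ => ?_
  rw [Function.comp, List.map_map]
  exact (List.map_congr_left fun p _ => by simp [hπ])

end Rep

end GaussDiagram

lemma exists_of_filter_eq_cons {P : Type} {K : P → Bool} {w l : List P} {p : P}
    (h : w.filter K = p :: l) :
    ∃ A m, w = A ++ p :: m ∧ A.filter K = [] ∧ m.filter K = l ∧ K p = true := by
  obtain ⟨u, v, rfl, hu, hp, hv⟩ := List.filter_eq_cons_iff.1 h
  exact ⟨u, v, rfl, List.filter_eq_nil_iff.2 hu, hv, hp⟩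

/-! ### Smoothings of Gauss diagrams -/

namespace GaussDiagram

open Crossings ArrowDiagram Classical

variable {P : Type} {α β : Type} {σ : Perm P} {X Y : Crossings P} {W W' : List (List P)}
  {G : GaussDiagram α} {G' : GaussDiagram β} {ι : α × Bool → P} {ι' : β × Bool → P}

/-- The circles of `G` begin with the passages through the crossing `a`. -/
def Starts (G : GaussDiagram α) (a : α) (x : Bool) (u v : List (α × Bool))
    (R : List (List (α × Bool))) : Bool → Prop
  | true => G.circles = ((a, x) :: u ++ (a, !x) :: v) :: R
  | false => G.circles = ((a, x) :: u) :: ((a, !x) :: v) :: R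

/-- The circles of the smoothed diagram. -/
def smoothed (u v : List (α × Bool)) (R : List (List (α × Bool))) : Bool → List (List (α × Bool))
  | true => u :: v :: R
  | false => (u ++ v) :: R

lemma smoothing_iff {Gz : GaussDiagram β} {a : α} : G.Smoothing Gz a ↔
    ∃ κ : β ↪ α, (∀ b, Gz.sign b = G.sign (κ b)) ∧ ∃ x u v R s, G.Starts a x u v R s ∧
      Gz.circles.map (List.map (Prod.map κ id)) = smoothed u v R s := by
  constructor
  · rintro ⟨κ, hs, x, u, v, R, h | h⟩
    exacts [⟨κ, hs, x, u, v, R, true, h⟩, ⟨κ, hs, x, u, v, R, false, h⟩]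
  · rintro ⟨κ, hs, x, u, v, R, _ | _, h⟩
    exacts [⟨κ, hs, x, u, v, R, Or.inr h⟩, ⟨κ, hs, x, u, v, R, Or.inl h⟩]

lemma Starts.mem_iff {a : α} {x : Bool} {u v : List (α × Bool)} {R : List (List (α × Bool))}
    {s : Bool} (h : G.Starts a x u v R s) (p : α × Bool) :
    p ∈ (smoothed u v R s).flatten ↔ p.1 ≠ a := by
  have hc := G.complete p
  have hn := G.nodup
  change p ∈ G.circles.flatten at hc
  change G.circles.flatten.Nodup at hn
  have h1 : p.1 = a ↔ p = (a, x) ∨ p = (a, !x) := by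
    rcases p with ⟨b, y⟩
    cases x <;> cases y <;> simp
  cases s <;> rw [show G.circles = _ from h] at hc hn <;>
  · simp only [smoothed, List.flatten_cons, List.append_assoc, List.cons_append, List.nodup_append,
      List.nodup_cons, List.mem_append, List.mem_cons] at hc hn ⊢
    grind

namespace Rep

/-- The words of a smoothed diagram. -/
lemma exists_smoothed (h : Rep σ X W G ι) {a : α} {x : Bool} {u v : List (α × Bool)}
    {R : List (List (α × Bool))} {s : Bool} (hs : G.Starts a x u v R s) :
    ∃ W' L, Words (σ * swap (ι (a, x)) (ι (a, !x)) : Perm P) W' ∧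
      sift (· ∈ Set.range ι) W' = List.map (List.map ι) L ∧
      ∀ K : α × Bool → Prop, (∀ p, K p ↔ p.1 ≠ a) → sift K L = smoothed u v R s := by
  have hw := h.words
  have hmem := hs.mem_iff
  have hK : ∀ {K : α × Bool → Prop}, (∀ p, K p ↔ p.1 ≠ a) → ∀ l ∈ smoothed u v R s,
      l.filter (fun z => decide (K z)) = l := fun hK l hl => List.filter_eq_self.2 fun z hz =>
    decide_eq_true ((hK z).2 ((hmem z).1 (List.mem_flatten.2 ⟨l, hl, hz⟩)))
  cases s
  · have hc := h.circles
    rw [show G.circles = _ from hs] at hc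
    rcases W with _ | ⟨w₁, _ | ⟨w₂, W⟩⟩
    · simp [sift] at hc
    · simp [sift] at hc
    simp only [sift, List.map_cons, List.cons.injEq] at hc
    obtain ⟨h1, h2, h3⟩ := hc
    obtain ⟨A, m, rfl, hA, hm, hp⟩ := exists_of_filter_eq_cons h1.symm
    obtain ⟨B, n, rfl, hB, hn, hq⟩ := exists_of_filter_eq_cons h2.symm
    -- On the smoothed curve the two points of the crossing remain, now as dummies. `L` lists the
    -- words with these points, and sifting by `K` removes them.
    refine ⟨_, ((a, !x) :: u ++ (a, x) :: v) :: R, hw.merge, ?_, fun K hKa => ?_⟩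
    · simp only [sift, List.map_cons, List.filter_append, List.map_append, List.filter_cons, hp, hq,
        hA, hB, hm, hn, h3]
      simp
    · have hR := sift_eq_self (C := R) (K := K) fun w hw z hz => (hKa z).2 ((hmem z).1
        (List.mem_flatten.2 ⟨w, List.mem_cons_of_mem _ hw, hz⟩))
      have h4 := hK hKa (u ++ v) (by simp [smoothed])
      have h5 : ∀ y, decide (K (a, y)) = false := fun y => by simp [hKa]
      unfold sift at hR ⊢
      rw [List.map_cons, hR, List.filter_append, List.filter_cons_of_neg (by simp [h5]),
        List.filter_cons_of_neg (by simp [h5]), ← List.filter_append, h4]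
      rfl
  · have hc := h.circles
    rw [show G.circles = _ from hs] at hc
    rcases W with _ | ⟨w, W⟩
    · simp [sift] at hc
    simp only [sift, List.map_cons, List.cons.injEq, List.map_append, List.cons_append] at hc
    obtain ⟨h1, h3⟩ := hc
    obtain ⟨A, m, rfl, hA, hm, hp⟩ := exists_of_filter_eq_cons h1.symm
    obtain ⟨u', m', rfl, hu, hm'⟩ := List.filter_eq_append_iff.1 hm
    obtain ⟨B, n, rfl, hB, hn, hq⟩ := exists_of_filter_eq_cons hm'
    have hw' : Words σ ((A ++ ι (a, x) :: (u' ++ B) ++ ι (a, !x) :: n) :: W) := by simpa using hw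
    refine ⟨_, ((a, !x) :: u) :: ((a, x) :: v) :: R, hw'.split, ?_, fun K hKa => ?_⟩
    · simp only [sift, List.map_cons, List.filter_append, List.filter_cons, hp, hq,
        hA, hB, hu, hn, h3]
      simp
    · have hR := sift_eq_self (C := R) (K := K) fun w hw z hz => (hKa z).2 ((hmem z).1
        (List.mem_flatten.2 ⟨w, List.mem_cons_of_mem _ (List.mem_cons_of_mem _ hw), hz⟩))
      have h4 := hK hKa u (by simp [smoothed])
      have h4' := hK hKa v (by simp [smoothed])
      have h5 : ∀ y, decide (K (a, y)) = false := fun y => by simp [hKa]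
      unfold sift at hR ⊢
      rw [List.map_cons, List.map_cons, hR, List.filter_cons_of_neg (by simp [h5]),
        List.filter_cons_of_neg (by simp [h5]), h4, h4']
      rfl

lemma del_facts (h : Rep σ X W G ι) (a : α) (x : Bool) :
    (∀ p, p.1 ≠ a → (X.del (ι (a, x))).mate (ι p) = X.mate (ι p)) ∧
      (∀ p, ¬ p.1 ≠ a → (X.del (ι (a, x))).mate (ι p) = ι p) ∧
      ∀ z, X.mate z = z → (X.del (ι (a, x))).mate z = z := by
  refine ⟨fun p hp => ?_, fun p hp => ?_, fun z hz => ?_⟩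
  · rw [del_mate, h.mate, if_pos]
    constructor <;> intro h' <;> exact hp (congrArg Prod.fst (h.inj h'))
  · obtain ⟨b, y⟩ := p
    obtain rfl : b = a := not_not.1 hp
    rw [del_mate, h.mate, if_neg]
    rintro ⟨h1, h2⟩
    rcases Bool.eq_or_eq_not y x with rfl | rfl
    · exact h1 rfl
    · exact h2 (congrArg ι (by simp [ArrowDiagram.flip]))
  · rw [del_mate, hz, ite_self]

lemma swap_eq (h : Rep σ X W G ι) (a : α) (x : Bool) :
    swap (ι (a, x)) (ι (a, !x)) = swap (ι (a, true)) (X.mate (ι (a, true))) := by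
  rw [h.mate]
  cases x
  · exact Equiv.swap_comm _ _
  · rfl

lemma del_eq (h : Rep σ X W G ι) (a : α) (x : Bool) : X.del (ι (a, x)) = X.del (ι (a, true)) := by
  cases x
  · rw [← del_del, h.mate]; rfl
  · rfl

/-- Smoothing of a crossing of a Gauss diagram. -/
lemma of_smoothing (h : Rep σ X W G ι) {a : α} (hG : G.Smoothing G' a) : ∃ W' ι',
    Rep (σ * swap (ι (a, true)) (X.mate (ι (a, true)))) (X.del (ι (a, true))) W' G' ι' := by
  obtain ⟨κ, hs, x, u, v, R, s, hst, hC⟩ := smoothing_iff.1 hG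
  obtain ⟨W', L, hW, hL, hK⟩ := h.exists_smoothed hst
  rw [← h.swap_eq a x]
  have hκ : ∀ p : α × Bool, p.1 ≠ a ↔ ∃ q, Prod.map κ id q = p := by
    intro p
    rw [← hst.mem_iff p, ← hC, mem_flatten_map_map]
    constructor
    · rintro ⟨q, -, hq⟩; exact ⟨q, hq⟩
    · rintro ⟨q, hq⟩; exact ⟨q, G'.complete q, hq⟩
  have hr : ∀ p, ι p ∈ Set.range (fun p => ι (Prod.map κ id p)) ↔ p.1 ≠ a := fun p => by
    rw [hκ]
    exact ⟨fun ⟨q, hq⟩ => ⟨q, h.inj hq⟩, fun ⟨q, hq⟩ => ⟨q, congrArg ι hq⟩⟩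
  obtain ⟨h1, h2, h3⟩ := h.del_facts a true
  refine ⟨W', _, h.restrict κ hs hW (fun p => h1 _ ((hκ _).2 ⟨p, rfl⟩)) (fun z hz => ?_) rfl rfl ?_⟩
  · by_cases hz' : z ∈ Set.range ι
    · obtain ⟨p, rfl⟩ := hz'
      exact h2 p fun hk => hz ((hr p).2 hk)
    · exact h3 z (h.dummy z hz')
  · rw [← sift_sift _ _ _ (range_subset (ι' := fun p => ι (Prod.map κ id p)) fun _ => rfl), hL,
      sift_map, hC, ← hK _ hr]

/-- Gauss diagrams of smoothed diagrams. -/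
lemma exists_smoothing [Finite P] (h : Rep σ X W G ι) {a : α} {x : Bool} {u v : List (α × Bool)}
    {R : List (List (α × Bool))} {s : Bool} (hs : G.Starts a x u v R s) :
    ∃ (n : ℕ) (G' : GaussDiagram (Fin n)) (W' : _) (ι' : _), Rep (σ * swap (ι (a, true))
      (X.mate (ι (a, true)))) (X.del (ι (a, true))) W' G' ι' ∧ G.Smoothing G' a := by
  obtain ⟨W', L, hW, hL, hK⟩ := h.exists_smoothed hs
  rw [← h.swap_eq a x]
  have : Nonempty P := ⟨ι (a, true)⟩
  obtain ⟨n, G', ι', h'⟩ := hW.exists_rep (X.del (ι (a, true)))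
  obtain ⟨h1, h2, h3⟩ := h.del_facts a true
  obtain ⟨κ, h4, h5⟩ := h.exists_labels h' fun z hz => by
    rw [del_mate] at hz ⊢
    exact ⟨by rw [if_pos]; by_contra h0; rw [if_neg h0] at hz; exact hz rfl, rfl, rfl⟩
  have hr : ∀ p, ι p ∈ Set.range ι' ↔ p.1 ≠ a := fun p => by
    rw [h'.mem_range]
    constructor
    · exact fun hp h0 => hp (h2 p (not_not.2 h0))
    · intro hp
      rw [h1 p hp]
      exact h.mem_range.1 ⟨p, rfl⟩
  refine ⟨n, G', W', ι', h', smoothing_iff.2 ⟨κ, h4, x, u, v, R, s, hs, ?_⟩⟩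
  rw [h.circles_of_labels h' h5 (C := L), hK _ hr]
  rw [← hL, sift_sift _ _ _ (range_subset h5)]

end Rep

end GaussDiagram

/-! ### Crossing changes, third moves and Conway triples -/

namespace GaussDiagram

open Crossings ArrowDiagram

variable {P : Type} {α β : Type} {σ : Perm P} {X Y : Crossings P} {W W' : List (List P)}
  {G : GaussDiagram α} {G' : GaussDiagram β} {ι : α × Bool → P} {ι' : β × Bool → P}

/-- Move the endpoints of the arrows and change the signs. -/
def permute (G : GaussDiagram α) (π : Perm (α × Bool)) (s : α → ℤˣ) : GaussDiagram α where
  base := G.base.map π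
  others := G.others.map (List.map π)
  nodup := by
    rw [← List.map_cons (f := List.map π), ← List.map_flatten]
    exact G.nodup.map π.injective
  complete p := by
    rw [← List.map_cons (f := List.map π), ← List.map_flatten]
    exact List.mem_map.2 ⟨π.symm p, G.complete _, by simp⟩
  sign := s

variable [DecidableEq α]

namespace Rep

/-- Crossing changes of Gauss diagrams. -/
lemma of_crossingChange (h : Rep σ X W G ι) {Gm : GaussDiagram α} {a : α}
    (hG : G.CrossingChange Gm a) : ∃ ι', Rep σ (X.cc (ι (a, true))) W Gm ι' := by
  obtain ⟨h1, h2, hC⟩ := hG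
  have hπ : ∀ p, swap (a, true) (a, false) p = if p.1 = a then ArrowDiagram.flip p else p := by
    rintro ⟨b, _ | _⟩ <;> by_cases hb : b = a <;> simp [swap_apply_def, ArrowDiagram.flip, hb]
  refine ⟨_, h.relabel _ hC (fun p => by simp) (fun z hz => hz) (fun p => ?_) (fun p => ?_)
    fun p => ?_⟩
  · rw [hπ, hπ]
    refine (h.mate _).trans ?_
    by_cases hp : p.1 = a <;> simp [ArrowDiagram.flip, hp]
  · rw [hπ]
    refine (h.ε _).trans ?_
    obtain ⟨b, _ | _⟩ := p <;> by_cases hp : b = a <;>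
      simp [ArrowDiagram.flip, crossings, hp, h1, h2]
  · rw [hπ]
    have h3 := h.up
    have h4 : ∀ b y z, ι (b, y) = ι (a, z) ↔ b = a ∧ y = z := fun b y z => by
      rw [h.inj.eq_iff, Prod.mk.injEq]
    obtain ⟨b, _ | _⟩ := p <;> by_cases hp : b = a <;>
      simp [ArrowDiagram.flip, cc, h.mate, h3, h4, hp]

lemma exists_crossingChange (h : Rep σ X W G ι) {a : α} (ha : G.sign a = 1) :
    ∃ Gm : GaussDiagram α, G.CrossingChange Gm a ∧ ∃ ι', Rep σ (X.cc (ι (a, true))) W Gm ι' := by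
  have : G.CrossingChange (G.permute (swap (a, true) (a, false))
    (Function.update G.sign a (-1))) a := ⟨ha, rfl, rfl⟩
  exact ⟨_, this, h.of_crossingChange this⟩

/-- The third Reidemeister move. -/
lemma of_triPerm (h : Rep σ X W G ι) {a a' c c' e e' : α × Bool}
    (hn : [a, a', c, c', e, e'].Nodup) {G'' : GaussDiagram α} (hs : ∀ a, G''.sign a = G.sign a)
    (hC : G''.circles = G.circles.map (List.map
      (swap a c * swap a' e * swap c' e' : Perm (α × Bool)))) :
    ∃ ι', Rep σ (X.map (triPerm (ι a) (ι a') (ι c) (ι c') (ι e) (ι e'))) W G'' ι' := by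
  set π : Perm (α × Bool) := swap a c * swap a' e * swap c' e' with hπ
  set τ := triPerm (ι a) (ι a') (ι c) (ι c') (ι e) (ι e') with hτ
  have he : ∀ p, ι (π p) = τ (ι p) := fun p => by
    classical
    simp only [hτ, triPerm, hπ, Perm.mul_apply, h.inj.swap_apply]
  have hi : ∀ p, π (π p) = p := fun p => by
    simp only [hπ, Perm.mul_apply, swap_apply_def]
    simp only [List.nodup_cons, List.mem_cons, List.not_mem_nil, or_false, not_or] at hn
    grind
  refine ⟨_, h.relabel π hC hi (fun z hz => ?_) (fun p => ?_) (fun p => ?_) fun p => ?_⟩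
  · have h1 : X.mate (τ.symm z) = τ.symm z := by
      by_contra h2
      obtain ⟨p, hp⟩ := h.mem_range.2 h2
      have h3 := he p
      rw [hp, τ.apply_symm_apply] at h3
      exact h.mem_range.1 ⟨_, h3⟩ hz
    show τ (X.mate (τ.symm z)) = z
    rw [h1, τ.apply_symm_apply]
  · show τ (X.mate (τ.symm _)) = _
    rw [he, τ.symm_apply_apply, h.mate, he]
  · show X.ε (τ.symm _) = _
    rw [he, τ.symm_apply_apply, h.ε]
    simp [crossings, hs]
  · show X.up (τ.symm _) = _
    rw [he, τ.symm_apply_apply, h.up]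

end Rep

/-- Some Gauss diagram of a link diagram begins with the passages through a given crossing. -/
lemma _root_.Crossings.exists_starts [Finite P] (σ : Perm P) (X : Crossings P) {p : P}
    (hp : X.mate p ≠ p) : ∃ (n : ℕ) (G : GaussDiagram (Fin n)) (W : _) (ι : _) (a : Fin n) (x : Bool)
      (u v : _) (R : _) (s : Bool), Rep σ X W G ι ∧ ι (a, x) = p ∧ G.Starts a x u v R s := by
  classical
  have : Nonempty P := ⟨p⟩
  obtain ⟨W₀, hW₀⟩ := Words.exists_words σ
  obtain ⟨w, R, hW⟩ := hW₀.exists_head p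
  have key : ∀ {W : List (List P)} {n : ℕ} {G : GaussDiagram (Fin n)} {ι : Fin n × Bool → P},
      Rep σ X W G ι → ∃ a x, ι (a, x) = p ∧ ι (a, !x) = X.mate p ∧
        p ∈ Set.range ι ∧ X.mate p ∈ Set.range ι := fun h => by
    obtain ⟨⟨a, x⟩, hax⟩ := h.mem_range.2 hp
    have := h.mate (a, x)
    rw [hax] at this
    exact ⟨a, x, hax, this.symm, ⟨_, hax⟩, ⟨_, this.symm⟩⟩
  obtain ⟨w', hw', hq'⟩ := hW.exists_mem (X.mate p)
  rcases List.mem_cons.1 hw' with rfl | hw'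
  · obtain ⟨u, v, rfl⟩ := List.append_of_mem ((List.mem_cons.1 hq').resolve_left hp)
    obtain ⟨n, G, ι, h⟩ := hW.exists_rep X
    obtain ⟨a, x, h1, h2, h3, h4⟩ := key h
    obtain ⟨c, C, hC, hc, -⟩ := List.map_eq_cons_iff.1 h.circles
    rw [List.filter_cons_of_pos (by simpa using h3), List.filter_append,
      List.filter_cons_of_pos (by simpa using h4)] at hc
    obtain ⟨y, l, rfl, hy, hl⟩ := List.map_eq_cons_iff.1 hc
    obtain ⟨l₁, l₂, rfl, -, hl₂⟩ := List.map_eq_append_iff.1 hl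
    obtain ⟨z, l₃, rfl, hz, -⟩ := List.map_eq_cons_iff.1 hl₂
    obtain rfl := h.inj (hy.trans h1.symm)
    obtain rfl := h.inj (hz.trans h2.symm)
    exact ⟨n, G, _, ι, a, x, l₁, l₃, C, true, h, h1, hC⟩
  · obtain ⟨A, B, rfl⟩ := List.append_of_mem hw'
    obtain ⟨v, hv⟩ := exists_isRotated_cons hq'
    have hW' : Words σ ((p :: w) :: (X.mate p :: v) :: (A ++ B)) :=
      hW.reordered (List.perm_middle.cons _)
        (.cons (.refl _) (.cons hv (List.forall₂_same.2 fun _ _ => .refl _)))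
    obtain ⟨n, G, ι, h⟩ := hW'.exists_rep X
    obtain ⟨a, x, h1, h2, h3, h4⟩ := key h
    obtain ⟨c, C, hC, hc, hC'⟩ := List.map_eq_cons_iff.1 h.circles
    obtain ⟨d, D, rfl, hd, -⟩ := List.map_eq_cons_iff.1 hC'
    rw [List.filter_cons_of_pos (by simpa using h3)] at hc
    rw [List.filter_cons_of_pos (by simpa using h4)] at hd
    obtain ⟨y, l, rfl, hy, -⟩ := List.map_eq_cons_iff.1 hc
    obtain ⟨z, l', rfl, hz, -⟩ := List.map_eq_cons_iff.1 hd
    obtain rfl := h.inj (hy.trans h1.symm)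
    obtain rfl := h.inj (hz.trans h2.symm)
    exact ⟨n, G, _, ι, a, x, l, l', D, false, h, h1, hC⟩

open Classical in
/-- Every positive crossing of a link diagram is part of a Conway triple. -/
lemma _root_.Crossings.exists_conwayTriple [Finite P] (σ : Perm P) (X : Crossings P) {p : P}
    (hp : X.mate p ≠ p) (hs : X.sgn p = 1) : ∃ (n k : ℕ) (Gp Gm : GaussDiagram (Fin n))
      (Gz : GaussDiagram (Fin k)), ConwayTriple Gp Gm Gz ∧ (∃ W ι, Rep σ X W Gp ι) ∧
      (∃ W ι, Rep σ (X.cc p) W Gm ι) ∧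
      ∃ W ι, Rep (σ * swap p (X.mate p)) (X.del p) W Gz ι := by
  obtain ⟨n, G, W, ι, a, x, u, v, R, s, h, rfl, hst⟩ := X.exists_starts σ hp
  obtain ⟨k, Gz, W', ι', h', hz⟩ := h.exists_smoothing hst
  obtain ⟨Gm, hm, ι'', h''⟩ := h.exists_crossingChange (a := a) (by rw [← h.sgn (a, x), hs])
  have := Fintype.ofFinite P
  have hcc : X.cc (ι (a, true)) = X.cc (ι (a, x)) := by
    cases x
    · have := cc_mate X (ι (a, false)) hp
      rwa [h.mate] at this
    · rfl
  have hsw : swap (ι (a, x)) (X.mate (ι (a, x))) = _ := (h.mate (a, x)) ▸ h.swap_eq a x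
  rw [← hsw, ← h.del_eq a x] at h'
  rw [hcc] at h''
  exact ⟨n, k, G, Gm, Gz, ⟨a, hm, hz⟩, ⟨W, ι, h⟩, ⟨W, ι'', h''⟩, W', ι', h'⟩

end GaussDiagram

/-! ### Compatibility of the moves with exchanging over and under -/

namespace Crossings

variable {P : Type} {σ : Perm P} {X : Crossings P}

lemma Planar.turn (h : X.Planar σ) (t : Bool) : (X.turn t).Planar σ := by
  cases t
  exacts [h.rev, h]

lemma turn_del (X : Crossings P) (t : Bool) (p : P) : (X.del p).turn t = (X.turn t).del p := by
  cases t <;> rfl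

lemma turn_cc (X : Crossings P) (t : Bool) (p : P) : (X.cc p).turn t = (X.turn t).cc p := by
  cases t
  · refine Crossings.ext rfl rfl (funext fun z => ?_)
    by_cases h : z = p ∨ z = X.mate p
    · exact (congrArg not (if_pos h)).trans (if_pos h).symm
    · exact (congrArg not (if_neg h)).trans (if_neg h).symm
  · rfl

lemma turn_map (X : Crossings P) (t : Bool) (e : Perm P) :
    (X.map e).turn t = (X.turn t).map e := by
  cases t <;> rfl

lemma Bigon.turn {p₁ p₂ q₁ q₂ : P} (h : Bigon σ X p₁ p₂ q₁ q₂) (t : Bool) :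
    Bigon σ (X.turn t) p₁ p₂ q₁ q₂ := by
  cases t
  · exact ⟨h.nodup, h.mate₁, h.mate₂, h.next_p, h.next_q, congrArg not h.up_eq,
      congrArg Neg.neg h.ε_neg⟩
  · exact h

lemma Triangle.turn {a a' c c' e e' : P} {x y w : ℤˣ} (h : Triangle σ X a a' c c' e e' x y w)
    (t : Bool) : Triangle σ (X.turn t) a a' c c' e e' x y w := by
  cases t
  · refine ⟨h.nodup, h.ma, h.mc, h.me, h.hx, h.hy, h.hw, ?_, ?_⟩
    · exact (mul_neg _ _).trans ((congrArg _ h.h₁).trans (mul_neg _ _).symm)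
    · exact (mul_neg _ _).trans ((congrArg _ h.h₂).trans (mul_neg _ _).symm)
  · exact h

lemma Triangle.Layered.turn {p q r : P} (h : Layered (X.up p) (X.up q) (X.up r)) (t : Bool) :
    Layered ((X.turn t).up p) ((X.turn t).up q) ((X.turn t).up r) := by
  rw [turn_up, turn_up, turn_up]
  exact h.imp (fun h => by rw [h]) fun h => by rw [h]

end Crossings

/-! ### Invariance of the counts and their skein relation -/

namespace GaussDiagram

open Crossings ArrowDiagram

variable {P : Type} {α β : Type} [DecidableEq α] [Fintype α] [DecidableEq β] [Fintype β]
  {σ : Perm P} {X Y : Crossings P}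
  {W W' : List (List P)} {G : GaussDiagram α} {G' : GaussDiagram β} {ι : α × Bool → P}

/-- The base point of `G` corresponds to the start of the first word; by `baseFree` any other point
serves as well, so two Gauss diagrams can be compared at a common point. -/
lemma Rep.count_eq_of_planar [Fintype P] (h : Rep σ X W G ι) (hP : X.Planar σ) (t : Bool) (k : ℕ)
    (b : P) : count t G k = stateSum k σ (X.turn t) b := by
  obtain ⟨b', w, W', rfl⟩ := h.exists_head
  rw [h.count_eq t k, baseFree k P σ _ (hP.turn t) b b']

lemma SameUnbased.count_eq (h : G.SameUnbased G') (hG : G.IsClassical) (t : Bool) (k : ℕ) :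
    count t G k = count t G' k := by
  obtain ⟨P, hP, σ, X, W, ι, hr, -⟩ := G.exists_rep
  have := Fintype.ofFinite P
  obtain ⟨W', ι', hr'⟩ := hr.of_sameUnbased h
  have hp := hr.planar_iff.2 hG
  obtain ⟨b, -⟩ := hr.exists_head
  rw [hr.count_eq_of_planar hp t k b, hr'.count_eq_of_planar hp t k b]

lemma Reidemeister1.count_eq (h : G.Reidemeister1 G') (hG : G.IsClassical) (hG' : G'.IsClassical)
    (t : Bool) (k : ℕ) : count t G k = count t G' k := by
  obtain ⟨a, x, ha, hd⟩ := h
  obtain ⟨P, hP, σ, X, W, ι, hr, hadj⟩ := G.exists_rep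
  have := Fintype.ofFinite P
  obtain ⟨h1, h2, h3⟩ := hr.del_facts a x
  obtain ⟨ι', hr'⟩ := hr.of_deletesTo hd h1 h2 h3 rfl rfl
  have hp := hr.planar_iff.2 hG
  have hm : X.mate (ι (a, x)) = ι (a, !x) := hr.mate _
  rw [hr.count_eq_of_planar hp t k (ι (a, x)),
    hr'.count_eq_of_planar (hr'.planar_iff.2 hG') t k (ι (a, x)), turn_del]
  refine (shiftFree k).kink (hp.turn t) ?_ ?_ _
  · rw [turn_mate]; exact hr.mem_range.1 ⟨_, rfl⟩
  · rw [turn_mate, hm, hadj _ _ ha]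

lemma Rep.del_del_facts (h : Rep σ X W G ι) (a b : α) (x : Bool) :
    (∀ p, p.1 ≠ a ∧ p.1 ≠ b → ((X.del (ι (a, x))).del (ι (b, x))).mate (ι p) = X.mate (ι p)) ∧
      (∀ p, ¬ (p.1 ≠ a ∧ p.1 ≠ b) → ((X.del (ι (a, x))).del (ι (b, x))).mate (ι p) = ι p) ∧
      ∀ z, X.mate z = z → ((X.del (ι (a, x))).del (ι (b, x))).mate z = z := by
  obtain ⟨h1, h2, h3⟩ := h.del_facts a x
  obtain ⟨h4, h5, h6⟩ := h.del_facts b x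
  simp only [del_mate X (ι (b, x))] at h4 h5 h6
  refine ⟨?_, ?_, ?_⟩ <;> intro p <;> rw [del_mate (X.del _)] <;> grind

lemma Reidemeister2.count_eq (h : G.Reidemeister2 G') (hG : G.IsClassical) (hG' : G'.IsClassical)
    (t : Bool) (k : ℕ) : count t G k = count t G' k := by
  obtain ⟨a, b, hab, hs, ha, ha', hd⟩ := h
  obtain ⟨P, hP, σ, X, W, ι, hr, hadj⟩ := G.exists_rep
  have := Fintype.ofFinite P
  obtain ⟨h1, h2, h3⟩ := hr.del_del_facts a b true
  obtain ⟨ι', hr'⟩ := hr.of_deletesTo hd h1 h2 h3 rfl rfl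
  have hp := hr.planar_iff.2 hG
  have hp' := hr'.planar_iff.2 hG'
  have hB : Bigon σ X (ι (a, true)) (ι (b, true)) (ι (a, false)) (ι (b, false)) := by
    refine ⟨?_, hr.mate _, hr.mate _, hadj _ _ ha, ha'.imp (hadj _ _) (hadj _ _), ?_, ?_⟩
    · simp [hr.inj.eq_iff, hab]
    · rw [hr.up, hr.up]
    · rw [hr.ε, hr.ε]; simp [crossings, hs]
  rw [hr.count_eq_of_planar hp t k (ι (a, true)), hr'.count_eq_of_planar hp' t k (ι (a, true)),
    turn_del, turn_del]
  exact (shiftFree k).bigon (hp.turn t) (hB.turn t) (by rw [← turn_del, ← turn_del]; exact hp'.turn t) _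

lemma Reidemeister3.count_eq {G' : GaussDiagram α} (h : G.Reidemeister3 G') (hG : G.IsClassical)
    (hG' : G'.IsClassical) (t : Bool) (k : ℕ) : count t G k = count t G' k := by
  obtain ⟨tm, tb, mb, x, y, w, h1, h2, h3, hx, hy, hw, h4, h5, hs, hC⟩ := h
  obtain ⟨P, hP, σ, X, W, ι, hr, hadj⟩ := G.exists_rep
  have := Fintype.ofFinite P
  obtain ⟨ι', hr'⟩ := hr.of_triPerm (by simp [h1, h2, h3]) hs hC
  have hp := hr.planar_iff.2 hG
  have hp' := hr'.planar_iff.2 hG'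
  have hN : ∀ {p q s}, G.Neighbours p q s → Nb σ (ι p) (ι q) s := fun h =>
    h.imp (And.imp_right (hadj _ _)) (And.imp_right (hadj _ _))
  have hT : Triangle σ X (ι (tm, true)) (ι (tm, false)) (ι (tb, true)) (ι (tb, false))
      (ι (mb, true)) (ι (mb, false)) x y w := by
    refine ⟨?_, hr.mate _, hr.mate _, hr.mate _, hN hx, hN hy, hN hw, ?_, ?_⟩
    · simp [hr.inj.eq_iff, h1, h2, h3]
    · rw [hr.ε, hr.ε]; exact h4
    · rw [hr.ε, hr.ε]; exact h5
  have hl : Triangle.Layered (X.up (ι (tm, true))) (X.up (ι (tb, true))) (X.up (ι (mb, true))) := by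
    simp [hr.up, Triangle.Layered]
  rw [hr.count_eq_of_planar hp t k (ι (tm, true)), hr'.count_eq_of_planar hp' t k (ι (tm, true)),
    turn_map]
  exact (shiftFree k).triangle (hp.turn t) (hT.turn t) (hl.turn t)
    (by rw [← turn_map]; exact hp'.turn t) _

lemma ConwayTriple.count_eq {Gp Gm : GaussDiagram α} (h : ConwayTriple Gp Gm G')
    (hp : Gp.IsClassical) (t : Bool) : count t Gp 0 = count t Gm 0 ∧
      ∀ k, count t Gp (k + 1) - count t Gm (k + 1) = count t G' k := by
  classical
  obtain ⟨a, hc, hs⟩ := h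
  obtain ⟨P, hP, σ, X, W, ι, hr, -⟩ := Gp.exists_rep
  have := Fintype.ofFinite P
  obtain ⟨ι₁, hr₁⟩ := hr.of_crossingChange hc
  obtain ⟨W₂, ι₂, hr₂⟩ := hr.of_smoothing hs
  have hX := hr.planar_iff.2 hp
  have ha : X.mate (ι (a, true)) ≠ ι (a, true) := hr.mem_range.1 ⟨_, rfl⟩
  have h1 := fun k => hr.count_eq_of_planar hX t k (ι (a, true))
  have h2 := fun k => hr₁.count_eq_of_planar (hX.cc _) t k (ι (a, true))
  have h3 := fun k => hr₂.count_eq_of_planar (hX.smooth ha) t k (ι (a, true))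
  refine ⟨?_, fun k => ?_⟩
  · rw [h1, h2, stateSum_zero, stateSum_zero]
  · have := skein k σ (X := X.turn t) (ι (a, true)) (p := ι (a, true)) (by rwa [turn_mate])
    rw [h1, h2, h3, turn_cc, turn_del, this, turn_sgn, turn_mate, hr.sgn, hc.1]
    simp

lemma count_eq_zero {n : ℕ} (G : GaussDiagram (Fin n)) (t : Bool) {k : ℕ} (h : n < k) :
    count t G k = 0 := by
  have : ∀ A : ArrowDiagram (Fin k), pairing A G = 0 := fun A => by
    have : IsEmpty (Hom A G.toArrowDiagram) := ⟨fun φ => by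
      have := Fintype.card_le_of_embedding φ.arrow
      simp at this
      omega⟩
    exact finsum_of_isEmpty _
  simp [count, this]

end GaussDiagram

/-! ### The Conway polynomial from the counts -/

namespace ClassicalDiagram

open GaussDiagram Crossings

lemma Step.count_eq {D D' : ClassicalDiagram} (h : Step D D') (t : Bool) (k : ℕ) :
    count t D.gauss k = count t D'.gauss k := by
  cases h with
  | same _ _ h => exact h.count_eq D.classical t k
  | r1 _ _ h => exact h.count_eq D.classical D'.classical t k
  | r2 _ _ h => exact h.count_eq D.classical D'.classical t k
  | r3 G G' hG hG' h => exact h.count_eq hG hG' t k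

/-- The polynomial of the numbers of states. -/
noncomputable def polynomial (t : Bool) (D : ClassicalDiagram) : Polynomial ℤ :=
  ∑ k ∈ Finset.range (D.n + 1), Polynomial.monomial k (count t D.gauss k)

lemma coeff_polynomial (t : Bool) (D : ClassicalDiagram) (k : ℕ) :
    (D.polynomial t).coeff k = count t D.gauss k := by
  simp only [polynomial, Polynomial.finsetSum_coeff, Polynomial.coeff_monomial]
  rw [Finset.sum_ite_eq']
  split_ifs with h
  · rfl
  · exact (count_eq_zero _ _ (by simpa using h)).symm

/-- The polynomial of the numbers of states of a link. -/
noncomputable def _root_.ClassicalLink.polynomial (t : Bool) : ClassicalLink → Polynomial ℤ :=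
  Quot.lift (ClassicalDiagram.polynomial t) fun D D' h => Polynomial.ext fun k => by
    rw [coeff_polynomial, coeff_polynomial, h.count_eq]

lemma coeff_link (t : Bool) (D : ClassicalDiagram) (k : ℕ) :
    (D.link.polynomial t).coeff k = count t D.gauss k := D.coeff_polynomial t k

lemma count_unknot (t : Bool) : count t unknot.gauss 0 = 1 := by
  obtain ⟨P, hP, σ, X, W, ι, hr, -⟩ := unknot.gauss.exists_rep
  have := Fintype.ofFinite P
  have hX := hr.planar_iff.2 unknot.classical
  obtain ⟨b, w, W', rfl⟩ := hr.exists_head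
  have hc := hr.circles
  have hW : W' = [] := by
    simp only [sift, List.map_cons] at hc
    exact List.map_eq_nil_iff.1 (List.cons.inj hc).2.symm
  subst hW
  rw [hr.count_eq_of_planar hX t 0 b, stateSum_zero, if_pos]
  intro q
  exact cyc_walk (hr.words.cyc _ List.mem_cons_self) List.mem_cons_self
    (by simpa using hr.words.complete q)

lemma isConwayPolynomial (t : Bool) : IsConwayPolynomial (ClassicalLink.polynomial t) where
  unknot := by
    ext k
    rw [coeff_link, Polynomial.coeff_one]
    split_ifs with h
    · rw [h, count_unknot]
    · exact count_eq_zero _ _ (Nat.pos_of_ne_zero h)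
  skein Gp Gm Gz hp hm hz h := by
    ext k
    obtain ⟨h0, hk⟩ := h.count_eq hp t
    rw [Polynomial.coeff_sub, coeff_link, coeff_link]
    rcases k with _ | k
    · rw [Polynomial.coeff_X_mul_zero, h0, sub_self]
    · rw [Polynomial.coeff_X_mul, coeff_link, hk]

end ClassicalDiagram

/-! ### Gauss diagrams whose words do not start inside a move -/

namespace GaussDiagram

open Crossings ArrowDiagram

variable {P : Type} {α : Type} {σ : Perm P} {X : Crossings P} {W W' : List (List P)}
  {G : GaussDiagram α} {ι : α × Bool → P}

lemma Rep.adjacent (h : Rep σ X W G ι) {p q : α × Bool} {w : List P} (hw : w ∈ W)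
    (hpq : [ι p, ι q] <:+: w) : G.Adjacent p q := by
  classical
  have : w.filter (fun z => decide (z ∈ Set.range ι)) ∈ G.circles.map (List.map ι) :=
    h.circles ▸ List.mem_map.2 ⟨w, hw, List.filter_congr fun z _ => by simp⟩
  obtain ⟨c, hc, hcw⟩ := List.mem_map.1 this
  obtain ⟨s, t, rfl⟩ := hpq
  simp only [List.filter_append, List.filter_cons, List.filter_nil, Set.mem_range_self, decide_true,
    if_true, List.append_assoc, List.cons_append, List.nil_append] at hcw
  obtain ⟨s', l, rfl, -, hl⟩ := List.map_eq_append_iff.1 hcw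
  obtain ⟨p', l, rfl, hp, hl⟩ := List.map_eq_cons_iff.1 hl
  obtain ⟨q', l, rfl, hq, -⟩ := List.map_eq_cons_iff.1 hl
  rw [h.inj hp, h.inj hq] at hc
  exact ⟨_, hc, s', l, by simp⟩

/-- A Gauss diagram in which the links in `T` do not contain the starting points of words. -/
lemma _root_.Crossings.exists_rep_avoiding [Finite P] [Nonempty P] (σ : Perm P)
    (X : Crossings P) (T : P → Prop) (hT : ∀ z, T z → ¬ T (σ z)) :
    ∃ (n : ℕ) (G : GaussDiagram (Fin n)) (W : _) (ι : _), Rep σ X W G ι ∧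
      ∀ p q, σ (ι p) = ι q → T (ι q) → G.Adjacent p q := by
  obtain ⟨W₀, hW₀⟩ := Words.exists_words σ
  obtain ⟨W, hW, hav⟩ := hW₀.exists_avoid T fun z h h' => hT z h' h
  obtain ⟨n, G, ι, h⟩ := hW.exists_rep X
  refine ⟨n, G, W, ι, h, fun p q hpq hq => ?_⟩
  obtain ⟨w, hw, hin⟩ := hW.infix hpq fun w hw z l hwz hz => hav w hw z l hwz (hz ▸ hq)
  exact h.adjacent hw hin

end GaussDiagram

namespace Crossings

open GaussDiagram

variable {P : Type} {σ : Perm P} {X : Crossings P}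

/-- The three strands of a triangle, from top to bottom. -/
lemma Triangle.exists_sorted {a a' c c' e e' : P} {x y w : ℤˣ}
    (T : Triangle σ X a a' c c' e e' x y w) (hl : Triangle.Layered (X.up a) (X.up c) (X.up e)) :
    ∃ b b' d d' f f' x y w, Triangle σ X b b' d d' f f' x y w ∧ X.up b = true ∧ X.up d = true ∧
      X.up f = true ∧ triPerm b b' d d' f f' = triPerm a a' c c' e e' := by
  have h2 : ∀ {a a' c c' e e' : P} {x y w : ℤˣ}, Triangle σ X a a' c c' e e' x y w →
      X.up a = true → X.up c = true → ∃ b b' d d' f f' x y w,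
      Triangle σ X b b' d d' f f' x y w ∧ X.up b = true ∧ X.up d = true ∧
      X.up f = true ∧ triPerm b b' d d' f f' = triPerm a a' c c' e e' := by
    intro a a' c c' e e' x y w T ha hc
    rcases he : X.up e with _ | _
    · exact ⟨_, _, _, _, _, _, _, _, _, T.swap₂, hc, ha, by rw [T.up_facts.2.2, he]; rfl, T.perm_swap₂⟩
    · grind
  have h1 : ∀ {a a' c c' e e' : P} {x y w : ℤˣ}, Triangle σ X a a' c c' e e' x y w →
      X.up c = true → X.up e = true → ∃ b b' d d' f f' x y w,
      Triangle σ X b b' d d' f f' x y w ∧ X.up b = true ∧ X.up d = true ∧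
      X.up f = true ∧ triPerm b b' d d' f f' = triPerm a a' c c' e e' := by
    intro a a' c c' e e' x y w T hc he
    rcases ha : X.up a with _ | _
    · exact ⟨_, _, _, _, _, _, _, _, _, T.swap₁, by rw [T.up_facts.1, ha]; rfl, he, hc, T.perm_swap₁⟩
    · grind
  have hu := T.up_facts
  rcases hc : X.up c with _ | _
  · rcases ha : X.up a with _ | _
    · rcases he : X.up e with _ | _
      · have T' := T.swap₁.swap₂
        have := h1 T' (by grind) (by grind)
        rwa [T.swap₁.perm_swap₂, T.perm_swap₁] at this
      · have := h2 T.swap₁ (by grind) he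
        rwa [T.perm_swap₁] at this
    · have he : X.up e = false := by rw [ha, hc] at hl; exact (hl.resolve_left (by grind)).symm
      have := h1 T.swap₂ ha (by grind)
      rwa [T.perm_swap₂] at this
  · rcases ha : X.up a with _ | _
    · exact h1 T hc (by rw [ha, hc] at hl; exact (hl.resolve_left (by grind)).symm)
    · grind

end Crossings

/-! ### Uniqueness of the Conway polynomial -/

namespace ClassicalDiagram

open GaussDiagram Crossings

variable {P : Type} {n k : ℕ} {σ : Perm P} {X : Crossings P} {W W' : List (List P)}
  {G : GaussDiagram (Fin n)} {G' : GaussDiagram (Fin k)} {ι : Fin n × Bool → P}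
  {ι' : Fin k × Bool → P}

/-- The function `f` vanishes on the link of `D`. -/
def VanishesOn (f : ClassicalLink → ℤ) (D : PlanarCurve) : Prop :=
  ∀ (n : ℕ) (G : GaussDiagram (Fin n)) (hG : G.IsClassical) (W : _) (ι : _),
    Rep D.σ D.X W G ι → f (link ⟨n, G, hG⟩) = 0

/-- All Gauss diagrams of one curve represent the same link, so one of them suffices. -/
lemma vanishesOn_iff {f : ClassicalLink → ℤ} {D : PlanarCurve} {W : _} {ι : _}
    (h : Rep D.σ D.X W G ι) (hG : G.IsClassical) : VanishesOn f D ↔ f (link ⟨n, G, hG⟩) = 0 := by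
  refine ⟨fun H => H n G hG W ι h, fun H k G' hG' W' ι' h' => ?_⟩
  rw [← H]
  exact congrArg f (Quot.sound (.same _ _ (h'.sameUnbased h)))

lemma VanishesOn.iff_of_link_eq {f : ClassicalLink → ℤ} {D D' : PlanarCurve} {W W' ι ι'}
    (h : Rep D.σ D.X W G ι) (h' : Rep D'.σ D'.X W' G' ι') (H : ∀ hG hG',
      f (link ⟨n, G, hG⟩) = f (link ⟨k, G', hG'⟩)) : VanishesOn f D ↔ VanishesOn f D' := by
  have := D.finite
  have := D'.finite
  have hG := h.planar_iff.1 D.planar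
  have hG' := h'.planar_iff.1 D'.planar
  rw [vanishesOn_iff h hG, vanishesOn_iff h' hG', H hG hG']

/-- On suitably read Gauss diagrams, deleting dummies does not affect the link, kinks, bigons and
triangles become Reidemeister moves, and a crossing change becomes part of a Conway triple, where
`hf` applies. -/
lemma _root_.PlanarCurve.Move.vanishesOn_iff {f : ClassicalLink → ℤ}
    (hf : ∀ {n k : ℕ} (Gp Gm : GaussDiagram (Fin n)) (Gz : GaussDiagram (Fin k))
      (hp : Gp.IsClassical) (hm : Gm.IsClassical), Gz.IsClassical → ConwayTriple Gp Gm Gz →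
        f (link ⟨n, Gp, hp⟩) = f (link ⟨n, Gm, hm⟩)) {D D' : PlanarCurve}
    (hm : PlanarCurve.Move D D') : VanishesOn f D ↔ VanishesOn f D' := by
  cases hm with
  | emb j E =>
    have := D.finite
    have := D'.finite
    by_cases hD : Nonempty D'.P
    · obtain ⟨W₀, hW₀⟩ := Words.exists_words D'.σ
      obtain ⟨n, G, ι, h⟩ := hW₀.exists_rep D'.X
      obtain ⟨W, ι', h'⟩ := h.of_emb E
      exact VanishesOn.iff_of_link_eq h' h fun _ _ => rfl
    · constructor
      · intro _ n G _ W ι h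
        obtain ⟨b, -⟩ := h.exists_head
        exact (hD ⟨b⟩).elim
      · intro _ n G _ W ι h
        obtain ⟨b, -⟩ := h.exists_head
        exact (hD ⟨j b⟩).elim
  | @kink P hP σ X p hp hσ h1 h2 =>
    have : Nonempty P := ⟨p⟩
    obtain ⟨n, G, W, ι, h, ha⟩ := X.exists_rep_avoiding σ (· = X.mate p) fun z hz hz' =>
      hp (by rw [← hz, σ.injective (hz'.trans hσ.symm)])
    obtain ⟨⟨a, x⟩, rfl⟩ := h.mem_range.2 hp
    have hm : X.mate (ι (a, x)) = ι (a, !x) := h.mate _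
    obtain ⟨d1, d2, d3⟩ := h.del_facts a x
    obtain ⟨k, G', ι', h', hd⟩ := h.exists_deletesTo (fun c => c ≠ a) d1 d2 d3 rfl rfl
    exact VanishesOn.iff_of_link_eq h h' fun _ _ => congrArg f (Quot.sound (.r1 _ _
      ⟨a, x, ha _ _ (hσ.trans hm) hm.symm, hd⟩))
  | @bigon P hP σ X p₁ p₂ q₁ q₂ hB h1 h2 =>
    have : Nonempty P := ⟨p₁⟩
    obtain ⟨T, hT, hT1, hT2⟩ := hB.exists_second
    obtain ⟨n, G, W, ι, h, ha⟩ := X.exists_rep_avoiding σ T hT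
    have hn := hB.nodup
    simp only [List.nodup_cons, List.mem_cons, List.not_mem_nil, or_false, not_or] at hn
    obtain ⟨⟨a, x⟩, rfl⟩ := (h.mem_range (z := p₁)).2 (by rw [hB.mate₁]; grind)
    obtain ⟨⟨b, y⟩, rfl⟩ := (h.mem_range (z := p₂)).2 (by rw [hB.mate₂]; grind)
    obtain rfl : x = y := by have := hB.up_eq; rwa [h.up, h.up] at this
    obtain rfl : ι (a, !x) = q₁ := (h.mate (a, x)).symm.trans hB.mate₁
    obtain rfl : ι (b, !x) = q₂ := (h.mate (b, x)).symm.trans hB.mate₂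
    have hab : a ≠ b := by grind
    have hs : G.sign a = -G.sign b := by
      have := hB.ε_neg
      rw [h.ε, h.ε] at this
      cases x <;> simp [crossings] at this <;> simp [this]
    have hp := ha _ _ hB.next_p hT1
    have hq : G.Adjacent (a, !x) (b, !x) ∨ G.Adjacent (b, !x) (a, !x) :=
      hT2.imp (fun h => ha _ _ h.1 h.2) fun h => ha _ _ h.1 h.2
    obtain ⟨d1, d2, d3⟩ := h.del_del_facts a b x
    obtain ⟨k, G', ι', h', hd⟩ := h.exists_deletesTo (fun c => c ≠ a ∧ c ≠ b) d1 d2 d3 rfl rfl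
    refine VanishesOn.iff_of_link_eq h h' fun _ _ => congrArg f (Quot.sound (.r2 _ _ ?_))
    cases x with
    | true => exact ⟨a, b, hab, hs, hp, hq, hd⟩
    | false =>
      rcases hq with hq | hq
      · exact ⟨a, b, hab, hs, hq, Or.inl hp, hd⟩
      · refine ⟨b, a, hab.symm, by rw [hs, neg_neg], hq, Or.inr hp, ?_⟩
        simpa only [and_comm] using hd
  | @triangle P hP σ X a a' c c' e e' x y w T hl h1 h2 =>
    have : Nonempty P := ⟨a⟩
    obtain ⟨b, b', d, d', g, g', x, y, w, T', hb, hd, hg, hτ⟩ := T.exists_sorted hl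
    obtain ⟨n, G, W, ι, h, ha⟩ := X.exists_rep_avoiding σ _ T'.second
    have hn := T'.ne
    have key : ∀ {z z'}, X.mate z = z' → z ≠ z' → X.up z = true →
        ∃ i, ι (i, true) = z ∧ ι (i, false) = z' := by
      intro z z' hz hne hu
      obtain ⟨⟨i, s⟩, rfl⟩ := (h.mem_range (z := z)).2 (by grind)
      rw [h.up] at hu
      obtain rfl : s = true := hu
      exact ⟨i, rfl, (h.mate _).symm.trans hz⟩
    obtain ⟨tm, rfl, rfl⟩ := key T'.ma hn.1.1 hb
    obtain ⟨tb, rfl, rfl⟩ := key T'.mc hn.2.2.1.1 hd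
    obtain ⟨mb, rfl, rfl⟩ := key T'.me hn.2.2.2.2 hg
    have hN : ∀ {p q s}, Nb σ (ι p) (ι q) s → (∀ z, z = edge σ (ι p) s → z =
        edge σ (ι (tm, true)) x ∨ z = edge σ (ι (tm, false)) y ∨ z = edge σ (ι (tb, false)) w) →
        G.Neighbours p q s := by
      rintro p q s (⟨rfl, hs⟩ | ⟨rfl, hs⟩) hT
      · exact Or.inl ⟨rfl, ha _ _ hs (hT _ (by rw [edge_one, hs]))⟩
      · exact Or.inr ⟨rfl, ha _ _ hs (hT _ (by rw [edge_neg_one]))⟩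
    have h12 : tm ≠ tb := by grind
    have h13 : tm ≠ mb := by grind
    have h23 : tb ≠ mb := by grind
    have e1 := T'.h₁
    have e2 := T'.h₂
    rw [h.ε, h.ε] at e1 e2
    obtain ⟨ι', h'⟩ := h.of_triPerm (G'' := G.permute _ G.sign) (a := (tm, true)) (a' := (tm, false))
      (c := (tb, true)) (c' := (tb, false)) (e := (mb, true)) (e' := (mb, false))
      (by simp [h12, h13, h23]) (fun _ => rfl) rfl
    rw [hτ] at h'
    exact VanishesOn.iff_of_link_eq h h' fun hG hG' => congrArg f (Quot.sound (.r3 _ _ hG hG'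
      ⟨tm, tb, mb, x, y, w, h12, h13, h23, hN T'.hx fun _ => Or.inl,
        hN T'.hy fun _ h => Or.inr (Or.inl h), hN T'.hw fun _ h => Or.inr (Or.inr h), e1, e2,
        fun _ => rfl, rfl⟩))
  | @cc P hP σ X p hp h1 h2 =>
    have key : ∀ {X : Crossings P} (h1 : X.Planar σ) (h2 : (X.cc p).Planar σ), X.mate p ≠ p →
        X.sgn p = 1 → (VanishesOn f ⟨P, hP, σ, X, h1⟩ ↔ VanishesOn f ⟨P, hP, σ, X.cc p, h2⟩) := by
      intro X h1 h2 hp hs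
      obtain ⟨n, k, Gp, Gm, Gz, hc, ⟨W, ι, h⟩, ⟨W', ι', h'⟩, W'', ι'', h''⟩ :=
        X.exists_conwayTriple σ hp hs
      exact VanishesOn.iff_of_link_eq h h' fun hG hG' =>
        hf Gp Gm Gz hG hG' (h''.planar_iff.1 (h1.smooth hp)) hc
    -- Conway triples start from a positive crossing; for a negative one `X` and `X.cc p` exchange
    -- their roles.
    rcases units_eq (X.sgn p) with hs | hs
    · grind
    · have : Fintype P := Fintype.ofFinite P
      have hcc := cc_cc X p
      have hs' : (X.cc p).sgn p = 1 := by
        have := cc_sgn (X := X) hp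
        rw [hs, neg_neg] at this
        rw [← this]
        exact ((X.cc p).sgn_mate p).symm
      have := key h2 (by grind) hp hs'
      grind

/-- A circle with a kink, and other circles without crossings. -/
def kinked (m : ℕ) (x : Bool) (s : ℤˣ) : GaussDiagram (Fin 1) where
  base := [(0, x), (0, !x)]
  others := List.replicate m []
  nodup := by simp
  complete p := by
    obtain ⟨i, y⟩ := p
    obtain rfl := Subsingleton.elim i 0
    cases x <;> cases y <;> simp
  sign _ := s

lemma kinked_isClassical (m : ℕ) (x : Bool) (s : ℤˣ) : (kinked m x s).IsClassical := by
  rw [isClassical_iff]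
  have hn : ∀ y, (kinked m x s).next (0, y) = (0, !y) := by
    intro y
    have : (kinked m x s).next = swap (0, x) (0, !x) := by
      simp [ArrowDiagram.next, ArrowDiagram.circles, kinked]
    rw [this]
    cases x <;> cases y <;> rfl
  have hε : ∀ y, (kinked m x s).crossings.ε (0, y) = if y then s else -s := fun _ => rfl
  have hm : ∀ y, (kinked m x s).crossings.mate (0, y) = (0, !y) := fun _ => rfl
  intro ξ _
  refine ⟨fun p a => if a = -(kinked m x s).crossings.ε p then 0 else
    (kinked m x s).crossings.ε p * ξ p, ?_, ?_, ?_⟩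
  · rintro p
    rcases units_eq ((kinked m x s).crossings.ε p) with h | h <;> simp [h]
  · exact fun p hp => (crossings_mate_ne _ p hp).elim
  · rintro ⟨i, y⟩ _ a b
    obtain rfl := Subsingleton.elim i 0
    rw [hm]
    rcases units_eq a with rfl | rfl <;> rcases units_eq b with rfl | rfl <;>
    rcases units_eq s with rfl | rfl <;> cases y <;> simp [edge, hn, hε]

/-- Circles without crossings. -/
def unlink (m : ℕ) : ClassicalDiagram where
  n := 0
  gauss :=
    { base := []
      others := List.replicate m []
      nodup := by simp
      complete := fun p => p.1.elim0
      sign := fun _ => 1 }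
  classical := by
    simp [GaussDiagram.IsClassical, GaussDiagram.numFaces, GaussDiagram.numGraphComponents]

lemma link_kinked (m : ℕ) (x : Bool) (s : ℤˣ) :
    link ⟨1, kinked m x s, kinked_isClassical m x s⟩ = (unlink m).link := by
  refine Quot.sound (.r1 _ _ ⟨0, x, ⟨_, List.mem_cons_self, [], [], rfl⟩, ⟨Fin.elim0, fun i => i.elim0⟩,
    fun i => i.elim0, ?_⟩)
  simp [ArrowDiagram.circles, kinked, unlink]

lemma conwayTriple_kinked (m : ℕ) :
    ConwayTriple (kinked m true 1) (kinked m false (-1)) (unlink (m + 1)).gauss := by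
  refine ⟨0, ⟨rfl, ?_, ?_⟩, ⟨Fin.elim0, fun i => i.elim0⟩, fun i => i.elim0, true, [], [],
    List.replicate m [], Or.inl ⟨rfl, ?_⟩⟩
  · funext i
    obtain rfl := Subsingleton.elim i 0
    simp [kinked]
  · simp [ArrowDiagram.circles, kinked]
  · simp [ArrowDiagram.circles, unlink, List.replicate_succ]

/-- Removing the kink from either kinked diagram gives the same unlink, while the smoothing has one
circle more. So the skein relation reads `0 = X * C (unlink (m + 1)).link`. -/
lemma eval_unlink {C : ClassicalLink → Polynomial ℤ} (hC : IsConwayPolynomial C) (m : ℕ) :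
    C (unlink m).link = if m = 0 then 1 else 0 := by
  rcases m with _ | m
  · exact hC.unknot
  · have := hC.skein _ _ _ (kinked_isClassical m _ _) (kinked_isClassical m _ _)
      (unlink (m + 1)).classical (conwayTriple_kinked m)
    rw [link_kinked, link_kinked, sub_self] at this
    exact (mul_eq_zero.1 this.symm).resolve_left Polynomial.X_ne_zero

lemma exists_link_eq_unlink (G : GaussDiagram (Fin 0)) (hG : G.IsClassical) :
    ∃ m, link ⟨0, G, hG⟩ = (unlink m).link := by
  have h0 : ∀ w : List (Fin 0 × Bool), w = [] := fun w => List.eq_nil_iff_forall_not_mem.2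
    fun p => p.1.elim0
  refine ⟨G.others.length, Quot.sound (.same _ _ ⟨Equiv.refl _, fun i => i.elim0, _, .refl _, ?_⟩)⟩
  have : G.circles.map (List.map (Prod.map (Equiv.refl (Fin 0)) id)) =
      (unlink G.others.length).gauss.circles := by
    have h1 : ∀ L : List (List (Fin 0 × Bool)), L = List.replicate L.length [] := fun L =>
      List.eq_replicate_iff.2 ⟨rfl, fun w _ => h0 w⟩
    rw [h1 (G.circles.map _), h1 (unlink _).gauss.circles]
    simp [ArrowDiagram.circles, unlink]
  exact (congrArg (List.Forall₂ List.IsRotated · (unlink G.others.length).gauss.circles) this).mpr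
    (List.forall₂_same.2 fun _ _ => .refl _)

/-- Induction on the degree `j`. If the lower coefficients agree, the skein relation makes the
difference `f` of the coefficients of degree `j` insensitive to crossing changes. By
`exists_trivial` it then suffices that `f` vanishes on diagrams without crossings, and these are
covered by `eval_unlink`. -/
lemma isConwayPolynomial_unique {C C' : ClassicalLink → Polynomial ℤ}
    (hC : IsConwayPolynomial C) (hC' : IsConwayPolynomial C') : C' = C := by
  suffices ∀ (j : ℕ) (ℓ : ClassicalLink), (C' ℓ).coeff j - (C ℓ).coeff j = 0 from
    funext fun ℓ => Polynomial.ext fun j => sub_eq_zero.1 (this j ℓ)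
  intro j
  induction j using Nat.strong_induction_on with
  | _ j ih =>
  let f : ClassicalLink → ℤ := fun ℓ => (C' ℓ).coeff j - (C ℓ).coeff j
  have hf : ∀ {n k : ℕ} (Gp Gm : GaussDiagram (Fin n)) (Gz : GaussDiagram (Fin k))
      (hp : Gp.IsClassical) (hm : Gm.IsClassical), Gz.IsClassical → ConwayTriple Gp Gm Gz →
        f (link ⟨n, Gp, hp⟩) = f (link ⟨n, Gm, hm⟩) := by
    intro n k Gp Gm Gz hp hm hz h
    have h1 := congrArg (Polynomial.coeff · j) (hC.skein Gp Gm Gz hp hm hz h)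
    have h2 := congrArg (Polynomial.coeff · j) (hC'.skein Gp Gm Gz hp hm hz h)
    simp only [Polynomial.coeff_sub] at h1 h2
    have h3 : (Polynomial.X * C' (link ⟨k, Gz, hz⟩)).coeff j =
        (Polynomial.X * C (link ⟨k, Gz, hz⟩)).coeff j := by
      rcases j with _ | j
      · simp
      · rw [Polynomial.coeff_X_mul, Polynomial.coeff_X_mul, ← sub_eq_zero, ih j j.lt_succ_self]
    grind
  have key : ∀ {D D' : PlanarCurve}, PlanarCurve.Equiv D D' → (VanishesOn f D ↔ VanishesOn f D') := by
    intro D D' h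
    induction h with
    | rel _ _ h => exact h.vanishesOn_iff hf
    | refl => grind
    | symm _ _ _ ih => grind
    | trans _ _ _ _ _ ih ih' => grind
  rintro ⟨⟨n, G, hG⟩⟩
  obtain ⟨P, hP, σ, X, W, ι, h, -⟩ := G.exists_rep
  obtain ⟨D', hD, h0⟩ := PlanarCurve.exists_trivial ⟨P, hP, σ, X, h.planar_iff.2 hG⟩
  refine (key hD).2 (fun m G' hG' W' ι' h' => ?_) n G hG W ι h
  obtain rfl : m = 0 := by
    by_contra hm
    exact h'.mem_range.1 ⟨(⟨0, Nat.pos_of_ne_zero hm⟩, true), rfl⟩ (h0 _)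
  obtain ⟨m, hm⟩ := exists_link_eq_unlink G' hG'
  simp only [f]
  rw [hm, eval_unlink hC, eval_unlink hC', sub_self]

end ClassicalDiagram

theorem mainTheorem2 :
    ∃ C : ClassicalLink → Polynomial ℤ,
      IsConwayPolynomial C ∧
      (∀ C' : ClassicalLink → Polynomial ℤ, IsConwayPolynomial C' → C' = C) ∧
      ∀ D : ClassicalDiagram,
        D.gauss.nablaA = (C D.link : PowerSeries ℤ) ∧
        D.gauss.nablaD = (C D.link : PowerSeries ℤ) := by
  -- By definition `nablaA` and `nablaD` are the series of `count true` and `count false`. Each of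
  -- these counts defines a Conway polynomial, and uniqueness identifies the two.
  have key : ∀ (t : Bool) (D : ClassicalDiagram), PowerSeries.mk (GaussDiagram.count t D.gauss) =
      (ClassicalLink.polynomial true D.link : PowerSeries ℤ) := fun t D => by
    rw [ClassicalDiagram.isConwayPolynomial_unique (ClassicalDiagram.isConwayPolynomial t)
      (ClassicalDiagram.isConwayPolynomial true)]
    ext k
    rw [PowerSeries.coeff_mk, Polynomial.coeff_coe, ClassicalDiagram.coeff_link]
  exact ⟨_, ClassicalDiagram.isConwayPolynomial true,
    fun C hC => ClassicalDiagram.isConwayPolynomial_unique (ClassicalDiagram.isConwayPolynomial true) hC,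
    fun D => ⟨key true D, key false D⟩⟩
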